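/- Let $R=\bigcup_{n\ge 1}\mathbf{R}((t^{1/n}))$ be the field of real Puiseux series, ordered so that a nonzero series is positive if and only if its leading coefficient is positive. A *bielliptic surface* over a field $k$ of characteristic $0$ is a smooth projective surface over $k$ whose base change to an algebraic closure $\bar k$ is isomorphic to $(E_1\times E_2)/G$, where $E_1$, $E_2$ are elliptic curves over $\bar k$ and $G$ is a finite group of translations of $E_1$ acting on $E_2$ with $E_2/G\simeq\mathbf{P}^1$. A smooth projective variety $X$ over $R$ has the *signs property* if for every $K\subset X(R)$ that is a union of semi-algebraic connected components of $X(R)$, there is a rational function $g$ on $X$ that is regular and invertible at all points of $X(R)$, such that $g>0$ on $K$ and $g<0$ on $X(R)\setminus K$. **Proposition.** There exists a bielliptic surface $S$ over $R$ that does not have the signs property. Moreover, $S$ can be chosen to be the quotient of $E\times E$ by a fixed-point-free action of $\mathbf{Z}/2\mathbf{Z}$ defined over $R$, where $E$ is the elliptic curve over $R$ with Weierstrass equation $y^2=x(x+1)(x-t)$. -/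

import Mathlib

open CategoryTheory CategoryTheory.Limits AlgebraicGeometry

noncomputable section

namespace SignsBielliptic

/-! ## The field of real Puiseux series -/

/-- The field embedding `ℝ((u)) → ℝ((t^ℚ))` sending `u` to `t^(1/n)`; its image is
`ℝ((t^(1/n)))`.  The target carries the lexicographic order, for which a nonzero series is positive
iff its leading (lowest order) coefficient is positive. -/
def puiseuxEmb (n : ℕ+) : LaurentSeries ℝ →+* Lex (HahnSeries ℚ ℝ) where
  toFun a := toLex (HahnSeries.embDomainRingHom
    ((AddMonoidHom.mulRight ((n : ℚ)⁻¹)).comp (Int.castAddHom ℚ))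
    (fun a b h => by simpa using h)
    (fun a b => by
      have : (0 : ℚ) < (n : ℚ)⁻¹ := by positivity
      simp [mul_le_mul_iff_left₀ this]) a)
  map_one' := by rw [map_one]; rfl
  map_mul' a b := by rw [map_mul]; rfl
  map_zero' := by rw [map_zero]; rfl
  map_add' a b := by rw [map_add]; rfl

theorem puiseuxEmb_coeff (n : ℕ+) (a : LaurentSeries ℝ) (z : ℤ) :
    (ofLex (puiseuxEmb n a)).coeff (z * (n : ℚ)⁻¹) = a.coeff z := by
  exact HahnSeries.embDomain_coeff (f := ⟨⟨fun z : ℤ => (z : ℚ) * (n : ℚ)⁻¹, _⟩, _⟩) (a := z)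

theorem puiseuxEmb_coeff_of_notMem (n : ℕ+) (a : LaurentSeries ℝ) (q : ℚ)
    (hq : ∀ z : ℤ, (z : ℚ) * (n : ℚ)⁻¹ ≠ q) : (ofLex (puiseuxEmb n a)).coeff q = 0 := by
  refine HahnSeries.embDomain_of_notMem_range ?_
  rintro ⟨z, hz⟩
  exact hq z hz

theorem mem_range_puiseuxEmb_iff (n : ℕ+) (x : Lex (HahnSeries ℚ ℝ)) :
    x ∈ Set.range (puiseuxEmb n) ↔
      ∀ q : ℚ, (ofLex x).coeff q ≠ 0 → ∃ z : ℤ, (z : ℚ) * (n : ℚ)⁻¹ = q := by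
  have hn : (0 : ℚ) < (n : ℚ)⁻¹ := by positivity
  constructor
  · rintro ⟨a, rfl⟩ q hq
    by_contra! h
    exact hq (puiseuxEmb_coeff_of_notMem n a q h)
  · intro h
    let a : LaurentSeries ℝ :=
      ⟨fun z => (ofLex x).coeff ((z : ℚ) * (n : ℚ)⁻¹), by
        rw [Set.isPWO_iff_isWF]
        have hx := (ofLex x).isWF_support
        rw [Set.isWF_iff_no_descending_seq] at hx ⊢
        intro f hf hmem
        refine hx (fun k => (f k : ℚ) * (n : ℚ)⁻¹) ?_ ?_
        · intro i j hij
          have := hf hij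
          simp only
          gcongr
        · intro k
          exact hmem k⟩
    refine ⟨a, ?_⟩
    apply ofLex.injective
    ext q
    by_cases hq : ∃ z : ℤ, (z : ℚ) * (n : ℚ)⁻¹ = q
    · obtain ⟨z, rfl⟩ := hq
      exact puiseuxEmb_coeff n a z
    · rw [puiseuxEmb_coeff_of_notMem n a q (by simpa using hq)]
      by_contra h0
      exact hq (h q (Ne.symm h0))

theorem range_puiseuxEmb_le_mul (n m : ℕ+) {x : Lex (HahnSeries ℚ ℝ)}
    (hx : x ∈ Set.range (puiseuxEmb n)) : x ∈ Set.range (puiseuxEmb (n * m)) := by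
  rw [mem_range_puiseuxEmb_iff] at hx ⊢
  intro q hq
  obtain ⟨z, rfl⟩ := hx q hq
  refine ⟨z * m, ?_⟩
  have hn : (n : ℚ) ≠ 0 := by positivity
  have hm : (m : ℚ) ≠ 0 := by positivity
  push_cast
  field_simp

/-- The field `R = ⋃_{n ≥ 1} ℝ((t^(1/n)))` of real Puiseux series. -/
def puiseuxField : Subfield (Lex (HahnSeries ℚ ℝ)) where
  carrier := ⋃ n : ℕ+, Set.range (puiseuxEmb n)
  zero_mem' := Set.mem_iUnion.2 ⟨1, 0, map_zero _⟩
  one_mem' := Set.mem_iUnion.2 ⟨1, 1, map_one _⟩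
  neg_mem' := by
    simp only [Set.mem_iUnion]
    rintro _ ⟨n, a, rfl⟩
    exact ⟨n, -a, map_neg _ _⟩
  inv_mem' := by
    simp only [Set.mem_iUnion]
    rintro _ ⟨n, a, rfl⟩
    exact ⟨n, a⁻¹, map_inv₀ _ _⟩
  add_mem' := by
    simp only [Set.mem_iUnion]
    rintro x y ⟨n, hx⟩ ⟨m, hy⟩
    obtain ⟨a, rfl⟩ := range_puiseuxEmb_le_mul n m hx
    obtain ⟨b, rfl⟩ := mul_comm n m ▸ range_puiseuxEmb_le_mul m n hy
    exact ⟨n * m, a + b, map_add _ _ _⟩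
  mul_mem' := by
    simp only [Set.mem_iUnion]
    rintro x y ⟨n, hx⟩ ⟨m, hy⟩
    obtain ⟨a, rfl⟩ := range_puiseuxEmb_le_mul n m hx
    obtain ⟨b, rfl⟩ := mul_comm n m ▸ range_puiseuxEmb_le_mul m n hy
    exact ⟨n * m, a * b, map_mul _ _ _⟩

/-- Real Puiseux series; as a subfield of an ordered field this is an ordered field, in which `t`
is a positive infinitesimal. -/
abbrev Puiseux : Type := puiseuxField

/-- The Puiseux series `t`. -/
def puiseuxT : Puiseux :=
  ⟨toLex (HahnSeries.single (1 : ℚ) (1 : ℝ)), Set.mem_iUnion.2 ⟨1, by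
    rw [mem_range_puiseuxEmb_iff]
    intro q hq
    refine ⟨1, ?_⟩
    by_contra h
    exact hq (HahnSeries.coeff_single_of_ne (by simpa [eq_comm] using h))⟩⟩

/-! ## Real points, semi-algebraic sets and the signs property -/

section Signs

variable {k : Type} [Field k] {X : Scheme.{0}}

/-- The set `X(k)` of rational points of a `k`-scheme `f : X ⟶ Spec k`. -/
def RatPoint (f : X ⟶ Spec (.of k)) : Type :=
  {p : Spec (.of k) ⟶ X // p ≫ f = 𝟙 _}

/-- The value in `k` of a section `s ∈ Γ(X, U)` at a rational point `p` lying in `U`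
(the hypothesis `h` says that `p` factors through `U`). -/
def RatPoint.eval {f : X ⟶ Spec (.of k)} (p : RatPoint f) (U : X.Opens)
    (h : ⊤ ≤ p.1 ⁻¹ᵁ U) (s : Γ(X, U)) : k :=
  (Scheme.ΓSpecIso (.of k)).hom.hom ((p.1.appLE U ⊤ h).hom s)

variable [LinearOrder k] [IsStrictOrderedRing k]

/-- The set of rational points of `U` where the regular function `s` on `U` is positive. -/
def posLocus (f : X ⟶ Spec (.of k)) (U : X.Opens) (s : Γ(X, U)) : Set (RatPoint f) :=
  {p | ∃ h : ⊤ ≤ p.1 ⁻¹ᵁ U, 0 < p.eval U h s}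

/-- The euclidean topology on `X(k)`, generated by the loci of positivity of regular functions on
affine open subsets. -/
instance (f : X ⟶ Spec (.of k)) : TopologicalSpace (RatPoint f) :=
  TopologicalSpace.generateFrom
    {A | ∃ (U : X.Opens) (_ : IsAffineOpen U) (s : Γ(X, U)), A = posLocus f U s}

/-- Semi-algebraic subsets of `X(k)`: the Boolean algebra of sets generated by the loci of
positivity of regular functions on affine open subsets. -/
inductive IsSemialgebraic (f : X ⟶ Spec (.of k)) : Set (RatPoint f) → Prop
  | pos (U : X.Opens) (hU : IsAffineOpen U) (s : Γ(X, U)) : IsSemialgebraic f (posLocus f U s)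
  | compl (A : Set (RatPoint f)) : IsSemialgebraic f A → IsSemialgebraic f Aᶜ
  | inter (A B : Set (RatPoint f)) :
      IsSemialgebraic f A → IsSemialgebraic f B → IsSemialgebraic f (A ∩ B)

/-- A semi-algebraic set `C` is semi-algebraically connected if whenever it is the disjoint union
of two semi-algebraic subsets `A` and `B` that are closed in `C`, one of them is empty. -/
def IsSemialgConnected (f : X ⟶ Spec (.of k)) (C : Set (RatPoint f)) : Prop :=
  ∀ A B : Set (RatPoint f), IsSemialgebraic f A → IsSemialgebraic f B →
    A ∪ B = C → Disjoint A B →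
    (∃ F, IsClosed F ∧ A = C ∩ F) → (∃ F, IsClosed F ∧ B = C ∩ F) → A = ∅ ∨ B = ∅

/-- The (semi-algebraic) connected components of `X(k)`: the nonempty, semi-algebraically
connected, semi-algebraic subsets that are open and closed. -/
def IsSemialgComponent (f : X ⟶ Spec (.of k)) (C : Set (RatPoint f)) : Prop :=
  C.Nonempty ∧ IsSemialgebraic f C ∧ IsClopen C ∧ IsSemialgConnected f C

/-- The signs property: for every union `K` of connected components of `X(k)`, there is a rational
function `g` (a regular function on a dense open subset `U`) that is defined and invertible on
`X(k)`, with `g > 0` on `K` and `g < 0` on `X(k) ∖ K`. -/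
def SignsProperty (f : X ⟶ Spec (.of k)) : Prop :=
  ∀ 𝒞 : Set (Set (RatPoint f)), (∀ C ∈ 𝒞, IsSemialgComponent f C) →
    ∃ (U : X.Opens) (_ : Dense (U : Set X)) (hU : ∀ p : RatPoint f, ⊤ ≤ p.1 ⁻¹ᵁ U)
      (g : Γ(X, U)),
      (∀ p ∈ ⋃₀ 𝒞, 0 < p.eval U (hU p) g) ∧ (∀ p ∉ ⋃₀ 𝒞, p.eval U (hU p) g < 0)

end Signs

/-! ## Projective schemes, elliptic curves, quotients and bielliptic surfaces -/

section Geometry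

attribute [local instance] MvPolynomial.gradedAlgebra

/-- Projective space `ℙⁿ` over a field, as the Proj of the polynomial ring in `n + 1` variables. -/
def projSpace (n : ℕ) (k : Type) [Field k] : Scheme.{0} :=
  Proj (MvPolynomial.homogeneousSubmodule (Fin (n + 1)) k)

/-- The structure morphism `ℙⁿ ⟶ Spec k`. -/
def projSpaceHom (n : ℕ) (k : Type) [Field k] : projSpace n k ⟶ Spec (.of k) :=
  Proj.toSpecZero (MvPolynomial.homogeneousSubmodule (Fin (n + 1)) k) ≫
    Spec.map (CommRingCat.ofHom
      (algebraMap k (MvPolynomial.homogeneousSubmodule (Fin (n + 1)) k 0)))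

variable {k : Type} [Field k]

/-- A `k`-scheme is projective if it is isomorphic to a closed subscheme of some `ℙⁿ`. -/
def IsProjective {X : Scheme.{0}} (f : X ⟶ Spec (.of k)) : Prop :=
  ∃ (n : ℕ) (i : X ⟶ projSpace n k), IsClosedImmersion i ∧ i ≫ projSpaceHom n k = f

/-- `e : E ⟶ Spec k`, together with `j`, is the elliptic curve with Weierstrass equation `W`:
the smooth proper curve over `k` that contains the affine plane curve `W` (with coordinate ring
`k[x, y]/(W)`) as a dense open subscheme through `j`. -/
structure IsEllipticCurve (W : WeierstrassCurve k) {E : Scheme.{0}} (e : E ⟶ Spec (.of k))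
    (j : Spec (.of W.toAffine.CoordinateRing) ⟶ E) : Prop where
  isElliptic : W.IsElliptic
  smooth : SmoothOfRelativeDimension 1 e
  proper : IsProper e
  isOpenImmersion : IsOpenImmersion j
  isDominant : IsDominant j
  comp_eq : j ≫ e = Spec.map (CommRingCat.ofHom (algebraMap k W.toAffine.CoordinateRing))

/-- Evaluation `k[x, y]/(W) → k` at a point `(x, y)` of the affine curve `W`. -/
def affineEval (W : WeierstrassCurve k) (x y : k) (h : W.toAffine.Equation x y) :
    W.toAffine.CoordinateRing →+* k :=
  AdjoinRoot.lift (Polynomial.evalRingHom x) y (by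
    rw [Polynomial.eval₂_evalRingHom]
    exact h)

/-- The rational point of the elliptic curve with affine coordinates `(x, y)`. -/
def affinePoint (W : WeierstrassCurve k) {E : Scheme.{0}}
    (j : Spec (.of W.toAffine.CoordinateRing) ⟶ E) (x y : k) (h : W.toAffine.Equation x y) :
    Spec (.of k) ⟶ E :=
  Spec.map (CommRingCat.ofHom (affineEval W x y h)) ≫ j

open Classical in
/-- Over an algebraically closed field: the endomorphism `τ` of the elliptic curve is the
translation `P ↦ P + T` by some point `T`.  (It is enough to compare `τ` with this translation at
the cofinitely many points `P` such that both `P` and `P + T` are affine.) -/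
def IsTranslation (W : WeierstrassCurve k) {E : Scheme.{0}}
    (j : Spec (.of W.toAffine.CoordinateRing) ⟶ E) (τ : E ⟶ E) : Prop :=
  ∃ T : W.toAffine.Point, ∀ (x y : k) (h : W.toAffine.Nonsingular x y)
    (x' y' : k) (h' : W.toAffine.Nonsingular x' y'),
    WeierstrassCurve.Affine.Point.some x y h + T = WeierstrassCurve.Affine.Point.some x' y' h' →
    affinePoint W j x y h.1 ≫ τ = affinePoint W j x' y' h'.1

/-- `π : X ⟶ Y` is the quotient of `X` by the finite group `G`, where `g : G` acts through the
automorphism `act g` of `X`: `π` is affine and invariant, and `𝒪_Y → (π_* 𝒪_X)^G` is an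
isomorphism. -/
structure IsQuotient {G : Type} {X Y : Scheme.{0}} (act : G → (X ⟶ X)) (π : X ⟶ Y) : Prop where
  invariant : ∀ g, act g ≫ π = π
  affine : IsAffineHom π
  sections : ∀ (U : Y.Opens) (s : Γ(X, π ⁻¹ᵁ U)),
    (∀ (g : G) (h : π ⁻¹ᵁ U ≤ act g ⁻¹ᵁ π ⁻¹ᵁ U),
      ((act g).appLE (π ⁻¹ᵁ U) (π ⁻¹ᵁ U) h).hom s = s) →
    ∃! r : Γ(Y, U), (π.app U).hom r = s

/-- The action is free: a nontrivial element fixes no point with values in a field. -/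
def IsFreeAction {G : Type} [Group G] {X : Scheme.{0}} (act : G → (X ⟶ X)) : Prop :=
  ∀ g : G, g ≠ 1 → ∀ (K : Type) [Field K] (x : Spec (.of K) ⟶ X), x ≫ act g ≠ x

/-- The product `α × β` of endomorphisms of two `k`-schemes. -/
def prodEnd {E F : Scheme.{0}} {e : E ⟶ Spec (.of k)} {f : F ⟶ Spec (.of k)}
    (α : Over.mk e ⟶ Over.mk e) (β : Over.mk f ⟶ Over.mk f) : pullback e f ⟶ pullback e f :=
  pullback.map e f e f α.left β.left (𝟙 _)
    (by simpa using (Over.w α).symm) (by simpa using (Over.w β).symm)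

/-- Over an algebraically closed field `k` of characteristic zero: `X` is isomorphic to
`(E × F)/G`, where `E` and `F` are elliptic curves and `G` is a finite group of translations of `E`
that acts on `F` in such a way that `F/G ≅ ℙ¹`. -/
def IsBiellipticQuotient {X : Scheme.{0}} (f : X ⟶ Spec (.of k)) : Prop :=
  ∃ (W₁ W₂ : WeierstrassCurve k) (E F : Scheme.{0})
    (e₁ : E ⟶ Spec (.of k)) (j₁ : Spec (.of W₁.toAffine.CoordinateRing) ⟶ E)
    (e₂ : F ⟶ Spec (.of k)) (j₂ : Spec (.of W₂.toAffine.CoordinateRing) ⟶ F)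
    (G : Type) (_ : Group G) (_ : Finite G)
    (a : G →* Aut (Over.mk e₁)) (b : G →* Aut (Over.mk e₂)),
    IsEllipticCurve W₁ e₁ j₁ ∧ IsEllipticCurve W₂ e₂ j₂ ∧
    Function.Injective a ∧ (∀ g, IsTranslation W₁ j₁ (a g).hom.left) ∧
    (∃ q : F ⟶ projSpace 1 k, q ≫ projSpaceHom 1 k = e₂ ∧
      IsQuotient (fun g => (b g).hom.left) q) ∧
    ∃ π : pullback e₁ e₂ ⟶ X, π ≫ f = pullback.fst e₁ e₂ ≫ e₁ ∧
      IsQuotient (fun g => prodEnd (a g).hom (b g).hom) π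

/-- A bielliptic surface over a field of characteristic zero: a smooth projective surface that
becomes a bielliptic surface over an algebraic closure. -/
def IsBielliptic [CharZero k] {S : Scheme.{0}} (f : S ⟶ Spec (.of k)) : Prop :=
  SmoothOfRelativeDimension 2 f ∧ IsProjective f ∧
    IsBiellipticQuotient (pullback.snd f
      (Spec.map (CommRingCat.ofHom (algebraMap k (AlgebraicClosure k)))))

end Geometry

/-- The Weierstrass equation `y² = x (x + 1) (x - t) = x³ + (1 - t) x² - t x` over the field of
real Puiseux series. -/
def curveW : WeierstrassCurve Puiseux where
  a₁ := 0
  a₂ := 1 - puiseuxT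
  a₃ := 0
  a₄ := -puiseuxT
  a₆ := 0

end SignsBielliptic

end

open SignsBielliptic

open CategoryTheory CategoryTheory.Limits AlgebraicGeometry

noncomputable section

namespace SignsBielliptic

/-! Put `s = x - t` on `E`. Then `y² = s (s² + (2t+1) s + t(t+1))`, and the functions `r = y/s`, `D
= s - t(t+1)/s` identify `E` with the smooth projective model of the quartic `D² = r⁴ - 2(2t+1) r² +
1`, glued from two copies of this affine curve by `(r, D) ↦ (1/r, D/r²)`. In these coordinates
translation by the 2-torsion point `(t, 0)` is `(r, D) ↦ (-r, -D)`, while `(r, D) ↦ (r, -D)` is an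
involution whose quotient is the projective line with coordinate `r`. The surface `S` is the
quotient of `E × E` by the product of these two involutions. The action is free because a fixed
point would have `r = D = 0` on the first factor, which the equation forbids. The quotient is
realised as the scheme-theoretic image of `E × E` in `ℙ¹⁵` under invariant sections
(`Chart.exists_image`, `isQuotient_of_charts`), which gives projectivity; smoothness comes from
describing `S` locally as a double cover of a line over the first curve modulo translation
(`AntiInvariant.smooth`). All this is done over any field of characteristic zero, so that the base
change to an algebraic closure is the same construction (`Surface.isBiellipticQuotient`).

Real points. At `r² = 1` the quartic takes the value `-4t < 0`, so `E(R)` splits into the ovals `r²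
< 1` and `r² > 1`. Every rational point of `S` lifts to `E × E`, because the invariant `r₁²` cannot
be negative there (`ProdRing.exists_lift_real`). Hence `S(R)` is the union of the images of the four
products of ovals. That these are connected in the semi-algebraic sense rests on the intermediate
value theorem for polynomials over `R` (`puiseux_ivt`, `IsTame.iff_of_oval`).

The obstruction. Since `t` is infinitesimal, the two ovals come infinitely close to the node of `y²
= x² (x + 1)`. For rational `0 < β < 1` there are points with `s = ± t^β` and `r` infinitely close
to `1`, and the sign of `s` decides the oval. Using such points on both factors gives four points of
`S`, indexed by the group `{±1}²`, one on each component. The key claim is that for generic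
exponents a nonzero function takes at these points values of the form `c · χ(ε₁, ε₂)` up to terms of
larger valuation, where `χ` is a character of `{±1}²` with values in `{±1}`: in a polynomial in `s`
a single monomial dominates once `β` avoids finitely many values, and functions involving `r` are
handled by a norm argument (`GenericMono.curve`, applied once for each factor). The four elements of
`{±1}²` have product `1`, so the four values have positive product (`IsMonomialLike.four_signs`). A
function that is positive on one component and negative on the three others would give a negative
product (`Surface.not_signsProperty`). -/

section

/-! ## Valuation and order on real Puiseux series -/

section PuiseuxOrder

open Polynomial

/-- The underlying Hahn series of a Puiseux series. -/
def puiseuxToHahn : Puiseux →+* HahnSeries ℚ ℝ where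
  toFun x := ofLex x.1
  map_one' := rfl
  map_mul' _ _ := rfl
  map_zero' := rfl
  map_add' _ _ := rfl

/-- The valuation of a Puiseux series. -/
def pval : AddValuation Puiseux (WithTop ℚ) := (HahnSeries.addVal ℚ ℝ).comap puiseuxToHahn

theorem pval_apply (x : Puiseux) : pval x = (ofLex x.1).orderTop := rfl

theorem pval_eq_top {x : Puiseux} : pval x = ⊤ ↔ x = 0 := AddValuation.top_iff _

theorem pval_ne_top {x : Puiseux} : pval x ≠ ⊤ ↔ x ≠ 0 := pval_eq_top.not

theorem pos_iff_leadingCoeff {x : Puiseux} : 0 < x ↔ 0 < (ofLex x.1).leadingCoeff := by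
  rw [HahnSeries.leadingCoeff_pos_iff]; rfl

theorem neg_iff_leadingCoeff {x : Puiseux} : x < 0 ↔ (ofLex x.1).leadingCoeff < 0 := by
  rw [HahnSeries.leadingCoeff_neg_iff]; rfl

/-- The error `x - y` starts strictly later than `y`, so it does not touch the first term of `y`.
All sign comparisons below go through this. -/
theorem leadingCoeff_eq_of_pval_sub_lt {x y : Puiseux} (h : pval y < pval (x - y)) :
    (ofLex x.1).leadingCoeff = (ofLex y.1).leadingCoeff := by
  have h' : (ofLex y.1).orderTop < (ofLex (x - y).1).orderTop := h
  have := HahnSeries.leadingCoeff_add_eq_left h'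
  rw [← this]; congr 1
  show ofLex x.1 = ofLex y.1 + (ofLex x.1 - ofLex y.1)
  abel

theorem pos_of_pval_sub_lt {x y : Puiseux} (h : pval y < pval (x - y)) (hy : 0 < y) : 0 < x := by
  rw [pos_iff_leadingCoeff, leadingCoeff_eq_of_pval_sub_lt h]
  exact pos_iff_leadingCoeff.1 hy

theorem neg_of_pval_sub_lt {x y : Puiseux} (h : pval y < pval (x - y)) (hy : y < 0) : x < 0 := by
  rw [neg_iff_leadingCoeff, leadingCoeff_eq_of_pval_sub_lt h]
  exact neg_iff_leadingCoeff.1 hy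

theorem mem_puiseuxField_single (q : ℚ) (c : ℝ) :
    (toLex (HahnSeries.single q c) : Lex (HahnSeries ℚ ℝ)) ∈ puiseuxField := by
  refine Set.mem_iUnion.2 ⟨q.pnatDen, ?_⟩
  rw [mem_range_puiseuxEmb_iff]
  intro r hr
  have : r = q := by
    by_contra h
    exact hr (HahnSeries.coeff_single_of_ne h)
  refine ⟨q.num, ?_⟩
  rw [this, ← div_eq_mul_inv, Rat.coe_pnatDen]
  exact Rat.num_div_den q

/-- The Puiseux series `t ^ q`. -/
def tpow (q : ℚ) : Puiseux := ⟨toLex (HahnSeries.single q 1), mem_puiseuxField_single q 1⟩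

theorem pval_tpow (q : ℚ) : pval (tpow q) = q := by
  rw [pval_apply]; exact HahnSeries.orderTop_single one_ne_zero

theorem tpow_pos (q : ℚ) : 0 < tpow q := by
  rw [pos_iff_leadingCoeff]
  show 0 < (HahnSeries.single q (1 : ℝ)).leadingCoeff
  rw [HahnSeries.leadingCoeff_of_single]; exact one_pos

theorem pval_puiseuxT : pval puiseuxT = (1 : ℚ) := pval_tpow 1

theorem puiseuxT_pos : 0 < puiseuxT := tpow_pos 1

theorem pval_of_natCast {n : ℕ} (hn : n ≠ 0) : pval (n : Puiseux) = 0 := by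
  rw [pval_apply]
  have : (ofLex (n : Puiseux).1) = HahnSeries.C (n : ℝ) := by
    rw [map_natCast]; exact map_natCast puiseuxToHahn n
  rw [this]
  exact HahnSeries.orderTop_single (by exact_mod_cast hn)

/-- The embedding of `ℝ⟦u⟧` sending `u` to `t ^ (1 / m)`. -/
def powEmb (m : ℕ+) : PowerSeries ℝ →+* Puiseux :=
  ((puiseuxEmb m).comp (HahnSeries.ofPowerSeries ℤ ℝ)).codRestrict puiseuxField
    (fun _ => Set.mem_iUnion.2 ⟨m, _, rfl⟩)

theorem powEmb_val (m : ℕ+) (f : PowerSeries ℝ) :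
    (powEmb m f).1 = puiseuxEmb m (HahnSeries.ofPowerSeries ℤ ℝ f) := rfl

theorem powEmb_injective (m : ℕ+) : Function.Injective (powEmb m) := by
  intro f g h
  have h1 := congrArg Subtype.val h
  rw [powEmb_val, powEmb_val] at h1
  exact HahnSeries.ofPowerSeries_injective ((puiseuxEmb m).injective h1)

theorem pval_nonneg_iff {x : Puiseux} : 0 ≤ pval x ↔ ∀ q < 0, (ofLex x.1).coeff q = 0 := by
  rw [pval_apply]
  constructor
  · intro h q hq
    exact HahnSeries.coeff_eq_zero_of_lt_orderTop (lt_of_lt_of_le (by exact_mod_cast hq) h)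
  · intro h
    exact HahnSeries.le_orderTop_iff_forall.2 (fun q hq => h q (by exact_mod_cast hq))

theorem powEmb_coeff (m : ℕ+) (f : PowerSeries ℝ) (n : ℕ) :
    (ofLex (powEmb m f).1).coeff (n * (m : ℚ)⁻¹) = PowerSeries.coeff n f := by
  have := puiseuxEmb_coeff m (HahnSeries.ofPowerSeries ℤ ℝ f) n
  rw [powEmb_val]
  rw [Int.cast_natCast] at this
  rw [this]
  exact HahnSeries.ofPowerSeries_apply_coeff f n

theorem pval_powEmb_nonneg (m : ℕ+) (f : PowerSeries ℝ) : 0 ≤ pval (powEmb m f) := by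
  rw [pval_nonneg_iff]
  intro q hq
  rw [powEmb_val]
  by_cases h : ∃ z : ℤ, (z : ℚ) * (m : ℚ)⁻¹ = q
  · obtain ⟨z, rfl⟩ := h
    rw [puiseuxEmb_coeff]
    have hz : z < 0 := by
      by_contra h0
      push Not at h0
      have : (0 : ℚ) ≤ z * (m : ℚ)⁻¹ := by positivity
      linarith
    rw [HahnSeries.ofPowerSeries_apply]
    apply HahnSeries.embDomain_of_notMem_range
    rintro ⟨n, hn⟩
    simp at hn
    omega
  · exact puiseuxEmb_coeff_of_notMem m _ q (by simpa using h)

theorem powEmb_constantCoeff (m : ℕ+) (f : PowerSeries ℝ) :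
    (ofLex (powEmb m f).1).coeff 0 = PowerSeries.constantCoeff f := by
  have := powEmb_coeff m f 0
  simpa using this

theorem powEmb_pos (m : ℕ+) (f : PowerSeries ℝ) (h : 0 < PowerSeries.constantCoeff f) :
    0 < powEmb m f := by
  rw [pos_iff_leadingCoeff]
  have h0 : (ofLex (powEmb m f).1).orderTop = (0 : ℚ) := by
    refine le_antisymm ?_ (pval_powEmb_nonneg m f)
    exact HahnSeries.orderTop_le_of_coeff_ne_zero (by rw [powEmb_constantCoeff]; exact h.ne')
  have h1 : (ofLex (powEmb m f).1).order = 0 := by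
    have hne : ofLex (powEmb m f).1 ≠ 0 := by
      intro hz
      rw [hz, HahnSeries.orderTop_zero] at h0
      exact WithTop.top_ne_coe h0
    have := HahnSeries.order_eq_orderTop_of_ne_zero hne
    rw [h0] at this
    exact_mod_cast this
  rw [HahnSeries.leadingCoeff_eq, h1, powEmb_constantCoeff]
  exact h

/-- The exponents of `x` lie in `(1/m) ℤ` and none is negative, so the coefficients at the exponents
`n / m` form a power series. -/
theorem exists_powEmb_of_mem_range {m : ℕ+} {x : Puiseux} (hx : x.1 ∈ Set.range (puiseuxEmb m))
    (h0 : 0 ≤ pval x) : ∃ f, powEmb m f = x := by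
  rw [mem_range_puiseuxEmb_iff] at hx
  refine ⟨PowerSeries.mk (fun n => (ofLex x.1).coeff (n * (m : ℚ)⁻¹)), ?_⟩
  apply Subtype.ext
  apply ofLex.injective
  ext q
  by_cases hq : (ofLex x.1).coeff q = 0
  · by_cases h : ∃ n : ℕ, (n : ℚ) * (m : ℚ)⁻¹ = q
    · obtain ⟨n, rfl⟩ := h
      rw [powEmb_coeff, PowerSeries.coeff_mk]
    · rw [hq]
      by_cases hneg : q < 0
      · exact pval_nonneg_iff.1 (pval_powEmb_nonneg m _) q hneg
      · rw [powEmb_val]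
        apply puiseuxEmb_coeff_of_notMem
        intro z hz
        apply h
        have : 0 ≤ z := by
          by_contra hz0
          push Not at hz0
          apply hneg
          rw [← hz]
          have : (z : ℚ) < 0 := by exact_mod_cast hz0
          have hm : (0 : ℚ) < (m : ℚ)⁻¹ := by positivity
          exact mul_neg_of_neg_of_pos this hm
        lift z to ℕ using this
        exact ⟨z, by simpa using hz⟩
  · obtain ⟨z, rfl⟩ := hx q hq
    have : 0 ≤ z := by
      by_contra hz0
      push Not at hz0
      apply hq
      apply pval_nonneg_iff.1 h0
      have : (z : ℚ) < 0 := by exact_mod_cast hz0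
      have hm : (0 : ℚ) < (m : ℚ)⁻¹ := by positivity
      exact mul_neg_of_neg_of_pos this hm
    lift z to ℕ using this
    rw [Int.cast_natCast, powEmb_coeff, PowerSeries.coeff_mk]

/-- A common denominator is the product of the individual ones. It brings questions about finitely
many integral Puiseux series down to the complete discrete valuation ring `ℝ⟦u⟧`. -/
theorem exists_mem_range_puiseuxEmb (s : Finset Puiseux) :
    ∃ m : ℕ+, ∀ x ∈ s, x.1 ∈ Set.range (puiseuxEmb m) := by
  classical
  induction s using Finset.induction_on with
  | empty => exact ⟨1, by simp⟩
  | insert a s _ ih =>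
    obtain ⟨m, hm⟩ := ih
    obtain ⟨n, hn⟩ := Set.mem_iUnion.1 a.2
    refine ⟨n * m, ?_⟩
    intro x hx
    rcases Finset.mem_insert.1 hx with rfl | hx
    · exact range_puiseuxEmb_le_mul n m hn
    · exact mul_comm m n ▸ range_puiseuxEmb_le_mul m n (hm x hx)

theorem exists_common_powEmb (s : Finset Puiseux) (h : ∀ x ∈ s, 0 ≤ pval x) :
    ∃ m : ℕ+, ∀ x ∈ s, ∃ f, powEmb m f = x := by
  obtain ⟨m, hm⟩ := exists_mem_range_puiseuxEmb s
  exact ⟨m, fun x hx => exists_powEmb_of_mem_range (hm x hx) (h x hx)⟩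

/-- A polynomial with integral coefficients, and an extra integral element, come from `ℝ⟦u⟧`. -/
theorem exists_lift_polynomial (P : Puiseux[X]) (hP : ∀ i, 0 ≤ pval (P.coeff i)) (x : Puiseux)
    (hx : 0 ≤ pval x) : ∃ (m : ℕ+) (p : (PowerSeries ℝ)[X]) (y : PowerSeries ℝ),
      p.map (powEmb m) = P ∧ powEmb m y = x := by
  classical
  obtain ⟨m, hm⟩ := exists_common_powEmb
    (insert x (P.support.image P.coeff)) (by
      intro z hz
      rcases Finset.mem_insert.1 hz with rfl | hz
      · exact hx
      · obtain ⟨i, -, rfl⟩ := Finset.mem_image.1 hz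
        exact hP i)
  obtain ⟨y, hy⟩ := hm x (Finset.mem_insert_self _ _)
  have : P ∈ Polynomial.lifts (powEmb m) := by
    rw [Polynomial.lifts_iff_coeff_lifts]
    intro i
    by_cases h : P.coeff i = 0
    · rw [h]; exact ⟨0, map_zero _⟩
    · exact hm _ (Finset.mem_insert_of_mem
        (Finset.mem_image_of_mem _ (Polynomial.mem_support_iff.2 h)))
  obtain ⟨p, hp⟩ := (Polynomial.mem_lifts _).1 this
  exact ⟨m, p, y, hp, hy⟩

end PuiseuxOrder

end

/-! ### The intermediate value theorem for polynomials over real Puiseux series -/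

section

section IVT

open Polynomial

/-- A monic polynomial over `ℝ⟦u⟧` whose reduction has a root of multiplicity smaller than the
degree factors. -/
theorem exists_factor_of_isRoot_map {p : (PowerSeries ℝ)[X]} (hp : p.Monic) {c : ℝ}
    (hc : (p.map (PowerSeries.constantCoeff (R := ℝ))).IsRoot c)
    (hne : p.map (PowerSeries.constantCoeff (R := ℝ)) ≠ (X - C c) ^ p.natDegree) :
    ∃ f g : (PowerSeries ℝ)[X], f.Monic ∧ g.Monic ∧ p = f * g ∧
      f.natDegree < p.natDegree ∧ g.natDegree < p.natDegree := by
  have : IsAdicComplete (IsLocalRing.maximalIdeal (PowerSeries ℝ)) (PowerSeries ℝ) := by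
    rw [PowerSeries.maximalIdeal_eq_span_X]; infer_instance
  set A := PowerSeries ℝ
  set c' : A := PowerSeries.C c
  -- With the root moved to `0`, Weierstrass preparation of `p'` splits off a distinguished
  -- polynomial `f`, which collects the roots reducing to `c`.
  set p' : A[X] := p.comp (X + C c') with hp'
  have hp'm : p'.Monic := hp.comp_X_add_C c'
  have hp'd : p'.natDegree = p.natDegree := by
    rw [hp', natDegree_comp, natDegree_X_add_C, mul_one]
  set G : PowerSeries A := (p' : PowerSeries A)
  have hres : Function.Surjective (IsLocalRing.residue A) := IsLocalRing.residue_surjective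
  have hGne : G.map (IsLocalRing.residue A) ≠ 0 := by
    intro h
    have := congrArg (PowerSeries.coeff p'.natDegree) h
    rw [PowerSeries.coeff_map, Polynomial.coeff_coe, hp'm.coeff_natDegree] at this
    simp at this
  obtain ⟨f, h, H⟩ := PowerSeries.exists_isWeierstrassFactorization hGne
  have hfm := H.isDistinguishedAt.monic
  have hfd := H.natDegree_eq_toNat_order_map
  -- `f` divides `p'`
  have hdiv : p' %ₘ f = 0 := by
    have e := modByMonic_add_div p' f
    have hfne : (f : PowerSeries A).map (IsLocalRing.residue A) ≠ 0 := by
      intro h0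
      have := congrArg (PowerSeries.coeff f.natDegree) h0
      rw [PowerSeries.coeff_map, Polynomial.coeff_coe, hfm.coeff_natDegree] at this
      simp at this
    have hford : ((f : PowerSeries A).map (IsLocalRing.residue A)).order.toNat = f.natDegree := by
      have h1 : (f : PowerSeries A).IsWeierstrassFactorization f 1 :=
        ⟨H.isDistinguishedAt, isUnit_one, by rw [mul_one]⟩
      exact h1.natDegree_eq_toNat_order_map.symm
    -- Both `h` and the polynomial quotient divide `p'` by `f`; uniqueness of Weierstrass division
    -- forces the polynomial remainder to vanish.
    have key : (f : PowerSeries A) * (h - (p' /ₘ f : A[X])) = ((p' %ₘ f : A[X]) : PowerSeries A) := by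
      have e2 : (p' : PowerSeries A) = f * h := H.eq_mul
      have e3 := congrArg (fun x : A[X] => (x : PowerSeries A)) e
      simp only [Polynomial.coe_add, Polynomial.coe_mul] at e3
      rw [mul_sub, ← e2, ← e3]; ring
    refine ((PowerSeries.IsWeierstrassDivisor.of_map_ne_zero hfne).eq_zero_of_mul_eq ?_ key).2
    refine lt_of_lt_of_eq (degree_modByMonic_lt _ hfm) ?_
    rw [degree_eq_natDegree hfm.ne_zero]
    exact congrArg Nat.cast hford.symm
  have hprod : p' = f * (p' /ₘ f) := by
    conv_lhs => rw [← modByMonic_add_div p' f, hdiv, zero_add]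
  set g := p' /ₘ f
  have hgm : g.Monic := hfm.of_mul_monic_left (hprod ▸ hp'm)
  have hdeg : p'.natDegree = f.natDegree + g.natDegree := by
    conv_lhs => rw [hprod]
    exact hfm.natDegree_mul hgm
  have hcomp : (p'.comp (X - C c')) = p := by
    rw [hp', comp_assoc]; simp
  refine ⟨f.comp (X - C c'), g.comp (X - C c'), hfm.comp_X_sub_C _, hgm.comp_X_sub_C _, ?_, ?_, ?_⟩
  · rw [← mul_comp, ← hprod, hcomp]
  · rw [natDegree_comp, natDegree_X_sub_C, mul_one, ← hp'd, hdeg]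
    -- If `f` had full degree, `p'` would be distinguished and reduce to a power of `X`, so `p`
    -- would reduce to the excluded power of `X - c`.
    by_contra hcon
    have hg0 : g = 1 := by
      rw [← hgm.natDegree_eq_zero]; omega
    have hpf : p' = f := by rw [hprod, hg0, mul_one]
    have h1 := H.isDistinguishedAt.map_eq_X_pow
    apply hne
    have h2 : p'.map (PowerSeries.constantCoeff (R := ℝ)) = X ^ p.natDegree := by
      rw [← hp'd, hpf]
      ext i
      rw [coeff_map, coeff_X_pow]
      have := congrArg (fun q => q.coeff i) h1
      simp only [coeff_map, coeff_X_pow] at this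
      split_ifs with hi
      · rw [hi, hfm.coeff_natDegree, map_one]
      · rw [if_neg hi] at this
        rw [Ideal.Quotient.eq_zero_iff_mem, PowerSeries.maximalIdeal_eq_span_X,
          Ideal.mem_span_singleton, PowerSeries.X_dvd_iff] at this
        exact this
    conv_lhs => rw [← hcomp, Polynomial.map_comp, h2]
    simp [c']
  · rw [natDegree_comp, natDegree_X_sub_C, mul_one, ← hp'd, hdeg]
    -- If `f` had degree `0`, `p'` would be a unit as a power series, so that its constant term, the
    -- value of `p` at `c`, would have nonzero reduction.
    suffices f.natDegree ≠ 0 by omega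
    intro h0
    have hf1 : f = 1 := by rw [← hfm.natDegree_eq_zero]; exact h0
    have hu : IsUnit G := by
      rw [H.eq_mul, hf1]; simpa using H.isUnit
    rw [PowerSeries.isUnit_iff_constantCoeff, ← PowerSeries.coeff_zero_eq_constantCoeff_apply,
      Polynomial.coeff_coe, PowerSeries.isUnit_iff_constantCoeff] at hu
    apply hu.ne_zero
    rw [hp', coeff_zero_eq_eval_zero, eval_comp]
    simp only [eval_add, eval_X, eval_C, zero_add]
    have := hc
    rw [IsRoot, Polynomial.eval_map] at this
    rw [← this, ← eval₂_at_apply]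
    congr 1

/-- The ordinary intermediate value theorem: a monic polynomial is positive somewhere, hence
everywhere if it never vanishes, whereas an odd degree would make it negative far to the left. -/
theorem real_poly_pos_of_no_root {p : ℝ[X]} (hp : p.Monic) (h : ∀ c, ¬ p.IsRoot c) :
    (∀ c, 0 < p.eval c) ∧ Even p.natDegree := by
  have hcont : Continuous fun x => p.eval x := p.continuous
  have hnn : ∀ x y, p.eval x < 0 → 0 < p.eval y → False := by
    intro x y hx hy
    obtain ⟨z, hz⟩ := mem_range_of_exists_le_of_exists_ge hcont ⟨x, hx.le⟩ ⟨y, hy.le⟩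
    exact h z hz
  have hsign : ∃ y, 0 < p.eval y := by
    by_cases h0 : p.natDegree = 0
    · rw [hp.natDegree_eq_zero.1 h0]; exact ⟨0, by simp⟩
    · have hd : 0 < p.degree := natDegree_pos_iff_degree_pos.1 (Nat.pos_of_ne_zero h0)
      have := p.tendsto_atTop_of_leadingCoeff_nonneg hd (by rw [hp.leadingCoeff]; exact zero_le_one)
      obtain ⟨y, hy⟩ := (this.eventually_gt_atTop 0).exists
      exact ⟨y, hy⟩
  obtain ⟨y, hy⟩ := hsign
  have hpos : ∀ c, 0 < p.eval c := by
    intro c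
    rcases lt_trichotomy (p.eval c) 0 with hc | hc | hc
    · exact (hnn c y hc hy).elim
    · exact (h c hc).elim
    · exact hc
  refine ⟨hpos, ?_⟩
  by_contra hodd
  rw [Nat.not_even_iff_odd] at hodd
  have hd : 0 < (p.comp (-X)).degree := by
    rw [← natDegree_pos_iff_degree_pos, natDegree_comp, natDegree_neg, natDegree_X, mul_one]
    exact hodd.pos
  have := (p.comp (-X)).tendsto_atBot_of_leadingCoeff_nonpos hd (by
    rw [leadingCoeff_comp (by rw [natDegree_neg, natDegree_X]; exact one_ne_zero), hp.leadingCoeff]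
    simp [hodd.neg_one_pow])
  obtain ⟨z, hz⟩ := (this.eventually_lt_atBot 0).exists
  rw [eval_comp] at hz
  exact lt_asymm hz (hpos _)

theorem reverse_map_of_injective {R S : Type*} [Semiring R] [Semiring S] {f : R →+* S} (p : R[X])
    (hf : Function.Injective f) : (p.map f).reverse = p.reverse.map f := by
  ext i
  rw [coeff_reverse, coeff_map, coeff_map, coeff_reverse, natDegree_map_eq_of_injective hf]

theorem eval_map_powEmb_pos {m : ℕ+} {p : (PowerSeries ℝ)[X]} {y : PowerSeries ℝ}
    (h : 0 < (p.map (PowerSeries.constantCoeff (R := ℝ))).eval (PowerSeries.constantCoeff y)) :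
    0 < (p.map (powEmb m)).eval (powEmb m y) := by
  rw [Polynomial.eval_map, eval₂_at_apply]
  apply powEmb_pos
  rwa [Polynomial.eval_map, eval₂_at_apply] at h

theorem constantCoeff_eq_zero_of_pval_pos {m : ℕ+} {f : PowerSeries ℝ} (h : 0 < pval (powEmb m f)) :
    PowerSeries.constantCoeff f = 0 := by
  rw [← powEmb_constantCoeff m]
  exact HahnSeries.coeff_eq_zero_of_lt_orderTop h

/-- Integral monic polynomials whose reduction has no real root are positive. -/
theorem eval_pos_of_no_root {P : Puiseux[X]} (hP : P.Monic) (hint : ∀ i, 0 ≤ pval (P.coeff i))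
    (h : ∀ (m : ℕ+) (p : (PowerSeries ℝ)[X]), p.map (powEmb m) = P →
      ∀ c, ¬ (p.map (PowerSeries.constantCoeff (R := ℝ))).IsRoot c) (x : Puiseux) :
    0 < P.eval x := by
  by_cases hx : 0 ≤ pval x
  · obtain ⟨m, p, y, rfl, rfl⟩ := exists_lift_polynomial P hint x hx
    have hpm : p.Monic := (Function.Injective.monic_map_iff (powEmb_injective m)).2 hP
    exact eval_map_powEmb_pos ((real_poly_pos_of_no_root (hpm.map _) (h m p rfl)).1 _)
  · have hx0 : x ≠ 0 := by rintro rfl; simp at hx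
    have hxi : 0 < pval x⁻¹ := by
      rw [AddValuation.map_inv]
      have : pval x < 0 := not_le.1 hx
      obtain ⟨q, hq⟩ := WithTop.ne_top_iff_exists.1 (pval_ne_top.2 hx0)
      rw [← hq] at this ⊢
      have h1 : q < 0 := by exact_mod_cast this
      have h2 : (0 : WithTop ℚ) < ((-q : ℚ) : WithTop ℚ) := by
        exact_mod_cast (neg_pos.2 h1)
      exact h2
    obtain ⟨m, p, y, rfl, hy⟩ := exists_lift_polynomial P hint x⁻¹ hxi.le
    have hpm : p.Monic := (Function.Injective.monic_map_iff (powEmb_injective m)).2 hP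
    have heven := (real_poly_pos_of_no_root (hpm.map _) (h m p rfl)).2
    rw [hpm.natDegree_map] at heven
    have hy0 : PowerSeries.constantCoeff y = 0 :=
      constantCoeff_eq_zero_of_pval_pos (m := m) (by rw [hy]; exact hxi)
    have : Invertible x := invertibleOfNonzero hx0
    -- For infinite `x` write the value at `x` as `x ^ n` times the value of the reversed polynomial
    -- at `1 / x`. The degree `n` is even, and at the infinitesimal `1 / x` the reversed polynomial
    -- reduces to its constant term `1`.
    have e := eval₂_reverse_mul_pow (RingHom.id Puiseux) x (p.map (powEmb m))
    rw [eval₂_id, eval₂_id] at e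
    rw [← e]
    apply mul_pos
    · rw [invOf_eq_inv, ← hy, reverse_map_of_injective _ (powEmb_injective m)]
      apply eval_map_powEmb_pos
      rw [hy0, ← coeff_zero_eq_eval_zero, coeff_map, coeff_zero_reverse, hpm.leadingCoeff, map_one]
      exact one_pos
    · apply Even.pow_pos _ hx0
      rwa [hpm.natDegree_map]

theorem constantCoeff_ne_zero_of_pval_eq_zero {m : ℕ+} {f : PowerSeries ℝ}
    (h : pval (powEmb m f) = 0) : PowerSeries.constantCoeff f ≠ 0 := by
  have hne : ofLex (powEmb m f).1 ≠ 0 := by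
    intro h0
    rw [pval_apply, h0, HahnSeries.orderTop_zero] at h
    exact WithTop.top_ne_zero h
  have h1 : (ofLex (powEmb m f).1).order = 0 := by
    have := HahnSeries.order_eq_orderTop_of_ne_zero hne
    rw [← pval_apply, h] at this
    exact_mod_cast this
  rw [← powEmb_constantCoeff m, ← h1, ← HahnSeries.leadingCoeff_eq]
  exact HahnSeries.leadingCoeff_ne_zero.2 hne

/-- The subleading coefficient moves by `(n + 1) s` under translation by `s`, so in characteristic
zero some translation kills it. -/
theorem coeff_taylor_natDegree_sub_one {R : Type*} [CommRing R] {P : R[X]} {n : ℕ} (hP : P.Monic)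
    (hn : P.natDegree = n + 1) (s : R) :
    (taylor s P).coeff n = P.coeff n + (n + 1) * s := by
  rw [taylor_coeff, eval_eq_sum_range' (n := 2)]
  · rw [Finset.sum_range_succ, Finset.sum_range_one, hasseDeriv_coeff, hasseDeriv_coeff]
    have : P.coeff (1 + n) = 1 := by rw [add_comm, ← hn]; exact hP
    rw [this, zero_add, Nat.choose_self, add_comm 1 n, Nat.choose_succ_self_right]
    push_cast; ring
  · refine lt_of_le_of_lt (natDegree_hasseDeriv_le P n) ?_
    omega

/-- A slope of the Newton polygon: `c` is the power of `t` whose exponent is minus the least of the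
ratios `v(f i) / (n - i)`. The minimality makes the scaled coefficients integral, and an index
realising the minimum gives a unit. -/
theorem exists_scaling (n : ℕ) (f : ℕ → Puiseux) (hf : ∃ i < n, f i ≠ 0) :
    ∃ c : Puiseux, 0 < c ∧ (∀ i < n, 0 ≤ pval (f i * c ^ (n - i))) ∧
      ∃ i < n, pval (f i * c ^ (n - i)) = 0 := by
  classical
  let S := (Finset.range n).filter (fun i => f i ≠ 0)
  have hS : S.Nonempty := by
    obtain ⟨i, hi, h⟩ := hf
    exact ⟨i, Finset.mem_filter.2 ⟨Finset.mem_range.2 hi, h⟩⟩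
  let w : ℕ → ℚ := fun i => (ofLex (f i).1).order / (n - i : ℕ)
  obtain ⟨i₀, hi₀, hmin⟩ := S.exists_min_image w hS
  have hv : ∀ i ∈ S, pval (f i * tpow (-(w i₀)) ^ (n - i)) =
      (((n - i : ℕ) * (w i - w i₀) : ℚ) : WithTop ℚ) := by
    intro i hi
    obtain ⟨hi1, hi2⟩ := Finset.mem_filter.1 hi
    have hpos : ((n - i : ℕ) : ℚ) ≠ 0 := by
      have := Finset.mem_range.1 hi1
      exact_mod_cast (by omega : n - i ≠ 0)
    rw [AddValuation.map_mul, AddValuation.map_pow, pval_tpow, pval_apply,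
      ← HahnSeries.order_eq_orderTop_of_ne_zero (by
        intro h0; exact hi2 (Subtype.ext h0)), ← WithTop.coe_nsmul, ← WithTop.coe_add]
    congr 1
    have : (ofLex (f i).1).order = (n - i : ℕ) * w i := by
      simp only [w]; field_simp
    rw [this, nsmul_eq_mul]; ring
  refine ⟨tpow (-(w i₀)), tpow_pos _, ?_, ?_⟩
  · intro i hi
    by_cases h : f i = 0
    · rw [h, zero_mul, AddValuation.map_zero]; exact le_top
    · have hiS : i ∈ S := Finset.mem_filter.2 ⟨Finset.mem_range.2 hi, h⟩
      rw [hv i hiS]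
      have : 0 ≤ ((n - i : ℕ) : ℚ) * (w i - w i₀) :=
        mul_nonneg (by positivity) (sub_nonneg.2 (hmin i hiS))
      exact_mod_cast this
  · refine ⟨i₀, Finset.mem_range.1 (Finset.mem_filter.1 hi₀).1, ?_⟩
    rw [hv i₀ hi₀, sub_self, mul_zero]; rfl

/-- The intermediate value property of a polynomial. -/
def HasIVP (P : Puiseux[X]) : Prop :=
  ∀ α β, α ≤ β → P.eval α * P.eval β < 0 → ∃ c ∈ Set.Icc α β, P.eval c = 0

/-- If a product changes sign, so does one of its factors. -/
theorem HasIVP.mul {P Q : Puiseux[X]} (hP : HasIVP P) (hQ : HasIVP Q) : HasIVP (P * Q) := by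
  intro α β hαβ h
  rw [eval_mul, eval_mul] at h
  have : P.eval α * P.eval β < 0 ∨ Q.eval α * Q.eval β < 0 := by
    by_contra hcon
    push Not at hcon
    have := mul_nonneg hcon.1 hcon.2
    linarith
  rcases this with h | h
  · obtain ⟨c, hc, h0⟩ := hP α β hαβ h
    exact ⟨c, hc, by rw [eval_mul, h0, zero_mul]⟩
  · obtain ⟨c, hc, h0⟩ := hQ α β hαβ h
    exact ⟨c, hc, by rw [eval_mul, h0, mul_zero]⟩

/-- Increasing affine changes of variable and positive factors do not matter; this covers both the
translation and the rescaling of roots used in the reduction below. -/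
theorem HasIVP.of_affine {P Q : Puiseux[X]} (hQ : HasIVP Q) {l s d : Puiseux} (hl : 0 < l)
    (hd : 0 < d) (h : ∀ x, Q.eval (l * (x - s)) = d * P.eval x) : HasIVP P := by
  intro α β hαβ hs
  obtain ⟨c, hc, h0⟩ := hQ (l * (α - s)) (l * (β - s)) (by gcongr) (by
    rw [h, h]
    have : d * P.eval α * (d * P.eval β) = d ^ 2 * (P.eval α * P.eval β) := by ring
    rw [this]
    exact mul_neg_of_pos_of_neg (by positivity) hs)
  refine ⟨c / l + s, ⟨?_, ?_⟩, ?_⟩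
  · have := (le_div_iff₀' hl).2 hc.1
    linarith
  · have := (div_le_iff₀' hl).2 hc.2
    linarith
  · have := h (c / l + s)
    rw [add_sub_cancel_right, mul_div_cancel₀ _ hl.ne', h0] at this
    exact (mul_eq_zero.1 this.symm).resolve_left hd.ne'

theorem hasIVP_X_pow (n : ℕ) : HasIVP (X ^ n) := by
  intro α β hαβ h
  refine ⟨0, ⟨?_, ?_⟩, ?_⟩
  · by_contra hα
    push Not at hα
    have hβ : 0 < β := lt_of_lt_of_le hα hαβ
    rw [eval_pow, eval_pow, eval_X, eval_X] at h
    have : 0 < α ^ n * β ^ n := by positivity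
    linarith
  · by_contra hβ
    push Not at hβ
    have hα : α < 0 := lt_of_le_of_lt hαβ hβ
    rw [eval_pow, eval_pow, eval_X, eval_X, ← mul_pow] at h
    have : 0 < (α * β) ^ n := pow_pos (mul_pos_of_neg_of_neg hα hβ) n
    linarith
  · rcases n with _ | n
    · simp at h
      exact absurd h (not_lt.2 zero_le_one)
    · simp

/-- Induction on the degree. A translation kills the subleading coefficient and a rescaling makes
all coefficients integral with a unit among the lower ones. If the reduction has no real root the
polynomial is positive; otherwise it splits into monic factors of smaller degree. -/
theorem hasIVP_of_monic (n : ℕ) : ∀ P : Puiseux[X], P.Monic → P.natDegree = n → HasIVP P := by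
  induction n using Nat.strong_induction_on with
  | _ n ih =>
  intro P hP hn
  rcases n with _ | n
  · rw [hP.natDegree_eq_zero.1 hn]
    simpa using hasIVP_X_pow 0
  set s : Puiseux := -(P.coeff n) / (n + 1) with hs
  set Q := taylor s P with hQ
  have hQm : Q.Monic := by rw [hQ, taylor_apply]; exact hP.comp_X_add_C s
  have hQd : Q.natDegree = n + 1 := by rw [hQ, natDegree_taylor, hn]
  have hQ0 : Q.coeff n = 0 := by
    rw [hQ, coeff_taylor_natDegree_sub_one hP hn, hs]
    have : (n + 1 : Puiseux) ≠ 0 := by positivity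
    field_simp
    ring
  have hQP : ∀ x, Q.eval (1 * (x - s)) = 1 * P.eval x := by
    intro x; rw [hQ, taylor_eval]; ring_nf
  suffices HasIVP Q from this.of_affine one_pos one_pos hQP
  by_cases hne : ∃ i < n + 1, Q.coeff i ≠ 0
  swap
  · push Not at hne
    have : Q = X ^ (n + 1) := by
      ext i
      rw [coeff_X_pow]
      rcases lt_trichotomy i (n + 1) with h | h | h
      · rw [hne i h, if_neg h.ne]
      · rw [h, if_pos rfl, ← hQd, hQm.coeff_natDegree]
      · rw [if_neg h.ne', coeff_eq_zero_of_natDegree_lt (by omega)]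
    rw [this]; exact hasIVP_X_pow _
  obtain ⟨c, hc, hc1, i₀, hi₀, hi₀v⟩ := exists_scaling (n + 1) Q.coeff hne
  set F := scaleRoots Q c with hF
  have hFm : F.Monic := (monic_scaleRoots_iff c).2 hQm
  have hFd : F.natDegree = n + 1 := by rw [hF, natDegree_scaleRoots, hQd]
  have hFc : ∀ i, F.coeff i = Q.coeff i * c ^ (n + 1 - i) := by
    intro i; rw [hF, coeff_scaleRoots, hQd]
  have hFQ : ∀ x, F.eval (c * (x - 0)) = c ^ (n + 1) * Q.eval x := by
    intro x; rw [sub_zero, hF, scaleRoots_eval_mul, hQd]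
  suffices HasIVP F from this.of_affine hc (by positivity) hFQ
  have hint : ∀ i, 0 ≤ pval (F.coeff i) := by
    intro i
    rcases lt_trichotomy i (n + 1) with h | h | h
    · rw [hFc]; exact hc1 i h
    · rw [h, ← hFd, hFm.coeff_natDegree, AddValuation.map_one]
    · rw [coeff_eq_zero_of_natDegree_lt (by omega), AddValuation.map_zero]; exact le_top
  by_cases hroot : ∀ (m : ℕ+) (p : (PowerSeries ℝ)[X]), p.map (powEmb m) = F →
      ∀ c, ¬ (p.map (PowerSeries.constantCoeff (R := ℝ))).IsRoot c
  · intro α β _ h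
    exact absurd h (not_lt.2 (mul_pos (eval_pos_of_no_root hFm hint hroot α)
      (eval_pos_of_no_root hFm hint hroot β)).le)
  push Not at hroot
  obtain ⟨m, p, hpF, r, hr⟩ := hroot
  have hpm : p.Monic := (Function.Injective.monic_map_iff (powEmb_injective m)).2 (hpF ▸ hFm)
  have hpd : p.natDegree = n + 1 := by rw [← hFd, ← hpF, hpm.natDegree_map]
  -- The root `r` does not have full multiplicity in the reduction: the vanishing subleading
  -- coefficient would give `r = 0`, so that all lower coefficients reduce to `0`, contrary to the
  -- unit coefficient at `i₀`.
  obtain ⟨f, g, hf, hg, hfg, hfd, hgd⟩ := exists_factor_of_isRoot_map hpm hr (by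
    intro heq
    have hcoeff : ∀ i, powEmb m (p.coeff i) = F.coeff i := by
      intro i; rw [← hpF, coeff_map]
    have h1 : p.coeff n = 0 := by
      apply powEmb_injective m
      rw [hcoeff, hFc, hQ0, zero_mul, map_zero]
    have h2 := congrArg (fun q => q.coeff n) heq
    simp only [coeff_map, h1, map_zero, hpd, sub_eq_add_neg, ← C_neg] at h2
    rw [coeff_X_add_C_pow, show n + 1 - n = 1 by omega, pow_one, Nat.choose_succ_self_right] at h2
    have hr0 : r = 0 := by
      rcases mul_eq_zero.1 h2.symm with h | h
      · exact neg_eq_zero.1 h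
      · exact absurd h (by positivity)
    have h3 := congrArg (fun q => q.coeff i₀) heq
    simp only [coeff_map, hr0, C_0, sub_zero, coeff_X_pow, hpd, if_neg hi₀.ne] at h3
    refine constantCoeff_ne_zero_of_pval_eq_zero (m := m) ?_ h3
    rw [hcoeff, hFc]; exact hi₀v)
  rw [← hpF, hfg, Polynomial.map_mul]
  exact (ih _ (hpd ▸ hfd) _ (hf.map _) (hf.natDegree_map _)).mul
    (ih _ (hpd ▸ hgd) _ (hg.map _) (hg.natDegree_map _))

/-- **Intermediate value theorem** for polynomials over the field of real Puiseux series. -/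
theorem puiseux_ivt (P : Puiseux[X]) : HasIVP P := by
  by_cases hP : P = 0
  · intro α β _ h; simp [hP] at h
  have hl : P.leadingCoeff⁻¹ ≠ 0 := inv_ne_zero (leadingCoeff_ne_zero.2 hP)
  have hmon := monic_mul_leadingCoeff_inv hP
  generalize P.leadingCoeff⁻¹ = l at hl hmon
  have hm := hasIVP_of_monic _ (P * C l) hmon rfl
  have hl2 : 0 < l * l := mul_self_pos.2 hl
  intro α β hαβ h
  obtain ⟨c, hc, h0⟩ := hm α β hαβ (by
    rw [eval_mul, eval_mul, eval_C, eval_C, mul_mul_mul_comm]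
    exact mul_neg_of_neg_of_pos h hl2)
  rw [eval_mul, eval_C] at h0
  exact ⟨c, hc, (mul_eq_zero.1 h0).resolve_right hl⟩

theorem puiseux_exists_sqrt {x : Puiseux} (hx : 0 ≤ x) : ∃ y, 0 ≤ y ∧ y ^ 2 = x := by
  rcases hx.eq_or_lt with rfl | hx
  · exact ⟨0, le_rfl, by simp⟩
  obtain ⟨c, hc, h0⟩ := puiseux_ivt (X ^ 2 - C x) 0 (x + 1) (by linarith) (by
    simp only [eval_sub, eval_pow, eval_X, eval_C]
    apply mul_neg_of_neg_of_pos
    · rw [zero_pow two_ne_zero, zero_sub]; exact neg_neg_of_pos hx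
    · nlinarith)
  refine ⟨c, hc.1, ?_⟩
  rw [eval_sub, eval_pow, eval_X, eval_C] at h0
  exact sub_eq_zero.1 h0

end IVT

end

/-! ### Functions dominated by a sign character, and generic points of a curve -/

section

section MonomialLike

open Polynomial Filter

/-- A sign, as a Puiseux series. -/
def sgn (u : ℤˣ) : Puiseux := ((u : ℤ) : Puiseux)

theorem sgn_mul (u v : ℤˣ) : sgn (u * v) = sgn u * sgn v := by simp [sgn]

theorem sgn_mul_self (u : ℤˣ) : sgn u * sgn u = 1 := by
  rw [← sgn_mul, Int.units_mul_self]; simp [sgn]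

theorem sgn_ne_zero (u : ℤˣ) : sgn u ≠ 0 := by
  intro h; have := sgn_mul_self u; rw [h, mul_zero] at this; exact zero_ne_one this

theorem pval_sgn (u : ℤˣ) : pval (sgn u) = 0 := by
  rcases Int.units_eq_one_or u with rfl | rfl
  · simp [sgn]
  · simp [sgn, AddValuation.map_neg]

theorem pval_mul_lt_mul_left {x a b : Puiseux} (hx : x ≠ 0) (h : pval a < pval b) :
    pval (x * a) < pval (x * b) := by
  rw [AddValuation.map_mul, AddValuation.map_mul]
  exact WithTop.add_lt_add_left (pval_ne_top.2 hx) h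

variable {Λ : Type*} [CommGroup Λ]

/-- A function on a group which, up to terms of larger valuation, is a multiple of a sign
character. -/
def IsMonomialLike (f : Λ → Puiseux) : Prop :=
  ∃ c : Puiseux, c ≠ 0 ∧ ∃ χ : Λ →* ℤˣ, ∀ x, pval c < pval (f x - sgn (χ x) * c)

theorem pval_sgn_mul (u : ℤˣ) (c : Puiseux) : pval (sgn u * c) = pval c := by
  rw [AddValuation.map_mul, pval_sgn, zero_add]

theorem pval_eq_of_lt {f : Puiseux} {u : ℤˣ} {c : Puiseux} (h : pval c < pval (f - sgn u * c)) :
    pval f = pval c := by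
  rw [← pval_sgn_mul u c] at h ⊢
  exact AddValuation.map_eq_of_lt_sub _ h

namespace IsMonomialLike

variable {f g : Λ → Puiseux}

theorem pval_eq (hf : IsMonomialLike f) (x : Λ) : pval (f x) = pval (f 1) := by
  obtain ⟨c, hc, χ, h⟩ := hf
  rw [pval_eq_of_lt (h x), pval_eq_of_lt (h 1)]

theorem ne_zero (hf : IsMonomialLike f) (x : Λ) : f x ≠ 0 := by
  obtain ⟨c, hc, χ, h⟩ := hf
  rw [← pval_ne_top, pval_eq_of_lt (h x)]
  exact pval_ne_top.2 hc

theorem mul (hf : IsMonomialLike f) (hg : IsMonomialLike g) :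
    IsMonomialLike (fun x => f x * g x) := by
  obtain ⟨c, hc, χ, h⟩ := hf
  obtain ⟨d, hd, ψ, h'⟩ := hg
  refine ⟨c * d, mul_ne_zero hc hd, χ * ψ, fun x => ?_⟩
  have e : f x * g x - sgn ((χ * ψ) x) * (c * d) =
      g x * (f x - sgn (χ x) * c) + sgn (χ x) * c * (g x - sgn (ψ x) * d) := by
    rw [MonoidHom.mul_apply, sgn_mul]; ring
  rw [e]
  apply AddValuation.map_lt_add
  · have hgx : g x ≠ 0 := by rw [← pval_ne_top, pval_eq_of_lt (h' x)]; exact pval_ne_top.2 hd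
    have : pval (c * d) = pval (g x * c) := by
      rw [AddValuation.map_mul, AddValuation.map_mul, pval_eq_of_lt (h' x), add_comm]
    rw [this]
    exact pval_mul_lt_mul_left hgx (h x)
  · have : pval (c * d) = pval (sgn (χ x) * c * d) := by
      rw [mul_assoc, pval_sgn_mul]
    rw [this]
    exact pval_mul_lt_mul_left (mul_ne_zero (sgn_ne_zero _) hc) (h' x)

theorem inv (hf : IsMonomialLike f) : IsMonomialLike (fun x => (f x)⁻¹) := by
  have hne := hf.ne_zero
  obtain ⟨c, hc, χ, h⟩ := hf
  refine ⟨c⁻¹, inv_ne_zero hc, χ, fun x => ?_⟩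
  have h1 := sgn_mul_self (χ x)
  have hfx : f x ≠ 0 := hne x
  have e : (f x)⁻¹ - sgn (χ x) * c⁻¹ =
      -(sgn (χ x) * (c⁻¹ * (f x)⁻¹)) * (f x - sgn (χ x) * c) := by
    field_simp
    linear_combination (-c) * h1
  have e2 : pval c⁻¹ = pval (-(sgn (χ x) * (c⁻¹ * (f x)⁻¹)) * c) := by
    rw [neg_mul, AddValuation.map_neg, mul_assoc, pval_sgn_mul, mul_assoc,
      AddValuation.map_mul, AddValuation.map_mul, AddValuation.map_inv (x := f x),
      pval_eq_of_lt (h x), ← AddValuation.map_inv, ← AddValuation.map_mul, inv_mul_cancel₀ hc,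
      AddValuation.map_one, add_zero]
  rw [e, e2]
  exact pval_mul_lt_mul_left (neg_ne_zero.2 (mul_ne_zero (sgn_ne_zero _)
    (mul_ne_zero (inv_ne_zero hc) (inv_ne_zero hfx)))) (h x)

theorem of_mul (hfg : IsMonomialLike (fun x => f x * g x)) (hg : IsMonomialLike g) :
    IsMonomialLike f := by
  have := hfg.mul hg.inv
  convert this using 2 with x
  field_simp [hg.ne_zero x]

/-- All values of `f` have the same valuation, so it is enough to compare the error with `f 1`. -/
theorem of_sub_lt (hf : IsMonomialLike f) (h : ∀ x, pval (f 1) < pval (g x - f x)) :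
    IsMonomialLike g := by
  obtain ⟨c, hc, χ, h'⟩ := hf
  refine ⟨c, hc, χ, fun x => ?_⟩
  have e : g x - sgn (χ x) * c = (g x - f x) + (f x - sgn (χ x) * c) := by ring
  rw [e]
  apply AddValuation.map_lt_add _ _ (h' x)
  rw [← pval_eq_of_lt (h' 1)]
  exact h x

theorem sgn_mul_const (χ : Λ →* ℤˣ) {c : Puiseux} (hc : c ≠ 0) :
    IsMonomialLike (fun x => sgn (χ x) * c) :=
  ⟨c, hc, χ, fun x => by
    simp only [sub_self]
    rw [AddValuation.map_zero]
    exact lt_top_iff_ne_top.2 (pval_ne_top.2 hc)⟩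

theorem pow (hf : IsMonomialLike f) (n : ℕ) : IsMonomialLike (fun x => f x ^ n) := by
  induction n with
  | zero =>
    have := sgn_mul_const (1 : Λ →* ℤˣ) (one_ne_zero (α := Puiseux))
    simpa [sgn] using this
  | succ n ih => simpa [pow_succ] using ih.mul hf

/-- The product of the signs over four elements with trivial product. -/
theorem four_signs (hf : IsMonomialLike f) {x y z w : Λ} (h : x * y * z * w = 1) :
    0 < f x * f y * (f z * f w) := by
  obtain ⟨c, hc, χ, h'⟩ := hf
  have hpos : ∀ x, 0 < f x * (sgn (χ x) * c) := by
    intro x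
    have hne : sgn (χ x) * c ≠ 0 := mul_ne_zero (sgn_ne_zero _) hc
    have h1 := h' x
    rw [← pval_sgn_mul (χ x) c] at h1
    rcases lt_or_gt_of_ne hne with hlt | hgt
    · exact mul_pos_of_neg_of_neg (neg_of_pval_sub_lt h1 hlt) hlt
    · exact mul_pos (pos_of_pval_sub_lt h1 hgt) hgt
  have h1 := mul_pos (mul_pos (hpos x) (hpos y)) (mul_pos (hpos z) (hpos w))
  -- The only place where the product of the four points matters: a character sends it to the
  -- product of the four signs.
  have h2 : sgn (χ x) * sgn (χ y) * sgn (χ z) * sgn (χ w) = 1 := by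
    rw [← sgn_mul, ← sgn_mul, ← sgn_mul, ← map_mul, ← map_mul, ← map_mul, h, map_one]
    simp [sgn]
  have h3 : f x * (sgn (χ x) * c) * (f y * (sgn (χ y) * c)) *
      (f z * (sgn (χ z) * c) * (f w * (sgn (χ w) * c))) =
      f x * f y * (f z * f w) * c ^ 4 := by
    linear_combination (f x * f y * (f z * f w) * c ^ 4) * h2
  rw [h3] at h1
  exact (mul_pos_iff_of_pos_right (by positivity)).1 h1

end IsMonomialLike

/-- The valuation of a monomial-like term does not depend on the point, so a term that is strictly
dominant at `1` is strictly dominant everywhere. -/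
theorem exists_dominant {S : Finset ℕ} (hS : S.Nonempty) {p : ℕ → Λ → Puiseux}
    (hp : ∀ k ∈ S, IsMonomialLike (p k)) {s : Λ → Puiseux} (hs : IsMonomialLike s)
    (hd : ∀ k ∈ S, ∀ l ∈ S, k ≠ l → pval (p k 1 * s 1 ^ k) ≠ pval (p l 1 * s 1 ^ l)) :
    ∃ k ∈ S, ∀ x, pval (p k 1 * s 1 ^ k) < pval (∑ i ∈ S, p i x * s x ^ i - p k x * s x ^ k) := by
  classical
  obtain ⟨k, hk, hmin⟩ := S.exists_min_image (fun k => pval (p k 1 * s 1 ^ k)) hS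
  refine ⟨k, hk, fun x => ?_⟩
  rw [← Finset.add_sum_erase S _ hk, add_sub_cancel_left]
  apply AddValuation.map_lt_sum'
  · rw [lt_top_iff_ne_top, pval_ne_top]
    exact mul_ne_zero ((hp k hk).ne_zero 1) (pow_ne_zero _ (hs.ne_zero 1))
  · intro i hi
    obtain ⟨hik, hiS⟩ := Finset.mem_erase.1 hi
    have := ((hp i hiS).mul (hs.pow i)).pval_eq x
    rw [this]
    exact lt_of_le_of_ne (hmin i hiS) (hd k hk i hiS hik.symm)

/-- Equality of the two valuations is a linear equation in `β` with slope `k - l ≠ 0`, so it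
excludes a single value. -/
theorem eventually_pval_ne {a b : Puiseux} (ha : a ≠ 0) (hb : b ≠ 0) {k l : ℕ} (hkl : k ≠ l) :
    ∀ᶠ β : ℚ in cofinite, pval (a * tpow β ^ k) ≠ pval (b * tpow β ^ l) := by
  obtain ⟨p, hp⟩ := WithTop.ne_top_iff_exists.1 (pval_ne_top.2 ha)
  obtain ⟨q, hq⟩ := WithTop.ne_top_iff_exists.1 (pval_ne_top.2 hb)
  rw [Filter.eventually_cofinite]
  refine (Set.finite_singleton ((p - q) / ((l : ℚ) - k))).subset ?_
  intro β hβ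
  simp only [ne_eq, not_not, Set.mem_ofPred_eq] at hβ
  rw [AddValuation.map_mul, AddValuation.map_mul, AddValuation.map_pow, AddValuation.map_pow,
    pval_tpow, ← hp, ← hq, ← WithTop.coe_nsmul, ← WithTop.coe_nsmul, ← WithTop.coe_add,
    ← WithTop.coe_add, WithTop.coe_inj, nsmul_eq_mul, nsmul_eq_mul] at hβ
  have : (l : ℚ) - k ≠ 0 := by
    rw [sub_ne_zero]; exact_mod_cast hkl.symm
  rw [Set.mem_singleton_iff, eq_div_iff this]
  linarith

theorem pval_two : pval (2 : Puiseux) = 0 := by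
  exact_mod_cast pval_of_natCast (n := 2) two_ne_zero

/-- If `P ≈ u * m` and `r * Q ≈ v * m` for a common monomial, and the "norm" of `P + r * Q` is
monomial-like, then so is `P + r * Q`. -/
theorem isMonomialLike_of_norm {P Q r m u v : Λ → Puiseux}
    (hu : IsMonomialLike u) (hv : IsMonomialLike v) (hm : IsMonomialLike m)
    (hr : ∀ x, 0 < pval (r x - 1))
    (hP : ∀ x, pval (u 1 * m 1) < pval (P x - u x * m x))
    (hQ : ∀ x, pval (v 1 * m 1) < pval (Q x - v x * m x))
    (hadd : (∀ x, u x + v x = 0) ∨ IsMonomialLike (fun x => u x + v x))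
    (hsub : (∀ x, u x - v x = 0) ∨ IsMonomialLike (fun x => u x - v x))
    (hN : IsMonomialLike (fun x => P x ^ 2 - r x ^ 2 * Q x ^ 2)) :
    IsMonomialLike (fun x => P x + r x * Q x) := by
  set μ := min (pval (u 1 * m 1)) (pval (v 1 * m 1)) with hμ
  have hm1 := hm.ne_zero 1
  have hrv : ∀ x, pval (r x) = 0 := by
    intro x
    have h1 : pval (1 : Puiseux) < pval (r x - 1) := by rw [AddValuation.map_one]; exact hr x
    rw [AddValuation.map_eq_of_lt_sub _ h1, AddValuation.map_one]
  have hsmall : ∀ x, μ < pval (P x - u x * m x) ∧ μ < pval (r x * Q x - v x * m x) := by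
    intro x
    refine ⟨lt_of_le_of_lt (min_le_left _ _) (hP x), lt_of_le_of_lt (min_le_right _ _) ?_⟩
    have e : r x * Q x - v x * m x = r x * (Q x - v x * m x) + v x * m x * (r x - 1) := by ring
    rw [e]
    apply AddValuation.map_lt_add
    · have h3 : pval (r x * (Q x - v x * m x)) = pval (Q x - v x * m x) := by
        rw [AddValuation.map_mul, hrv, zero_add]
      rw [h3]; exact hQ x
    · have h5 : pval (v x * m x) = pval (v 1 * m 1) := (hv.mul hm).pval_eq x
      have h4 : pval (v x * m x * 1) < pval (v x * m x * (r x - 1)) :=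
        pval_mul_lt_mul_left (mul_ne_zero (hv.ne_zero x) (hm.ne_zero x))
          (by rw [AddValuation.map_one]; exact hr x)
      rwa [mul_one, h5] at h4
  have hmain : ∀ (w F : Λ → Puiseux), IsMonomialLike w → pval (w 1 * m 1) ≤ μ →
      (∀ x, μ < pval (F x - w x * m x)) → IsMonomialLike F := by
    intro w F hw hwμ hF
    exact (hw.mul hm).of_sub_lt (fun x => lt_of_le_of_lt hwμ (hF x))
  -- Since `2` is a unit, `u + v` and `u - v` cannot both have valuation above the smaller of those
  -- of `u` and `v`: cancellation occurs in at most one of `P + r Q` and `P - r Q`.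
  by_cases hcase : pval ((u 1 + v 1) * m 1) ≤ μ
  · rcases hadd with h0 | h0
    · rw [h0 1, zero_mul, AddValuation.map_zero, top_le_iff, hμ, min_eq_top] at hcase
      exact absurd hcase.1 (pval_ne_top.2 (mul_ne_zero (hu.ne_zero 1) hm1))
    · refine hmain _ _ h0 hcase (fun x => ?_)
      have e : P x + r x * Q x - (u x + v x) * m x =
        (P x - u x * m x) + (r x * Q x - v x * m x) := by ring
      rw [e]
      exact AddValuation.map_lt_add _ (hsmall x).1 (hsmall x).2
  · have hcase' : pval ((u 1 - v 1) * m 1) ≤ μ := by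
      by_contra hcon
      push Not at hcase hcon
      have h1 : μ < pval (u 1 * m 1) := by
        have e : (2 : Puiseux) * (u 1 * m 1) = (u 1 + v 1) * m 1 + (u 1 - v 1) * m 1 := by ring
        have := AddValuation.map_lt_add _ hcase hcon
        rwa [← e, AddValuation.map_mul, pval_two, zero_add] at this
      have h2 : μ < pval (v 1 * m 1) := by
        have e : (2 : Puiseux) * (v 1 * m 1) = (u 1 + v 1) * m 1 + -((u 1 - v 1) * m 1) := by ring
        have := AddValuation.map_lt_add pval hcase
          (y := -((u 1 - v 1) * m 1)) (by rwa [AddValuation.map_neg])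
        rwa [← e, AddValuation.map_mul, pval_two, zero_add] at this
      exact absurd (lt_min h1 h2) (lt_irrefl _)
    rcases hsub with h0 | h0
    · rw [h0 1, zero_mul, AddValuation.map_zero, top_le_iff, hμ, min_eq_top] at hcase'
      exact absurd hcase'.1 (pval_ne_top.2 (mul_ne_zero (hu.ne_zero 1) hm1))
    · have hbar : IsMonomialLike (fun x => P x - r x * Q x) := by
        refine hmain _ _ h0 hcase' (fun x => ?_)
        have e : P x - r x * Q x - (u x - v x) * m x =
          (P x - u x * m x) + -(r x * Q x - v x * m x) := by ring
        rw [e]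
        exact AddValuation.map_lt_add _ (hsmall x).1
          (by rw [AddValuation.map_neg]; exact (hsmall x).2)
      -- The conjugate `P - r Q` is monomial-like because it suffers no cancellation, and the norm
      -- is monomial-like by assumption, hence so is their quotient.
      refine IsMonomialLike.of_mul (g := fun x => P x - r x * Q x) ?_ hbar
      convert hN using 2 with x
      ring

/-- A family of evaluations of a ring for which, generically in the parameter, every nonzero element
takes monomial-like values. -/
def GenericMono {𝒜 ι : Type*} [CommRing 𝒜] (l : Filter ι) (ev : ι → Λ → 𝒜 →+* Puiseux) : Prop :=
  ∀ x : 𝒜, x ≠ 0 → ∀ᶠ p in l, IsMonomialLike (fun y => ev p y x)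

section Step

variable {𝒜 ι : Type*} [CommRing 𝒜] {l : Filter ι} {ev : ι → Λ → 𝒜 →+* Puiseux}

theorem isMonomialLike_tpow (e : Λ →* ℤˣ) (β : ℚ) :
    IsMonomialLike (fun y => sgn (e y) * tpow β) :=
  IsMonomialLike.sgn_mul_const e (tpow_pos β).ne'

theorem eval₂_eq_sum_support (P : 𝒜[X]) (φ : 𝒜 →+* Puiseux) (s : Puiseux) :
    P.eval₂ φ s = ∑ i ∈ P.support, φ (P.coeff i) * s ^ i := by
  rw [Polynomial.eval₂_eq_sum, Polynomial.sum_def]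

theorem tpow_pow_ne {a b : Puiseux} (u v : ℤˣ) {β : ℚ} {k l : ℕ}
    (h : pval (a * tpow β ^ k) ≠ pval (b * tpow β ^ l)) :
    pval (a * (sgn u * tpow β) ^ k) ≠ pval (b * (sgn v * tpow β) ^ l) := by
  simpa only [AddValuation.map_mul, AddValuation.map_pow, pval_sgn, zero_add] using h

/-- First choose the parameter so that the finitely many nonzero coefficients are monomial-like;
with it fixed, only finitely many `β` give two terms the same valuation. The order of these choices
is why iterated filters appear. -/
theorem GenericMono.exists_dominant (h : GenericMono l ev) (e : Λ →* ℤˣ) {P : 𝒜[X]} (hP : P ≠ 0) :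
    ∀ᶠ p in l, ∀ᶠ β : ℚ in cofinite, ∃ k, P.coeff k ≠ 0 ∧
      ∀ x, pval (ev p 1 (P.coeff k) * (sgn (e 1) * tpow β) ^ k) <
        pval (P.eval₂ (ev p x) (sgn (e x) * tpow β) -
          ev p x (P.coeff k) * (sgn (e x) * tpow β) ^ k) := by
  have h1 : ∀ᶠ p in l, ∀ k ∈ P.support, IsMonomialLike (fun y => ev p y (P.coeff k)) := by
    rw [Finset.eventually_all]
    exact fun k hk => h _ (Polynomial.mem_support_iff.1 hk)
  filter_upwards [h1] with p hp
  have h2 : ∀ᶠ β : ℚ in cofinite, ∀ k ∈ P.support, ∀ l ∈ P.support, k ≠ l →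
      pval (ev p 1 (P.coeff k) * tpow β ^ k) ≠ pval (ev p 1 (P.coeff l) * tpow β ^ l) := by
    rw [Finset.eventually_all]
    intro k hk
    rw [Finset.eventually_all]
    intro l hl
    by_cases hkl : k = l
    · exact Eventually.of_forall fun _ h => absurd hkl h
    · filter_upwards [eventually_pval_ne ((hp k hk).ne_zero 1) ((hp l hl).ne_zero 1) hkl]
        with β hβ _ using hβ
  filter_upwards [h2] with β hβ
  obtain ⟨k, hk, hdom⟩ := SignsBielliptic.exists_dominant (Polynomial.support_nonempty.2 hP) hp
    (isMonomialLike_tpow e β) (fun k hk l hl hkl => tpow_pow_ne _ _ (hβ k hk l hl hkl))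
  refine ⟨k, Polynomial.mem_support_iff.1 hk, fun x => ?_⟩
  rw [eval₂_eq_sum_support]
  exact hdom x

theorem GenericMono.eval₂ (h : GenericMono l ev) (e : Λ →* ℤˣ) {P : 𝒜[X]} (hP : P ≠ 0) :
    ∀ᶠ p in l, ∀ᶠ β : ℚ in cofinite,
      IsMonomialLike (fun x => P.eval₂ (ev p x) (sgn (e x) * tpow β)) := by
  have h1 : ∀ᶠ p in l, ∀ k ∈ P.support, IsMonomialLike (fun y => ev p y (P.coeff k)) := by
    rw [Finset.eventually_all]
    exact fun k hk => h _ (Polynomial.mem_support_iff.1 hk)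
  filter_upwards [h.exists_dominant e hP, h1] with p hp hp1
  filter_upwards [hp] with β hβ
  obtain ⟨k, hk, hdom⟩ := hβ
  exact ((hp1 k (Polynomial.mem_support_iff.2 hk)).mul
    ((isMonomialLike_tpow e β).pow k)).of_sub_lt hdom

/-- Parity of degrees: the first term has odd degree and the second has even degree. -/
theorem ne_of_odd_degree [IsDomain 𝒜] {P Q g : 𝒜[X]} (hP : P ≠ 0) (hQ : Q ≠ 0)
    (hg : g.natDegree = 2) : X * P ^ 2 - g * Q ^ 2 ≠ 0 := by
  intro h
  have hg0 : g ≠ 0 := by rintro rfl; simp at hg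
  have := congrArg Polynomial.natDegree (sub_eq_zero.1 h)
  rw [Polynomial.natDegree_mul Polynomial.X_ne_zero (pow_ne_zero _ hP),
    Polynomial.natDegree_mul hg0 (pow_ne_zero _ hQ), Polynomial.natDegree_pow,
    Polynomial.natDegree_pow, Polynomial.natDegree_X, hg] at this
  omega

/-- If the dominant terms of `P` and `Q` have different degrees in `s`, generic `β` separates their
valuations and one of them wins. If the degrees agree, cancellation is possible, and the norm
decides: `s` times the norm of `P + r Q` is the value of the polynomial `X P² - g Q²`, which is
nonzero by parity and therefore generically monomial-like. -/
theorem GenericMono.add_root [IsDomain 𝒜] (h : GenericMono l ev) (e : Λ →* ℤˣ) {P Q : 𝒜[X]}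
    (a b : 𝒜) (hPQ : P ≠ 0 ∨ Q ≠ 0) :
    ∀ᶠ p in l, ∀ᶠ β : ℚ in cofinite, ∀ r : Λ → Puiseux, (∀ x, 0 < pval (r x - 1)) →
      (∀ x, (sgn (e x) * tpow β) * r x ^ 2 =
        (sgn (e x) * tpow β) ^ 2 + ev p x a * (sgn (e x) * tpow β) + ev p x b) →
      IsMonomialLike (fun x => P.eval₂ (ev p x) (sgn (e x) * tpow β) +
        r x * Q.eval₂ (ev p x) (sgn (e x) * tpow β)) := by
  by_cases hP : P = 0
  · have hQ : Q ≠ 0 := by tauto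
    filter_upwards [h.eval₂ e hQ] with p hp
    filter_upwards [hp] with β hβ r hr _
    have hr' : IsMonomialLike r := by
      refine ⟨1, one_ne_zero, 1, fun x => ?_⟩
      simpa [sgn, AddValuation.map_one] using hr x
    simpa [hP] using hr'.mul hβ
  by_cases hQ : Q = 0
  · filter_upwards [h.eval₂ e hP] with p hp
    filter_upwards [hp] with β hβ r hr _
    simpa [hQ] using hβ
  set g : 𝒜[X] := X ^ 2 + C a * X + C b with hg
  have hgd : g.natDegree = 2 := by
    rw [hg, show (X ^ 2 + C a * X + C b : 𝒜[X]) = C 1 * X ^ 2 + C a * X + C b by simp]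
    exact Polynomial.natDegree_quadratic one_ne_zero
  have h1 : ∀ x : 𝒜, ∀ᶠ p in l, x ≠ 0 → IsMonomialLike (fun y => ev p y x) := by
    intro x
    by_cases hx : x = 0
    · exact Eventually.of_forall fun _ h => absurd hx h
    · filter_upwards [h x hx] with p hp _ using hp
  -- In the case of equal degrees the coefficients may combine to their sum or their difference, so
  -- these have to be monomial-like as well, unless they vanish identically.
  have h2 : ∀ᶠ p in l, ∀ k ∈ P.support ∪ Q.support,
      (P.coeff k ≠ 0 → IsMonomialLike (fun y => ev p y (P.coeff k))) ∧
      (Q.coeff k ≠ 0 → IsMonomialLike (fun y => ev p y (Q.coeff k))) ∧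
      (P.coeff k + Q.coeff k ≠ 0 → IsMonomialLike (fun y => ev p y (P.coeff k + Q.coeff k))) ∧
      (P.coeff k - Q.coeff k ≠ 0 → IsMonomialLike (fun y => ev p y (P.coeff k - Q.coeff k))) := by
    rw [Finset.eventually_all]
    intro k _
    exact ((h1 _).and ((h1 _).and ((h1 _).and (h1 _))))
  filter_upwards [h2, h.exists_dominant e hP, h.exists_dominant e hQ,
    h.eval₂ e (ne_of_odd_degree hP hQ hgd)] with p hp hpP hpQ hpN
  have h3 : ∀ᶠ β : ℚ in cofinite, ∀ k ∈ P.support, ∀ l ∈ Q.support, k ≠ l →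
      pval (ev p 1 (P.coeff k) * tpow β ^ k) ≠ pval (ev p 1 (Q.coeff l) * tpow β ^ l) := by
    rw [Finset.eventually_all]
    intro k hk
    rw [Finset.eventually_all]
    intro l hl
    by_cases hkl : k = l
    · exact Eventually.of_forall fun _ h => absurd hkl h
    · filter_upwards [eventually_pval_ne
        (((hp k (Finset.mem_union_left _ hk)).1 (Polynomial.mem_support_iff.1 hk)).ne_zero 1)
        (((hp l (Finset.mem_union_right _ hl)).2.1 (Polynomial.mem_support_iff.1 hl)).ne_zero 1)
        hkl] with β hβ _ using hβ
  filter_upwards [hpP, hpQ, hpN, h3] with β ⟨k, hk, hkd⟩ ⟨j, hj, hjd⟩ hN hne r hr hrs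
  have hkP := Polynomial.mem_support_iff.2 hk
  have hjQ := Polynomial.mem_support_iff.2 hj
  have hs := isMonomialLike_tpow e β
  obtain ⟨hk1, -, hk3, hk4⟩ := hp k (Finset.mem_union_left _ hkP)
  obtain ⟨-, hj2, -, -⟩ := hp j (Finset.mem_union_right _ hjQ)
  by_cases hkj : k = j
  · subst hkj
    refine isMonomialLike_of_norm (hk1 hk) (hj2 hj) (hs.pow k) hr hkd hjd ?_ ?_ ?_
    · by_cases h0 : P.coeff k + Q.coeff k = 0
      · left; intro x; rw [← map_add, h0, map_zero]
      · right; simpa only [map_add] using hk3 h0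
    · by_cases h0 : P.coeff k - Q.coeff k = 0
      · left; intro x; rw [← map_sub, h0, map_zero]
      · right; simpa only [map_sub] using hk4 h0
    · refine IsMonomialLike.of_mul (g := fun x => sgn (e x) * tpow β) ?_ hs
      convert hN using 2 with x
      rw [hg]
      simp only [Polynomial.eval₂_sub, Polynomial.eval₂_mul, Polynomial.eval₂_X,
        Polynomial.eval₂_pow, Polynomial.eval₂_add, Polynomial.eval₂_C]
      rw [← hrs x]
      ring
  · have hu := (hk1 hk).mul (hs.pow k)
    have hv := (hj2 hj).mul (hs.pow j)
    have hr' : IsMonomialLike r := by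
      refine ⟨1, one_ne_zero, 1, fun x => ?_⟩
      simpa [sgn, AddValuation.map_one] using hr x
    have hrv : ∀ x, pval (r x) = 0 := by
      intro x
      have h1 : pval (1 : Puiseux) < pval (r x - 1) := by rw [AddValuation.map_one]; exact hr x
      rw [AddValuation.map_eq_of_lt_sub _ h1, AddValuation.map_one]
    have hQ' := hr'.mul (hv.of_sub_lt hjd)
    have hP' := hu.of_sub_lt hkd
    have hPv := fun x => hP'.pval_eq x
    have hPu : ∀ x, pval (P.eval₂ (ev p x) (sgn (e x) * tpow β)) =
        pval (ev p 1 (P.coeff k) * (sgn (e 1) * tpow β) ^ k) := fun x => by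
      rw [← hu.pval_eq x]
      exact AddValuation.map_eq_of_lt_sub _ (by rw [hu.pval_eq x]; exact hkd x)
    have hQv : ∀ x, pval (r x * Q.eval₂ (ev p x) (sgn (e x) * tpow β)) =
        pval (ev p 1 (Q.coeff j) * (sgn (e 1) * tpow β) ^ j) := fun x => by
      rw [AddValuation.map_mul, hrv, zero_add, ← hv.pval_eq x]
      exact AddValuation.map_eq_of_lt_sub _ (by rw [hv.pval_eq x]; exact hjd x)
    have hne' := tpow_pow_ne (e 1) (e 1) (hne k hkP j hjQ hkj)
    rcases lt_or_gt_of_ne hne' with hlt | hgt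
    · refine hP'.of_sub_lt (fun x => ?_)
      rw [add_sub_cancel_left, hPu, hQv]
      exact hlt
    · refine hQ'.of_sub_lt (fun x => ?_)
      rw [add_sub_cancel_right, hPu, hQv]
      exact hgt

variable {𝓑 : Type*} [CommRing 𝓑] [Algebra 𝒜 𝓑]

/-- Normal form of a function: both `D` and `r²` are polynomials in `s` divided by `s`, so up to a
power of `s` only `1` and `r` are needed over the polynomials in `s`. -/
theorem exists_pow_mul_eq {r D s : 𝓑} {a b : 𝒜} (hgen : Algebra.adjoin 𝒜 {r, D} = ⊤)
    (hr : s * r ^ 2 = s ^ 2 + algebraMap 𝒜 𝓑 a * s + algebraMap 𝒜 𝓑 b)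
    (hD : s * D = s ^ 2 - algebraMap 𝒜 𝓑 b) (f : 𝓑) :
    ∃ (N : ℕ) (P Q : 𝒜[X]), s ^ N * f = aeval s P + r * aeval s Q := by
  have hf : f ∈ Algebra.adjoin 𝒜 {r, D} := hgen ▸ Algebra.mem_top
  induction hf using Algebra.adjoin_induction with
  | mem x hx =>
    rcases hx with rfl | rfl
    · exact ⟨0, 0, 1, by simp⟩
    · exact ⟨1, X ^ 2 - C b, 0, by simp [hD]⟩
  | algebraMap x => exact ⟨0, C x, 0, by simp⟩
  | add x y _ _ hx hy =>
    obtain ⟨N, P, Q, h⟩ := hx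
    obtain ⟨N', P', Q', h'⟩ := hy
    refine ⟨N + N', X ^ N' * P + X ^ N * P', X ^ N' * Q + X ^ N * Q', ?_⟩
    simp only [map_add, map_mul, map_pow, aeval_X]
    linear_combination s ^ N' * h + s ^ N * h'
  | mul x y _ _ hx hy =>
    obtain ⟨N, P, Q, h⟩ := hx
    obtain ⟨N', P', Q', h'⟩ := hy
    refine ⟨N + N' + 1, X * P * P' + (X ^ 2 + C a * X + C b) * Q * Q',
      X * (P * Q' + P' * Q), ?_⟩
    simp only [map_add, map_mul, map_pow, aeval_X, aeval_C]
    linear_combination (s * s ^ N' * y) * h + s * (aeval s P + r * aeval s Q) * h' +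
      aeval s Q * aeval s Q' * hr

/-- Passing from a coefficient ring to (the coordinate ring of) the curve
`s r² = s² + a s + b`, evaluated at the points with `s = ± t ^ β` and `r ≈ 1`. -/
theorem GenericMono.curve [IsDomain 𝒜] (h : GenericMono l ev) (e : Λ →* ℤˣ) {r D s : 𝓑} {a b : 𝒜}
    (hgen : Algebra.adjoin 𝒜 {r, D} = ⊤) (hs : IsUnit s)
    (hr : s * r ^ 2 = s ^ 2 + algebraMap 𝒜 𝓑 a * s + algebraMap 𝒜 𝓑 b)
    (hD : s * D = s ^ 2 - algebraMap 𝒜 𝓑 b)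
    {ev' : ι × Set.Ioo (0 : ℚ) 1 → Λ → 𝓑 →+* Puiseux}
    (hev : ∀ p β y x, ev' (p, β) y (algebraMap 𝒜 𝓑 x) = ev p y x)
    (hevr : ∀ p y, 0 < pval (ev' p y r - 1))
    (hevs : ∀ p y, ev' p y s = sgn (e y) * tpow p.2) :
    GenericMono (l.curry cofinite) ev' := by
  intro f hf
  obtain ⟨N, P, Q, hPQ⟩ := exists_pow_mul_eq hgen hr hD f
  have hne : P ≠ 0 ∨ Q ≠ 0 := by
    by_contra hcon
    push Not at hcon
    rw [hcon.1, hcon.2, map_zero, mul_zero, add_zero] at hPQ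
    exact hf ((hs.pow N).mul_left_eq_zero.1 (by rw [mul_comm]; exact hPQ))
  rw [eventually_curry_iff]
  filter_upwards [h.add_root e a b hne] with p hp
  -- Finitely many excluded exponents in `ℚ` exclude only finitely many in the interval.
  have hp' := (Subtype.val_injective (p := fun q : ℚ => q ∈ Set.Ioo (0 : ℚ) 1)).tendsto_cofinite.eventually hp
  filter_upwards [hp'] with β hβ
  have hcomp : ∀ y, (ev' (p, β) y).comp (algebraMap 𝒜 𝓑) = ev p y := fun y =>
    RingHom.ext fun x => hev p β y x
  have hev2 : ∀ (y : Λ) (P : 𝒜[X]), ev' (p, β) y (aeval s P) =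
      P.eval₂ (ev p y) (sgn (e y) * tpow β) := by
    intro y P
    rw [Polynomial.aeval_def, Polynomial.hom_eval₂, hcomp, hevs]
  have key := hβ (fun y => ev' (p, β) y r) (fun y => hevr _ _) (fun y => by
    have := congrArg (ev' (p, β) y) hr
    simpa only [map_mul, map_pow, map_add, hev, hevs] using this)
  refine IsMonomialLike.of_mul (g := fun y => (sgn (e y) * tpow β) ^ N) ?_
    ((isMonomialLike_tpow e β).pow N)
  convert key using 2 with y
  rw [← hev2, ← hev2, ← map_mul, ← map_add, ← hPQ, map_mul, map_pow, hevs, mul_comm]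

/-- The starting point of the iteration: constants, with the trivial character and a parameter space
reduced to a point. -/
theorem genericMono_id : GenericMono (pure () : Filter Unit)
    (fun _ (_ : Λ) => RingHom.id Puiseux) := by
  intro x hx
  refine Eventually.of_forall fun _ => ⟨x, hx, 1, fun y => ?_⟩
  simpa [sgn, AddValuation.map_zero, lt_top_iff_ne_top] using pval_ne_top.2 hx

end Step

end MonomialLike

end

/-! ### Double covers of the affine line -/

section

open Polynomial

section DoubleCover

variable {R S : Type*} [CommRing R] [CommRing S]

/-- The double cover `R[x, y]/(y² - g(x))` of the affine line. -/
abbrev DoubleCover (g : R[X]) := QuadraticAlgebra R[X] g 0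

namespace DoubleCover

/-- The coordinate `x`. -/
def x (g : R[X]) : DoubleCover g := algebraMap R[X] _ X

/-- The coordinate `y`. -/
def y (g : R[X]) : DoubleCover g := QuadraticAlgebra.omega

variable {g : R[X]}

theorem aeval_x (p : R[X]) : aeval (x g) p = algebraMap R[X] (DoubleCover g) p := by
  rw [x, aeval_algebraMap_apply, aeval_X_left_apply]

theorem y_sq : y g ^ 2 = aeval (x g) g := by
  rw [aeval_x, y, pow_two, QuadraticAlgebra.omega_mul_omega_eq_mk]
  rfl

theorem eq_add (f : DoubleCover g) : f = aeval (x g) f.re + aeval (x g) f.im * y g := by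
  rw [aeval_x, aeval_x, y]
  ext <;> simp

theorem ext_basis {p q p' q' : R[X]} (h : aeval (x g) p + aeval (x g) q * y g =
    aeval (x g) p' + aeval (x g) q' * y g) : p = p' ∧ q = q' := by
  simp only [aeval_x, y] at h
  have h1 := congrArg QuadraticAlgebra.re h
  have h2 := congrArg QuadraticAlgebra.im h
  simp at h1 h2
  exact ⟨h1, h2⟩

/-- The universal property of the double cover. -/
def lift (φ : R →+* S) (a b : S) (h : b ^ 2 = g.eval₂ φ a) : DoubleCover g →+* S where
  toFun z := z.re.eval₂ φ a + z.im.eval₂ φ a * b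
  map_zero' := by simp
  map_one' := by simp [QuadraticAlgebra.re_one, QuadraticAlgebra.im_one]
  map_add' z w := by simp [Polynomial.eval₂_add]; ring
  map_mul' z w := by
    simp only [QuadraticAlgebra.re_mul, QuadraticAlgebra.im_mul, Polynomial.eval₂_add,
      Polynomial.eval₂_mul, ← h, zero_mul, add_zero]
    ring

section lift

variable (φ : R →+* S) (a b : S) (h : b ^ 2 = g.eval₂ φ a)

@[simp] theorem lift_x : lift φ a b h (x g) = a := by simp [lift, x]

@[simp] theorem lift_y : lift φ a b h (y g) = b := by simp [lift, y]

@[simp] theorem lift_algebraMap (c : R) : lift φ a b h (algebraMap R _ c) = φ c := by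
  rw [IsScalarTower.algebraMap_apply R R[X] (DoubleCover g)]
  simp [lift]

theorem lift_comp_algebraMap : (lift φ a b h).comp (algebraMap R _) = φ :=
  RingHom.ext fun c => lift_algebraMap φ a b h c

theorem lift_apply (z : DoubleCover g) :
    lift φ a b h z = z.re.eval₂ φ a + z.im.eval₂ φ a * b := rfl

end lift

theorem hom_ext {f f' : DoubleCover g →+* S}
    (h : f.comp (algebraMap R _) = f'.comp (algebraMap R _)) (hx : f (x g) = f' (x g))
    (hy : f (y g) = f' (y g)) : f = f' := by
  ext z
  rw [eq_add z]
  simp only [map_add, map_mul, hy, aeval_def, Polynomial.hom_eval₂, h, hx]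

theorem algHom_ext {A : Type*} [CommRing A] [Algebra R A] {f f' : DoubleCover g →ₐ[R] A}
    (hx : f (x g) = f' (x g)) (hy : f (y g) = f' (y g)) : f = f' := by
  have := hom_ext (f := (f : DoubleCover g →+* A)) (f' := f') (by ext; simp) hx hy
  ext z
  exact RingHom.congr_fun this z

/-- The universal property of the double cover, for algebras. -/
def liftₐ {A : Type*} [CommRing A] [Algebra R A] (a b : A) (h : b ^ 2 = aeval a g) :
    DoubleCover g →ₐ[R] A :=
  { lift (algebraMap R A) a b h with commutes' := fun c => lift_algebraMap _ _ _ _ c }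

section liftₐ

variable {A : Type*} [CommRing A] [Algebra R A] (a b : A) (h : b ^ 2 = aeval a g)

@[simp] theorem liftₐ_x : liftₐ a b h (x g) = a := lift_x _ _ _ h

@[simp] theorem liftₐ_y : liftₐ a b h (y g) = b := lift_y _ _ _ h

end liftₐ

theorem adjoin_eq_top : Algebra.adjoin R {x g, y g} = ⊤ := by
  rw [eq_top_iff]
  intro z _
  have hx : ∀ p : R[X], aeval (x g) p ∈ Algebra.adjoin R {x g, y g} := fun p =>
    Algebra.adjoin_mono (by simp) (aeval_mem_adjoin_singleton R (x g))
  rw [eq_add z]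
  exact add_mem (hx _) (mul_mem (hx _) (Algebra.subset_adjoin (by simp)))

/-- A double cover of the line over a field, ramified somewhere with order one, is integral. -/
theorem isDomain {K : Type*} [Field K] {g : K[X]} (hg : IsCoprime g (derivative g))
    (hd : 0 < g.natDegree) : IsDomain (DoubleCover g) := by
  have hg0 : g ≠ 0 := by rintro rfl; simp at hd
  have hnu : ¬ IsUnit g := by
    intro h; rw [Polynomial.natDegree_eq_zero_of_isUnit h] at hd; exact lt_irrefl _ hd
  obtain ⟨p, hp, hpg⟩ := WfDvdMonoid.exists_irreducible_factor hnu hg0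
  have hpp := hp.prime
  have hfin : ∀ f : K[X], f ≠ 0 → FiniteMultiplicity p f := fun f hf =>
    FiniteMultiplicity.of_not_isUnit hp.not_isUnit hf
  have hsq : Squarefree g := (Separable.squarefree (show g.Separable from hg))
  have hmul : multiplicity p g = 1 := by
    apply le_antisymm
    · by_contra hcon
      have h2 : p ^ 2 ∣ g := (hfin g hg0).pow_dvd_iff_le_multiplicity.2 (by omega)
      exact hp.not_isUnit (hsq p (by rwa [pow_two] at h2))
    · have := (hfin g hg0).pow_dvd_iff_le_multiplicity (k := 1)
      rw [pow_one] at this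
      exact this.1 hpg
  -- The irreducible `p` divides `g` exactly once, so it would occur to an even power on the left
  -- and to an odd power on the right.
  have key : ∀ u v : K[X], u ^ 2 = g * v ^ 2 → v = 0 := by
    intro u v huv
    by_contra hv
    have hu : u ≠ 0 := by
      rintro rfl
      rw [zero_pow two_ne_zero] at huv
      exact mul_ne_zero hg0 (pow_ne_zero 2 hv) huv.symm
    have := congrArg (multiplicity p) huv
    rw [(hfin u hu).multiplicity_pow hpp, multiplicity_mul hpp
      (hfin _ (mul_ne_zero hg0 (pow_ne_zero 2 hv))), (hfin v hv).multiplicity_pow hpp, hmul] at this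
    omega
  have hnorm : ∀ z : DoubleCover g, QuadraticAlgebra.norm z = 0 → z = 0 := by
    intro z hz
    rw [QuadraticAlgebra.norm_def] at hz
    have him : z.im = 0 := key z.re z.im (by linear_combination hz)
    have hre : z.re = 0 := by
      rw [him] at hz
      simpa using hz
    exact QuadraticAlgebra.ext hre him
  have : NoZeroDivisors (DoubleCover g) := by
    refine ⟨fun {a b} hab => ?_⟩
    have := congrArg QuadraticAlgebra.norm hab
    rw [map_mul, QuadraticAlgebra.norm_zero] at this
    rcases mul_eq_zero.1 this with h | h
    · exact Or.inl (hnorm a h)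
    · exact Or.inr (hnorm b h)
  exact NoZeroDivisors.to_isDomain _

end DoubleCover

end DoubleCover

/-! ### Smoothness of double covers -/

section Smooth

open RingHom

/-- A criterion for a ring homomorphism to be étale, via the universal property of standard étale
algebras. -/
theorem etale_of_standardEtalePair {R L : Type} [CommRing R] [CommRing L] (φ : R →+* L)
    (P : StandardEtalePair R) (x : L) (hf : P.f.eval₂ φ x = 0) (hg : IsUnit (P.g.eval₂ φ x))
    (ψ : L →+* P.Ring) (hψ : ψ.comp φ = algebraMap R P.Ring) (hψx : ψ x = P.X)
    (hext : ∀ χ : L →+* L, χ.comp φ = φ → χ x = x → χ = RingHom.id L) : φ.Etale := by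
  let := φ.toAlgebra
  have hm : P.HasMap x := ⟨hf, hg⟩
  let ψ' : L →ₐ[R] P.Ring := { ψ with commutes' := fun r => RingHom.congr_fun hψ r }
  let e : P.Ring ≃ₐ[R] L := AlgEquiv.ofAlgHom (P.lift x hm) ψ'
    (by
      have h := hext ((P.lift x hm).comp ψ' : L →ₐ[R] L)
        (RingHom.ext fun r => ((P.lift x hm).comp ψ').commutes r) (by
          change P.lift x hm (ψ x) = x
          rw [hψx, StandardEtalePair.lift_X])
      ext z
      exact RingHom.congr_fun h z)
    (StandardEtalePair.hom_ext (by
      change ψ (P.lift x hm P.X) = P.X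
      rw [StandardEtalePair.lift_X, hψx]))
  have : Algebra.Etale R L := Algebra.Etale.of_equiv e
  exact this

/-- The presentation with one generator and no relation: its Jacobian is an empty determinant. -/
theorem isStandardSmooth_C (R : Type) [CommRing R] :
    IsStandardSmoothOfRelativeDimension 1 (C : R →+* R[X]) := by
  have hsurj : Function.Surjective (MvPolynomial.aeval (R := R) (fun _ : Unit => (X : R[X]))) := by
    intro p
    refine ⟨p.eval₂ MvPolynomial.C (MvPolynomial.X ()), ?_⟩
    rw [← AlgHom.coe_toRingHom, Polynomial.hom_eval₂]
    have : ((MvPolynomial.aeval (R := R) (fun _ : Unit => (X : R[X]))) :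
      MvPolynomial Unit R →+* R[X]).comp MvPolynomial.C = C := by ext; simp
    rw [this]
    simp
  have hinj : Function.Injective (MvPolynomial.aeval (R := R) (fun _ : Unit => (X : R[X]))) := by
    have : Function.LeftInverse (fun p : R[X] => p.eval₂ MvPolynomial.C (MvPolynomial.X ()))
        (MvPolynomial.aeval (R := R) (fun _ : Unit => (X : R[X]))) := by
      intro p
      induction p using MvPolynomial.induction_on with
      | C a => simp
      | add p q hp hq => simp only [map_add, Polynomial.eval₂_add, hp, hq]
      | mul_X p n hp => simp only [map_mul, Polynomial.eval₂_mul, hp]; simp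
    exact this.injective
  let P : Algebra.PreSubmersivePresentation R R[X] Unit PEmpty.{1} :=
    { toGenerators := .ofSurjective _ hsurj
      relation := PEmpty.elim
      span_range_relation_eq_ker := by
        rw [Set.range_eq_empty, Ideal.span_empty, Algebra.Generators.ker_eq_ker_aeval_val]
        exact ((RingHom.injective_iff_ker_eq_bot _).1 hinj).symm
      map := PEmpty.elim
      map_inj := fun a => a.elim }
  let P' : Algebra.SubmersivePresentation R R[X] Unit PEmpty.{1} :=
    { P with
      jacobian_isUnit := by
        have : P.jacobian = 1 := by
          rw [Algebra.PreSubmersivePresentation.jacobian_eq_jacobiMatrix_det,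
            Matrix.det_isEmpty, map_one]
        exact this ▸ isUnit_one }
  have := P'.isStandardSmoothOfRelativeDimension (n := 1) (by simp [Algebra.Presentation.dimension])
  rw [← Polynomial.algebraMap_eq, isStandardSmoothOfRelativeDimension_algebraMap]
  exact this

/-- An étale map to the affine line is what a local coordinate on a curve amounts to. -/
theorem locally_smooth_of_etale {R L : Type} [CommRing R] [CommRing L] {f : R →+* L}
    {φ : R[X] →+* L} (hφ : φ.Etale) (h : φ.comp C = f) :
    IsStandardSmoothOfRelativeDimension 1 f := by
  rw [← h]
  exact IsStandardSmoothOfRelativeDimension.comp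
    (etale_iff_isStandardSmoothOfRelativeDimension_zero.1 hφ) (isStandardSmooth_C R)

/-- The Jacobian criterion for `y² = u g(x)`. Where `y` is invertible the curve is étale over the
`x`-line, and where `g'(x)` is invertible it is étale over the `y`-line. A Bézout relation between
`g` and `g'` shows that these two loci cover, since `g(x)` is a multiple of `y²`. -/
theorem DoubleCover.locally_smooth {R : Type} [CommRing R] {g : R[X]} {u v : R} (huv : u * v = 1)
    (hg : g.Monic) (hco : IsCoprime g (derivative g)) (h2 : IsUnit (2 : R)) :
    Locally (IsStandardSmoothOfRelativeDimension 1)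
      (algebraMap R (DoubleCover (C u * g))) := by
  set A := DoubleCover (C u * g) with hA
  obtain ⟨w, hw⟩ := h2.exists_right_inv
  have hy : y (C u * g) ^ 2 = algebraMap R A u * aeval (x (C u * g)) g := by
    rw [y_sq, map_mul, aeval_C]
  refine ⟨{y (C u * g), aeval (x (C u * g)) (derivative g)}, ?_, ?_⟩
  · obtain ⟨p, q, hpq⟩ := hco
    rw [Ideal.eq_top_iff_one]
    have h1 := congrArg (aeval (x (C u * g))) hpq
    rw [map_add, map_mul, map_mul, map_one] at h1
    have huv' : algebraMap R A u * algebraMap R A v = 1 := by rw [← map_mul, huv, map_one]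
    rw [Ideal.mem_span_pair]
    refine ⟨aeval (x (C u * g)) p * algebraMap R A v * y _, aeval (x (C u * g)) q, ?_⟩
    linear_combination h1 + aeval (x (C u * g)) p * algebraMap R A v * hy +
      aeval (x (C u * g)) p * aeval (x (C u * g)) g * huv'
  · rintro t (rfl | rfl)
    -- The coordinate is `x`; the equation `z² = u g` has invertible derivative `2 z` where `z = y`
    -- is invertible.
    · set L := Localization.Away (y (C u * g))
      let ι : A →+* L := algebraMap A L
      let P : StandardEtalePair R[X] :=
        { f := X ^ 2 - C (C u * g)
          monic_f := monic_X_pow_sub_C _ two_ne_zero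
          g := X
          cond := ⟨C (C w), 0, 1, by
            rw [derivative_sub, derivative_X_pow, derivative_C, mul_zero, add_zero, sub_zero]
            have : (C (C w) : R[X][X]) * 2 = 1 := by
              rw [← map_ofNat C, ← map_ofNat C, ← map_mul, ← map_mul, mul_comm, hw, map_one,
                map_one]
            push_cast
            simp only [map_ofNat]
            linear_combination X * this⟩ }
      have hPX : P.X ^ 2 = algebraMap R[X] P.Ring (C u * g) := by
        have := P.hasMap_X.1
        change aeval P.X (X ^ 2 - C (C u * g)) = 0 at this
        rw [map_sub, aeval_C, map_pow, aeval_X, sub_eq_zero] at this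
        exact this
      have hrel : P.X ^ 2 = eval₂ ((algebraMap R[X] P.Ring).comp C) (algebraMap R[X] P.Ring X)
          (C u * g) := by
        rw [hPX, ← Polynomial.hom_eval₂, Polynomial.eval₂_C_X]
      let ψ₀ : A →+* P.Ring := DoubleCover.lift ((algebraMap R[X] P.Ring).comp C)
        (algebraMap R[X] P.Ring X) P.X hrel
      have hψ₀y : ψ₀ (y _) = P.X := DoubleCover.lift_y _ _ _ hrel
      have hunit : IsUnit (ψ₀ (y _)) := by
        rw [hψ₀y]
        have := P.hasMap_X.2
        change IsUnit (aeval P.X X) at this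
        rwa [aeval_X] at this
      let φ : R[X] →+* L := ι.comp (algebraMap R[X] A)
      refine locally_smooth_of_etale (φ := φ) (etale_of_standardEtalePair φ P (ι (y _)) ?_ ?_
        (IsLocalization.Away.lift (y (C u * g)) hunit) ?_ ?_ ?_) ?_
      · change eval₂ φ _ (X ^ 2 - C (C u * g)) = 0
        rw [Polynomial.eval₂_sub, Polynomial.eval₂_C, Polynomial.eval₂_X_pow, ← map_pow, y_sq,
          aeval_x, sub_eq_zero]
        rfl
      · change IsUnit (eval₂ φ _ X)
        rw [Polynomial.eval₂_X]
        exact IsLocalization.Away.algebraMap_isUnit (y (C u * g))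
      · rw [← RingHom.comp_assoc, IsLocalization.Away.lift_comp]
        apply Polynomial.ringHom_ext'
        · ext c
          simp only [RingHom.comp_apply]
          exact DoubleCover.lift_algebraMap _ _ _ hrel c
        · exact DoubleCover.lift_x _ _ _ hrel
      · rw [IsLocalization.Away.lift_eq, hψ₀y]
      · intro χ hχ hχy
        apply IsLocalization.ringHom_ext (Submonoid.powers (y (C u * g)))
        refine DoubleCover.hom_ext ?_ ?_ ?_
        · ext c
          exact RingHom.congr_fun hχ (C c)
        · exact RingHom.congr_fun hχ X
        · exact hχy
      · rfl
    · set d := aeval (x (C u * g)) (derivative g)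
      set L := Localization.Away d
      let ι : A →+* L := algebraMap A L
      -- The coordinate is now `y`, and `x` is a root of the polynomial `g(z) - v y²`. It is monic
      -- in `z` as soon as `g` has positive degree; if `g = 1` then `g' = 0` and the localisation is
      -- the zero ring.
      have hmon : (g.map C - C (C v * X ^ 2) : R[X][X]).Monic ∨ g = 1 := by
        by_cases h : g = 1
        · exact Or.inr h
        · left
          apply Monic.sub_of_left (hg.map _)
          rw [Polynomial.degree_map_eq_of_injective C_injective]
          refine lt_of_le_of_lt degree_C_le ?_
          exact Polynomial.natDegree_pos_iff_degree_pos.1 (hg.natDegree_pos.2 h)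
      rcases hmon with hmon | rfl
      swap
      · have h0 : d = 0 := by simp [d]
        have : Subsingleton L := IsLocalization.subsingleton (M := Submonoid.powers d) (S := L)
          ⟨1, by simp [h0]⟩
        have : IsStandardSmoothOfRelativeDimension 1 (ι.comp (algebraMap R A)) := by
          refine locally_smooth_of_etale (φ := eval₂RingHom (ι.comp (algebraMap R A)) 0) ?_ ?_
          · rw [etale_iff_isStandardSmoothOfRelativeDimension_zero]
            let := (eval₂RingHom (ι.comp (algebraMap R A)) 0).toAlgebra
            exact (inferInstance : Algebra.IsStandardSmoothOfRelativeDimension 0 R[X] L)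
          · ext c; exact Subsingleton.elim _ _
        exact this
      let P : StandardEtalePair R[X] :=
        { f := g.map C - C (C v * X ^ 2)
          monic_f := hmon
          g := (derivative g).map C
          cond := ⟨1, 0, 1, by rw [derivative_sub, derivative_C, sub_zero, derivative_map]; simp⟩ }
      have hfe : ∀ {T : Type} [CommRing T] (φ : R[X] →+* T) (z : T), eval₂ φ z P.f =
          eval₂ (φ.comp C) z g - φ (C v) * φ X ^ 2 := by
        intro T _ φ z
        change eval₂ φ z (g.map C - C (C v * X ^ 2)) = _
        rw [Polynomial.eval₂_sub, Polynomial.eval₂_C, Polynomial.eval₂_map, map_mul, map_pow]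
      have hge : ∀ {T : Type} [CommRing T] (φ : R[X] →+* T) (z : T), eval₂ φ z P.g =
          eval₂ (φ.comp C) z (derivative g) := by
        intro T _ φ z
        change eval₂ φ z ((derivative g).map C) = _
        rw [Polynomial.eval₂_map]
      have hPX : eval₂ ((algebraMap R[X] P.Ring).comp C) P.X g =
          algebraMap R[X] P.Ring (C v) * algebraMap R[X] P.Ring X ^ 2 := by
        rw [← sub_eq_zero, ← hfe]
        exact P.hasMap_X.1
      have hrel : algebraMap R[X] P.Ring X ^ 2 = eval₂ ((algebraMap R[X] P.Ring).comp C) P.X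
          (C u * g) := by
        rw [Polynomial.eval₂_mul, Polynomial.eval₂_C, hPX, ← mul_assoc, RingHom.comp_apply,
          ← map_mul, ← map_mul, huv, map_one, map_one, one_mul]
      let ψ₀ : A →+* P.Ring := DoubleCover.lift ((algebraMap R[X] P.Ring).comp C)
        P.X (algebraMap R[X] P.Ring X) hrel
      have hψ₀x : ψ₀ (x _) = P.X := DoubleCover.lift_x _ _ _ hrel
      have hψ₀c : ψ₀.comp (algebraMap R A) = (algebraMap R[X] P.Ring).comp C :=
        DoubleCover.lift_comp_algebraMap _ _ _ hrel
      have hunit : IsUnit (ψ₀ d) := by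
        change IsUnit (ψ₀ (eval₂ (algebraMap R A) (x (C u * g)) (derivative g)))
        rw [Polynomial.hom_eval₂, hψ₀c, hψ₀x, ← hge]
        exact P.hasMap_X.2
      let φ : R[X] →+* L := eval₂RingHom (ι.comp (algebraMap R A)) (ι (y _))
      have hφC : φ.comp C = ι.comp (algebraMap R A) := by ext; simp [φ]
      have hφX : φ X = ι (y _) := by simp [φ]
      refine locally_smooth_of_etale (φ := φ) (etale_of_standardEtalePair φ P (ι (x _)) ?_ ?_
        (IsLocalization.Away.lift d hunit) ?_ ?_ ?_) hφC
      · rw [hfe, hφC, hφX, ← RingHom.comp_apply φ C, hφC, ← Polynomial.hom_eval₂, ← aeval_def,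
          RingHom.comp_apply, ← map_pow, ← map_mul, ← map_sub, hy, ← mul_assoc, ← map_mul,
          mul_comm v u, huv, map_one, one_mul, sub_self, map_zero]
      · rw [hge, hφC, ← Polynomial.hom_eval₂, ← aeval_def]
        exact IsLocalization.Away.algebraMap_isUnit d
      · apply Polynomial.ringHom_ext'
        · rw [RingHom.comp_assoc, hφC, ← RingHom.comp_assoc, IsLocalization.Away.lift_comp, hψ₀c]
        · rw [RingHom.comp_apply, hφX, IsLocalization.Away.lift_eq]
          exact DoubleCover.lift_y _ _ _ hrel
      · rw [IsLocalization.Away.lift_eq, hψ₀x]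
      · intro χ hχ hχx
        apply IsLocalization.ringHom_ext (Submonoid.powers d)
        refine DoubleCover.hom_ext ?_ ?_ ?_
        · have := congrArg (fun f => f.comp C) hχ
          simp only [RingHom.comp_assoc, hφC] at this
          exact this
        · exact hχx
        · have := RingHom.congr_fun hχ X
          rw [RingHom.comp_apply, hφX] at this
          exact this

end Smooth

end

/-! ### Charts of a morphism and a criterion for quotients -/

section

section Schemes

theorem top_le_preimage_opensRange {X Y : Scheme.{0}} (f : X ⟶ Y) [IsOpenImmersion f] :
    ⊤ ≤ f ⁻¹ᵁ f.opensRange := fun x _ => ⟨x, rfl⟩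

theorem isIso_appLE_opensRange {X Y : Scheme.{0}} (f : X ⟶ Y) [IsOpenImmersion f] :
    IsIso (f.appLE f.opensRange ⊤ (top_le_preimage_opensRange f)) := by
  have h : ∀ (U : Y.Opens) (hU : U = f ''ᵁ ⊤) (e : ⊤ ≤ f ⁻¹ᵁ U), IsIso (f.appLE U ⊤ e) := by
    rintro U rfl e
    rw [← f.appIso_hom']
    infer_instance
  exact h _ f.image_top_eq_opensRange.symm _

theorem bijective_appLE_opensRange {X Y : Scheme.{0}} (f : X ⟶ Y) [IsOpenImmersion f] :
    Function.Bijective (f.appLE f.opensRange ⊤ (top_le_preimage_opensRange f)).hom := by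
  have := isIso_appLE_opensRange f
  exact ConcreteCategory.bijective_of_isIso (f.appLE f.opensRange ⊤ (top_le_preimage_opensRange f))

theorem appLE_appLE_apply {X Y Z : Scheme.{0}} (f : X ⟶ Y) (g : Y ⟶ Z) (U V W e₁ e₂)
    (s : Γ(Z, U)) : (f.appLE V W e₂).hom ((g.appLE U V e₁).hom s) =
      ((f ≫ g).appLE U W (e₂.trans ((TopologicalSpace.Opens.map f.base).map (homOfLE e₁)).le)).hom
        s := by
  rw [← Scheme.Hom.appLE_comp_appLE f g U V W e₁ e₂]; rfl

theorem appLE_eq_of_eq {X Y : Scheme.{0}} {f g : X ⟶ Y} (h : f = g) (U : Y.Opens) (V : X.Opens)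
    (e : V ≤ f ⁻¹ᵁ U) (s : Γ(Y, U)) :
    (f.appLE U V e).hom s = (g.appLE U V (h ▸ e)).hom s := by
  subst h; rfl

theorem appLE_map_apply {X Y : Scheme.{0}} (f : X ⟶ Y) {U U' : Y.Opens} {V : X.Opens}
    (e : V ≤ f ⁻¹ᵁ U) (i : U ⟶ U') (s : Γ(Y, U')) :
    (f.appLE U V e).hom ((Y.presheaf.map i.op).hom s) =
      (f.appLE U' V (e.trans ((TopologicalSpace.Opens.map f.base).map i).le)).hom s := by
  rw [← Scheme.Hom.map_appLE f e i.op]; rfl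

theorem appTop_apply {X Y : Scheme.{0}} (f : X ⟶ Y) (e : ⊤ ≤ f ⁻¹ᵁ ⊤) (s : Γ(Y, ⊤)) :
    f.appTop.hom s = (f.appLE ⊤ ⊤ e).hom s := by
  rw [Scheme.Hom.appTop, Scheme.Hom.app_eq_appLE]; rfl

theorem app_apply {X Y : Scheme.{0}} (f : X ⟶ Y) (U : Y.Opens) (s : Γ(Y, U)) :
    (f.app U).hom s = (f.appLE U (f ⁻¹ᵁ U) le_rfl).hom s := by
  rw [Scheme.Hom.app_eq_appLE]

/-- A chart of the morphism `π : X ⟶ Y`: an affine morphism `ρ` which is the restriction of `π` over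
an open subscheme of `Y`. -/
structure Chart {X Y : Scheme.{0}} (π : X ⟶ Y) {T Z : Scheme.{0}} (c : T ⟶ X) (ι : Z ⟶ Y)
    (ρ : T ⟶ Z) : Prop where
  left : IsOpenImmersion c
  right : IsOpenImmersion ι
  comm : c ≫ π = ρ ≫ ι
  range_le : ∀ x : X, π x ∈ Set.range ι → x ∈ Set.range c

namespace Chart

variable {X Y T Z : Scheme.{0}} {π : X ⟶ Y} {c : T ⟶ X} {ι : Z ⟶ Y} {ρ : T ⟶ Z}

theorem preimage_eq (h : Chart π c ι ρ) :
    haveI := h.left; haveI := h.right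
    π ⁻¹ᵁ ι.opensRange = c.opensRange := by
  have := h.left; have := h.right
  ext x
  refine ⟨fun hx => h.range_le x hx, ?_⟩
  rintro ⟨y, rfl⟩
  refine ⟨ρ y, ?_⟩
  rw [← Scheme.Hom.comp_apply, ← h.comm, Scheme.Hom.comp_apply]

theorem isPullback (h : Chart π c ι ρ) : IsPullback ρ c ι π := by
  have := h.left; have := h.right
  exact IsOpenImmersion.isPullback ρ c ι π h.comm h.preimage_eq

theorem of_isPullback [IsOpenImmersion ι] (h : IsPullback ρ c ι π) : Chart π c ι ρ := by
  have : IsOpenImmersion c := MorphismProperty.of_isPullback h inferInstance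
  refine ⟨inferInstance, inferInstance, h.w.symm, fun x hx => ?_⟩
  obtain ⟨z, hz⟩ := hx
  obtain ⟨t, -, ht⟩ := Scheme.exists_preimage_of_isPullback h z x hz
  exact ⟨t, ht⟩

/-- Charts can be shrunk to basic open sets. -/
theorem basicOpen {A B : CommRingCat.{0}} {c : Spec A ⟶ X} {ι : Spec B ⟶ Y} {φ : B ⟶ A}
    (h : Chart π c ι (Spec.map φ)) (f : B) :
    Chart π (Spec.map (CommRingCat.ofHom (algebraMap A (Localization.Away (φ f)))) ≫ c)
      (Spec.map (CommRingCat.ofHom (algebraMap B (Localization.Away f))) ≫ ι)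
      (Spec.map (CommRingCat.ofHom (Localization.awayMap φ.hom f))) := by
  have := h.left; have := h.right
  refine ⟨inferInstance, inferInstance, ?_, ?_⟩
  · rw [Category.assoc, h.comm, ← Category.assoc, ← Category.assoc, ← Spec.map_comp,
      ← Spec.map_comp]
    congr 2
    ext x
    simp [Localization.awayMap, IsLocalization.Away.map]
  · rintro x ⟨z, hz⟩
    rw [Scheme.Hom.comp_apply] at hz
    obtain ⟨y, rfl⟩ := h.range_le x ⟨_, hz⟩
    rw [← Scheme.Hom.comp_apply c, h.comm, Scheme.Hom.comp_apply] at hz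
    have hz' := ι.isOpenEmbedding.injective hz
    have hy : y ∈ Set.range (Spec.map (CommRingCat.ofHom
        (algebraMap A (Localization.Away (φ f))))) := by
      have h1 : Spec.map φ y ∈ Set.range (Spec.map (CommRingCat.ofHom
        (algebraMap B (Localization.Away f)))) := ⟨z, hz'⟩
      have e1 := PrimeSpectrum.localization_away_comap_range (Localization.Away f) f
      have e2 := PrimeSpectrum.localization_away_comap_range (Localization.Away (φ f)) (φ f)
      have h2 : Spec.map φ y ∈ (PrimeSpectrum.basicOpen f : Set (PrimeSpectrum B)) := e1 ▸ h1
      have h3 : y ∈ (PrimeSpectrum.basicOpen (φ f) : Set (PrimeSpectrum A)) := h2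
      exact e2.symm ▸ h3
    obtain ⟨w, rfl⟩ := hy
    exact ⟨w, rfl⟩

/-- On the image of `ι` the pullback of functions along `π` is the pullback along `ρ`, up to the
identifications given by the two open immersions. -/
theorem injective_of (h : Chart π c ι ρ) (hρ : Function.Injective ρ.appTop.hom) {U : Y.Opens}
    (hU : haveI := h.right; ι.opensRange ≤ U) {r r' : Γ(Y, U)}
    (hr : (π.app U).hom r = (π.app U).hom r') :
    haveI := h.right
    (Y.presheaf.map (homOfLE hU).op).hom r = (Y.presheaf.map (homOfLE hU).op).hom r' := by
  have := h.left; have := h.right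
  apply (bijective_appLE_opensRange ι).1
  rw [appLE_map_apply, appLE_map_apply]
  apply hρ
  have e : ∀ e', ρ.appTop.hom ((ι.appLE U ⊤ e').hom r) = ρ.appTop.hom ((ι.appLE U ⊤ e').hom r') := by
    intro e'
    have e1 : ∀ s, ρ.appTop.hom ((ι.appLE U ⊤ e').hom s) = (c.appLE (π ⁻¹ᵁ U) ⊤ (by
        intro x _
        change π (c x) ∈ U
        rw [← Scheme.Hom.comp_apply, h.comm, Scheme.Hom.comp_apply]
        exact hU ⟨_, rfl⟩)).hom ((π.app U).hom s) := by
      intro s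
      refine (appTop_apply ρ (fun x _ => trivial) _).trans ?_
      rw [app_apply]
      exact (appLE_appLE_apply ..).trans ((appLE_eq_of_eq h.comm.symm ..).trans
        (appLE_appLE_apply ..).symm)
    rw [e1, e1, hr]
  exact e _

/-- An invariant section restricts on the chart to a function fixed by `σ`, which by hypothesis
comes from `Z`. -/
theorem exists_of_invariant (h : Chart π c ι ρ) {σ : T ⟶ T} {α : X ⟶ X} (hα : c ≫ α = σ ≫ c)
    (hαπ : α ≫ π = π)
    (hρ : ∀ a : Γ(T, ⊤), σ.appTop.hom a = a → ∃ b, ρ.appTop.hom b = a) {U : Y.Opens}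
    (hU : haveI := h.right; ι.opensRange ≤ U) {s : Γ(X, π ⁻¹ᵁ U)}
    (hs : ∀ e, (α.appLE (π ⁻¹ᵁ U) (π ⁻¹ᵁ U) e).hom s = s) :
    haveI := h.right
    ∃ r : Γ(Y, ι.opensRange), (π.app ι.opensRange).hom r =
      (X.presheaf.map (homOfLE (π.preimage_mono hU)).op).hom s := by
  have := h.left; have := h.right
  have hcU : ⊤ ≤ c ⁻¹ᵁ π ⁻¹ᵁ U := by
    intro x _
    change π (c x) ∈ U
    rw [← Scheme.Hom.comp_apply, h.comm, Scheme.Hom.comp_apply]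
    exact hU ⟨_, rfl⟩
  have hcι : ⊤ ≤ c ⁻¹ᵁ π ⁻¹ᵁ ι.opensRange := by
    rw [h.preimage_eq]; exact top_le_preimage_opensRange c
  obtain ⟨b, hb⟩ := hρ ((c.appLE (π ⁻¹ᵁ U) ⊤ hcU).hom s) (by
    have hαU : π ⁻¹ᵁ U ≤ α ⁻¹ᵁ π ⁻¹ᵁ U := by
      rw [← Scheme.Hom.comp_preimage, hαπ]
    refine (appTop_apply σ (fun x _ => trivial) _).trans ?_
    refine (appLE_appLE_apply ..).trans ((appLE_eq_of_eq hα.symm ..).trans ?_)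
    rw [← appLE_appLE_apply c α _ (π ⁻¹ᵁ U) ⊤ hαU hcU, hs])
  obtain ⟨r, hr⟩ := (bijective_appLE_opensRange ι).2 b
  refine ⟨r, ?_⟩
  have hinj : Function.Injective (c.appLE (π ⁻¹ᵁ ι.opensRange) ⊤ hcι).hom := by
    have key : ∀ (V : X.Opens) (hV : V = c.opensRange) (e : ⊤ ≤ c ⁻¹ᵁ V),
        Function.Injective (c.appLE V ⊤ e).hom := by
      rintro V rfl e
      exact (bijective_appLE_opensRange c).1
    exact key _ h.preimage_eq _
  apply hinj
  rw [appLE_map_apply, app_apply]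
  refine (appLE_appLE_apply ..).trans ((appLE_eq_of_eq h.comm ..).trans ?_)
  refine ((appTop_apply ρ (fun x _ => trivial) _).trans (appLE_appLE_apply ρ ι _ ⊤ ⊤
    (top_le_preimage_opensRange ι) (fun x _ => trivial) r)).symm.trans ?_
  exact (congrArg ρ.appTop.hom hr).trans hb

end Chart

theorem appTop_specMap_injective {A B : CommRingCat.{0}} (φ : A ⟶ B)
    (h : Function.Injective φ) : Function.Injective (Spec.map φ).appTop.hom := by
  intro a b hab
  have e := Scheme.ΓSpecIso_naturality φ
  have e' : ∀ x, (Scheme.ΓSpecIso B).hom.hom ((Spec.map φ).appTop.hom x) =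
      φ.hom ((Scheme.ΓSpecIso A).hom.hom x) := fun x => by
    have := congrArg (fun f => f.hom x) e
    exact this
  have h1 := congrArg (Scheme.ΓSpecIso B).hom.hom hab
  rw [e', e'] at h1
  exact (ConcreteCategory.bijective_of_isIso (Scheme.ΓSpecIso A).hom).1 (h h1)

theorem appTop_specMap_exists {A B : CommRingCat.{0}} (φ : A ⟶ B) (σ : B ⟶ B)
    (h : ∀ b, σ b = b → ∃ a, φ a = b) (b) (hb : (Spec.map σ).appTop.hom b = b) :
    ∃ a, (Spec.map φ).appTop.hom a = b := by
  have e' : ∀ {A B : CommRingCat.{0}} (φ : A ⟶ B) x,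
      (Scheme.ΓSpecIso B).hom.hom ((Spec.map φ).appTop.hom x) =
      φ.hom ((Scheme.ΓSpecIso A).hom.hom x) := fun φ x => by
    have := congrArg (fun f => f.hom x) (Scheme.ΓSpecIso_naturality φ)
    exact this
  obtain ⟨a, ha⟩ := h ((Scheme.ΓSpecIso B).hom.hom b) (by
    have := e' σ b
    rw [hb] at this
    exact this.symm)
  obtain ⟨a', rfl⟩ := (ConcreteCategory.bijective_of_isIso (Scheme.ΓSpecIso A).hom).2 a
  refine ⟨a', (ConcreteCategory.bijective_of_isIso (Scheme.ΓSpecIso B).hom).1 ?_⟩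
  exact (e' φ a').trans ha

theorem awayMap_injective {A B : Type} [CommRing A] [CommRing B] (φ : A →+* B)
    (h : Function.Injective φ) (f : A) : Function.Injective (Localization.awayMap φ f) := by
  rw [injective_iff_map_eq_zero]
  intro x hx
  obtain ⟨n, a, hn⟩ := IsLocalization.Away.surj f x
  have h1 : algebraMap B (Localization.Away (φ f)) (φ a) = algebraMap B _ (0 : B) := by
    have := congrArg (Localization.awayMap φ f) hn
    rw [map_mul, hx, zero_mul] at this
    rw [map_zero, this]
    simp [Localization.awayMap, IsLocalization.Away.map]
  obtain ⟨m, hm⟩ := IsLocalization.Away.exists_of_eq (φ f) h1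
  rw [mul_zero, ← map_pow, ← map_mul, ← map_zero φ] at hm
  have h2 := congrArg (algebraMap A (Localization.Away f)) (h hm)
  have hu : IsUnit (algebraMap A (Localization.Away f) f) :=
    IsLocalization.Away.algebraMap_isUnit _
  rw [map_mul, map_pow, ← hn, map_zero] at h2
  exact ((hu.pow n).mul_left_eq_zero).1 (((hu.pow m).mul_right_eq_zero).1 h2)

/-- Clear denominators: the denominator is fixed by `σ`, so the numerator times a suitable power of
it is fixed too and lies in the range of `φ`. -/
theorem awayMap_exists_of_invariant {A B : Type} [CommRing A] [CommRing B] (φ : B →+* A)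
    (σ : A →+* A) (hrange : ∀ a, σ a = a → ∃ b, φ b = a) (f : B) (hf : σ (φ f) = φ f)
    (σ' : Localization.Away (φ f) →+* Localization.Away (φ f))
    (hσ' : ∀ a, σ' (algebraMap A _ a) = algebraMap A _ (σ a)) (a : Localization.Away (φ f))
    (ha : σ' a = a) : ∃ b, Localization.awayMap φ f b = a := by
  obtain ⟨n, a₀, hn⟩ := IsLocalization.Away.surj (φ f) a
  have h1 : algebraMap A (Localization.Away (φ f)) (σ a₀) = algebraMap A _ a₀ := by
    have := congrArg σ' hn
    rw [map_mul, ha, map_pow, hσ', hσ', hf, hn] at this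
    exact this.symm
  obtain ⟨m, hm⟩ := IsLocalization.Away.exists_of_eq (φ f) h1
  obtain ⟨b, hb⟩ := hrange ((φ f) ^ m * a₀) (by rw [map_mul, map_pow, hf]; exact hm)
  have hu : IsUnit (algebraMap A (Localization.Away (φ f)) (φ f)) :=
    IsLocalization.Away.algebraMap_isUnit _
  have hv : IsUnit (algebraMap B (Localization.Away f) f) :=
    IsLocalization.Away.algebraMap_isUnit _
  have e : ∀ x, Localization.awayMap φ f (algebraMap B _ x) = algebraMap A _ (φ x) := fun x => by
    simp [Localization.awayMap, IsLocalization.Away.map]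
  obtain ⟨v, hv'⟩ := (hv.pow (m + n)).exists_left_inv
  refine ⟨v * algebraMap B _ b, ?_⟩
  have h2 := congrArg (Localization.awayMap φ f) hv'
  rw [map_mul, map_pow, e, map_one] at h2
  rw [map_mul, e, hb, map_mul, map_pow, ← hn]
  linear_combination a * h2

/-- A criterion for being the quotient by a finite group, in terms of charts. -/
theorem isQuotient_of_charts {G : Type} {X Y : Scheme.{0}} {act : G → (X ⟶ X)} {π : X ⟶ Y}
    (hinv : ∀ g, act g ≫ π = π) (g₀ : G) {I : Type} {A B : I → CommRingCat.{0}}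
    {c : ∀ i, Spec (A i) ⟶ X} {ι : ∀ i, Spec (B i) ⟶ Y} {φ : ∀ i, B i ⟶ A i}
    (hch : ∀ i, Chart π (c i) (ι i) (Spec.map (φ i))) (hcov : ∀ y : Y, ∃ i, y ∈ Set.range (ι i))
    {σ : ∀ i, A i ⟶ A i} (hσ : ∀ i, c i ≫ act g₀ = Spec.map (σ i) ≫ c i)
    (hinj : ∀ i, Function.Injective (φ i))
    (hrange : ∀ i a, σ i a = a → ∃ b, φ i b = a) : IsQuotient act π := by
  -- Invariance of `π` is transported to the rings, `ι i` being a monomorphism.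
  have hσφ : ∀ i b, σ i (φ i b) = φ i b := by
    intro i b
    have := (hch i).right
    have h1 : Spec.map (φ i ≫ σ i) = Spec.map (φ i) := by
      rw [← cancel_mono (ι i), Spec.map_comp, Category.assoc, ← (hch i).comm, ← Category.assoc,
        ← hσ, Category.assoc, hinv]
    have h2 := Spec.map_injective h1
    exact congrArg (fun f => f.hom b) h2
  -- the shrunken charts
  let c' : ∀ p : Σ i, B i, Spec (.of (Localization.Away (φ p.1 p.2))) ⟶ X := fun p =>
    Spec.map (CommRingCat.ofHom (algebraMap _ _)) ≫ c p.1
  let ι' : ∀ p : Σ i, B i, Spec (.of (Localization.Away p.2)) ⟶ Y := fun p =>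
    Spec.map (CommRingCat.ofHom (algebraMap _ _)) ≫ ι p.1
  have hch' : ∀ p : Σ i, B i, Chart π (c' p) (ι' p)
      (Spec.map (CommRingCat.ofHom (Localization.awayMap (φ p.1).hom p.2))) := fun p =>
    (hch p.1).basicOpen p.2
  have := fun p => (hch' p).right
  have hcov' : ∀ (U : Y.Opens) (y : Y), y ∈ U → ∃ p, y ∈ (ι' p).opensRange ∧
      (ι' p).opensRange ≤ U := by
    intro U y hy
    obtain ⟨i, z, rfl⟩ := hcov y
    obtain ⟨_, ⟨f, rfl⟩, hf, hfU⟩ := TopologicalSpace.Opens.isBasis_iff_nbhd.1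
      (PrimeSpectrum.isBasis_basic_opens (R := B i)) (show z ∈ ι i ⁻¹ᵁ U from hy)
    have hr := PrimeSpectrum.localization_away_comap_range (Localization.Away f) f
    refine ⟨⟨i, f⟩, ?_, ?_⟩
    · have hf' : z ∈ (PrimeSpectrum.basicOpen f : Set (PrimeSpectrum (B i))) := hf
      rw [← hr] at hf'
      obtain ⟨w, hw⟩ := hf'
      exact ⟨w, congrArg (ι i) hw⟩
    · rintro _ ⟨w, rfl⟩
      have hw : Spec.map (CommRingCat.ofHom (algebraMap (B i) (Localization.Away f))) w ∈
          (PrimeSpectrum.basicOpen f : Set (PrimeSpectrum (B i))) := hr ▸ ⟨w, rfl⟩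
      exact hfU hw
  have hinj' : ∀ p : Σ i, B i, Function.Injective (Spec.map (CommRingCat.ofHom
      (Localization.awayMap (φ p.1).hom p.2))).appTop.hom := fun p =>
    appTop_specMap_injective _ (awayMap_injective (φ p.1).hom (hinj p.1) p.2)
  -- Injectivity serves twice: for the uniqueness of the descended section, and to match the local
  -- descents on overlaps, where their pullbacks are restrictions of one section.
  have hπinj : ∀ (U : Y.Opens), Function.Injective (π.app U).hom := by
    intro U r r' hrr
    choose p hp hpU using fun y : U => hcov' U y.1 y.2
    refine TopCat.Sheaf.eq_of_locally_eq' Y.sheaf (fun y => (ι' (p y)).opensRange) U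
      (fun y => homOfLE (hpU y)) ?_ r r' (fun y => ?_)
    · intro y hy
      exact TopologicalSpace.Opens.mem_iSup.2 ⟨⟨y, hy⟩, hp ⟨y, hy⟩⟩
    · exact (hch' (p y)).injective_of (hinj' _) (hpU y) hrr
  refine ⟨hinv, ?_, ?_⟩
  · apply isAffineHom_of_forall_exists_isAffineOpen
    intro y
    obtain ⟨i, hi⟩ := hcov y
    have := (hch i).left
    have := (hch i).right
    refine ⟨(ι i).opensRange, hi, isAffineOpen_opensRange _, ?_⟩
    rw [(hch i).preimage_eq]
    exact isAffineOpen_opensRange _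
  · intro U s hs
    choose p hp hpU using fun y : U => hcov' U y.1 y.2
    have hex : ∀ y : U, ∃ r : Γ(Y, (ι' (p y)).opensRange), (π.app (ι' (p y)).opensRange).hom r =
        (X.presheaf.map (homOfLE (π.preimage_mono (hpU y))).op).hom s := by
      intro y
      set q := p y
      have hcomm : (σ q.1).hom (φ q.1 q.2) = φ q.1 q.2 := hσφ q.1 q.2
      let σ' : Localization.Away (φ q.1 q.2) →+* Localization.Away (φ q.1 q.2) :=
        IsLocalization.Away.lift (φ q.1 q.2) (g := (algebraMap _ _).comp (σ q.1).hom) (by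
          rw [RingHom.comp_apply, hcomm]
          exact IsLocalization.Away.algebraMap_isUnit _)
      have hσ' : σ'.comp (algebraMap _ _) = (algebraMap _ _).comp (σ q.1).hom :=
        IsLocalization.Away.lift_comp _ _
      -- Invariance under the single element `g₀` is enough here; the rest of the group is not
      -- needed for descent.
      refine (hch' q).exists_of_invariant (σ := Spec.map (CommRingCat.ofHom σ')) (α := act g₀)
        ?_ (hinv g₀) ?_ (hpU y) (fun e => hs g₀ e)
      · change (Spec.map _ ≫ c q.1) ≫ act g₀ = Spec.map _ ≫ Spec.map _ ≫ c q.1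
        rw [Category.assoc, hσ, ← Category.assoc, ← Category.assoc, ← Spec.map_comp,
          ← Spec.map_comp]
        congr 2
        ext x
        exact (RingHom.congr_fun hσ' x).symm
      · apply appTop_specMap_exists
        intro a ha
        change σ' a = a at ha
        exact awayMap_exists_of_invariant (φ q.1).hom (σ q.1).hom (hrange q.1) q.2 hcomm σ'
          (RingHom.congr_fun hσ') a ha
    choose r hr using hex
    obtain ⟨R, hR, -⟩ := TopCat.Sheaf.existsUnique_gluing' Y.sheaf
      (fun y => (ι' (p y)).opensRange) U (fun y => homOfLE (hpU y))
      (fun y hy => TopologicalSpace.Opens.mem_iSup.2 ⟨⟨y, hy⟩, hp ⟨y, hy⟩⟩) r (by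
        intro y y'
        apply hπinj
        simp only []
        have nat : ∀ {V W : Y.Opens} (i : W ⟶ V) (a : Γ(Y, V)),
            (π.app W).hom ((Y.presheaf.map i.op).hom a) =
            (X.presheaf.map (homOfLE (π.preimage_mono i.le)).op).hom ((π.app V).hom a) :=
          fun i a => congrArg (fun f => f.hom a) (π.naturality i.op)
        refine (nat _ (r y)).trans (Eq.trans ?_ (nat _ (r y')).symm)
        rw [hr, hr]
        simp only [← CommRingCat.comp_apply, ← Functor.map_comp]
        rfl)
    have hRs : (π.app U).hom R = s := by
      refine TopCat.Sheaf.eq_of_locally_eq' X.sheaf (fun y => π ⁻¹ᵁ (ι' (p y)).opensRange)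
        (π ⁻¹ᵁ U) (fun y => homOfLE (π.preimage_mono (hpU y))) ?_ _ _ (fun y => ?_)
      · intro x hx
        exact TopologicalSpace.Opens.mem_iSup.2 ⟨⟨π x, hx⟩, hp ⟨π x, hx⟩⟩
      · refine Eq.trans ?_ (hr y)
        rw [← hR y]
        exact (congrArg (fun f => f.hom R) (π.naturality (homOfLE (hpU y)).op)).symm
    exact ⟨R, hRs, fun R' hR' => hπinj U (hR'.trans hRs.symm)⟩

end Schemes

end

/-! ### Scheme-theoretic images in charts -/

section

section Image

theorem eq_specMap_fromSpec {A : CommRingCat.{0}} {Z : Scheme.{0}} (f : Spec A ⟶ Z) {V : Z.Opens}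
    (hV : IsAffineOpen V) (e : ⊤ ≤ f ⁻¹ᵁ V) :
    f = Spec.map (f.appLE V ⊤ e ≫ (Scheme.ΓSpecIso A).hom) ≫ hV.fromSpec := by
  rw [Spec.map_comp, Category.assoc, hV.SpecMap_appLE_fromSpec f (isAffineOpen_top (Spec A)) e,
    IsAffineOpen.fromSpec_top, Scheme.isoSpec_Spec_inv, ← Category.assoc, ← Spec.map_comp,
    Iso.inv_hom_id, Spec.map_id, Category.id_comp]

/-- The chart of the scheme-theoretic image induced by a chart of a morphism. -/
theorem Chart.exists_image {X Y : Scheme.{0}} {φ : X ⟶ Y} [QuasiCompact φ] {R A : CommRingCat.{0}}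
    {c : Spec A ⟶ X} {a : Spec R ⟶ Y} {ψ : R ⟶ A} (h : Chart φ c a (Spec.map ψ)) :
    ∃ ι : Spec (.of ψ.hom.range) ⟶ φ.image,
      Chart φ.toImage c ι (Spec.map (CommRingCat.ofHom ψ.hom.range.subtype)) ∧
      ι ≫ φ.imageι = Spec.map (CommRingCat.ofHom ψ.hom.rangeRestrict) ≫ a := by
  have := h.left
  have := h.right
  let U := a.opensRange
  have hU : IsAffineOpen U := isAffineOpen_opensRange a
  let V := φ.imageι ⁻¹ᵁ U
  have hV : IsAffineOpen V := hU.preimage φ.imageι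
  have hcV : φ.toImage ⁻¹ᵁ V = c.opensRange := by
    rw [← h.preimage_eq, ← Scheme.Hom.comp_preimage, Scheme.Hom.toImage_imageι]
  have hβe : ⊤ ≤ (c ≫ φ.toImage) ⁻¹ᵁ V := by
    rw [Scheme.Hom.comp_preimage, hcV]
    exact top_le_preimage_opensRange c
  let β : Γ(φ.image, V) ⟶ A := (c ≫ φ.toImage).appLE V ⊤ hβe ≫ (Scheme.ΓSpecIso A).hom
  have h1 : c ≫ φ.toImage = Spec.map β ≫ hV.fromSpec := eq_specMap_fromSpec _ hV hβe
  have hcinj : ∀ (W : X.Opens) (hW : W = c.opensRange) (e : ⊤ ≤ c ⁻¹ᵁ W),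
      Function.Injective (c.appLE W ⊤ e).hom := by
    rintro W rfl e
    exact (bijective_appLE_opensRange c).1
  have hβinj : Function.Injective β.hom := by
    have hce : ⊤ ≤ c ⁻¹ᵁ φ.toImage ⁻¹ᵁ V := by
      rw [hcV]; exact top_le_preimage_opensRange c
    have e1 : β = (φ.toImage.app V ≫ c.appLE _ ⊤ hce) ≫ (Scheme.ΓSpecIso A).hom := by
      rw [Scheme.Hom.app_eq_appLE, Scheme.Hom.appLE_comp_appLE]
    rw [e1]
    exact (ConcreteCategory.bijective_of_isIso (Scheme.ΓSpecIso A).hom).1.comp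
      ((hcinj _ hcV hce).comp (φ.toImage_app_injective ⟨U, hU⟩))
  let γ : Γ(Y, U) ⟶ R := a.appLE U ⊤ (top_le_preimage_opensRange a) ≫ (Scheme.ΓSpecIso R).hom
  have h3 : a = Spec.map γ ≫ hU.fromSpec := eq_specMap_fromSpec _ hU _
  have hγ : Function.Surjective γ.hom :=
    (ConcreteCategory.bijective_of_isIso (Scheme.ΓSpecIso R).hom).2.comp
      (bijective_appLE_opensRange a).2
  let δ : Γ(Y, U) ⟶ Γ(φ.image, V) := φ.imageι.appLE U V le_rfl
  have hδ : Function.Surjective δ.hom := by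
    have : δ = φ.imageι.app U := (Scheme.Hom.app_eq_appLE _).symm
    rw [this]
    exact φ.ker.subschemeι_app_surjective ⟨U, hU⟩
  have h4 : Spec.map δ ≫ hU.fromSpec = hV.fromSpec ≫ φ.imageι :=
    hU.SpecMap_appLE_fromSpec φ.imageι hV le_rfl
  have h5 : δ ≫ β = γ ≫ ψ := by
    apply Spec.map_injective
    rw [← cancel_mono hU.fromSpec, Spec.map_comp δ β, Spec.map_comp γ ψ, Category.assoc, Category.assoc, h4,
      ← h3, ← Category.assoc, ← h1, Category.assoc, Scheme.Hom.toImage_imageι, h.comm]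
  have h5' : ∀ x, β.hom (δ.hom x) = ψ.hom (γ.hom x) := fun x => congrArg (fun f => f.hom x) h5
  -- Functions on `V` embed in `A`, because `X` dominates its image, and lift to `R`, because the
  -- image is closed in `Y`; hence they are exactly the range of `ψ`.
  have hβmem : ∀ x, β.hom x ∈ ψ.hom.range := by
    intro x
    obtain ⟨y, rfl⟩ := hδ x
    exact ⟨_, (h5' y).symm⟩
  let β' : Γ(φ.image, V) →+* ψ.hom.range := β.hom.codRestrict _ hβmem
  have hβ' : Function.Bijective β' := by
    refine ⟨fun x y hxy => hβinj (congrArg Subtype.val hxy), ?_⟩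
    rintro ⟨_, r, rfl⟩
    obtain ⟨y, rfl⟩ := hγ r
    exact ⟨δ.hom y, Subtype.ext (h5' y)⟩
  have : IsIso (CommRingCat.ofHom β') := by
    rw [ConcreteCategory.isIso_iff_bijective]
    exact hβ'
  refine ⟨Spec.map (CommRingCat.ofHom β') ≫ hV.fromSpec, ⟨inferInstance, inferInstance, ?_, ?_⟩, ?_⟩
  · rw [h1, ← Category.assoc, ← Spec.map_comp]
    rfl
  · rintro x ⟨z, hz⟩
    apply h.range_le x
    have hx : φ.toImage x ∈ V := by
      rw [← hz, Scheme.Hom.comp_apply, ← SetLike.mem_coe, ← hV.range_fromSpec]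
      exact ⟨_, rfl⟩
    have hx' : φ.imageι (φ.toImage x) ∈ U := hx
    rwa [← Scheme.Hom.comp_apply, Scheme.Hom.toImage_imageι] at hx'
  · rw [Category.assoc, ← h4, ← Category.assoc, ← Spec.map_comp]
    conv_rhs => rw [h3, ← Category.assoc, ← Spec.map_comp]
    congr 2
    ext x
    exact h5' x

end Image

/-! ### Gluing morphisms and schemes -/

section Gluing

theorem hom_ext_of_cover {X Y : Scheme.{0}} {I : Type} {U : I → Scheme.{0}} (c : ∀ i, U i ⟶ X)
    [hi : ∀ i, IsOpenImmersion (c i)] (hc : ∀ x : X, ∃ i, x ∈ Set.range (c i)) {f g : X ⟶ Y}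
    (h : ∀ i, c i ≫ f = c i ≫ g) : f = g :=
  Scheme.Cover.hom_ext (Scheme.Cover.mkOfCovers I U c hc hi : X.OpenCover) _ _ h

theorem hom_ext_affine {X Y : Scheme.{0}} {f g : X ⟶ Y}
    (h : ∀ (R : CommRingCat.{0}) (u : Spec R ⟶ X), u ≫ f = u ≫ g) : f = g :=
  Scheme.Cover.hom_ext X.affineCover _ _ fun i => h _ (X.affineCover.f i)

/-- Morphisms on the members of an open cover glue, if they agree on affine test schemes. -/
theorem exists_desc_of_affine {X Y : Scheme.{0}} {I : Type} {U : I → Scheme.{0}}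
    (c : ∀ i, U i ⟶ X) [hi : ∀ i, IsOpenImmersion (c i)] (hc : ∀ x : X, ∃ i, x ∈ Set.range (c i))
    (F : ∀ i, U i ⟶ Y)
    (hF : ∀ i j (R : CommRingCat.{0}) (f : Spec R ⟶ U i) (g : Spec R ⟶ U j),
      f ≫ c i = g ≫ c j → f ≫ F i = g ≫ F j) : ∃ k : X ⟶ Y, ∀ i, c i ≫ k = F i := by
  let 𝒰 : X.OpenCover := Scheme.Cover.mkOfCovers I U c hc hi
  have key : ∀ i j, pullback.fst (c i) (c j) ≫ F i = pullback.snd (c i) (c j) ≫ F j := by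
    intro i j
    refine hom_ext_affine fun R u => ?_
    rw [← Category.assoc, ← Category.assoc]
    exact hF i j R _ _ (by rw [Category.assoc, pullback.condition, Category.assoc])
  exact ⟨Scheme.Cover.glueMorphisms 𝒰 F key, Scheme.Cover.ι_glueMorphisms 𝒰 F key⟩

/-- By `Chart.isPullback` the maps `ρ i` are the base changes of `π` along an open cover of the
target. -/
theorem Chart.property {P : MorphismProperty Scheme.{0}} [IsZariskiLocalAtTarget P] {X Y : Scheme.{0}}
    {π : X ⟶ Y} {I : Type} {T Z : I → Scheme.{0}} {c : ∀ i, T i ⟶ X} {ι : ∀ i, Z i ⟶ Y}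
    {ρ : ∀ i, T i ⟶ Z i} (h : ∀ i, Chart π (c i) (ι i) (ρ i))
    (hcov : ∀ y : Y, ∃ i, y ∈ Set.range (ι i)) (hP : ∀ i, P (ρ i)) : P π := by
  have hi := fun i => (h i).right
  let 𝒰 : Y.OpenCover := Scheme.Cover.mkOfCovers I Z ι hcov hi
  refine IsZariskiLocalAtTarget.of_openCover 𝒰 fun i => ?_
  have hp := (h i).isPullback.flip
  have e : hp.isoPullback.hom ≫ pullback.snd π (ι i) = ρ i := hp.isoPullback_hom_snd
  have : P (pullback.snd π (ι i)) := by
    rw [← MorphismProperty.cancel_left_of_respectsIso P hp.isoPullback.hom, e]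
    exact hP i
  exact this

/-- The scheme `X` is covered by the open subschemes `U` and `V`, which meet in `P`. -/
structure OpenGluing {P U V X : Scheme.{0}} (p : P ⟶ U) (q : P ⟶ V) (u : U ⟶ X) (v : V ⟶ X) :
    Prop where
  left : IsOpenImmersion u
  chart : Chart u p v q
  cover : ∀ x : X, x ∈ Set.range u ∨ x ∈ Set.range v

/-- Two open immersions glue. -/
theorem openGluing_pushout {P U V : Scheme.{0}} (p : P ⟶ U) (q : P ⟶ V) [IsOpenImmersion p]
    [IsOpenImmersion q] : OpenGluing p q (pushout.inl p q) (pushout.inr p q) := by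
  let F := span p q
  have hl : IsOpenImmersion (pushout.inl p q) :=
    inferInstanceAs (IsOpenImmersion (colimit.ι F WalkingSpan.left))
  have hr : IsOpenImmersion (pushout.inr p q) :=
    inferInstanceAs (IsOpenImmersion (colimit.ι F WalkingSpan.right))
  refine ⟨hl, ⟨inferInstance, hr, pushout.condition, ?_⟩, ?_⟩
  · rintro x ⟨y, hy⟩
    obtain ⟨k, fi, fj, z, h1, h2⟩ := (Scheme.IsLocallyDirected.ι_eq_ι_iff F
      (i := WalkingSpan.left) (j := WalkingSpan.right) (xi := x) (xj := y)).1 hy.symm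
    rcases k with _ | _ | _
    · rw [Subsingleton.elim fi WalkingSpan.Hom.fst] at h1
      exact ⟨z, h1⟩
    -- There is no arrow between the two feet of the span, so a common preimage can only come from
    -- the apex.
    · exact nomatch (show WidePushoutShape.Hom (some WalkingPair.left) (some WalkingPair.right)
        from fj)
    · exact nomatch (show WidePushoutShape.Hom (some WalkingPair.right) (some WalkingPair.left)
        from fi)
  · intro x
    obtain ⟨i, y, rfl⟩ := Scheme.IsLocallyDirected.ι_jointly_surjective F x
    match i, y with
    | WalkingSpan.left, y => exact Or.inl ⟨y, rfl⟩
    | WalkingSpan.right, y => exact Or.inr ⟨y, rfl⟩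
    | WalkingSpan.zero, y =>
      refine Or.inl ⟨p y, Eq.trans ?_ (congrArg (fun f => f y) (colimit.w F WalkingSpan.Hom.fst))⟩
      rfl

end Gluing

end

/-! ### Morphisms to projective space given by homogeneous coordinates -/

section

section ToProj

open MvPolynomial HomogeneousLocalization

attribute [local instance] MvPolynomial.gradedAlgebra

variable {K : Type} [Field K] {n : ℕ} {R R' : Type} [CommRing R] [Algebra K R] [CommRing R']
  [Algebra K R']

/-- Evaluation of degree zero fractions with denominator a power of `f` at a vector at which `f` is
invertible. -/
def awayHom (v : Fin (n + 1) → R) (f : MvPolynomial (Fin (n + 1)) K) (hf : IsUnit (aeval v f)) :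
    Away (homogeneousSubmodule (Fin (n + 1)) K) f →+* R :=
  (IsLocalization.Away.lift (S := Localization.Away f) f (g := (aeval v).toRingHom) hf).comp
    (algebraMap _ (Localization (Submonoid.powers f)))

theorem awayHom_mk (v : Fin (n + 1) → R) (f : MvPolynomial (Fin (n + 1)) K)
    (hf : IsUnit (aeval v f)) {d : ℕ} (hd : f ∈ homogeneousSubmodule (Fin (n + 1)) K d) (m : ℕ)
    (a : MvPolynomial (Fin (n + 1)) K) (ha) :
    awayHom v f hf (Away.mk _ hd m a ha) * aeval v f ^ m = aeval v a := by
  have h1 : ∀ p, IsLocalization.Away.lift (S := Localization.Away f) f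
      (g := (aeval v).toRingHom) hf (algebraMap _ _ p) = aeval v p := fun p =>
    IsLocalization.Away.lift_eq f hf p
  have h2 : awayHom v f hf (Away.mk _ hd m a ha) = IsLocalization.Away.lift
      (S := Localization.Away f) f (g := (aeval v).toRingHom) hf
      (Away.mk (homogeneousSubmodule (Fin (n + 1)) K) hd m a ha).val := rfl
  rw [h2, Away.val_mk, ← map_pow, ← h1, ← map_mul, ← h1, Localization.mk_eq_mk']
  congr 1
  exact IsLocalization.mk'_spec _ a (⟨f ^ m, m, rfl⟩ : Submonoid.powers f)

theorem awayHom_eq_of {v : Fin (n + 1) → R} {f : MvPolynomial (Fin (n + 1)) K}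
    (hf : IsUnit (aeval v f)) {d : ℕ} (hd : f ∈ homogeneousSubmodule (Fin (n + 1)) K d)
    {φ : Away (homogeneousSubmodule (Fin (n + 1)) K) f →+* R}
    (h : ∀ m a ha, φ (Away.mk _ hd m a ha) * aeval v f ^ m = aeval v a) : φ = awayHom v f hf := by
  ext x
  obtain ⟨m, a, ha, rfl⟩ := Away.mk_surjective _ hd x
  exact (hf.pow m).mul_left_injective ((h m a ha).trans (awayHom_mk v f hf hd m a ha).symm)

theorem aeval_smul_of_isHomogeneous {v w : Fin (n + 1) → R} (u : R) (hw : ∀ k, w k = u * v k)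
    {e : ℕ} {a : MvPolynomial (Fin (n + 1)) K} (ha : a ∈ homogeneousSubmodule (Fin (n + 1)) K e) :
    aeval w a = u ^ e * aeval v a := by
  have hw' : w = fun k => u * v k := funext hw
  rw [hw', aeval_def, aeval_def, eval₂_eq, eval₂_eq, Finset.mul_sum]
  refine Finset.sum_congr rfl fun m hm => ?_
  have hm' := ha (mem_support_iff.1 hm)
  rw [Finsupp.weight_apply, Finsupp.sum] at hm'
  simp only [mul_pow, Finset.prod_mul_distrib, Finset.prod_pow_eq_pow_sum]
  simp only [Pi.one_apply, smul_eq_mul, mul_one] at hm'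
  rw [hm']
  ring

/-- Numerator and denominator have the same degree, so the powers of the common factor `u` cancel.
-/
theorem awayHom_smul {v w : Fin (n + 1) → R} (u : R) (hw : ∀ k, w k = u * v k)
    {f : MvPolynomial (Fin (n + 1)) K} {d : ℕ} (hd : f ∈ homogeneousSubmodule (Fin (n + 1)) K d)
    (hf : IsUnit (aeval v f)) (hf' : IsUnit (aeval w f)) : awayHom v f hf = awayHom w f hf' := by
  apply awayHom_eq_of hf' hd
  intro m a ha
  rw [aeval_smul_of_isHomogeneous u hw ha, aeval_smul_of_isHomogeneous u hw hd,
    ← awayHom_mk v f hf hd m a ha]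
  rw [smul_eq_mul]
  ring

theorem awayHom_comp (v : Fin (n + 1) → R) (g : R →ₐ[K] R') {f : MvPolynomial (Fin (n + 1)) K}
    {d : ℕ} (hd : f ∈ homogeneousSubmodule (Fin (n + 1)) K d) (hf : IsUnit (aeval v f))
    (hf' : IsUnit (aeval (g ∘ v) f)) :
    (g : R →+* R').comp (awayHom v f hf) = awayHom (g ∘ v) f hf' := by
  have hg : ∀ p : MvPolynomial (Fin (n + 1)) K, aeval (g ∘ v) p = g (aeval v p) := fun p => by
    rw [← AlgHom.comp_apply, comp_aeval]; rfl
  apply awayHom_eq_of hf' hd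
  intro m a ha
  rw [hg, hg, ← awayHom_mk v f hf hd m a ha, map_mul, map_pow]
  rfl

theorem awayHom_awayMap (v : Fin (n + 1) → R) {f g : MvPolynomial (Fin (n + 1)) K} {d e : ℕ}
    (hd : f ∈ homogeneousSubmodule (Fin (n + 1)) K d)
    (he : g ∈ homogeneousSubmodule (Fin (n + 1)) K e) (hf : IsUnit (aeval v f))
    {x : MvPolynomial (Fin (n + 1)) K} (hx : x = f * g) (hfg : IsUnit (aeval v x)) :
    (awayHom v x hfg).comp (awayMap (homogeneousSubmodule (Fin (n + 1)) K) he hx) =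
      awayHom v f hf := by
  subst hx
  apply awayHom_eq_of hf hd
  intro m a ha
  rw [RingHom.comp_apply, awayMap_mk]
  have h := awayHom_mk v (f * g) hfg (SetLike.mul_mem_graded hd he) m (a * g ^ m)
    (by convert! SetLike.mul_mem_graded ha (SetLike.pow_mem_graded m he) using 2; ring)
  rw [map_mul, map_mul, map_pow, mul_pow, ← mul_assoc] at h
  have hg : IsUnit (aeval v g) := by
    rw [map_mul] at hfg
    exact (IsUnit.mul_iff.1 hfg).2
  exact (hg.pow m).mul_left_injective h

/-- The open immersion onto the locus where the homogeneous polynomial `f` does not vanish. -/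
def awayEmb (f : MvPolynomial (Fin (n + 1)) K) {d : ℕ}
    (hf : f ∈ homogeneousSubmodule (Fin (n + 1)) K d) (hd : 0 < d) :
    Spec (.of (Away (homogeneousSubmodule (Fin (n + 1)) K) f)) ⟶ projSpace n K :=
  Proj.awayι (homogeneousSubmodule (Fin (n + 1)) K) f hf hd

instance (f : MvPolynomial (Fin (n + 1)) K) {d : ℕ}
    (hf : f ∈ homogeneousSubmodule (Fin (n + 1)) K d) (hd : 0 < d) :
    IsOpenImmersion (awayEmb f hf hd) :=
  inferInstanceAs (IsOpenImmersion (Proj.awayι _ f hf hd))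

theorem specMap_awayEmb {f g x : MvPolynomial (Fin (n + 1)) K} {d e : ℕ}
    (hf : f ∈ homogeneousSubmodule (Fin (n + 1)) K d) (hd : 0 < d)
    (hg : g ∈ homogeneousSubmodule (Fin (n + 1)) K e) (hx : x = f * g) :
    Spec.map (CommRingCat.ofHom (awayMap _ hg hx)) ≫ awayEmb f hf hd =
      awayEmb x (hx ▸ SetLike.mul_mem_graded hf hg) (hd.trans_le (d.le_add_right e)) :=
  Proj.SpecMap_awayMap_awayι ..

theorem awayEmb_hom (f : MvPolynomial (Fin (n + 1)) K) {d : ℕ}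
    (hf : f ∈ homogeneousSubmodule (Fin (n + 1)) K d) (hd : 0 < d) :
    awayEmb f hf hd ≫ projSpaceHom n K = Spec.map (CommRingCat.ofHom ((fromZeroRingHom _ _).comp
      (algebraMap K (homogeneousSubmodule (Fin (n + 1)) K 0)))) := by
  refine (Category.assoc _ _ _).symm.trans ?_
  refine (congrArg (· ≫ _) (Proj.awayι_toSpecZero _ f hf hd)).trans ?_
  rw [← Spec.map_comp, ← CommRingCat.ofHom_comp]

theorem X_mem_homogeneousSubmodule (i : Fin (n + 1)) :
    (X i : MvPolynomial (Fin (n + 1)) K) ∈ homogeneousSubmodule (Fin (n + 1)) K 1 :=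
  isHomogeneous_X K i

variable (K) in
/-- The standard affine charts of projective space. -/
def coordEmb (i : Fin (n + 1)) :
    Spec (.of (Away (homogeneousSubmodule (Fin (n + 1)) K) (X i))) ⟶ projSpace n K :=
  awayEmb (X i) (X_mem_homogeneousSubmodule i) one_pos

instance (i : Fin (n + 1)) : IsOpenImmersion (coordEmb K i) :=
  inferInstanceAs (IsOpenImmersion (awayEmb _ _ _))

/-- The morphism to projective space with homogeneous coordinates `v`, one of which is a unit. -/
def toProj (v : Fin (n + 1) → R) (i : Fin (n + 1)) (hi : IsUnit (v i)) :
    Spec (.of R) ⟶ projSpace n K :=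
  Spec.map (CommRingCat.ofHom (awayHom v (X i : MvPolynomial (Fin (n + 1)) K)
    (by rwa [aeval_X]))) ≫ coordEmb K i

/-- Both morphisms land in the locus where `X i * X j` is invertible, and fractions of degree zero
do not see the scaling by `u`. -/
theorem toProj_eq {v w : Fin (n + 1) → R} {i j : Fin (n + 1)} (hi : IsUnit (v i))
    (hj : IsUnit (w j)) (u : R) (hu : IsUnit u) (h : ∀ k, w k = u * v k) :
    toProj (K := K) v i hi = toProj w j hj := by
  have hvj : IsUnit (v j) := by
    rw [h] at hj
    exact (IsUnit.mul_iff.1 hj).2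
  have hij : IsUnit (aeval v (X i * X j : MvPolynomial (Fin (n + 1)) K)) := by
    rw [map_mul, aeval_X, aeval_X]
    exact hi.mul hvj
  have hij' : IsUnit (aeval w (X j * X i : MvPolynomial (Fin (n + 1)) K)) := by
    rw [map_mul, aeval_X, aeval_X, h i]
    exact hj.mul (hu.mul hi)
  have hXi := X_mem_homogeneousSubmodule (K := K) i
  have hXj := X_mem_homogeneousSubmodule (K := K) j
  have e1 : toProj (K := K) v i hi = Spec.map (CommRingCat.ofHom (awayHom v _ hij)) ≫
      awayEmb (X i * X j) (SetLike.mul_mem_graded hXi hXj) two_pos := by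
    rw [toProj, ← awayHom_awayMap v hXi hXj _ rfl hij, CommRingCat.ofHom_comp, Spec.map_comp,
      Category.assoc, coordEmb, specMap_awayEmb]
  have e2 : toProj (K := K) w j hj = Spec.map (CommRingCat.ofHom (awayHom w _ hij')) ≫
      awayEmb (X j * X i) (SetLike.mul_mem_graded hXj hXi) two_pos := by
    rw [toProj, ← awayHom_awayMap w hXj hXi _ rfl hij', CommRingCat.ofHom_comp, Spec.map_comp,
      Category.assoc, coordEmb, specMap_awayEmb]
  have e3 : ∀ (f f' : MvPolynomial (Fin (n + 1)) K) (hff : f = f')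
      (hf : f ∈ homogeneousSubmodule (Fin (n + 1)) K 2)
      (hf' : f' ∈ homogeneousSubmodule (Fin (n + 1)) K 2) (hu hu'),
      Spec.map (CommRingCat.ofHom (awayHom v f hu)) ≫ awayEmb f hf two_pos =
      Spec.map (CommRingCat.ofHom (awayHom w f' hu')) ≫ awayEmb f' hf' two_pos := by
    rintro f _ rfl hf hf' hu hu'
    rw [awayHom_smul u h hf hu hu']
  rw [e1, e2]
  exact e3 _ _ (mul_comm _ _) _ _ _ _

theorem specMap_toProj (v : Fin (n + 1) → R) (i : Fin (n + 1)) (hi : IsUnit (v i)) (g : R →ₐ[K] R') :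
    Spec.map (CommRingCat.ofHom (g : R →+* R')) ≫ toProj (K := K) v i hi =
      toProj (g ∘ v) i (hi.map g) := by
  rw [toProj, toProj, ← Category.assoc, ← Spec.map_comp, ← CommRingCat.ofHom_comp,
    awayHom_comp v g (X_mem_homogeneousSubmodule i)]

theorem toProj_hom (v : Fin (n + 1) → R) (i : Fin (n + 1)) (hi : IsUnit (v i)) :
    toProj v i hi ≫ projSpaceHom n K = Spec.map (CommRingCat.ofHom (algebraMap K R)) := by
  rw [toProj, Category.assoc, coordEmb, awayEmb_hom, ← Spec.map_comp]
  congr 1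
  ext x
  have h := awayHom_mk v (X i : MvPolynomial (Fin (n + 1)) K) (by rwa [aeval_X])
    (X_mem_homogeneousSubmodule i) 0 (C x) (isHomogeneous_C _ _)
  rw [pow_zero, mul_one, aeval_C] at h
  refine Eq.trans ?_ h
  change awayHom v (X i : MvPolynomial (Fin (n + 1)) K) (by rwa [aeval_X]) _ = _
  congr 1

theorem toProj_mem_range_iff (i j : Fin (n + 1)) (v : Fin (n + 1) → R) (hi : IsUnit (v i))
    (x : PrimeSpectrum R) :
    toProj (K := K) v i hi x ∈ Set.range (coordEmb K j) ↔ v j ∉ x.asIdeal := by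
  have hi' : IsUnit (aeval v (X i : MvPolynomial (Fin (n + 1)) K)) := by rwa [aeval_X]
  have h1 : ∀ y : Proj (homogeneousSubmodule (Fin (n + 1)) K), y ∈ Set.range (coordEmb K j) ↔
      y ∈ Proj.basicOpen (homogeneousSubmodule (Fin (n + 1)) K) (X j) := fun y =>
    (congrArg (fun U : (Proj (homogeneousSubmodule (Fin (n + 1)) K)).Opens => y ∈ U)
      (Proj.opensRange_awayι (homogeneousSubmodule (Fin (n + 1)) K)
      (X j) (X_mem_homogeneousSubmodule j) one_pos)).to_iff
  have h2 : ∀ z, Proj.awayι (homogeneousSubmodule (Fin (n + 1)) K) (X i)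
      (X_mem_homogeneousSubmodule i) one_pos z ∈
        Proj.basicOpen (homogeneousSubmodule (Fin (n + 1)) K) (X j) ↔
      Away.isLocalizationElem (X_mem_homogeneousSubmodule i) (X_mem_homogeneousSubmodule j) ∉
        z.asIdeal := fun z =>
    (congrArg (fun U => z ∈ U) (Proj.awayι_preimage_basicOpen
      (homogeneousSubmodule (Fin (n + 1)) K) (X_mem_homogeneousSubmodule i) one_pos
      (X_mem_homogeneousSubmodule j) one_pos)).to_iff
  refine (h1 _).trans ((h2 (Spec.map (CommRingCat.ofHom (awayHom v _ hi')) x)).trans ?_)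
  change awayHom v _ hi' _ ∉ x.asIdeal ↔ _
  have h4 := awayHom_mk v (X i : MvPolynomial (Fin (n + 1)) K) hi' (X_mem_homogeneousSubmodule i) 1
    (X j ^ 1) (by simpa using X_mem_homogeneousSubmodule j)
  simp only [pow_one, aeval_X] at h4
  rw [← h4, Ideal.mul_unit_mem_iff_mem _ hi]
  simp only [Away.isLocalizationElem, pow_one]

/-- A form of any degree is evaluated without denominator because the coordinate `i` is `1`. This is
what computes the affine charts of the image of a morphism to projective space. -/
theorem range_awayHom (v : Fin (n + 1) → R) (i : Fin (n + 1)) (hi : v i = 1)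
    (hi' : IsUnit (aeval v (X i : MvPolynomial (Fin (n + 1)) K))) (r : R) :
    r ∈ Set.range (awayHom v (X i : MvPolynomial (Fin (n + 1)) K) hi') ↔
      r ∈ Algebra.adjoin K (Set.range v) := by
  have h0 : ∀ m a ha, awayHom v (X i : MvPolynomial (Fin (n + 1)) K) hi'
      (Away.mk _ (X_mem_homogeneousSubmodule i) m a ha) = aeval v a := by
    intro m a ha
    have := awayHom_mk v (X i : MvPolynomial (Fin (n + 1)) K) hi' (X_mem_homogeneousSubmodule i) m a ha
    rwa [aeval_X, hi, one_pow, mul_one] at this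
  constructor
  · rintro ⟨x, rfl⟩
    obtain ⟨m, a, ha, rfl⟩ := Away.mk_surjective _ (X_mem_homogeneousSubmodule i) x
    rw [h0, Algebra.adjoin_range_eq_range_aeval]
    exact ⟨a, rfl⟩
  · intro h
    induction h using Algebra.adjoin_induction with
    | mem x hx =>
      obtain ⟨j, rfl⟩ := hx
      exact ⟨Away.mk _ (X_mem_homogeneousSubmodule i) 1 (X j) (by simpa using X_mem_homogeneousSubmodule j), by
        rw [h0, aeval_X]⟩
    | algebraMap c =>
      exact ⟨Away.mk _ (X_mem_homogeneousSubmodule i) 0 (C c) (isHomogeneous_C _ _),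
        (h0 _ _ _).trans (aeval_C _ _)⟩
    | add x y _ _ hx hy =>
      obtain ⟨a, rfl⟩ := hx
      obtain ⟨b, rfl⟩ := hy
      exact ⟨a + b, map_add _ _ _⟩
    | mul x y _ _ hx hy =>
      obtain ⟨a, rfl⟩ := hx
      obtain ⟨b, rfl⟩ := hy
      exact ⟨a * b, map_mul _ _ _⟩

theorem exists_mem_range_coordEmb (y : projSpace n K) : ∃ i, y ∈ Set.range (coordEmb K i) := by
  have h := Proj.iSup_basicOpen_eq_top' (homogeneousSubmodule (Fin (n + 1)) K)
    (fun i => (X i : MvPolynomial (Fin (n + 1)) K)) (fun i => ⟨1, X_mem_homogeneousSubmodule i⟩) (by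
      rw [eq_top_iff]
      intro p _
      induction p using MvPolynomial.induction_on with
      | C c =>
        exact Subalgebra.algebraMap_mem _
          (⟨C c, isHomogeneous_C _ c⟩ : homogeneousSubmodule (Fin (n + 1)) K 0)
      | add p q hp hq => exact add_mem (hp trivial) (hq trivial)
      | mul_X p i hp => exact mul_mem (hp trivial) (Algebra.subset_adjoin ⟨i, rfl⟩))
  have h0 : ∀ z : Proj (homogeneousSubmodule (Fin (n + 1)) K), ∃ i, z ∈ Proj.basicOpen
      (homogeneousSubmodule (Fin (n + 1)) K) (X i : MvPolynomial (Fin (n + 1)) K) := by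
    intro z
    rw [← TopologicalSpace.Opens.mem_iSup, h]
    trivial
  obtain ⟨i, hi⟩ := h0 y
  refine ⟨i, ?_⟩
  have h1 := Proj.opensRange_awayι (homogeneousSubmodule (Fin (n + 1)) K)
      (X i) (X_mem_homogeneousSubmodule i) one_pos
  rw [← h1] at hi
  exact hi

instance isProper_projSpaceHom : IsProper (projSpaceHom n K) := by
  have h0 : IsScalarTower K (homogeneousSubmodule (Fin (n + 1)) K 0)
      (MvPolynomial (Fin (n + 1)) K) := 
    ⟨fun a b c => Algebra.smul_mul_assoc a (b : MvPolynomial (Fin (n + 1)) K) c⟩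
  have h1 : Algebra.FiniteType (homogeneousSubmodule (Fin (n + 1)) K 0)
      (MvPolynomial (Fin (n + 1)) K) := Algebra.FiniteType.of_restrictScalars_finiteType K _ _
  have h2 : IsIso (CommRingCat.ofHom
      (algebraMap K (homogeneousSubmodule (Fin (n + 1)) K 0))) := by
    rw [ConcreteCategory.isIso_iff_bijective]
    refine ⟨fun x y hxy => C_injective (Fin (n + 1)) K (congrArg Subtype.val hxy), ?_⟩
    rintro ⟨p, hp⟩
    refine ⟨coeff 0 p, Subtype.ext ?_⟩
    exact (totalDegree_eq_zero_iff_eq_C.1 (Nat.le_zero.1 (IsHomogeneous.totalDegree_le hp))).symm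
  have h3 : IsProper (Proj.toSpecZero (homogeneousSubmodule (Fin (n + 1)) K)) := inferInstance
  exact MorphismProperty.comp_mem (W := @IsProper) _ _ h3 inferInstance

/-- The hypothesis on `j` leaves at most one coordinate besides `i`, so this concerns the projective
line. A form vanishing when one coordinate is `1` and the other is the transcendental `x` has zero
dehomogenisation, hence is zero as a fraction. -/
theorem awayHom_injective {x : R} (hx : Function.Injective (Polynomial.aeval (R := K) x))
    (v : Fin (n + 1) → R) (i : Fin (n + 1)) (hi : v i = 1) (j : Fin (n + 1))
    (hj : ∀ k, k ≠ i → k = j) (hv : ∀ k, k ≠ i → v k = x)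
    (hi' : IsUnit (aeval v (X i : MvPolynomial (Fin (n + 1)) K))) :
    Function.Injective (awayHom v (X i : MvPolynomial (Fin (n + 1)) K) hi') := by
  rw [injective_iff_map_eq_zero]
  intro z hz
  obtain ⟨m, a, ha, rfl⟩ := Away.mk_surjective _ (X_mem_homogeneousSubmodule i) z
  have h1 := awayHom_mk v (X i : MvPolynomial (Fin (n + 1)) K) hi'
    (X_mem_homogeneousSubmodule i) m a ha
  rw [hz, zero_mul] at h1
  let w : Fin (n + 1) → Polynomial K := fun j => if j = i then 1 else Polynomial.X
  have h2 : ∀ (S : Type) [CommRing S] [Algebra K S] (s : S) (v' : Fin (n + 1) → S), v' i = 1 →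
      (∀ j, j ≠ i → v' j = s) → ∀ p : MvPolynomial (Fin (n + 1)) K,
      aeval v' p = Polynomial.aeval s (aeval w p) := by
    intro S _ _ s v' h1 h2 p
    rw [← AlgHom.comp_apply, comp_aeval]
    congr 2
    funext j
    by_cases hj : j = i
    · subst hj
      simp [w, h1]
    · simp [w, hj, h2 j hj]
  have h3 : aeval w a = 0 := by
    apply hx
    rw [← h2 R x v hi hv, ← h1, map_zero]
  let L := Localization.Away (X i : MvPolynomial (Fin (n + 1)) K)
  let u : L := IsLocalization.Away.invSelf (X i : MvPolynomial (Fin (n + 1)) K)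
  have hu : algebraMap _ L (X i : MvPolynomial (Fin (n + 1)) K) * u = 1 :=
    IsLocalization.Away.mul_invSelf _
  let y : Fin (n + 1) → L := fun k => algebraMap _ L (X k : MvPolynomial (Fin (n + 1)) K)
  have hy : ∀ p : MvPolynomial (Fin (n + 1)) K, aeval y p = algebraMap _ L p := by
    intro p
    rw [← IsScalarTower.toAlgHom_apply K (MvPolynomial (Fin (n + 1)) K) L, aeval_unique
      (IsScalarTower.toAlgHom K (MvPolynomial (Fin (n + 1)) K) L)]
    rfl
  have h4 : aeval (fun k => u * y k) a = 0 := by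
    rw [h2 L (u * y j) _ (by rw [mul_comm]; exact hu) (fun k hk => by rw [hj k hk]), h3, map_zero]
  rw [aeval_smul_of_isHomogeneous (v := y) u (fun _ => rfl) ha, hy] at h4
  have hu' : IsUnit u := IsUnit.of_mul_eq_one _ (by rw [mul_comm]; exact hu)
  have h5 : algebraMap _ L a = 0 := ((hu'.pow _).mul_right_eq_zero).1 h4
  apply val_injective
  rw [Away.val_mk, Localization.mk_eq_mk']
  have h6 := IsLocalization.mk'_spec L a
    (⟨X i ^ m, m, rfl⟩ : Submonoid.powers (X i : MvPolynomial (Fin (n + 1)) K))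
  rw [h5] at h6
  have h7 : IsUnit (algebraMap _ L (X i ^ m : MvPolynomial (Fin (n + 1)) K)) := by
    rw [map_pow]
    exact (IsLocalization.Away.algebraMap_isUnit _).pow m
  exact ((h7.mul_left_eq_zero).1 h6).trans val_zero.symm

end ToProj

end

section

/-! ## The quartic model -/

section CurveRing

open Polynomial

variable {K : Type} [Field K] (t : K)

/-- The quartic `X⁴ - 2 (2 t + 1) X² + 1`. -/
def quartic : K[X] := X ^ 4 - C (2 * (2 * t + 1)) * X ^ 2 + 1

theorem quartic_monic : (quartic t).Monic := by
  unfold quartic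
  monicity!

theorem quartic_natDegree : (quartic t).natDegree = 4 := by
  unfold quartic
  compute_degree!

/-- With `q = X² - (2t+1)` the quartic is `q² - 4t(t+1)` and its derivative is `4 X q`. It equals
`-4t(t+1)` where `q = 0` and `1` where `X = 0`; the coefficients below make this into a Bézout
identity. -/
theorem quartic_isCoprime [CharZero K] (h0 : t ≠ 0) (h1 : t + 1 ≠ 0) :
    IsCoprime (quartic t) (derivative (quartic t)) := by
  set e : K := (-4 * (t * (t + 1)))⁻¹ with he
  have he' : e * (-4 * (t * (t + 1))) = 1 :=
    inv_mul_cancel₀ (mul_ne_zero (by norm_num) (mul_ne_zero h0 h1))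
  have hE : C e * (-4 * (C t * (C t + 1))) = 1 := by
    have h := congrArg C he'
    have c4 : C (4 : K) = 4 := map_ofNat C 4
    simpa only [map_mul, map_add, map_neg, map_one, c4] using h
  have h4 : C (4⁻¹ : K) * 4 = 1 := by
    rw [show (4 : K[X]) = C 4 from (map_ofNat C 4).symm, ← C_mul, inv_mul_cancel₀ (by norm_num),
      C_1]
  have c2 : C (2 : K) = 2 := map_ofNat C 2
  have hd : derivative (quartic t) = 4 * X * (X ^ 2 - (2 * C t + 1)) := by
    have c2' : derivative (2 : K[X]) = 0 := derivative_ofNat 2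
    simp only [quartic, derivative_sub, derivative_X_pow, derivative_mul,
      derivative_C, derivative_one, map_mul, map_add, map_one, c2, c2', map_natCast]
    push_cast
    ring
  have hq : quartic t = (X ^ 2 - (2 * C t + 1)) ^ 2 + (-4 * (C t * (C t + 1))) := by
    simp only [quartic, map_mul, map_add, map_one, c2]
    ring
  refine ⟨C e * (1 + (2 * C t + 1) * (X ^ 2 - (2 * C t + 1))),
    -(C (4⁻¹ : K) * C e * X * ((2 * C t + 1) * (X ^ 2 - (2 * C t + 1)) +
      (-4 * (C t * (C t + 1))))), ?_⟩
  rw [hd, hq]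
  linear_combination hE + (-C e * X ^ 2 * (X ^ 2 - (2 * C t + 1)) *
    ((2 * C t + 1) * (X ^ 2 - (2 * C t + 1)) + (-4 * (C t * (C t + 1))))) * h4

/-- The coordinate ring of the affine curve `D² = r⁴ - 2 (2 t + 1) r² + 1`. -/
abbrev CurveRing := DoubleCover (quartic t)

namespace CurveRing

/-- The coordinate `r`. -/
def r : CurveRing t := DoubleCover.x _

/-- The coordinate `D`. -/
def D : CurveRing t := DoubleCover.y _

variable {R : Type} [CommRing R] [Algebra K R]

theorem aeval_quartic (a : R) :
    aeval a (quartic t) = a ^ 4 - algebraMap K R (2 * (2 * t + 1)) * a ^ 2 + 1 := by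
  simp only [quartic, map_add, map_sub, map_mul, map_pow, aeval_X, aeval_C, map_one, map_ofNat]

theorem D_sq : D t ^ 2 = r t ^ 4 - algebraMap K _ (2 * (2 * t + 1)) * r t ^ 2 + 1 := by
  rw [D, DoubleCover.y_sq, aeval_quartic]
  rfl

variable {t}

/-- The algebra homomorphism given by the images of `r` and `D`. -/
def lift (a b : R) (h : b ^ 2 = a ^ 4 - algebraMap K R (2 * (2 * t + 1)) * a ^ 2 + 1) :
    CurveRing t →ₐ[K] R :=
  DoubleCover.liftₐ a b (by rw [h, aeval_quartic])

@[simp] theorem lift_r (a b : R) (h) : lift (t := t) a b h (r t) = a :=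
  DoubleCover.liftₐ_x (h := by rw [h, aeval_quartic])

@[simp] theorem lift_D (a b : R) (h) : lift (t := t) a b h (D t) = b :=
  DoubleCover.liftₐ_y (h := by rw [h, aeval_quartic])

theorem algHom_ext {f g : CurveRing t →ₐ[K] R} (hr : f (r t) = g (r t)) (hD : f (D t) = g (D t)) :
    f = g := DoubleCover.algHom_ext hr hD

theorem ringHom_ext {R : Type} [CommRing R] {f g : CurveRing t →+* R}
    (hK : f.comp (algebraMap K _) = g.comp (algebraMap K _)) (hr : f (r t) = g (r t))
    (hD : f (D t) = g (D t)) : f = g := DoubleCover.hom_ext hK hr hD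

variable (t) in
theorem adjoin_eq_top : Algebra.adjoin K {r t, D t} = ⊤ := DoubleCover.adjoin_eq_top

theorem aeval_r_injective : Function.Injective (aeval (R := K) (r t)) := by
  intro p q h
  have := DoubleCover.ext_basis (g := quartic t) (p := p) (q := 0) (p' := q) (q' := 0) (by
    rw [map_zero, zero_mul, add_zero, add_zero]; exact h)
  exact this.1

variable (t) in
theorem isDomain [CharZero K] (h0 : t ≠ 0) (h1 : t + 1 ≠ 0) : IsDomain (CurveRing t) :=
  DoubleCover.isDomain (quartic_isCoprime t h0 h1) (by rw [quartic_natDegree]; norm_num)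

variable (t) in
/-- The automorphisms `(r, D) ↦ (± r, ± D)`. -/
def sgnHom (ε δ : ℤˣ) : CurveRing t →ₐ[K] CurveRing t :=
  lift (((ε : ℤ) : CurveRing t) * r t) (((δ : ℤ) : CurveRing t) * D t) (by
    have h : ∀ u : ℤˣ, ((u : ℤ) : CurveRing t) ^ 2 = 1 := fun u => by
      rw [← Int.cast_pow, ← Units.val_pow_eq_pow_val, Int.units_sq, Units.val_one, Int.cast_one]
    have h4 : ((ε : ℤ) : CurveRing t) ^ 4 = 1 := by
      rw [show 4 = 2 * 2 from rfl, pow_mul, h, one_pow]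
    rw [mul_pow, mul_pow, mul_pow, h, h, h4, one_mul, one_mul, one_mul, D_sq])

theorem sgnHom_r (ε δ : ℤˣ) : sgnHom t ε δ (r t) = ((ε : ℤ) : CurveRing t) * r t := lift_r _ _ _

theorem sgnHom_D (ε δ : ℤˣ) : sgnHom t ε δ (D t) = ((δ : ℤ) : CurveRing t) * D t := lift_D _ _ _

theorem sgnHom_sgnHom (ε δ : ℤˣ) : (sgnHom t ε δ).comp (sgnHom t ε δ) = AlgHom.id K _ := by
  have h : ∀ u : ℤˣ, ((u : ℤ) : CurveRing t) * ((u : ℤ) : CurveRing t) = 1 := fun u => by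
    rw [← Int.cast_mul, ← Units.val_mul, Int.units_mul_self, Units.val_one, Int.cast_one]
  apply algHom_ext
  · rw [AlgHom.comp_apply, sgnHom_r, map_mul, map_intCast, sgnHom_r, ← mul_assoc, h, one_mul,
      AlgHom.id_apply]
  · rw [AlgHom.comp_apply, sgnHom_D, map_mul, map_intCast, sgnHom_D, ← mul_assoc, h, one_mul,
      AlgHom.id_apply]

variable (t) in
/-- The ring of the overlap of the two charts. -/
abbrev Overlap := Localization.Away (r t)

variable (t) in
/-- The inverse of `r`. -/
def rInv : Overlap t := IsLocalization.Away.invSelf (r t)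

variable (t) in
theorem r_mul_rInv : algebraMap _ (Overlap t) (r t) * rInv t = 1 :=
  IsLocalization.Away.mul_invSelf _

variable (t) in
/-- The coordinate change `(r, D) ↦ (1 / r, D / r²)` between the two charts. -/
def swap : CurveRing t →ₐ[K] Overlap t :=
  lift (rInv t) (algebraMap _ (Overlap t) (D t) * rInv t ^ 2) (by
    have h := congrArg (algebraMap _ (Overlap t)) (D_sq t)
    simp only [map_add, map_sub, map_mul, map_pow, map_one,
      ← IsScalarTower.algebraMap_apply K (CurveRing t) (Overlap t)] at h ⊢
    have h1 := r_mul_rInv t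
    set ρ := algebraMap _ (Overlap t) (r t)
    set s := rInv t
    set E := algebraMap _ (Overlap t) (D t)
    set u := algebraMap K (Overlap t) 2
    set v := algebraMap K (Overlap t) t
    linear_combination s ^ 4 * h + (1 - s ^ 2 * (u * (u * v + 1))) * (s * ρ + 1) * h1 +
      (s ^ 2 * ρ ^ 2) * (s * ρ + 1) * h1)

variable (t) in
theorem swap_r : swap t (r t) = rInv t := lift_r _ _ _

variable (t) in
theorem swap_D : swap t (D t) = algebraMap _ (Overlap t) (D t) * rInv t ^ 2 := lift_D _ _ _

end CurveRing

end CurveRing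

end

/-! ### The smooth projective model of the quartic -/

section

instance isZariskiLocalAtSource_smoothOfRelativeDimension (n : ℕ) :
    IsZariskiLocalAtSource (@SmoothOfRelativeDimension.{0} n) :=
  HasRingHomProperty.instIsZariskiLocalAtSource

section Curve

open CurveRing

attribute [local instance] MvPolynomial.gradedAlgebra

variable {K : Type} [Field K] (t : K)

/-- The coordinate change extends to an involution `σ` of the overlap, so `swap` is the localisation
map followed by an automorphism. -/
instance isOpenImmersion_specMap_swap :
    IsOpenImmersion (Spec.map (CommRingCat.ofHom (swap t : CurveRing t →+* Overlap t))) := by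
  have hu : IsUnit (swap t (r t)) := by
    rw [swap, lift_r]
    exact IsUnit.of_mul_eq_one _ (by rw [mul_comm]; exact r_mul_rInv t)
  let σ : Overlap t →+* Overlap t :=
    IsLocalization.Away.lift (r t) (g := (swap t : CurveRing t →+* Overlap t)) hu
  have hσ : ∀ a, σ (algebraMap _ _ a) = swap t a := fun a => IsLocalization.Away.lift_eq _ _ a
  have hσr : σ (rInv t) = algebraMap _ _ (r t) := by
    have h := congrArg σ (r_mul_rInv t)
    rw [map_mul, hσ, map_one, swap, lift_r] at h
    calc σ (rInv t) = algebraMap _ _ (r t) * (rInv t * σ (rInv t)) := by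
          rw [← mul_assoc, r_mul_rInv, one_mul]
      _ = _ := by rw [h, mul_one]
  have hσσ : σ.comp σ = RingHom.id _ := by
    apply IsLocalization.ringHom_ext (Submonoid.powers (r t))
    apply CurveRing.ringHom_ext
    · ext c
      simp only [RingHom.comp_apply, RingHom.id_apply, hσ, AlgHom.commutes]
      rw [IsScalarTower.algebraMap_apply K (CurveRing t) (Overlap t), hσ, AlgHom.commutes,
        IsScalarTower.algebraMap_apply K (CurveRing t) (Overlap t)]
    · simp only [RingHom.comp_apply, RingHom.id_apply, hσ]
      rw [swap_r, hσr]
    · simp only [RingHom.comp_apply, RingHom.id_apply, hσ]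
      rw [swap_D, map_mul, map_pow, hσr, hσ, swap_D]
      have h := r_mul_rInv t
      linear_combination (algebraMap _ (Overlap t) (D t)) *
        (algebraMap _ (Overlap t) (r t) * rInv t + 1) * h
  have hi : IsIso (CommRingCat.ofHom σ) :=
    ⟨CommRingCat.ofHom σ, by rw [← CommRingCat.ofHom_comp, hσσ]; rfl,
      by rw [← CommRingCat.ofHom_comp, hσσ]; rfl⟩
  have e : (swap t : CurveRing t →+* Overlap t) = σ.comp (algebraMap _ _) := by
    ext a; exact (hσ a).symm
  rw [e, CommRingCat.ofHom_comp, Spec.map_comp]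
  infer_instance

/-- The smooth projective model of the curve `D² = r⁴ - 2 (2 t + 1) r² + 1`. -/
def Curve : Scheme.{0} :=
  pushout (Spec.map (CommRingCat.ofHom (algebraMap (CurveRing t) (Overlap t))))
    (Spec.map (CommRingCat.ofHom (swap t : CurveRing t →+* Overlap t)))

namespace Curve

/-- The two affine charts of the curve. -/
def chart : Bool → (Spec (.of (CurveRing t)) ⟶ Curve t)
  | false => pushout.inl _ _
  | true => pushout.inr _ _

theorem openGluing : OpenGluing
    (Spec.map (CommRingCat.ofHom (algebraMap (CurveRing t) (Overlap t))))
    (Spec.map (CommRingCat.ofHom (swap t : CurveRing t →+* Overlap t)))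
    (chart t false) (chart t true) := openGluing_pushout _ _

instance (i : Bool) : IsOpenImmersion (chart t i) :=
  match i with
  | false => (openGluing t).left
  | true => (openGluing t).chart.right

theorem exists_mem_range_chart (x : Curve t) : ∃ i, x ∈ Set.range (chart t i) :=
  ((openGluing t).cover x).elim (fun h => ⟨false, h⟩) fun h => ⟨true, h⟩

theorem hom_ext {Y : Scheme.{0}} {f g : Curve t ⟶ Y} (h : ∀ i, chart t i ≫ f = chart t i ≫ g) :
    f = g := hom_ext_of_cover (chart t) (exists_mem_range_chart t) h

variable {t}

/-- The relation between points of the two charts with the same image. -/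
def Glued {R : Type} [CommRing R] (i j : Bool) (α β : CurveRing t →+* R) : Prop :=
  α.comp (algebraMap K _) = β.comp (algebraMap K _) ∧
  if i = j then α (r t) = β (r t) ∧ α (D t) = β (D t)
  else α (r t) * β (r t) = 1 ∧ β (D t) = α (D t) * β (r t) ^ 2

theorem Glued.symm {R : Type} [CommRing R] {i j : Bool} {α β : CurveRing t →+* R}
    (h : Glued i j α β) : Glued j i β α := by
  refine ⟨h.1.symm, ?_⟩
  have h2 := h.2
  by_cases hij : i = j
  · rw [if_pos hij] at h2
    rw [if_pos hij.symm]
    exact ⟨h2.1.symm, h2.2.symm⟩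
  · rw [if_neg hij] at h2
    rw [if_neg (Ne.symm hij)]
    refine ⟨by rw [mul_comm]; exact h2.1, ?_⟩
    rw [h2.2]
    linear_combination (-α (D t)) * (α (r t) * β (r t) + 1) * h2.1

/-- Turns equality of points of the glued curve into equations between coordinates. For distinct
charts a common point factors through the overlap, which is a fibre product; conversely the equation
makes `r` invertible and produces a point of the overlap. -/
theorem specMap_chart_eq_iff {R : Type} [CommRing R] {i j : Bool} {α β : CurveRing t →+* R} :
    Spec.map (CommRingCat.ofHom α) ≫ chart t i = Spec.map (CommRingCat.ofHom β) ≫ chart t j ↔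
      Glued i j α β := by
  have same : ∀ (i : Bool) (α β : CurveRing t →+* R), Spec.map (CommRingCat.ofHom α) ≫ chart t i =
      Spec.map (CommRingCat.ofHom β) ≫ chart t i ↔ Glued i i α β := by
    intro i α β
    rw [cancel_mono]
    constructor
    · intro h
      have : α = β := by
        have := Spec.map_injective h
        exact congrArg CommRingCat.Hom.hom this
      subst this
      exact ⟨rfl, by rw [if_pos rfl]; exact ⟨rfl, rfl⟩⟩
    · intro h
      have h2 := h.2
      rw [if_pos rfl] at h2
      rw [CurveRing.ringHom_ext h.1 h2.1 h2.2]
  have diff : ∀ (α β : CurveRing t →+* R), Spec.map (CommRingCat.ofHom α) ≫ chart t false =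
      Spec.map (CommRingCat.ofHom β) ≫ chart t true ↔ Glued false true α β := by
    intro α β
    constructor
    · intro h
      have hp := (openGluing t).chart.isPullback.flip
      let l := hp.lift _ _ h
      obtain ⟨ν, hl⟩ := Spec.map_surjective l
      have h1 : ν.hom.comp (algebraMap (CurveRing t) (Overlap t)) = α := by
        have := hp.lift_fst _ _ h
        change l ≫ _ = _ at this
        rw [← hl, ← Spec.map_comp] at this
        exact congrArg CommRingCat.Hom.hom (Spec.map_injective this)
      have h2 : ν.hom.comp (swap t : CurveRing t →+* Overlap t) = β := by
        have := hp.lift_snd _ _ h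
        change l ≫ _ = _ at this
        rw [← hl, ← Spec.map_comp] at this
        exact congrArg CommRingCat.Hom.hom (Spec.map_injective this)
      have h3 : β (r t) = ν.hom (rInv t) := by
        rw [← h2, RingHom.comp_apply]
        exact congrArg ν.hom (swap_r t)
      refine ⟨?_, ?_⟩
      · rw [← h1, ← h2]
        ext c
        simp only [RingHom.comp_apply]
        congr 1
        exact ((swap t).commutes c).symm
      · rw [if_neg (by simp)]
        refine ⟨?_, ?_⟩
        · rw [h3, ← h1, RingHom.comp_apply, ← map_mul, r_mul_rInv, map_one]
        · rw [h3, ← h1, RingHom.comp_apply, ← map_pow, ← map_mul, ← h2, RingHom.comp_apply]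
          exact congrArg ν.hom (swap_D t)
    · rintro ⟨hK, h2⟩
      rw [if_neg (by simp)] at h2
      have hu : IsUnit (α (r t)) := IsUnit.of_mul_eq_one _ h2.1
      let μ : Overlap t →+* R := IsLocalization.Away.lift (r t) hu
      have hμ : ∀ a, μ (algebraMap _ _ a) = α a := fun a => IsLocalization.Away.lift_eq _ _ a
      have hμr : μ (rInv t) = β (r t) := by
        have h := congrArg μ (r_mul_rInv t)
        rw [map_mul, hμ, map_one] at h
        calc μ (rInv t) = (α (r t) * β (r t)) * μ (rInv t) := by rw [h2.1, one_mul]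
          _ = β (r t) * (α (r t) * μ (rInv t)) := by ring
          _ = _ := by rw [h, mul_one]
      have h3 : μ.comp (algebraMap (CurveRing t) (Overlap t)) = α := by ext a; exact hμ a
      have h4 : μ.comp (swap t : CurveRing t →+* Overlap t) = β := by
        apply CurveRing.ringHom_ext
        · rw [← hK]
          ext c
          simp only [RingHom.comp_apply]
          rw [← hμ]
          congr 1
          exact (swap t).commutes c
        · exact (congrArg μ (swap_r t)).trans hμr
        · refine (congrArg μ (swap_D t)).trans ?_
          rw [map_mul, map_pow, hμ, hμr, h2.2]
      have e1 : Spec.map (CommRingCat.ofHom α) = Spec.map (CommRingCat.ofHom μ) ≫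
          Spec.map (CommRingCat.ofHom (algebraMap (CurveRing t) (Overlap t))) := by
        rw [← Spec.map_comp, ← CommRingCat.ofHom_comp, h3]
      have e2 : Spec.map (CommRingCat.ofHom β) = Spec.map (CommRingCat.ofHom μ) ≫
          Spec.map (CommRingCat.ofHom (swap t : CurveRing t →+* Overlap t)) := by
        rw [← Spec.map_comp, ← CommRingCat.ofHom_comp, h4]
      rw [e1, e2, Category.assoc, Category.assoc]
      exact congrArg _ (openGluing t).chart.comm
  match i, j with
  | false, false => exact same _ _ _
  | true, true => exact same _ _ _
  | false, true => exact diff _ _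
  | true, false =>
    rw [eq_comm, diff]
    exact ⟨Glued.symm, Glued.symm⟩

/-- Descent for morphisms out of the curve. -/
theorem exists_desc {Y : Scheme.{0}} (F : Bool → (Spec (.of (CurveRing t)) ⟶ Y))
    (hF : ∀ i j (R : Type) [CommRing R] (α β : CurveRing t →+* R), Glued i j α β →
      Spec.map (CommRingCat.ofHom α) ≫ F i = Spec.map (CommRingCat.ofHom β) ≫ F j) :
    ∃ k : Curve t ⟶ Y, ∀ i, chart t i ≫ k = F i := by
  refine exists_desc_of_affine (chart t) (exists_mem_range_chart t) F fun i j R f g h => ?_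
  obtain ⟨α, rfl⟩ := Spec.map_surjective f
  obtain ⟨β, rfl⟩ := Spec.map_surjective g
  exact hF i j R α.hom β.hom (specMap_chart_eq_iff.1 h)

theorem chart_mem_range {i j : Bool} (x : PrimeSpectrum (CurveRing t))
    (hx : i = j ∨ r t ∉ x.asIdeal) : chart t i x ∈ Set.range (chart t j) := by
  have key : ∀ x : PrimeSpectrum (CurveRing t), r t ∉ x.asIdeal →
      ∃ y, Spec.map (CommRingCat.ofHom (algebraMap (CurveRing t) (Overlap t))) y = x := by
    intro x hx
    have h := PrimeSpectrum.localization_away_comap_range (Overlap t) (r t)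
    have hx' : x ∈ (PrimeSpectrum.basicOpen (r t) : Set (PrimeSpectrum (CurveRing t))) := hx
    rw [← h] at hx'
    exact hx'
  by_cases hij : i = j
  · subst hij; exact ⟨x, rfl⟩
  · obtain ⟨y, rfl⟩ := key x (hx.resolve_left hij)
    have h : Glued i j (algebraMap (CurveRing t) (Overlap t)) (swap t : CurveRing t →+* Overlap t) := by
      refine ⟨?_, ?_⟩
      · ext c; exact ((swap t).commutes c).symm
      · rw [if_neg hij]
        refine ⟨?_, ?_⟩
        · exact (congrArg _ (swap_r t)).trans (r_mul_rInv t)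
        · exact (swap_D t).trans (congrArg (fun z => _ * z ^ 2) (swap_r t).symm)
    have h2 := congrArg (fun f => f y) (specMap_chart_eq_iff.2 h)
    exact ⟨_, h2.symm⟩

/-! ### The structure morphism -/

variable (t) in
theorem exists_hom : ∃ e : Curve t ⟶ Spec (.of K), ∀ i, chart t i ≫ e =
    Spec.map (CommRingCat.ofHom (algebraMap K (CurveRing t))) := by
  refine exists_desc _ fun i j R _ α β h => ?_
  rw [← Spec.map_comp, ← Spec.map_comp, ← CommRingCat.ofHom_comp, ← CommRingCat.ofHom_comp, h.1]

variable (t) in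
/-- The structure morphism of the curve. -/
def hom : Curve t ⟶ Spec (.of K) := (exists_hom t).choose

@[simp]
theorem chart_hom (i : Bool) : chart t i ≫ hom t =
    Spec.map (CommRingCat.ofHom (algebraMap K (CurveRing t))) := (exists_hom t).choose_spec i

/-! ### Automorphisms -/

variable (t) in
theorem exists_sgn (ε δ : ℤˣ) : ∃ σ : Curve t ⟶ Curve t, ∀ i, chart t i ≫ σ =
    Spec.map (CommRingCat.ofHom (sgnHom t ε δ : CurveRing t →+* CurveRing t)) ≫ chart t i := by
  refine exists_desc _ fun i j R _ α β h => ?_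
  rw [← Category.assoc, ← Category.assoc, ← Spec.map_comp, ← Spec.map_comp,
    ← CommRingCat.ofHom_comp, ← CommRingCat.ofHom_comp, specMap_chart_eq_iff]
  have h1 : ∀ γ : CurveRing t →+* R, γ (sgnHom t ε δ (r t)) = ((ε : ℤ) : R) * γ (r t) := fun γ => by
    rw [sgnHom_r, map_mul, map_intCast]
  have h2 : ∀ γ : CurveRing t →+* R, γ (sgnHom t ε δ (D t)) = ((δ : ℤ) : R) * γ (D t) := fun γ => by
    rw [sgnHom_D, map_mul, map_intCast]
  have hε : ((ε : ℤ) : R) * ((ε : ℤ) : R) = 1 := by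
    rw [← Int.cast_mul, ← Units.val_mul, Int.units_mul_self, Units.val_one, Int.cast_one]
  refine ⟨?_, ?_⟩
  · rw [RingHom.comp_assoc, RingHom.comp_assoc, AlgHom.comp_algebraMap, h.1]
  · have h' := h.2
    change if i = j then α (sgnHom t ε δ (r t)) = β (sgnHom t ε δ (r t)) ∧
      α (sgnHom t ε δ (D t)) = β (sgnHom t ε δ (D t)) else
      α (sgnHom t ε δ (r t)) * β (sgnHom t ε δ (r t)) = 1 ∧
      β (sgnHom t ε δ (D t)) = α (sgnHom t ε δ (D t)) * β (sgnHom t ε δ (r t)) ^ 2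
    simp only [h1, h2]
    split_ifs at h' ⊢ with hij
    · rw [h'.1, h'.2]; exact ⟨rfl, rfl⟩
    · refine ⟨by linear_combination ((ε : ℤ) : R) * ((ε : ℤ) : R) * h'.1 + hε, ?_⟩
      rw [h'.2]
      linear_combination (-((δ : ℤ) : R) * (α (D t)) * β (r t) ^ 2) * hε

variable (t) in
/-- The automorphism `(r, D) ↦ (± r, ± D)` of the curve. -/
def sgn (ε δ : ℤˣ) : Curve t ⟶ Curve t := (exists_sgn t ε δ).choose

theorem chart_sgn (ε δ : ℤˣ) (i : Bool) : chart t i ≫ sgn t ε δ =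
    Spec.map (CommRingCat.ofHom (sgnHom t ε δ : CurveRing t →+* CurveRing t)) ≫ chart t i :=
  (exists_sgn t ε δ).choose_spec i

theorem sgn_hom (ε δ : ℤˣ) : sgn t ε δ ≫ hom t = hom t := by
  apply hom_ext
  intro i
  rw [reassoc_of% chart_sgn, chart_hom, ← Spec.map_comp, ← CommRingCat.ofHom_comp,
    AlgHom.comp_algebraMap]

theorem sgn_sgn (ε δ : ℤˣ) : sgn t ε δ ≫ sgn t ε δ = 𝟙 _ := by
  apply hom_ext
  intro i
  rw [reassoc_of% chart_sgn, chart_sgn, ← Category.assoc, ← Spec.map_comp, ← CommRingCat.ofHom_comp]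
  have h : (sgnHom t ε δ : CurveRing t →+* CurveRing t).comp
      (sgnHom t ε δ : CurveRing t →+* CurveRing t) = RingHom.id _ :=
    congrArg (fun f : CurveRing t →ₐ[K] CurveRing t => (f : CurveRing t →+* CurveRing t))
      (sgnHom_sgnHom ε δ)
  rw [h]
  simp

/-! ### The projection to the projective line -/

variable (t) in
/-- The homogeneous coordinates of `r`. -/
def coords (i : Bool) : Fin 2 → CurveRing t := fun k => if k = (if i then 1 else 0) then 1 else r t

/-- The coordinate that is invertible on a chart. -/
def unitIndex (i : Bool) : Fin 2 := if i then 1 else 0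

theorem coords_unitIndex (i : Bool) : coords t i (unitIndex i) = 1 := if_pos rfl

variable (t) in
theorem exists_proj : ∃ q : Curve t ⟶ projSpace 1 K, ∀ i, chart t i ≫ q =
    toProj (coords t i) (unitIndex i) (by rw [coords_unitIndex]; exact isUnit_one) := by
  refine exists_desc _ fun i j R _ α β h => ?_
  algebraize [α.comp (algebraMap K _)]
  let α' : CurveRing t →ₐ[K] R := { α with commutes' := fun c => rfl }
  let β' : CurveRing t →ₐ[K] R := { β with commutes' := fun c => (RingHom.congr_fun h.1 c).symm }
  have hα : α = (α' : CurveRing t →+* R) := rfl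
  have hβ : β = (β' : CurveRing t →+* R) := rfl
  rw [hα, hβ, specMap_toProj, specMap_toProj]
  have h2 := h.2
  split_ifs at h2 with hij
  · subst hij
    refine toProj_eq _ _ 1 isUnit_one fun k => ?_
    change β' (if _ then 1 else r t) = 1 * α' (if _ then 1 else r t)
    rw [one_mul]
    split_ifs <;> first | rw [map_one, map_one] | exact h2.1.symm
  · refine toProj_eq _ _ (β (r t)) (IsUnit.of_mul_eq_one _ (by rw [mul_comm]; exact h2.1)) fun k => ?_
    have h3 : α' (r t) = α (r t) := rfl
    have h4 : β' (r t) = β (r t) := rfl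
    match i, j with
    | false, false => exact absurd rfl hij
    | true, true => exact absurd rfl hij
    | false, true =>
      fin_cases k
      · simp [coords, h4]
      · simp [coords, h3, mul_comm, h2.1]
    | true, false =>
      fin_cases k
      · simp [coords, h3, mul_comm, h2.1]
      · simp [coords, h4]

variable (t) in
/-- The projection of the curve to the projective line. -/
def proj : Curve t ⟶ projSpace 1 K := (exists_proj t).choose

theorem chart_proj (i : Bool) : chart t i ≫ proj t =
    toProj (coords t i) (unitIndex i) (by rw [coords_unitIndex]; exact isUnit_one) :=
  (exists_proj t).choose_spec i

theorem proj_hom : proj t ≫ projSpaceHom 1 K = hom t := by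
  apply hom_ext
  intro i
  rw [← Category.assoc, chart_proj, toProj_hom, chart_hom]

variable (t) in
/-- The projection in coordinates. -/
def projRingHom (i : Bool) := awayHom (K := K) (coords t i) (MvPolynomial.X (unitIndex i))
  (by rw [MvPolynomial.aeval_X, coords_unitIndex]; exact isUnit_one)

theorem chart_proj' (i : Bool) : chart t i ≫ proj t =
    Spec.map (CommRingCat.ofHom (projRingHom t i)) ≫ coordEmb K (unitIndex i) := chart_proj i

theorem projRingHom_injective (i : Bool) : Function.Injective (projRingHom t i) := by
  refine awayHom_injective aeval_r_injective _ _ (coords_unitIndex i) (unitIndex (!i)) ?_ ?_ _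
  · intro k hk
    cases i <;> fin_cases k <;> simp_all [unitIndex]
  · intro k hk
    exact if_neg hk

theorem mem_range_projRingHom (i : Bool) (a : CurveRing t) :
    a ∈ Set.range (projRingHom t i) ↔ a ∈ Algebra.adjoin K {r t} := by
  rw [projRingHom, range_awayHom _ _ (coords_unitIndex i)]
  have h : Set.range (coords t i) = {1, r t} := by
    ext x
    cases i <;> simp [coords, Set.mem_range, Fin.exists_fin_two, eq_comm, or_comm]
  rw [h]
  constructor
  · refine fun h => Algebra.adjoin_le ?_ h
    rintro x (rfl | rfl)
    · exact one_mem _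
    · exact Algebra.subset_adjoin rfl
  · exact fun h => Algebra.adjoin_mono (by simp) h

variable (t) in
theorem proj_isChart (i : Bool) : Chart (proj t) (chart t i) (coordEmb K (unitIndex i))
    (Spec.map (CommRingCat.ofHom (projRingHom t i))) := by
  refine ⟨inferInstance, inferInstance, chart_proj' i, ?_⟩
  intro x hx
  obtain ⟨j, y, rfl⟩ := exists_mem_range_chart t x
  apply chart_mem_range
  by_cases hji : j = i
  · exact Or.inl hji
  · right
    rw [← Scheme.Hom.comp_apply, chart_proj] at hx
    have hx' := (toProj_mem_range_iff _ _ _ _ _).1 hx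
    have h : coords t j (unitIndex i) = r t := by
      refine if_neg ?_
      cases i <;> cases j <;> simp_all [unitIndex]
    rwa [h] at hx'

theorem exists_mem_range_coordEmb_unitIndex (y : projSpace 1 K) :
    ∃ i, y ∈ Set.range (coordEmb K (unitIndex i)) := by
  obtain ⟨i, hi⟩ := exists_mem_range_coordEmb y
  fin_cases i
  · exact ⟨false, hi⟩
  · exact ⟨true, hi⟩

theorem exists_eq_add (a : CurveRing t) : ∃ b ∈ Algebra.adjoin K {r t}, ∃ c ∈ Algebra.adjoin K {r t},
    a = b + c * D t :=
  ⟨_, Polynomial.aeval_mem_adjoin_singleton K (r t), _,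
    Polynomial.aeval_mem_adjoin_singleton K (r t), DoubleCover.eq_add a⟩

variable (t) in
-- The projection is finite: on each chart the functions are generated by `1` and `D` over the
-- polynomials in `r`. Properness of the curve itself follows by composing with the projective line.
theorem isProper_proj : IsProper (proj t) := by
  refine Chart.property (P := @IsProper) (proj_isChart t) exists_mem_range_coordEmb_unitIndex
    fun i => ?_
  have : IsFinite (Spec.map (CommRingCat.ofHom (projRingHom t i))) := ?_
  · infer_instance
  rw [IsFinite.SpecMap_iff]
  change (projRingHom t i).Finite
  algebraize [projRingHom t i]
  classical
  refine ⟨⟨{1, D t}, ?_⟩⟩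
  rw [eq_top_iff]
  intro a _
  obtain ⟨b, hb, c, hc, rfl⟩ := exists_eq_add a
  rw [← mem_range_projRingHom i] at hb hc
  obtain ⟨b, rfl⟩ := hb
  obtain ⟨c, rfl⟩ := hc
  have h1 : (1 : CurveRing t) ∈ (({1, D t} : Finset (CurveRing t)) : Set (CurveRing t)) := by simp
  have h2 : D t ∈ (({1, D t} : Finset (CurveRing t)) : Set (CurveRing t)) := by simp
  have e1 : projRingHom t i b = b • (1 : CurveRing t) := by
    rw [Algebra.smul_def, mul_one]; rfl
  have e2 : projRingHom t i c * D t = c • D t := by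
    rw [Algebra.smul_def]; rfl
  rw [e1, e2]
  exact add_mem (Submodule.smul_mem _ _ (Submodule.subset_span h1))
    (Submodule.smul_mem _ _ (Submodule.subset_span h2))

instance isProper_hom : IsProper (hom t) := by
  have := isProper_proj t
  rw [← proj_hom]
  infer_instance

theorem smooth_hom [CharZero K] (h0 : t ≠ 0) (h1 : t + 1 ≠ 0) :
    SmoothOfRelativeDimension 1 (hom t) := by
  have hA : RingHom.Locally (RingHom.IsStandardSmoothOfRelativeDimension 1)
      (algebraMap K (CurveRing t)) := by
    have h := DoubleCover.locally_smooth (R := K) (u := 1) (v := 1) (one_mul 1) (quartic_monic t)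
      (quartic_isCoprime t h0 h1) (IsUnit.mk0 2 two_ne_zero)
    rwa [Polynomial.C_1, one_mul] at h
  let 𝒰 : (Curve t).OpenCover := Scheme.Cover.mkOfCovers Bool _ (chart t)
    (exists_mem_range_chart t) (fun i => inferInstance)
  refine (IsZariskiLocalAtSource.iff_of_openCover (P := @SmoothOfRelativeDimension 1) 𝒰).2
    fun (i : Bool) => ?_
  have key : ∀ i, SmoothOfRelativeDimension 1 (chart t i ≫ hom t) := ?_
  · exact key i
  intro i
  rw [chart_hom]
  exact (HasRingHomProperty.Spec_iff (P := @SmoothOfRelativeDimension 1)).2 hA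

/-! ### The group `ℤ/2` acting through an involution -/

end Curve

end Curve

end

/-! ### Involutions, and the quotient of the curve by `(r, D) ↦ (r, -D)` -/

section

section Involution

/-- The homomorphism from `ℤ/2` given by an involution. -/
def involutionHom {M : Type*} [Group M] (x : M) (hx : x * x = 1) : Multiplicative (ZMod 2) →* M :=
  MonoidHom.mk' (fun g => if g = 1 then 1 else x) (by
    have h : ∀ g : Multiplicative (ZMod 2), g = 1 ∨ g = Multiplicative.ofAdd 1 := by decide
    have h1 : (Multiplicative.ofAdd (1 : ZMod 2)) ≠ 1 := by decide
    have h2 : (Multiplicative.ofAdd (1 : ZMod 2)) * Multiplicative.ofAdd 1 = 1 := by decide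
    intro a b
    rcases h a with rfl | rfl <;> rcases h b with rfl | rfl <;> simp [h2, hx])

theorem multiplicative_zmod_two (g : Multiplicative (ZMod 2)) :
    g = 1 ∨ g = Multiplicative.ofAdd 1 := by
  revert g; decide

theorem involutionHom_ofAdd_one {M : Type*} [Group M] (x : M) (hx : x * x = 1) :
    involutionHom x hx (Multiplicative.ofAdd 1) = x :=
  (if_neg (by decide) : (if Multiplicative.ofAdd (1 : ZMod 2) = 1 then 1 else x) = x)

variable {X S : Scheme.{0}} {f : X ⟶ S}

/-- The action of `ℤ/2` on a scheme over `S` through an involution. -/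
def involutionAct (σ : X ⟶ X) (h : σ ≫ f = f) (h2 : σ ≫ σ = 𝟙 X) :
    Multiplicative (ZMod 2) →* Aut (Over.mk f) :=
  involutionHom
    (⟨Over.homMk σ h, Over.homMk σ h, by ext1; exact h2, by ext1; exact h2⟩ : Aut (Over.mk f))
    (by ext1; ext1; exact h2)

theorem involutionAct_one (σ : X ⟶ X) (h : σ ≫ f = f) (h2 : σ ≫ σ = 𝟙 X) :
    ((involutionAct σ h h2) 1).hom.left = 𝟙 X := by
  rw [map_one]; rfl

theorem involutionAct_ofAdd_one (σ : X ⟶ X) (h : σ ≫ f = f) (h2 : σ ≫ σ = 𝟙 X) :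
    ((involutionAct σ h h2) (Multiplicative.ofAdd 1)).hom.left = σ := by
  exact congrArg (fun g : Aut (Over.mk f) => g.hom.left) (involutionHom_ofAdd_one _ _)

theorem involutionAct_injective {σ : X ⟶ X} (h : σ ≫ f = f) (h2 : σ ≫ σ = 𝟙 X) (hσ : σ ≠ 𝟙 X) :
    Function.Injective (involutionAct σ h h2) := by
  rw [injective_iff_map_eq_one]
  intro g hg
  rcases multiplicative_zmod_two g with rfl | rfl
  · rfl
  · exact absurd ((involutionAct_ofAdd_one σ h h2).symm.trans (by rw [hg]; rfl)) hσ

end Involution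

namespace Curve

open CurveRing

variable {K : Type} [Field K] {t : K}

theorem sgnHom_algebraMap_adjoin (δ : ℤˣ) {a : CurveRing t} (ha : a ∈ Algebra.adjoin K {r t}) :
    sgnHom t 1 δ a = a := by
  induction ha using Algebra.adjoin_induction with
  | mem x hx =>
    obtain rfl : x = r t := hx
    rw [sgnHom_r]; simp
  | algebraMap c => exact AlgHom.commutes _ _
  | add x y _ _ hx hy => rw [map_add, hx, hy]
  | mul x y _ _ hx hy => rw [map_mul, hx, hy]

/-- The involution changes the sign of the part `c D` in the decomposition `b + c D`, so invariance
gives `2 c D = 0`. -/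
theorem mem_adjoin_of_sgnHom_eq [CharZero K] {a : CurveRing t} (ha : sgnHom t 1 (-1) a = a) :
    a ∈ Algebra.adjoin K {r t} := by
  obtain ⟨b, hb, c, hc, rfl⟩ := exists_eq_add a
  rw [map_add, map_mul, sgnHom_algebraMap_adjoin _ hb, sgnHom_algebraMap_adjoin _ hc, sgnHom_D] at ha
  have h1 : algebraMap K (CurveRing t) 2 * (c * D t) = 0 := by
    rw [map_ofNat]
    simp only [Units.val_neg, Units.val_one, Int.cast_neg, Int.cast_one] at ha
    linear_combination (-1 : CurveRing t) * ha
  have h2 : IsUnit (algebraMap K (CurveRing t) 2) := (IsUnit.mk0 (2 : K) two_ne_zero).map _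
  rw [(h2.mul_right_eq_zero).1 h1, add_zero]
  exact hb

variable (t) in
/-- The curve modulo the involution `(r, D) ↦ (r, -D)` is the projective line. -/
theorem isQuotient_proj [CharZero K] : IsQuotient
    (fun g => ((involutionAct (f := hom t) (sgn t 1 (-1)) (sgn_hom _ _) (sgn_sgn _ _)) g).hom.left)
    (proj t) := by
  have hσ : sgn t 1 (-1) ≫ proj t = proj t := by
    apply hom_ext
    intro i
    rw [reassoc_of% chart_sgn, chart_proj', ← Category.assoc, ← Spec.map_comp]
    congr 2
    refine CommRingCat.hom_ext (RingHom.ext fun x => ?_)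
    exact sgnHom_algebraMap_adjoin _ ((mem_range_projRingHom i _).1 ⟨x, rfl⟩)
  refine isQuotient_of_charts (g₀ := Multiplicative.ofAdd 1) ?_ (proj_isChart t)
    exists_mem_range_coordEmb_unitIndex
    (σ := fun _ => CommRingCat.ofHom (sgnHom t 1 (-1) : CurveRing t →+* CurveRing t)) ?_
    projRingHom_injective ?_
  · intro g
    rcases multiplicative_zmod_two g with rfl | rfl
    · exact (congrArg (· ≫ _) (involutionAct_one _ _ _)).trans (Category.id_comp _)
    · exact (congrArg (· ≫ _) (involutionAct_ofAdd_one _ _ _)).trans hσ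
  · intro i
    exact (congrArg (_ ≫ ·) (involutionAct_ofAdd_one _ _ _)).trans (chart_sgn _ _ _)
  · intro i a ha
    exact (mem_range_projRingHom i a).2 (mem_adjoin_of_sgnHom_eq ha)

theorem sgn_ne_id [CharZero K] : sgn t (-1) (-1) ≠ 𝟙 _ := by
  intro h
  have h1 := chart_sgn (t := t) (-1) (-1) false
  rw [h, Category.comp_id] at h1
  have h2 : (RingHom.id (CurveRing t)) = (sgnHom t (-1) (-1) : CurveRing t →+* CurveRing t) := by
    have : Spec.map (CommRingCat.ofHom (RingHom.id (CurveRing t))) =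
        Spec.map (CommRingCat.ofHom (sgnHom t (-1) (-1) : CurveRing t →+* CurveRing t)) := by
      rw [← cancel_mono (chart t false), ← h1]
      simp
    exact congrArg CommRingCat.Hom.hom (Spec.map_injective this)
  have h3 : r t = sgnHom t (-1) (-1) (r t) := RingHom.congr_fun h2 (r t)
  rw [sgnHom_r] at h3
  have h4 : Polynomial.aeval (r t) (Polynomial.X : Polynomial K) =
      Polynomial.aeval (r t) (-Polynomial.X : Polynomial K) := by
    simpa using h3
  have h5 := congrArg (Polynomial.eval 1) (aeval_r_injective h4)
  simp at h5
  exact two_ne_zero (α := K) (by linear_combination h5)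

/-- The involution `(r, D) ↦ (-r, -D)` has no fixed points with values in a field. -/
theorem comp_sgn_ne [CharZero K] {F : Type} [Field F] (x : Spec (.of F) ⟶ Curve t) :
    x ≫ sgn t (-1) (-1) ≠ x := by
  intro h
  obtain ⟨i, hi⟩ := exists_mem_range_chart t (x default)
  obtain ⟨α, rfl⟩ : ∃ α : CurveRing t →+* F, Spec.map (CommRingCat.ofHom α) ≫ chart t i = x := by
    have hr : Set.range x ⊆ Set.range (chart t i) := by
      rintro _ ⟨y, rfl⟩
      rwa [Subsingleton.elim y default]
    obtain ⟨α, hα⟩ := Spec.map_surjective (IsOpenImmersion.lift (chart t i) x hr)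
    exact ⟨α.hom, by
      rw [CommRingCat.ofHom_hom, hα, IsOpenImmersion.lift_fac]⟩
  -- The involution preserves each chart, so a fixed point can be examined in the coordinates of one
  -- chart containing it.
  rw [Category.assoc, chart_sgn, ← Category.assoc, ← Spec.map_comp, ← CommRingCat.ofHom_comp,
    specMap_chart_eq_iff] at h
  have h2 := h.2
  rw [if_pos rfl, RingHom.comp_apply, RingHom.comp_apply] at h2
  have hr : α (sgnHom t (-1) (-1) (r t)) = α (r t) := h2.1
  have hD : α (sgnHom t (-1) (-1) (D t)) = α (D t) := h2.2
  rw [sgnHom_r, map_mul, map_intCast] at hr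
  rw [sgnHom_D, map_mul, map_intCast] at hD
  simp only [Units.val_neg, Units.val_one, Int.cast_neg, Int.cast_one] at hr hD
  have : CharZero F := by
    algebraize [α.comp (algebraMap K _)]
    exact charZero_of_injective_algebraMap (algebraMap K F).injective
  have h2' : (2 : F) ≠ 0 := two_ne_zero
  have hr0 : α (r t) = 0 := (mul_eq_zero.1 (by linear_combination -hr :
    (2 : F) * α (r t) = 0)).resolve_left h2'
  have hD0 : α (D t) = 0 := (mul_eq_zero.1 (by linear_combination -hD :
    (2 : F) * α (D t) = 0)).resolve_left h2'
  -- A fixed point has `r = D = 0`, and the equation of the quartic then reads `0 = 1`.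
  have h := congrArg α (D_sq t)
  simp only [map_add, map_sub, map_mul, map_pow, map_one, hr0, hD0] at h
  norm_num at h

end Curve

end

/-! ### The Weierstrass curve inside the quartic model -/

section

section BasicOpen

/-- An affine scheme is glued from two basic open sets defined by coprime elements. -/
theorem range_specMap_away {R : Type} [CommRing R] (f : R) (x : PrimeSpectrum R) :
    x ∈ Set.range (Spec.map (CommRingCat.ofHom (algebraMap R (Localization.Away f)))) ↔
      f ∉ x.asIdeal := by
  have h := PrimeSpectrum.localization_away_comap_range (Localization.Away f) f
  exact (congrArg (fun s => x ∈ s) h).to_iff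

end BasicOpen

/-- Read off on the projective line: the chart `j` lies over the standard open set on which the
other homogeneous coordinate, equal to `r` on the chart `i`, does not vanish. -/
theorem Curve.notMem_of_chart_mem_range {K : Type} [Field K] {t : K} {i j : Bool} (hij : i ≠ j)
    (x : PrimeSpectrum (CurveRing t)) (h : Curve.chart t i x ∈ Set.range (Curve.chart t j)) :
    CurveRing.r t ∉ x.asIdeal := by
  obtain ⟨w, hw⟩ := h
  have h1 : toProj (Curve.coords t i) (Curve.unitIndex i)
      (by rw [Curve.coords_unitIndex]; exact isUnit_one) x ∈
        Set.range (coordEmb K (Curve.unitIndex j)) := by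
    have e : toProj (Curve.coords t i) (Curve.unitIndex i)
        (by rw [Curve.coords_unitIndex]; exact isUnit_one) x = Curve.proj t (Curve.chart t i x) :=
      congrArg (fun f : Spec (.of (CurveRing t)) ⟶ projSpace 1 K => f x) (Curve.chart_proj i).symm
    have e' : Curve.proj t (Curve.chart t j w) = _ :=
      congrArg (fun f : Spec (.of (CurveRing t)) ⟶ projSpace 1 K => f w) (Curve.chart_proj' j)
    rw [e, ← hw, e']
    exact ⟨_, rfl⟩
  rw [toProj_mem_range_iff] at h1
  have h2 : Curve.coords t i (Curve.unitIndex j) = CurveRing.r t := by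
    cases i <;> cases j <;> simp_all [Curve.coords, Curve.unitIndex]
  rwa [h2] at h1

/-- The Weierstrass curve `y² = x (x + 1) (x - t)`. -/
def legendre {K : Type} [Field K] (t : K) : WeierstrassCurve K where
  a₁ := 0
  a₂ := 1 - t
  a₃ := 0
  a₄ := -t
  a₆ := 0

namespace legendre

variable {K : Type} [Field K] {t : K}

theorem isElliptic [CharZero K] (h0 : t ≠ 0) (h1 : t + 1 ≠ 0) : (legendre t).IsElliptic := by
  refine ⟨IsUnit.mk0 _ ?_⟩
  have : (legendre t).Δ = 16 * t ^ 2 * (t + 1) ^ 2 := by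
    simp only [WeierstrassCurve.Δ, WeierstrassCurve.b₂, WeierstrassCurve.b₄, WeierstrassCurve.b₆,
      WeierstrassCurve.b₈, legendre]
    ring
  rw [this]
  exact mul_ne_zero (mul_ne_zero (by norm_num) (pow_ne_zero 2 h0)) (pow_ne_zero 2 h1)

variable (t) in
/-- The coordinate ring. -/
abbrev Ring := (legendre t).toAffine.CoordinateRing

variable (t) in
/-- The function `x - t`. -/
def s : Ring t := algebraMap (Polynomial K) _ Polynomial.X - algebraMap K _ t

variable (t) in
/-- The function `y`. -/
def y : Ring t := AdjoinRoot.root _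

variable (t) in
/-- The function `x (x + 1)`. -/
def g : Ring t := s t ^ 2 + algebraMap K _ (2 * t + 1) * s t + algebraMap K _ (t * (t + 1))

variable {R : Type} [CommRing R] [Algebra K R]

theorem eval_polynomial (a b : R) : Polynomial.eval₂ (Polynomial.aeval a : Polynomial K →ₐ[K] R)
    b (legendre t).toAffine.polynomial =
      b ^ 2 - (a ^ 3 + (1 - algebraMap K R t) * a ^ 2 - algebraMap K R t * a) := by
  simp only [WeierstrassCurve.Affine.polynomial, legendre, WeierstrassCurve.toAffine]
  simp [Polynomial.eval₂_pow, Polynomial.eval₂_C]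
  ring

/-- The algebra homomorphism determined by the images of `x - t` and `y`. -/
def lift (a b : R) (h : b ^ 2 = a * (a ^ 2 + algebraMap K R (2 * t + 1) * a +
    algebraMap K R (t * (t + 1)))) : Ring t →ₐ[K] R :=
  AdjoinRoot.liftAlgHom _ (Polynomial.aeval (a + algebraMap K R t)) b (by
    refine (eval_polynomial _ b).trans ?_
    rw [h]
    simp only [map_add, map_mul, map_ofNat, map_one]
    ring)

theorem lift_s (a b : R) (h) : lift (t := t) a b h (s t) = a := by
  have h1 : lift (t := t) a b h (algebraMap (Polynomial K) _ Polynomial.X) =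
      a + algebraMap K R t :=
    (AdjoinRoot.liftAlgHom_of _ _ _ _ _).trans (Polynomial.aeval_X _)
  rw [s, map_sub, h1, AlgHom.commutes, add_sub_cancel_right]

theorem lift_y (a b : R) (h) : lift (t := t) a b h (y t) = b :=
  AdjoinRoot.liftAlgHom_root _ _ _ _

theorem algHom_ext {f f' : Ring t →ₐ[K] R} (hs : f (s t) = f' (s t)) (hy : f (y t) = f' (y t)) :
    f = f' := by
  refine AdjoinRoot.algHom_ext' ?_ hy
  refine Polynomial.algHom_ext ?_
  rw [s, map_sub, map_sub, AlgHom.commutes, AlgHom.commutes] at hs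
  exact sub_left_injective hs

variable (t) in
theorem y_sq : y t ^ 2 = s t * g t := by
  have h0 : Polynomial.eval₂ (Polynomial.aeval
      (algebraMap (Polynomial K) (Ring t) Polynomial.X) : Polynomial K →ₐ[K] Ring t)
      (y t) (legendre t).toAffine.polynomial = 0 := by
    have h : ((Polynomial.aeval (algebraMap (Polynomial K) (Ring t) Polynomial.X) :
        Polynomial K →ₐ[K] Ring t) : Polynomial K →+* Ring t) =
        AdjoinRoot.of (legendre t).toAffine.polynomial := by
      refine Polynomial.ringHom_ext (fun c => ?_) ?_
      · exact (Polynomial.aeval_C _ _).trans rfl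
      · exact Polynomial.aeval_X _
    rw [h]
    exact AdjoinRoot.eval₂_root _
  rw [eval_polynomial] at h0
  simp only [g, s, map_add, map_mul, map_ofNat, map_one]
  linear_combination h0

/-! ### The two open subsets identified with open subsets of the charts -/

variable (t) in
/-- The functions `x - t` and `x (x + 1)`, which have no common zero if `t (t + 1) ≠ 0`. -/
def coord : Bool → Ring t
  | false => s t
  | true => g t

variable (t) in
/-- The localization at `coord t i`. -/
abbrev Local (i : Bool) := Localization.Away (coord t i)

variable (t) in
/-- The inverse of `coord t i`. -/
def coordInv (i : Bool) : Local t i := IsLocalization.Away.invSelf (coord t i)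

theorem coord_mul_coordInv (i : Bool) :
    algebraMap (Ring t) (Local t i) (coord t i) * coordInv t i = 1 :=
  IsLocalization.Away.mul_invSelf _

variable (t) in
/-- The comparison of the charts. -/
def chartHom (i : Bool) : CurveRing t →ₐ[K] Local t i :=
  -- With `b = t(t+1)`: where `s` is invertible, `r = y / s` and `D = s - b / s`. On the other chart
  -- the coordinates are `1 / r = y / g` and `D / r² = (s² - b) / g`, defined where `g` is
  -- invertible. Both cases are therefore given by one formula with `coord t i` as denominator.
  CurveRing.lift (algebraMap _ _ (y t) * coordInv t i)
    (algebraMap _ _ (s t ^ 2 - algebraMap K _ (t * (t + 1))) * coordInv t i) (by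
      have h1 := congrArg (algebraMap (Ring t) (Local t i)) (y_sq t)
      have h2 := coord_mul_coordInv (t := t) i
      cases i
      · simp only [coord] at h2
        generalize coordInv t false = S' at *
        simp only [g, map_mul, map_add, map_sub, map_pow, map_ofNat, map_one,
          ← IsScalarTower.algebraMap_apply] at h1 ⊢
        generalize algebraMap _ (Local t false) (s t) = S at *
        generalize algebraMap _ (Local t false) (y t) = Y at *
        generalize algebraMap K (Local t false) t = T at *
        have h3 : (Y * S') ^ 2 = S + (2 * T + 1) + T * (T + 1) * S' := by
          linear_combination S' ^ 2 * h1 + ((S * S' + 1) * (S + (2 * T + 1)) +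
            T * (T + 1) * S') * h2
        have h4 : (S ^ 2 - T * (T + 1)) * S' = S - T * (T + 1) * S' := by
          linear_combination S * h2
        rw [h4, show (Y * S') ^ 4 = ((Y * S') ^ 2) ^ 2 by ring, h3]
        linear_combination (-4) * T * (T + 1) * h2
      · simp only [coord, g] at h2
        generalize coordInv t true = G' at *
        simp only [g, map_mul, map_add, map_sub, map_pow, map_ofNat, map_one,
          ← IsScalarTower.algebraMap_apply] at h1 h2 ⊢
        generalize algebraMap _ (Local t true) (s t) = S at *
        generalize algebraMap _ (Local t true) (y t) = Y at *
        generalize algebraMap K (Local t true) t = T at *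
        have h3 : (Y * G') ^ 2 = S * G' := by
          linear_combination G' ^ 2 * h1 + S * G' * h2
        rw [show (Y * G') ^ 4 = ((Y * G') ^ 2) ^ 2 by ring, h3]
        linear_combination (-2 * (2 * T + 1) * S * G' + (S ^ 2 + (2 * T + 1) * S + T * (T + 1)) * G'
          + 1) * h2)

theorem chartHom_r_mul (i : Bool) :
    chartHom t i (CurveRing.r t) * algebraMap _ _ (coord t i) = algebraMap _ _ (y t) := by
  rw [chartHom, CurveRing.lift_r, mul_right_comm, mul_assoc, coord_mul_coordInv, mul_one]

theorem chartHom_D_mul (i : Bool) :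
    chartHom t i (CurveRing.D t) * algebraMap _ _ (coord t i) =
      algebraMap _ _ (s t ^ 2 - algebraMap K _ (t * (t + 1))) := by
  rw [chartHom, CurveRing.lift_D, mul_right_comm, mul_assoc, coord_mul_coordInv, mul_one]

theorem chartHom_r_mul_s : chartHom t false (CurveRing.r t) * algebraMap _ _ (s t) =
    algebraMap _ _ (y t) := chartHom_r_mul false

theorem chartHom_r_mul_g : chartHom t true (CurveRing.r t) * algebraMap _ _ (g t) =
    algebraMap _ _ (y t) := chartHom_r_mul true

theorem chartHom_D_mul_s : chartHom t false (CurveRing.D t) * algebraMap _ _ (s t) =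
    algebraMap _ _ (s t ^ 2 - algebraMap K _ (t * (t + 1))) := chartHom_D_mul false

theorem chartHom_D_mul_g : chartHom t true (CurveRing.D t) * algebraMap _ _ (g t) =
    algebraMap _ _ (s t ^ 2 - algebraMap K _ (t * (t + 1))) := chartHom_D_mul true

theorem local_algHom_ext {i : Bool} {f f' : Local t i →ₐ[K] R}
    (hs : f (algebraMap _ _ (s t)) = f' (algebraMap _ _ (s t)))
    (hy : f (algebraMap _ _ (y t)) = f' (algebraMap _ _ (y t))) : f = f' := by
  have h : f.comp (IsScalarTower.toAlgHom K (Ring t) (Local t i)) =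
      f'.comp (IsScalarTower.toAlgHom K (Ring t) (Local t i)) := algHom_ext hs hy
  have h2 : (f : Local t i →+* R) = f' := IsLocalization.ringHom_ext (Submonoid.powers (coord t i))
    (RingHom.ext fun x => AlgHom.congr_fun h x)
  exact AlgHom.ext fun x => RingHom.congr_fun h2 x

/-- The extension of a homomorphism to the localization. -/
def localLift (i : Bool) (f : Ring t →ₐ[K] R) (hf : IsUnit (f (coord t i))) : Local t i →ₐ[K] R :=
  IsLocalization.liftAlgHom (M := Submonoid.powers (coord t i)) (f := f) (by
    rintro ⟨_, n, rfl⟩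
    rw [map_pow]
    exact hf.pow n)

theorem localLift_algebraMap (i : Bool) (f : Ring t →ₐ[K] R) (hf) (x : Ring t) :
    localLift i f hf (algebraMap _ _ x) = f x :=
  IsLocalization.lift_eq _ _

variable (t R) in
theorem isUnit_b (h0 : t ≠ 0) (h1 : t + 1 ≠ 0) :
    IsUnit (algebraMap K R t * (algebraMap K R t + 1)) := by
  have := (IsUnit.mk0 (t * (t + 1)) (mul_ne_zero h0 h1)).map (algebraMap K R)
  rwa [map_mul, map_add, map_one] at this

section

variable [CharZero K]

theorem half_mul_two : algebraMap K R (1 / 2) * 2 = 1 := by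
  rw [← map_ofNat (algebraMap K R) 2, ← map_mul]
  norm_num

open CurveRing in
-- The elements `S` and `S'` stand for `s` and `b / s` with `b = t(t+1)`: they solve `S + S' = r² -
-- (2t+1)` and `S - S' = D`. Then `S S' = b` is a unit, so the locus `s ≠ 0` is the whole affine
-- quartic.
theorem exists_fromLocal_false (h0 : t ≠ 0) (h1 : t + 1 ≠ 0) :
    ∃ ψ : Local t false →ₐ[K] CurveRing t,
      (∀ x, ψ (chartHom t false x) = x) ∧ ∀ x, chartHom t false (ψ x) = x := by
  set S : CurveRing t := algebraMap K _ (1 / 2) * (r t ^ 2 - (2 * algebraMap K _ t + 1) + D t)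
    with hS
  set S' : CurveRing t := algebraMap K _ (1 / 2) * (r t ^ 2 - (2 * algebraMap K _ t + 1) - D t)
    with hS'
  have h2 : algebraMap K (CurveRing t) (1 / 2) * 2 = 1 := half_mul_two
  have hD := D_sq t
  simp only [map_mul, map_add, map_ofNat, map_one] at hD
  have hSS : S * S' = algebraMap K _ t * (algebraMap K _ t + 1) := by
    rw [hS, hS']
    linear_combination (-algebraMap K (CurveRing t) (1 / 2) ^ 2) * hD +
      algebraMap K _ t * (algebraMap K _ t + 1) *
        (algebraMap K (CurveRing t) (1 / 2) * 2 + 1) * h2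
  have hr : r t ^ 2 = S + S' + (2 * algebraMap K _ t + 1) := by
    rw [hS, hS']
    linear_combination (- r t ^ 2 + 2 * algebraMap K _ t + 1) * h2
  have hDS : D t = S - S' := by
    rw [hS, hS']
    linear_combination (-D t) * h2
  have hSu : IsUnit S := isUnit_of_dvd_unit ⟨S', hSS.symm⟩ (isUnit_b t _ h0 h1)
  let ψ₀ : Ring t →ₐ[K] CurveRing t := lift S (r t * S) (by
    simp only [map_mul, map_add, map_ofNat, map_one]
    linear_combination S ^ 2 * hr + S * hSS)
  have hs : ψ₀ (s t) = S := lift_s _ _ _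
  have hy : ψ₀ (y t) = r t * S := lift_y _ _ _
  let ψ := localLift false ψ₀ (by rw [coord, hs]; exact hSu)
  have hψ : ∀ x, ψ (algebraMap _ _ x) = ψ₀ x := localLift_algebraMap _ _ _
  have hinv : ψ.comp (chartHom t false) = AlgHom.id K _ := by
    refine CurveRing.algHom_ext ?_ ?_
    · have := congrArg ψ (chartHom_r_mul_s (t := t))
      rw [map_mul, hψ, hψ, hs, hy] at this
      exact hSu.mul_right_cancel this
    · have := congrArg ψ (chartHom_D_mul_s (t := t))
      rw [map_mul, hψ, hψ, hs, map_sub, map_pow, hs, AlgHom.commutes] at this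
      refine hSu.mul_right_cancel (this.trans ?_)
      simp only [map_mul, map_add, map_one, AlgHom.coe_id, id]
      rw [← hSS, hDS]
      ring
  have hinv2 : (chartHom t false).comp ψ = AlgHom.id K _ := by
    have hs2 : chartHom t false S = algebraMap _ _ (s t) := by
      have h3 := congrArg (chartHom t false) hr
      have h4 := congrArg (chartHom t false) hDS
      have e1 := chartHom_r_mul_s (t := t)
      have e2 := chartHom_D_mul_s (t := t)
      have e3 := congrArg (algebraMap _ (Local t false)) (y_sq t)
      have hu : IsUnit (algebraMap _ (Local t false) (s t)) :=
        .of_mul_eq_one _ (coord_mul_coordInv false)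
      simp only [map_mul, map_sub, map_add, map_pow, map_ofNat, map_one, AlgHom.commutes,
        g, ← IsScalarTower.algebraMap_apply] at h3 h4 e1 e2 e3 hu
      refine hu.mul_left_cancel (hu.mul_left_cancel ?_)
      have h2' : algebraMap K (Local t false) (1 / 2) * 2 = 1 := half_mul_two
      have two : chartHom t false S * 2 = chartHom t false (r t) ^ 2 -
          (2 * algebraMap K _ t + 1) + chartHom t false (D t) := by
        rw [h3, h4]; ring
      generalize chartHom t false S = x at *
      generalize chartHom t false (r t) = ρ at *
      generalize chartHom t false (D t) = δ at *
      generalize algebraMap (Ring t) (Local t false) (s t) = σ at *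
      generalize algebraMap (Ring t) (Local t false) (y t) = η at *
      generalize algebraMap K (Local t false) t = τ at *
      generalize algebraMap K (Local t false) (1 / 2) = h at *
      linear_combination (-σ ^ 2 * x + σ ^ 3) * h2' + h * σ ^ 2 * two + h * (ρ * σ + η) * e1 +
        h * σ * e2 + h * e3
    refine local_algHom_ext ?_ ?_
    · exact (congrArg (chartHom t false) ((hψ _).trans hs)).trans hs2
    · refine (congrArg (chartHom t false) ((hψ _).trans hy)).trans ?_
      rw [map_mul, hs2]
      exact chartHom_r_mul false
  exact ⟨ψ, AlgHom.congr_fun hinv, AlgHom.congr_fun hinv2⟩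

open CurveRing in
-- On the second chart `r² = s / g` and `D = (s² - b) / g`, where `b = t(t+1)`, so that `f = 1 -
-- (2t+1) r² - D` becomes `2 b / g`. Inverting `f` thus recovers `g = 2 b / f`, `s = r² g` and `y =
-- r g`. The only zero of `f` is `(r, D) = (0, 1)`, the point at infinity of the Weierstrass curve.
theorem exists_fromLocal_true (h0 : t ≠ 0) (h1 : t + 1 ≠ 0) :
    ∃ f : CurveRing t, ∃ e : Localization.Away f ≃ₐ[K] Local t true,
      ∀ x, e (algebraMap _ _ x) = chartHom t true x := by
  set f : CurveRing t := 1 - (2 * algebraMap K _ t + 1) * r t ^ 2 - D t with hf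
  let A := Localization.Away f
  let F : A := IsLocalization.Away.invSelf f
  have hF : algebraMap _ A f * F = 1 := IsLocalization.Away.mul_invSelf f
  have hFu : IsUnit F := IsUnit.of_mul_eq_one _ (by rw [mul_comm]; exact hF)
  have hfu : IsUnit (algebraMap _ A f) := .of_mul_eq_one _ hF
  have hb := isUnit_b t A h0 h1
  have hb' := isUnit_b t (Local t true) h0 h1
  have h2 : IsUnit (2 : A) := .of_mul_eq_one (algebraMap K A (1 / 2)) (by
    rw [mul_comm]; exact half_mul_two)
  have h2' : IsUnit (2 : Local t true) := .of_mul_eq_one (algebraMap K _ (1 / 2)) (by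
    rw [mul_comm]; exact half_mul_two)
  have hD := congrArg (algebraMap _ A) (D_sq t)
  have hF' : algebraMap _ A (1 - (2 * algebraMap K _ t + 1) * r t ^ 2 - D t) * F = 1 := hF
  simp only [map_mul, map_add, map_sub, map_pow, map_ofNat, map_one,
    ← IsScalarTower.algebraMap_apply] at hD hF'
  have hgS : (2 * (algebraMap K A t * (algebraMap K A t + 1)) * algebraMap _ A (r t) ^ 2 * F) ^ 2 +
      (2 * algebraMap K A t + 1) *
        (2 * (algebraMap K A t * (algebraMap K A t + 1)) * algebraMap _ A (r t) ^ 2 * F) +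
      algebraMap K A t * (algebraMap K A t + 1) =
        2 * (algebraMap K A t * (algebraMap K A t + 1)) * F := by
    generalize algebraMap _ A (r t) = ρ at *
    generalize algebraMap _ A (D t) = δ at *
    generalize algebraMap K A t = τ at *
    linear_combination τ * (τ + 1) * F ^ 2 * hD + τ * (τ + 1) * (-2 * (2 * τ + 1) * ρ ^ 2 * F -
      ((1 - (2 * τ + 1) * ρ ^ 2 - δ) * F + 1) + 2 * F) * hF'
  let ψ₀ : Ring t →ₐ[K] A :=
    lift (2 * (algebraMap K A t * (algebraMap K A t + 1)) * algebraMap _ A (r t) ^ 2 * F)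
    (2 * (algebraMap K A t * (algebraMap K A t + 1)) * algebraMap _ A (r t) * F) (by
      simp only [map_mul, map_add, map_ofNat, map_one]
      rw [hgS]
      ring)
  have hs : ψ₀ (s t) = _ := lift_s _ _ _
  have hy : ψ₀ (y t) = _ := lift_y _ _ _
  have hg : ψ₀ (g t) = 2 * (algebraMap K A t * (algebraMap K A t + 1)) * F := by
    rw [g, ← hgS]
    simp only [map_mul, map_add, map_ofNat, map_one, map_pow, AlgHom.commutes, hs]
  have hgu : IsUnit (ψ₀ (g t)) := by
    rw [hg]
    exact (h2.mul hb).mul hFu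
  let ψ := localLift true ψ₀ hgu
  have hψ : ∀ x, ψ (algebraMap _ _ x) = ψ₀ x := localLift_algebraMap _ _ _
  have hr2 : chartHom t true (r t) ^ 2 * algebraMap _ _ (g t) = algebraMap _ _ (s t) := by
    have hu : IsUnit (algebraMap _ (Local t true) (g t)) :=
      .of_mul_eq_one _ (coord_mul_coordInv true)
    have e3 := congrArg (algebraMap _ (Local t true)) (y_sq t)
    rw [map_pow, map_mul, ← chartHom_r_mul_g] at e3
    refine hu.mul_right_cancel ?_
    linear_combination e3
  have hφf : chartHom t true f * algebraMap _ (Local t true) (g t) =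
      2 * (algebraMap K _ t * (algebraMap K _ t + 1)) := by
    have e1 := chartHom_D_mul_g (t := t)
    have e2 : algebraMap _ (Local t true) (g t) = algebraMap _ _ (s t) ^ 2 +
        (2 * algebraMap K _ t + 1) * algebraMap _ _ (s t) +
          algebraMap K _ t * (algebraMap K _ t + 1) := by
      simp only [g, map_mul, map_add, map_ofNat, map_one, map_pow,
        ← IsScalarTower.algebraMap_apply]
    simp only [map_mul, map_add, map_sub, map_pow, map_one,
      ← IsScalarTower.algebraMap_apply] at e1
    rw [hf]
    simp only [map_mul, map_add, map_sub, map_ofNat, map_one, map_pow, AlgHom.commutes]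
    linear_combination e2 - (2 * algebraMap K _ t + 1) * hr2 - e1
  have hφfu : IsUnit (chartHom t true f) := by
    have h3 := h2'.mul hb'
    rw [← hφf] at h3
    exact isUnit_of_mul_isUnit_left h3
  let φ : A →ₐ[K] Local t true := IsLocalization.liftAlgHom (M := Submonoid.powers f)
    (f := chartHom t true) (by
      rintro ⟨_, n, rfl⟩
      rw [map_pow]
      exact hφfu.pow n)
  have hφ : ∀ x, φ (algebraMap _ _ x) = chartHom t true x := fun x => IsLocalization.lift_eq _ _
  have hφF : φ F * (2 * (algebraMap K _ t * (algebraMap K _ t + 1))) =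
      algebraMap _ (Local t true) (g t) := by
    have h3 := congrArg φ hF
    rw [map_mul, hφ, map_one] at h3
    linear_combination (- φ F) * hφf + algebraMap _ (Local t true) (g t) * h3
  have hinv : ψ.comp φ = AlgHom.id K _ := by
    have h3 : (ψ.comp φ).comp (IsScalarTower.toAlgHom K (CurveRing t) A) =
        (AlgHom.id K A).comp (IsScalarTower.toAlgHom K (CurveRing t) A) := by
      have e : ∀ x, (ψ.comp φ).comp (IsScalarTower.toAlgHom K (CurveRing t) A) x =
        ψ (chartHom t true x) := fun x => congrArg ψ (hφ x)
      refine CurveRing.algHom_ext ((e _).trans ?_) ((e _).trans ?_)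
      · have := congrArg ψ (chartHom_r_mul_g (t := t))
        rw [map_mul, hψ, hψ, hy] at this
        refine hgu.mul_right_cancel (this.trans ?_)
        rw [hg]
        exact by
          change _ = algebraMap _ A (r t) * _
          ring
      · have := congrArg ψ (chartHom_D_mul_g (t := t))
        rw [map_mul, hψ, hψ, map_sub, map_pow, hs, AlgHom.commutes] at this
        refine hgu.mul_right_cancel (this.trans ?_)
        change _ = algebraMap _ A (D t) * _
        rw [hg]
        simp only [map_mul, map_add, map_one]
        have key : ∀ ρ δ τ : A, δ ^ 2 = ρ ^ 4 - 2 * (2 * τ + 1) * ρ ^ 2 + 1 →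
            (1 - (2 * τ + 1) * ρ ^ 2 - δ) * F = 1 →
            (2 * (τ * (τ + 1)) * ρ ^ 2 * F) ^ 2 - τ * (τ + 1) = δ * (2 * (τ * (τ + 1)) * F) := by
          intro ρ δ τ h3 h4
          linear_combination τ * (τ + 1) * F ^ 2 * h3 + τ * (τ + 1) *
            (((1 - (2 * τ + 1) * ρ ^ 2 - δ) * F + 1) + 2 * δ * F) * h4
        exact key _ _ _ hD hF'
    have h4 : (ψ.comp φ : A →+* A) = RingHom.id A :=
      IsLocalization.ringHom_ext (Submonoid.powers f) (RingHom.ext fun x => AlgHom.congr_fun h3 x)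
    exact AlgHom.ext fun x => RingHom.congr_fun h4 x
  have hinv2 : φ.comp ψ = AlgHom.id K _ := by
    refine local_algHom_ext ?_ ?_
    · refine (congrArg φ ((hψ _).trans hs)).trans ?_
      change _ = algebraMap _ _ (s t)
      simp only [map_mul, map_add, map_one, map_ofNat, map_pow, AlgHom.commutes, hφ]
      linear_combination chartHom t true (r t) ^ 2 * hφF + hr2
    · refine (congrArg φ ((hψ _).trans hy)).trans ?_
      change _ = algebraMap _ _ (y t)
      simp only [map_mul, map_add, map_one, map_ofNat, AlgHom.commutes, hφ]
      have e := chartHom_r_mul_g (t := t)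
      linear_combination chartHom t true (r t) * hφF + e
  exact ⟨f, AlgEquiv.ofAlgHom φ ψ hinv2 hinv, hφ⟩

end

/-! ### The Weierstrass model as an open subscheme -/

section Embedding

variable (t) in
/-- The open subset where `coord t i` is invertible. -/
def opens (i : Bool) : Spec (.of (Local t i)) ⟶ Spec (.of (Ring t)) :=
  Spec.map (CommRingCat.ofHom (algebraMap (Ring t) (Local t i)))

instance (i : Bool) : IsOpenImmersion (opens t i) :=
  AlgebraicGeometry.IsOpenImmersion.of_isLocalization (coord t i)

theorem mem_range_opens {i : Bool} {x : PrimeSpectrum (Ring t)} :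
    x ∈ Set.range (opens t i) ↔ coord t i ∉ x.asIdeal := range_specMap_away _ x

theorem exists_mem_range_opens (h0 : t ≠ 0) (h1 : t + 1 ≠ 0) (x : PrimeSpectrum (Ring t)) :
    ∃ i, x ∈ Set.range (opens t i) := by
  by_contra! h
  have hs : s t ∈ x.asIdeal := by simpa [mem_range_opens, coord] using h false
  have hg : g t ∈ x.asIdeal := by simpa [mem_range_opens, coord] using h true
  have hb : algebraMap K (Ring t) (t * (t + 1)) ∈ x.asIdeal := by
    have : algebraMap K (Ring t) (t * (t + 1)) =
        g t - (s t + algebraMap K _ (2 * t + 1)) * s t := by rw [g]; ring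
    rw [this]
    exact sub_mem hg (Ideal.mul_mem_left _ _ hs)
  exact x.isPrime.ne_top (Ideal.eq_top_of_isUnit_mem _ hb
    ((IsUnit.mk0 (t * (t + 1)) (mul_ne_zero h0 h1)).map (algebraMap K (Ring t))))

theorem glued_chartHom {R : Type} [CommRing R] (α : Local t false →+* R) (β : Local t true →+* R)
    (h : α.comp (algebraMap (Ring t) _) = β.comp (algebraMap (Ring t) _)) :
    Curve.Glued false true (α.comp (chartHom t false : CurveRing t →+* Local t false))
      (β.comp (chartHom t true : CurveRing t →+* Local t true)) := by
  have hc : ∀ x, α (algebraMap _ _ x) = β (algebraMap _ _ x) := fun x => RingHom.congr_fun h x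
  have hus : IsUnit (β (algebraMap _ _ (s t))) := by
    rw [← hc]
    exact (IsUnit.of_mul_eq_one _ (coord_mul_coordInv (t := t) false)).map α
  have hug : IsUnit (β (algebraMap _ _ (g t))) :=
    (IsUnit.of_mul_eq_one _ (coord_mul_coordInv (t := t) true)).map β
  have e1 := congrArg α (chartHom_r_mul_s (t := t))
  have e2 := congrArg α (chartHom_D_mul_s (t := t))
  have e3 := congrArg β (chartHom_r_mul_g (t := t))
  have e4 := congrArg β (chartHom_D_mul_g (t := t))
  have e5 := congrArg (fun x => β (algebraMap _ _ x)) (y_sq t)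
  rw [map_mul, hc, hc] at e1 e2
  rw [map_mul] at e3 e4
  simp only [map_mul, map_pow] at e5
  refine ⟨?_, ?_⟩
  · rw [RingHom.comp_assoc, RingHom.comp_assoc, AlgHom.comp_algebraMap, AlgHom.comp_algebraMap]
    ext c
    simp only [RingHom.comp_apply]
    rw [IsScalarTower.algebraMap_apply K (Ring t) (Local t false),
      IsScalarTower.algebraMap_apply K (Ring t) (Local t true), hc]
  · rw [if_neg (by decide)]
    simp only [RingHom.comp_apply, RingHom.coe_coe]
    constructor
    · refine hus.mul_left_cancel (hug.mul_left_cancel ?_)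
      linear_combination e1 * β (chartHom t true (CurveRing.r t)) * β (algebraMap _ _ (g t)) +
        β (algebraMap _ _ (y t)) * e3 + e5
    · refine hus.mul_left_cancel (hug.mul_left_cancel (hug.mul_left_cancel ?_))
      linear_combination β (algebraMap _ _ (s t)) * β (algebraMap _ _ (g t)) * e4 -
        (β (chartHom t true (CurveRing.r t)) * β (algebraMap _ _ (g t))) ^ 2 * e2 -
        β (algebraMap (Ring t) (Local t true) (s t ^ 2 - algebraMap K _ (t * (t + 1)))) *
          (β (chartHom t true (CurveRing.r t)) * β (algebraMap _ _ (g t)) +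
            β (algebraMap _ _ (y t))) * e3 -
        β (algebraMap (Ring t) (Local t true) (s t ^ 2 - algebraMap K _ (t * (t + 1)))) * e5

theorem exists_embedding (h0 : t ≠ 0) (h1 : t + 1 ≠ 0) : ∃ j : Spec (.of (Ring t)) ⟶ Curve t,
    ∀ i, opens t i ≫ j = Spec.map (CommRingCat.ofHom (chartHom t i : CurveRing t →+* Local t i)) ≫
      Curve.chart t i := by
  have key : ∀ (R : CommRingCat.{0}) (α : CommRingCat.of (Local t false) ⟶ R)
      (β : CommRingCat.of (Local t true) ⟶ R),
      Spec.map α ≫ opens t false = Spec.map β ≫ opens t true →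
      Spec.map α ≫ Spec.map (CommRingCat.ofHom (chartHom t false : CurveRing t →+* Local t false)) ≫
        Curve.chart t false = Spec.map β ≫
        Spec.map (CommRingCat.ofHom (chartHom t true : CurveRing t →+* Local t true)) ≫
        Curve.chart t true := by
    intro R α β h
    rw [opens, opens, ← Spec.map_comp, ← Spec.map_comp] at h
    have h2 := congrArg CommRingCat.Hom.hom (Spec.map_injective h)
    have h3 := Curve.specMap_chart_eq_iff.2 (glued_chartHom α.hom β.hom h2)
    rw [CommRingCat.ofHom_comp, CommRingCat.ofHom_comp, Spec.map_comp, Spec.map_comp,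
      Category.assoc, Category.assoc] at h3
    exact h3
  refine exists_desc_of_affine (opens t) (exists_mem_range_opens h0 h1) _ fun i j R f g h => ?_
  obtain ⟨α, rfl⟩ := Spec.map_surjective f
  obtain ⟨β, rfl⟩ := Spec.map_surjective g
  cases i <;> cases j
  · rw [(cancel_mono _).1 h]
  · exact key R α β h
  · exact (key R β α h.symm).symm
  · rw [(cancel_mono _).1 h]

variable (t) in
/-- The Weierstrass model inside the curve. -/
def embedding (h0 : t ≠ 0) (h1 : t + 1 ≠ 0) : Spec (.of (Ring t)) ⟶ Curve t :=
  (exists_embedding h0 h1).choose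

variable {h0 : t ≠ 0} {h1 : t + 1 ≠ 0}

theorem opens_embedding (i : Bool) : opens t i ≫ embedding t h0 h1 =
    Spec.map (CommRingCat.ofHom (chartHom t i : CurveRing t →+* Local t i)) ≫ Curve.chart t i :=
  (exists_embedding h0 h1).choose_spec i

theorem isOpenImmersion_chartHom [CharZero K] (h0 : t ≠ 0) (h1 : t + 1 ≠ 0) (i : Bool) :
    IsOpenImmersion (Spec.map (CommRingCat.ofHom (chartHom t i : CurveRing t →+* Local t i))) := by
  cases i
  · obtain ⟨ψ, hψ, hψ'⟩ := exists_fromLocal_false h0 h1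
    let e : CurveRing t ≃+* Local t false :=
      RingEquiv.ofRingHom (chartHom t false : CurveRing t →+* Local t false) ψ
        (RingHom.ext hψ') (RingHom.ext hψ)
    have : IsIso (CommRingCat.ofHom (chartHom t false : CurveRing t →+* Local t false)) :=
      e.toCommRingCatIso.isIso_hom
    infer_instance
  · obtain ⟨f, e, he⟩ := exists_fromLocal_true h0 h1
    have h : (chartHom t true : CurveRing t →+* Local t true) =
        (e : Localization.Away f →+* Local t true).comp (algebraMap _ _) :=
      RingHom.ext fun x => (he x).symm
    have : IsIso (CommRingCat.ofHom (e : Localization.Away f →+* Local t true)) :=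
      e.toRingEquiv.toCommRingCatIso.isIso_hom
    have : IsOpenImmersion (Spec.map (CommRingCat.ofHom (algebraMap (CurveRing t)
      (Localization.Away f)))) := AlgebraicGeometry.IsOpenImmersion.of_isLocalization f
    rw [h, CommRingCat.ofHom_comp, Spec.map_comp]
    infer_instance

theorem embedding_isChart (i : Bool) : Chart (embedding t h0 h1) (opens t i) (Curve.chart t i)
    (Spec.map (CommRingCat.ofHom (chartHom t i : CurveRing t →+* Local t i))) := by
  refine ⟨inferInstance, inferInstance, opens_embedding i, ?_⟩
  intro x hx
  obtain ⟨j, z, rfl⟩ := exists_mem_range_opens h0 h1 x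
  by_cases hij : j = i
  · subst hij
    exact ⟨z, rfl⟩
  have hx' : Curve.chart t j (Spec.map (CommRingCat.ofHom
      (chartHom t j : CurveRing t →+* Local t j)) z) ∈ Set.range (Curve.chart t i) := by
    have := congrArg (fun f : Spec (.of (Local t j)) ⟶ Curve t => f z)
      (opens_embedding (h0 := h0) (h1 := h1) j)
    simp only [Scheme.Hom.comp_apply] at this
    rwa [← this]
  have hr : chartHom t j (CurveRing.r t) ∉ z.asIdeal :=
    Curve.notMem_of_chart_mem_range hij _ hx'
  refine mem_range_opens.2 fun hc => ?_
  have hc' : algebraMap (Ring t) (Local t j) (coord t i) ∈ z.asIdeal := hc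
  -- Here the two indices differ and the product is `s g = y²`. Since `y = r · coord t j` with
  -- `coord t j` invertible, a zero of `coord t i` would be a zero of `r`, which is excluded on the
  -- overlap of the charts.
  have hprod : coord t i * coord t j = y t ^ 2 := by
    rw [y_sq]
    cases i <;> cases j <;> simp_all [coord, mul_comm]
  have hy : algebraMap (Ring t) (Local t j) (y t) ∈ z.asIdeal := by
    refine z.isPrime.mem_of_pow_mem 2 ?_
    rw [← map_pow, ← hprod, map_mul]
    exact Ideal.mul_mem_right _ _ hc'
  rw [← chartHom_r_mul] at hy
  refine (z.isPrime.mem_or_mem hy).elim hr fun h => z.isPrime.ne_top ?_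
  exact Ideal.eq_top_of_isUnit_mem _ h (.of_mul_eq_one _ (coord_mul_coordInv j))

theorem isOpenImmersion_embedding [CharZero K] : IsOpenImmersion (embedding t h0 h1) :=
  Chart.property (P := @IsOpenImmersion) embedding_isChart (Curve.exists_mem_range_chart t)
    (isOpenImmersion_chartHom h0 h1)

theorem embedding_hom : embedding t h0 h1 ≫ Curve.hom t =
    Spec.map (CommRingCat.ofHom (algebraMap K (Ring t))) := by
  refine hom_ext_of_cover (opens t) (exists_mem_range_opens h0 h1) fun i => ?_
  rw [← Category.assoc, opens_embedding, Category.assoc, Curve.chart_hom, opens, ← Spec.map_comp,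
    ← Spec.map_comp, ← CommRingCat.ofHom_comp, ← CommRingCat.ofHom_comp, AlgHom.comp_algebraMap,
    ← IsScalarTower.algebraMap_eq]

/-- Neither of the two open pieces of the Weierstrass curve is empty; this is needed for density. -/
theorem nontrivial_local [CharZero K] (h0 : t ≠ 0) (h1 : t + 1 ≠ 0) (i : Bool) :
    Nontrivial (Local t i) := by
  obtain ⟨ψ, hψ, -⟩ := exists_fromLocal_false h0 h1
  have := CurveRing.isDomain t h0 h1
  have hr : CurveRing.r t ≠ 0 := fun h =>
    Polynomial.X_ne_zero (R := K) (CurveRing.aeval_r_injective (t := t) (by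
      rw [Polynomial.aeval_X, h, map_zero]))
  cases i
  · exact (ψ : Local t false →+* CurveRing t).domain_nontrivial
  · by_contra hsub
    rw [not_nontrivial_iff_subsingleton,
      IsLocalization.subsingleton_iff (M := Submonoid.powers (coord t true))] at hsub
    obtain ⟨n, hn⟩ := hsub
    have h2 := congrArg (fun x => ψ (algebraMap _ _ x)) hn
    simp only [map_pow, map_zero] at h2
    have h3 : ψ (algebraMap _ _ (y t)) ^ 2 = 0 := by
      rw [← map_pow, ← map_pow, y_sq, map_mul, map_mul]
      exact mul_eq_zero_of_right _ (eq_zero_of_pow_eq_zero h2)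
    have h4 := congrArg ψ (chartHom_r_mul_s (t := t))
    rw [map_mul, eq_zero_of_pow_eq_zero h3, hψ] at h4
    have h5 : IsUnit (ψ (algebraMap _ _ (s t))) :=
      (IsUnit.of_mul_eq_one _ (coord_mul_coordInv (t := t) false)).map ψ
    exact hr ((h5.mul_left_eq_zero).1 h4)

/-- Each chart of the curve is irreducible, and the embedded curve meets it in a nonempty open set.
-/
theorem isDominant_embedding [CharZero K] : IsDominant (embedding t h0 h1) := by
  have := CurveRing.isDomain t h0 h1
  refine ⟨dense_iff_inter_open.2 fun U hU ⟨x, hx⟩ => ?_⟩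
  obtain ⟨i, z, rfl⟩ := Curve.exists_mem_range_chart t x
  have := nontrivial_local h0 h1 i
  have := isOpenImmersion_chartHom h0 h1 i
  have hV : IsOpen (Set.range (Spec.map (CommRingCat.ofHom
      (chartHom t i : CurveRing t →+* Local t i)))) := (Scheme.Hom.isOpenEmbedding _).isOpen_range
  have : IrreducibleSpace (Spec (.of (CurveRing t))) :=
    inferInstanceAs (IrreducibleSpace (PrimeSpectrum (CurveRing t)))
  obtain ⟨w, hw1, v, rfl⟩ := nonempty_preirreducible_inter
    (X := Spec (.of (CurveRing t))) (hU.preimage (Curve.chart t i).continuous) hV ⟨z, hx⟩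
    (Set.range_nonempty (ι := PrimeSpectrum (Local t i)) _)
  refine ⟨_, hw1, opens t i v, ?_⟩
  exact congrArg (fun f : Spec (.of (Local t i)) ⟶ Curve t => f v) (opens_embedding i)

theorem isEllipticCurve [CharZero K] :
    IsEllipticCurve (legendre t) (Curve.hom t) (embedding t h0 h1) :=
  ⟨isElliptic h0 h1, Curve.smooth_hom h0 h1, inferInstance, isOpenImmersion_embedding,
    isDominant_embedding, embedding_hom⟩

/-! ### Translation by the point `(t, 0)` -/

theorem specMap_embedding (γ : Ring t →+* K) (hγ : γ.comp (algebraMap K _) = RingHom.id K)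
    (hs : γ (s t) ≠ 0) : ∃ α : CurveRing t →+* K,
      Spec.map (CommRingCat.ofHom γ) ≫ embedding t h0 h1 =
        Spec.map (CommRingCat.ofHom α) ≫ Curve.chart t false ∧
      α.comp (algebraMap K _) = RingHom.id K ∧ α (CurveRing.r t) = γ (y t) / γ (s t) ∧
      α (CurveRing.D t) = γ (s t) - t * (t + 1) / γ (s t) := by
  let δ : Local t false →+* K := IsLocalization.Away.lift (coord t false) (g := γ) hs.isUnit
  have hδ : δ.comp (algebraMap (Ring t) _) = γ := IsLocalization.Away.lift_comp _ _
  have hδ' : ∀ x, δ (algebraMap _ _ x) = γ x := fun x => RingHom.congr_fun hδ x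
  refine ⟨δ.comp (chartHom t false : CurveRing t →+* Local t false), ?_, ?_, ?_, ?_⟩
  · rw [CommRingCat.ofHom_comp, Spec.map_comp, Category.assoc, ← opens_embedding, opens,
      ← Category.assoc, ← Spec.map_comp, ← CommRingCat.ofHom_comp, hδ]
  · rw [RingHom.comp_assoc, AlgHom.comp_algebraMap, IsScalarTower.algebraMap_eq K (Ring t),
      ← RingHom.comp_assoc, hδ, hγ]
  · have := congrArg δ (chartHom_r_mul_s (t := t))
    rw [map_mul, hδ', hδ'] at this
    exact eq_div_of_mul_eq hs this
  · have := congrArg δ (chartHom_D_mul_s (t := t))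
    have hc : ∀ c, γ (algebraMap K _ c) = c := fun c => RingHom.congr_fun hγ c
    rw [map_mul, hδ', hδ', map_sub, map_pow, hc] at this
    change δ (chartHom t false (CurveRing.D t)) = _
    field_simp
    linear_combination this

theorem equation_iff {x y : K} : (legendre t).toAffine.Equation x y ↔
    y ^ 2 = x * (x + 1) * (x - t) := by
  rw [WeierstrassCurve.Affine.equation_iff]
  simp only [legendre, WeierstrassCurve.toAffine]
  constructor <;> intro h <;> linear_combination h

theorem affineEval_s (x y : K) (h) : affineEval (legendre t) x y h (s t) = x - t := by
  rw [s, map_sub]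
  congr 1
  · exact (AdjoinRoot.lift_of _).trans Polynomial.eval_X
  · exact (AdjoinRoot.lift_of (x := Polynomial.C t) _).trans Polynomial.eval_C

theorem affineEval_y (x y₀ : K) (h) : affineEval (legendre t) x y₀ h (y t) = y₀ :=
  AdjoinRoot.lift_root _

theorem affineEval_comp (x y : K) (h) :
    (affineEval (legendre t) x y h).comp (algebraMap K (Ring t)) = RingHom.id K := by
  refine RingHom.ext fun c => ?_
  have e : affineEval (legendre t) x y h (algebraMap K (Ring t) c) = c :=
    (AdjoinRoot.lift_of (x := Polynomial.C c) _).trans Polynomial.eval_C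
  exact e

theorem isTranslation_id : IsTranslation (legendre t) (embedding t h0 h1) (𝟙 _) := by
  classical
  refine ⟨0, fun x y h x' y' h' hP => ?_⟩
  have hP' := (add_zero _).symm.trans hP
  rw [WeierstrassCurve.Affine.Point.some.injEq] at hP'
  obtain ⟨rfl, rfl⟩ := hP'
  exact Category.comp_id _

/-- The chord through `(x, y)` and `(t, 0)` sends `s = x - t` to `b / s` and `y` to `-b y / s²`,
with `b = t(t+1)`. Therefore `r = y / s` and `D = s - b / s` both change sign. -/
theorem isTranslation_sgn [CharZero K] : IsTranslation (legendre t) (embedding t h0 h1)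
    (Curve.sgn t (-1) (-1)) := by
  classical
  have hell := isElliptic h0 h1
  have hT : (legendre t).toAffine.Nonsingular t 0 :=
    WeierstrassCurve.Affine.equation_iff_nonsingular.1 (equation_iff.2 (by ring))
  refine ⟨.some t 0 hT, fun x y h x' y' h' hP => ?_⟩
  have hxy := equation_iff.1 h.1
  -- In the case `x = t` the point is the 2-torsion point itself, and its double is not affine, so
  -- there is nothing to compare.
  by_cases hx : x = t
  · subst hx
    have hy : y = 0 := by simpa using hxy
    subst hy
    rw [WeierstrassCurve.Affine.Point.add_self_of_Y_eq (by simp [legendre,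
      WeierstrassCurve.Affine.negY, WeierstrassCurve.toAffine])] at hP
    exact absurd hP (WeierstrassCurve.Affine.Point.some_ne_zero _).symm
  have hx' := sub_ne_zero.2 hx
  rw [WeierstrassCurve.Affine.Point.add_of_X_ne hx,
    WeierstrassCurve.Affine.Point.some.injEq] at hP
  obtain ⟨hX, hY⟩ := hP
  rw [WeierstrassCurve.Affine.slope_of_X_ne hx] at hX hY
  have hX' : x' - t = t * (t + 1) / (x - t) := by
    rw [← hX]
    simp only [WeierstrassCurve.Affine.addX, legendre, WeierstrassCurve.toAffine]
    field_simp
    linear_combination hxy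
  have hY' : y' = - (t * (t + 1)) * y / (x - t) ^ 2 := by
    rw [← hY, WeierstrassCurve.Affine.addY, hX, WeierstrassCurve.Affine.negAddY, hX]
    simp only [WeierstrassCurve.Affine.negY, legendre, WeierstrassCurve.toAffine]
    rw [show x' = t + t * (t + 1) / (x - t) by rw [← hX']; ring]
    field_simp
    ring
  have hb : t * (t + 1) ≠ 0 := mul_ne_zero h0 h1
  obtain ⟨α, e1, hα, hαr, hαD⟩ := specMap_embedding (h0 := h0) (h1 := h1)
    (affineEval (legendre t) x y h.1) (affineEval_comp _ _ _) (by rwa [affineEval_s])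
  obtain ⟨β, e2, hβ, hβr, hβD⟩ := specMap_embedding (h0 := h0) (h1 := h1)
    (affineEval (legendre t) x' y' h'.1) (affineEval_comp _ _ _) (by
      rw [affineEval_s, hX']
      exact div_ne_zero hb hx')
  rw [affineEval_s, affineEval_y] at hαr hβr
  rw [affineEval_s] at hαD hβD
  rw [affinePoint, affinePoint]
  refine (congrArg (· ≫ Curve.sgn t (-1) (-1)) e1).trans (Eq.trans ?_ e2.symm)
  rw [Category.assoc, Curve.chart_sgn, ← Category.assoc, ← Spec.map_comp, ← CommRingCat.ofHom_comp,
    Curve.specMap_chart_eq_iff]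
  refine ⟨?_, ?_⟩
  · rw [RingHom.comp_assoc, AlgHom.comp_algebraMap, hα, hβ]
  · rw [if_pos rfl]
    simp only [RingHom.comp_apply, RingHom.coe_coe, CurveRing.sgnHom_r, CurveRing.sgnHom_D,
      map_mul, Units.val_neg, Units.val_one, Int.cast_neg, Int.cast_one, map_neg, map_one, hαr, hαD,
      hβr, hβD, hX', hY']
    constructor
    · field_simp
    · field_simp
      ring

end Embedding

end legendre

end

/-! ### The product of the curve with itself -/

section

open scoped TensorProduct

section ProductRing

variable {K : Type} [Field K] (t : K)

/-- The coordinate ring of the affine charts of the product of the curve with itself. -/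
abbrev ProdRing := CurveRing t ⊗[K] CurveRing t

namespace ProdRing

/-- The first coordinate ring. -/
def inl : CurveRing t →ₐ[K] ProdRing t := Algebra.TensorProduct.includeLeft

/-- The second coordinate ring. -/
def inr : CurveRing t →ₐ[K] ProdRing t := Algebra.TensorProduct.includeRight

variable {t}

variable {R : Type} [CommRing R]

theorem algHom_ext [Algebra K R] {f g : ProdRing t →ₐ[K] R} (h1 : f.comp (inl t) = g.comp (inl t))
    (h2 : f.comp (inr t) = g.comp (inr t)) : f = g :=
  Algebra.TensorProduct.ext h1 h2

theorem ringHom_ext {f g : ProdRing t →+* R}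
    (h1 : f.comp (inl t : CurveRing t →+* ProdRing t) = g.comp (inl t : CurveRing t →+* ProdRing t))
    (h2 : f.comp (inr t : CurveRing t →+* ProdRing t) =
      g.comp (inr t : CurveRing t →+* ProdRing t)) : f = g :=
  RingHom.ext fun x => by
    induction x using TensorProduct.induction_on with
    | zero => rw [map_zero, map_zero]
    | add x y hx hy => rw [map_add, map_add, hx, hy]
    | tmul a b =>
      rw [← mul_one a, ← one_mul b, ← Algebra.TensorProduct.tmul_mul_tmul, map_mul, map_mul]
      exact congrArg₂ (· * ·) (RingHom.congr_fun h1 a) (RingHom.congr_fun h2 b)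

variable (t) in
theorem adjoin_eq_top : Algebra.adjoin K {inl t (CurveRing.r t), inl t (CurveRing.D t),
    inr t (CurveRing.r t), inr t (CurveRing.D t)} = ⊤ := by
  set B := Algebra.adjoin K {inl t (CurveRing.r t), inl t (CurveRing.D t),
    inr t (CurveRing.r t), inr t (CurveRing.D t)}
  have h1 : ∀ a, inl t a ∈ B := by
    intro a
    have ha : a ∈ Algebra.adjoin K {CurveRing.r t, CurveRing.D t} := by
      rw [CurveRing.adjoin_eq_top]; trivial
    have : inl t a ∈ Subalgebra.map (inl t) _ := Subalgebra.mem_map.2 ⟨a, ha, rfl⟩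
    rw [AlgHom.map_adjoin] at this
    refine Algebra.adjoin_mono ?_ this
    rintro _ ⟨x, rfl | rfl, rfl⟩ <;> simp
  have h2 : ∀ a, inr t a ∈ B := by
    intro a
    have ha : a ∈ Algebra.adjoin K {CurveRing.r t, CurveRing.D t} := by
      rw [CurveRing.adjoin_eq_top]; trivial
    have : inr t a ∈ Subalgebra.map (inr t) _ := Subalgebra.mem_map.2 ⟨a, ha, rfl⟩
    rw [AlgHom.map_adjoin] at this
    refine Algebra.adjoin_mono ?_ this
    rintro _ ⟨x, rfl | rfl, rfl⟩ <;> simp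
  rw [eq_top_iff]
  intro x _
  induction x using TensorProduct.induction_on with
  | zero => exact zero_mem _
  | add x y hx hy => exact add_mem (hx trivial) (hy trivial)
  | tmul a b =>
    rw [← mul_one a, ← one_mul b, ← Algebra.TensorProduct.tmul_mul_tmul]
    exact mul_mem (h1 a) (h2 b)

/-- The involution of the product. -/
def sigma (t : K) : ProdRing t →ₐ[K] ProdRing t :=
  Algebra.TensorProduct.map (CurveRing.sgnHom t (-1) (-1)) (CurveRing.sgnHom t 1 (-1))

theorem sigma_inl (a : CurveRing t) : sigma t (inl t a) = inl t (CurveRing.sgnHom t (-1) (-1) a) := by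
  simp [sigma, inl]

theorem sigma_inr (a : CurveRing t) : sigma t (inr t a) = inr t (CurveRing.sgnHom t 1 (-1) a) := by
  simp [sigma, inr]

end ProdRing

end ProductRing

section Product

open Curve

variable {K : Type} [Field K] (t : K)

/-- The product of the curve with itself. -/
abbrev Sq : Scheme.{0} := pullback (hom t) (hom t)

namespace Sq

/-- The affine charts of the product. -/
def chart (p : Bool × Bool) : Spec (.of (ProdRing t)) ⟶ Sq t :=
  (pullbackSpecIso K (CurveRing t) (CurveRing t)).inv ≫
    pullback.map _ _ (hom t) (hom t) (Curve.chart t p.1) (Curve.chart t p.2) (𝟙 _)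
      (by rw [Category.comp_id, chart_hom]) (by rw [Category.comp_id, chart_hom])

instance (p : Bool × Bool) : IsOpenImmersion (chart t p) := by
  have : IsOpenImmersion (pullback.map
      (Spec.map (CommRingCat.ofHom (algebraMap K (CurveRing t))))
      (Spec.map (CommRingCat.ofHom (algebraMap K (CurveRing t)))) (hom t) (hom t)
      (Curve.chart t p.1) (Curve.chart t p.2) (𝟙 _)
      (by rw [Category.comp_id, chart_hom]) (by rw [Category.comp_id, chart_hom])) :=
    MorphismProperty.pullbackMap (P := @IsOpenImmersion) inferInstance inferInstance
      (chart_hom p.1).symm (chart_hom p.2).symm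
  rw [chart]
  infer_instance

variable {t}

theorem chart_fst (p : Bool × Bool) : chart t p ≫ pullback.fst _ _ =
    Spec.map (CommRingCat.ofHom (ProdRing.inl t : CurveRing t →+* ProdRing t)) ≫
      Curve.chart t p.1 := by
  rw [chart, Category.assoc, pullback.map, pullback.lift_fst, pullbackSpecIso_inv_fst_assoc]
  rfl

theorem chart_snd (p : Bool × Bool) : chart t p ≫ pullback.snd _ _ =
    Spec.map (CommRingCat.ofHom (ProdRing.inr t : CurveRing t →+* ProdRing t)) ≫
      Curve.chart t p.2 := by
  rw [chart, Category.assoc, pullback.map, pullback.lift_snd, pullbackSpecIso_inv_snd_assoc]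
  rfl

theorem mem_range_chart_iff {p : Bool × Bool} (x : Sq t) : x ∈ Set.range (chart t p) ↔
    pullback.fst (hom t) (hom t) x ∈ Set.range (Curve.chart t p.1) ∧
      pullback.snd (hom t) (hom t) x ∈ Set.range (Curve.chart t p.2) := by
  have h : Set.range (chart t p) = Set.range (pullback.map
      (Spec.map (CommRingCat.ofHom (algebraMap K (CurveRing t))))
      (Spec.map (CommRingCat.ofHom (algebraMap K (CurveRing t)))) (hom t) (hom t)
      (Curve.chart t p.1) (Curve.chart t p.2) (𝟙 _)
      (by rw [Category.comp_id, Curve.chart_hom]) (by rw [Category.comp_id, Curve.chart_hom])) := by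
    rw [chart, Scheme.Hom.comp_base]
    exact Function.Surjective.range_comp
      (Scheme.homeoOfIso (pullbackSpecIso K (CurveRing t) (CurveRing t)).symm).surjective _
  rw [h, Scheme.Pullback.range_map]
  rfl

theorem exists_mem_range_chart (x : Sq t) : ∃ p, x ∈ Set.range (chart t p) := by
  obtain ⟨i, hi⟩ := Curve.exists_mem_range_chart t (pullback.fst (hom t) (hom t) x)
  obtain ⟨j, hj⟩ := Curve.exists_mem_range_chart t (pullback.snd (hom t) (hom t) x)
  exact ⟨(i, j), (mem_range_chart_iff x).2 ⟨hi, hj⟩⟩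

theorem chart_mem_range_of {p p' : Bool × Bool} (x : PrimeSpectrum (ProdRing t))
    (h1 : p.1 = p'.1 ∨ ProdRing.inl t (CurveRing.r t) ∉ x.asIdeal)
    (h2 : p.2 = p'.2 ∨ ProdRing.inr t (CurveRing.r t) ∉ x.asIdeal) :
    chart t p x ∈ Set.range (chart t p') := by
  rw [mem_range_chart_iff]
  constructor
  · have e := congrArg (fun f : Spec (.of (ProdRing t)) ⟶ Curve t => f x) (chart_fst p)
    exact e ▸ Curve.chart_mem_range (i := p.1) (j := p'.1)
      (PrimeSpectrum.comap (ProdRing.inl t : CurveRing t →+* ProdRing t) x) h1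
  · have e := congrArg (fun f : Spec (.of (ProdRing t)) ⟶ Curve t => f x) (chart_snd p)
    exact e ▸ Curve.chart_mem_range (i := p.2) (j := p'.2)
      (PrimeSpectrum.comap (ProdRing.inr t : CurveRing t →+* ProdRing t) x) h2

theorem specMap_chart_eq_iff {R : Type} [CommRing R] {p p' : Bool × Bool}
    {γ γ' : ProdRing t →+* R} :
    Spec.map (CommRingCat.ofHom γ) ≫ chart t p = Spec.map (CommRingCat.ofHom γ') ≫ chart t p' ↔
      Glued p.1 p'.1 (γ.comp (ProdRing.inl t : CurveRing t →+* ProdRing t))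
        (γ'.comp (ProdRing.inl t : CurveRing t →+* ProdRing t)) ∧
      Glued p.2 p'.2 (γ.comp (ProdRing.inr t : CurveRing t →+* ProdRing t))
        (γ'.comp (ProdRing.inr t : CurveRing t →+* ProdRing t)) := by
  rw [← Curve.specMap_chart_eq_iff, ← Curve.specMap_chart_eq_iff, CommRingCat.ofHom_comp,
    CommRingCat.ofHom_comp, CommRingCat.ofHom_comp, CommRingCat.ofHom_comp, Spec.map_comp,
    Spec.map_comp, Spec.map_comp, Spec.map_comp, Category.assoc, Category.assoc, Category.assoc,
    Category.assoc, ← chart_fst, ← chart_fst, ← chart_snd, ← chart_snd]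
  constructor
  · intro h
    exact ⟨by rw [← Category.assoc, h, Category.assoc], by rw [← Category.assoc, h, Category.assoc]⟩
  · rintro ⟨h1, h2⟩
    refine pullback.hom_ext ?_ ?_
    · rw [Category.assoc, h1, Category.assoc]
    · rw [Category.assoc, h2, Category.assoc]

theorem hom_ext {Y : Scheme.{0}} {f g : Sq t ⟶ Y} (h : ∀ p, chart t p ≫ f = chart t p ≫ g) :
    f = g := hom_ext_of_cover (chart t) exists_mem_range_chart h

theorem exists_desc {Y : Scheme.{0}} (F : Bool × Bool → (Spec (.of (ProdRing t)) ⟶ Y))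
    (hF : ∀ p p' (R : Type) [CommRing R] (γ γ' : ProdRing t →+* R),
      Glued p.1 p'.1 (γ.comp (ProdRing.inl t : CurveRing t →+* ProdRing t))
        (γ'.comp (ProdRing.inl t : CurveRing t →+* ProdRing t)) →
      Glued p.2 p'.2 (γ.comp (ProdRing.inr t : CurveRing t →+* ProdRing t))
        (γ'.comp (ProdRing.inr t : CurveRing t →+* ProdRing t)) →
      Spec.map (CommRingCat.ofHom γ) ≫ F p = Spec.map (CommRingCat.ofHom γ') ≫ F p') :
    ∃ k : Sq t ⟶ Y, ∀ p, chart t p ≫ k = F p := by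
  refine exists_desc_of_affine (chart t) exists_mem_range_chart F fun i j R f g h => ?_
  obtain ⟨α, rfl⟩ := Spec.map_surjective f
  obtain ⟨β, rfl⟩ := Spec.map_surjective g
  have h2 := specMap_chart_eq_iff (γ := α.hom) (γ' := β.hom).1 h
  exact hF i j R α.hom β.hom h2.1 h2.2

theorem chart_hom (p : Bool × Bool) : chart t p ≫ pullback.fst _ _ ≫ hom t =
    Spec.map (CommRingCat.ofHom (algebraMap K (ProdRing t))) := by
  rw [reassoc_of% chart_fst, Curve.chart_hom, ← Spec.map_comp, ← CommRingCat.ofHom_comp,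
    AlgHom.comp_algebraMap]

theorem chart_prodEnd {α β : Over.mk (hom t) ⟶ Over.mk (hom t)} (hα : α.left = Curve.sgn t (-1) (-1))
    (hβ : β.left = Curve.sgn t 1 (-1)) (p : Bool × Bool) : chart t p ≫ prodEnd α β =
      Spec.map (CommRingCat.ofHom (ProdRing.sigma t : ProdRing t →+* ProdRing t)) ≫ chart t p := by
  have h1 : prodEnd α β ≫ pullback.fst _ _ = pullback.fst _ _ ≫ Curve.sgn t (-1) (-1) := by
    rw [← hα]; exact pullback.lift_fst _ _ _
  have h2 : prodEnd α β ≫ pullback.snd _ _ = pullback.snd _ _ ≫ Curve.sgn t 1 (-1) := by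
    rw [← hβ]; exact pullback.lift_snd _ _ _
  refine pullback.hom_ext ?_ ?_
  · rw [Category.assoc, h1, reassoc_of% chart_fst, chart_sgn, Category.assoc, chart_fst,
      ← Category.assoc, ← Category.assoc, ← Spec.map_comp, ← Spec.map_comp,
      ← CommRingCat.ofHom_comp, ← CommRingCat.ofHom_comp]
    congr 3
    exact RingHom.ext fun x => (ProdRing.sigma_inl x).symm
  · rw [Category.assoc, h2, reassoc_of% chart_snd, chart_sgn, Category.assoc, chart_snd,
      ← Category.assoc, ← Category.assoc, ← Spec.map_comp, ← Spec.map_comp,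
      ← CommRingCat.ofHom_comp, ← CommRingCat.ofHom_comp]
    congr 3
    exact RingHom.ext fun x => (ProdRing.sigma_inr x).symm

end Sq

end Product

end

/-! ### The ring of invariants of the involution -/

section

open scoped TensorProduct

section Invariants

variable {K : Type} [Field K] {t : K}

namespace ProdRing

open CurveRing

variable (t) in
/-- The subalgebra generated by the invariants `r₁², r₁D₁, r₂, r₁D₂, D₁D₂`. -/
def invariants : Subalgebra K (ProdRing t) :=
  Algebra.adjoin K {inl t (r t) ^ 2, inl t (r t) * inl t (D t), inr t (r t),
    inl t (r t) * inr t (D t), inl t (D t) * inr t (D t)}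

theorem inl_D_sq : inl t (D t) ^ 2 = inl t (r t) ^ 4 -
    algebraMap K _ (2 * (2 * t + 1)) * inl t (r t) ^ 2 + 1 := by
  rw [← map_pow, D_sq, map_add, map_sub, map_mul, map_one, AlgHom.commutes, map_pow, map_pow]

theorem inr_D_sq : inr t (D t) ^ 2 = inr t (r t) ^ 4 -
    algebraMap K _ (2 * (2 * t + 1)) * inr t (r t) ^ 2 + 1 := by
  rw [← map_pow, D_sq, map_add, map_sub, map_mul, map_one, AlgHom.commutes, map_pow, map_pow]

theorem sigma_r₁ : sigma t (inl t (r t)) = -inl t (r t) := by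
  rw [sigma_inl, sgnHom_r]; simp

theorem sigma_D₁ : sigma t (inl t (D t)) = -inl t (D t) := by
  rw [sigma_inl, sgnHom_D]; simp

theorem sigma_r₂ : sigma t (inr t (r t)) = inr t (r t) := by
  rw [sigma_inr, sgnHom_r]; simp

theorem sigma_D₂ : sigma t (inr t (D t)) = -inr t (D t) := by
  rw [sigma_inr, sgnHom_D]; simp

theorem sigma_of_mem {a : ProdRing t} (ha : a ∈ invariants t) : sigma t a = a := by
  have h : invariants t ≤ AlgHom.equalizer (sigma t) (AlgHom.id K _) := by
    rw [invariants, Algebra.adjoin_le_iff]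
    rintro x (rfl | rfl | rfl | rfl | rfl) <;>
      simp [sigma_r₁, sigma_D₁, sigma_r₂, sigma_D₂] <;> ring
  exact h ha

theorem r₁_sq_mem : inl t (r t) ^ 2 ∈ invariants t := Algebra.subset_adjoin (by simp)

theorem r₁_D₁_mem : inl t (r t) * inl t (D t) ∈ invariants t := Algebra.subset_adjoin (by simp)

theorem r₂_mem : inr t (r t) ∈ invariants t := Algebra.subset_adjoin (by simp)

theorem r₁_D₂_mem : inl t (r t) * inr t (D t) ∈ invariants t := Algebra.subset_adjoin (by simp)

theorem D₁_D₂_mem : inl t (D t) * inr t (D t) ∈ invariants t := Algebra.subset_adjoin (by simp)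

theorem D₁_sq_mem : inl t (D t) ^ 2 ∈ invariants t := by
  rw [inl_D_sq, show inl t (r t) ^ 4 = (inl t (r t) ^ 2) ^ 2 by ring]
  exact add_mem (sub_mem (pow_mem r₁_sq_mem 2) (mul_mem (algebraMap_mem _ _) r₁_sq_mem))
    (one_mem _)

theorem D₂_sq_mem : inr t (D t) ^ 2 ∈ invariants t := by
  rw [inr_D_sq]
  exact add_mem (sub_mem (pow_mem r₂_mem 4) (mul_mem (algebraMap_mem _ _) (pow_mem r₂_mem 2)))
    (one_mem _)

/-- Every function decomposes into an invariant and an anti-invariant part. -/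
theorem exists_decomposition (a : ProdRing t) : ∃ b₀ ∈ invariants t, ∃ b₁ ∈ invariants t,
    ∃ b₂ ∈ invariants t, ∃ b₃ ∈ invariants t,
      a = b₀ + b₁ * inl t (r t) + b₂ * inl t (D t) + b₃ * inr t (D t) := by
  have ha : a ∈ Algebra.adjoin K {inl t (r t), inl t (D t), inr t (r t), inr t (D t)} := by
    rw [adjoin_eq_top]; trivial
  induction ha using Algebra.adjoin_induction with
  | mem x hx =>
    rcases hx with rfl | rfl | rfl | rfl
    · exact ⟨0, zero_mem _, 1, one_mem _, 0, zero_mem _, 0, zero_mem _, by ring⟩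
    · exact ⟨0, zero_mem _, 0, zero_mem _, 1, one_mem _, 0, zero_mem _, by ring⟩
    · exact ⟨_, r₂_mem, 0, zero_mem _, 0, zero_mem _, 0, zero_mem _, by ring⟩
    · exact ⟨0, zero_mem _, 0, zero_mem _, 0, zero_mem _, 1, one_mem _, by ring⟩
  | algebraMap c =>
    exact ⟨_, algebraMap_mem _ c, 0, zero_mem _, 0, zero_mem _, 0, zero_mem _, by ring⟩
  | add x y _ _ hx hy =>
    obtain ⟨b₀, h₀, b₁, h₁, b₂, h₂, b₃, h₃, rfl⟩ := hx
    obtain ⟨c₀, k₀, c₁, k₁, c₂, k₂, c₃, k₃, rfl⟩ := hy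
    exact ⟨_, add_mem h₀ k₀, _, add_mem h₁ k₁, _, add_mem h₂ k₂, _, add_mem h₃ k₃, by ring⟩
  | mul x y _ _ hx hy =>
    obtain ⟨b₀, h₀, b₁, h₁, b₂, h₂, b₃, h₃, rfl⟩ := hx
    obtain ⟨c₀, k₀, c₁, k₁, c₂, k₂, c₃, k₃, rfl⟩ := hy
    refine ⟨b₀ * c₀ + b₁ * c₁ * inl t (r t) ^ 2 + b₂ * c₂ * inl t (D t) ^ 2 +
      b₃ * c₃ * inr t (D t) ^ 2 + (b₁ * c₂ + b₂ * c₁) * (inl t (r t) * inl t (D t)) +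
      (b₁ * c₃ + b₃ * c₁) * (inl t (r t) * inr t (D t)) +
      (b₂ * c₃ + b₃ * c₂) * (inl t (D t) * inr t (D t)), ?_,
      b₀ * c₁ + b₁ * c₀, ?_, b₀ * c₂ + b₂ * c₀, ?_, b₀ * c₃ + b₃ * c₀, ?_, by ring⟩
    · exact add_mem (add_mem (add_mem (add_mem (add_mem (add_mem (mul_mem h₀ k₀)
        (mul_mem (mul_mem h₁ k₁) r₁_sq_mem)) (mul_mem (mul_mem h₂ k₂) D₁_sq_mem))
        (mul_mem (mul_mem h₃ k₃) D₂_sq_mem))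
        (mul_mem (add_mem (mul_mem h₁ k₂) (mul_mem h₂ k₁)) r₁_D₁_mem))
        (mul_mem (add_mem (mul_mem h₁ k₃) (mul_mem h₃ k₁)) r₁_D₂_mem))
        (mul_mem (add_mem (mul_mem h₂ k₃) (mul_mem h₃ k₂)) D₁_D₂_mem)
    · exact add_mem (mul_mem h₀ k₁) (mul_mem h₁ k₀)
    · exact add_mem (mul_mem h₀ k₂) (mul_mem h₂ k₀)
    · exact add_mem (mul_mem h₀ k₃) (mul_mem h₃ k₀)

/-- The involution fixes the invariant coefficients and negates `r₁`, `D₁`, `D₂`, so for a fixed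
element twice the anti-invariant part vanishes. -/
theorem mem_invariants_iff [CharZero K] {a : ProdRing t} : a ∈ invariants t ↔ sigma t a = a := by
  refine ⟨sigma_of_mem, fun ha => ?_⟩
  obtain ⟨b₀, h₀, b₁, h₁, b₂, h₂, b₃, h₃, rfl⟩ := exists_decomposition a
  rw [map_add, map_add, map_add, map_mul, map_mul, map_mul, sigma_of_mem h₀, sigma_of_mem h₁,
    sigma_of_mem h₂, sigma_of_mem h₃, sigma_r₁, sigma_D₁, sigma_D₂] at ha
  have h2 : algebraMap K (ProdRing t) 2 * (b₁ * inl t (r t) + b₂ * inl t (D t) +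
      b₃ * inr t (D t)) = 0 := by
    rw [map_ofNat]
    linear_combination (-1 : ProdRing t) * ha
  have h3 : IsUnit (algebraMap K (ProdRing t) 2) := (IsUnit.mk0 (2 : K) two_ne_zero).map _
  have h4 := (h3.mul_right_eq_zero).1 h2
  rw [add_assoc, add_assoc, ← add_assoc (b₁ * _), h4, add_zero]
  exact h₀

end ProdRing

end Invariants

/-! ### Homogeneous coordinates on the quotient surface -/

section Coordinates

variable {K : Type} [Field K] {t : K}

open CurveRing

/-- The sections of a line bundle of degree `8` on the curve used for the first factor. -/
def Curve.coords₁ (t : K) : Bool → Fin 8 → CurveRing t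
  | false => ![1, r t ^ 2, r t ^ 4, r t * D t, r t, r t ^ 3, D t, r t ^ 2 * D t]
  | true => ![r t ^ 4, r t ^ 2, 1, r t * D t, r t ^ 3, r t, r t ^ 2 * D t, D t]

/-- The sections of a line bundle of degree `4` on the curve used for the second factor. -/
def Curve.coords₂ (t : K) : Bool → Fin 4 → CurveRing t
  | false => ![1, r t, r t ^ 2, D t]
  | true => ![r t ^ 2, r t, 1, D t]

/-- The transition function is the fourth power of `r` in the new chart. Multiplying by it exchanges
`r ^ i` with `r ^ (4 - i)` and `r ^ j * D` with `r ^ (2 - j) * D`, which is how the two lists are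
matched. -/
theorem Curve.Glued.coords₁ {R : Type} [CommRing R] {i j : Bool} {α β : CurveRing t →+* R}
    (h : Curve.Glued i j α β) : ∃ u : R, IsUnit u ∧ ∀ k, β (Curve.coords₁ t j k) =
      u * α (Curve.coords₁ t i k) := by
  have h2 := h.2
  by_cases hij : i = j
  · subst hij
    rw [if_pos rfl] at h2
    refine ⟨1, isUnit_one, fun k => ?_⟩
    cases i <;> fin_cases k <;> simp [Curve.coords₁, h2.1, h2.2]
  · rw [if_neg hij] at h2
    obtain ⟨h3, h4⟩ := h2
    refine ⟨β (r t) ^ 4, (IsUnit.of_mul_eq_one _ (by rw [mul_comm]; exact h3)).pow 4, fun k => ?_⟩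
    generalize hα : α (r t) = x at *
    generalize hβ : β (r t) = y at *
    generalize hδ : α (D t) = d at *
    have e2 : y ^ 4 * x ^ 2 = y ^ 2 := by linear_combination y ^ 2 * (x * y + 1) * h3
    have e4 : y ^ 4 * x ^ 4 = 1 := by
      linear_combination ((x * y) ^ 3 + (x * y) ^ 2 + x * y + 1) * h3
    have e1 : y ^ 4 * x = y ^ 3 := by linear_combination y ^ 3 * h3
    have e3 : y ^ 4 * x ^ 3 = y := by linear_combination y * ((x * y) ^ 2 + x * y + 1) * h3
    cases i <;> cases j <;> first | exact absurd rfl hij | skip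
    all_goals
      fin_cases k <;> simp [Curve.coords₁, h4, hα, hβ, hδ, e1, e2, e3, e4] <;>
      first
      | linear_combination (- d) * e1
      | linear_combination (- d) * e2
      | ring

theorem Curve.Glued.coords₂ {R : Type} [CommRing R] {i j : Bool} {α β : CurveRing t →+* R}
    (h : Curve.Glued i j α β) : ∃ u : R, IsUnit u ∧ ∀ k, β (Curve.coords₂ t j k) =
      u * α (Curve.coords₂ t i k) := by
  have h2 := h.2
  by_cases hij : i = j
  · subst hij
    rw [if_pos rfl] at h2
    refine ⟨1, isUnit_one, fun k => ?_⟩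
    cases i <;> fin_cases k <;> simp [Curve.coords₂, h2.1, h2.2]
  · rw [if_neg hij] at h2
    obtain ⟨h3, h4⟩ := h2
    refine ⟨β (r t) ^ 2, (IsUnit.of_mul_eq_one _ (by rw [mul_comm]; exact h3)).pow 2, fun k => ?_⟩
    generalize hα : α (r t) = x at *
    generalize hβ : β (r t) = y at *
    generalize hδ : α (D t) = d at *
    have e2 : y ^ 2 * x ^ 2 = 1 := by linear_combination (x * y + 1) * h3
    have e1 : y ^ 2 * x = y := by linear_combination y * h3
    cases i <;> cases j <;> first | exact absurd rfl hij | skip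
    all_goals
      (fin_cases k <;> simp [Curve.coords₂, h4, hα, hβ, hδ, e1, e2]; ring)

namespace Sq

/-- The indices of the sections of the first line bundle. -/
def index₁ : Fin 16 → Fin 8 := ![0, 0, 0, 1, 1, 1, 2, 2, 2, 3, 3, 3, 4, 5, 6, 7]

/-- The indices of the sections of the second line bundle. -/
def index₂ : Fin 16 → Fin 4 := ![0, 1, 2, 0, 1, 2, 0, 1, 2, 0, 1, 2, 3, 3, 3, 3]

/-- The homogeneous coordinates of the quotient surface. -/
def coords (t : K) (p : Bool × Bool) (k : Fin 16) : ProdRing t :=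
  ProdRing.inl t (Curve.coords₁ t p.1 (index₁ k)) * ProdRing.inr t (Curve.coords₂ t p.2 (index₂ k))

/-- The coordinate that is invertible on a chart. -/
def unitIndex (p : Bool × Bool) : Fin 16 :=
  (if p.1 then 6 else 0) + (if p.2 then 2 else 0)

theorem coords_unitIndex (p : Bool × Bool) : coords t p (unitIndex p) = 1 := by
  obtain ⟨i, j⟩ := p
  cases i <;> cases j <;> simp [coords, unitIndex, index₁, index₂, Curve.coords₁, Curve.coords₂]

theorem isUnit_coords (p : Bool × Bool) : IsUnit (coords t p (unitIndex p)) := by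
  rw [coords_unitIndex]; exact isUnit_one

theorem coords₁_unitIndex (i : Bool) (p : Bool × Bool) :
    Curve.coords₁ t i (index₁ (unitIndex p)) = if i = p.1 then 1 else r t ^ 4 := by
  obtain ⟨i', j'⟩ := p
  cases i <;> cases i' <;> cases j' <;> rfl

theorem coords₂_unitIndex (j : Bool) (p : Bool × Bool) :
    Curve.coords₂ t j (index₂ (unitIndex p)) = if j = p.2 then 1 else r t ^ 2 := by
  obtain ⟨i', j'⟩ := p
  cases j <;> cases i' <;> cases j' <;> rfl

/-- The coordinate that equals `1` on the chart `p'` is, on another chart, a product of powers of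
`r₁` and `r₂`, one factor for each index in which the charts differ. Its non-vanishing is thus the
condition for belonging to the chart `p'`. -/
theorem coords_unitIndex_notMem {p p' : Bool × Bool} (x : PrimeSpectrum (ProdRing t))
    (h : coords t p (unitIndex p') ∉ x.asIdeal) :
    (p.1 = p'.1 ∨ ProdRing.inl t (r t) ∉ x.asIdeal) ∧
      (p.2 = p'.2 ∨ ProdRing.inr t (r t) ∉ x.asIdeal) := by
  rw [coords, coords₁_unitIndex, coords₂_unitIndex] at h
  constructor
  · by_contra! h'
    rw [if_neg h'.1] at h
    exact h (Ideal.mul_mem_right _ _ (by rw [map_pow]; exact Ideal.pow_mem_of_mem _ h'.2 4 (by simp)))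
  · by_contra! h'
    rw [if_neg h'.1] at h
    exact h (Ideal.mul_mem_left _ _ (by rw [map_pow]; exact Ideal.pow_mem_of_mem _ h'.2 2 (by simp)))

theorem inl_coords₁_mem (i : Bool) (m : Fin 8) (hm : m ≤ 3) :
    ProdRing.inl t (Curve.coords₁ t i m) ∈ ProdRing.invariants t := by
  have h : Curve.coords₁ t i m = 1 ∨ Curve.coords₁ t i m = r t ^ 2 ∨
      Curve.coords₁ t i m = r t ^ 4 ∨ Curve.coords₁ t i m = r t * D t := by
    cases i <;> fin_cases m <;> simp [Curve.coords₁] at hm ⊢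
  rcases h with h | h | h | h <;> rw [h]
  · rw [map_one]; exact one_mem _
  · rw [map_pow]; exact ProdRing.r₁_sq_mem
  · rw [map_pow, show ProdRing.inl t (r t) ^ 4 = (ProdRing.inl t (r t) ^ 2) ^ 2 by ring]
    exact pow_mem ProdRing.r₁_sq_mem 2
  · rw [map_mul]; exact ProdRing.r₁_D₁_mem

theorem inl_coords₁_mul_mem (i : Bool) (m : Fin 8) (hm : ¬ m ≤ 3) :
    ProdRing.inl t (Curve.coords₁ t i m) * ProdRing.inr t (D t) ∈ ProdRing.invariants t := by
  have h : Curve.coords₁ t i m = r t ∨ Curve.coords₁ t i m = r t ^ 3 ∨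
      Curve.coords₁ t i m = D t ∨ Curve.coords₁ t i m = r t ^ 2 * D t := by
    cases i <;> fin_cases m <;> simp [Curve.coords₁] at hm ⊢
  rcases h with h | h | h | h <;> rw [h]
  · exact ProdRing.r₁_D₂_mem
  · rw [map_pow, pow_succ, mul_assoc]
    exact mul_mem ProdRing.r₁_sq_mem ProdRing.r₁_D₂_mem
  · exact ProdRing.D₁_D₂_mem
  · rw [map_mul, map_pow, mul_assoc]
    exact mul_mem ProdRing.r₁_sq_mem ProdRing.D₁_D₂_mem

theorem inr_coords₂_mem (j : Bool) (m : Fin 4) (hm : m ≤ 2) :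
    ProdRing.inr t (Curve.coords₂ t j m) ∈ ProdRing.invariants t := by
  have h : Curve.coords₂ t j m = 1 ∨ Curve.coords₂ t j m = r t ∨
      Curve.coords₂ t j m = r t ^ 2 := by
    cases j <;> fin_cases m <;> simp [Curve.coords₂] at hm ⊢
  rcases h with h | h | h <;> rw [h]
  · rw [map_one]; exact one_mem _
  · exact ProdRing.r₂_mem
  · rw [map_pow]; exact pow_mem ProdRing.r₂_mem 2

theorem coords₂_three (j : Bool) : Curve.coords₂ t j 3 = D t := by cases j <;> rfl

/-- Among the sections on the first factor the first four are even under `(r, D) ↦ (-r, -D)` and the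
last four are odd. On the second factor only the last one, `D`, is odd under its involution. The
indices pair even with even and odd with odd. -/
theorem coords_mem (p : Bool × Bool) (k : Fin 16) : coords t p k ∈ ProdRing.invariants t := by
  have h : ∀ k, (index₁ k ≤ 3 ∧ index₂ k ≤ 2) ∨ (¬ index₁ k ≤ 3 ∧ index₂ k = 3) := by decide
  rcases h k with ⟨h1, h2⟩ | ⟨h1, h2⟩
  · exact mul_mem (inl_coords₁_mem _ _ h1) (inr_coords₂_mem _ _ h2)
  · rw [coords, h2, coords₂_three]
    exact inl_coords₁_mul_mem _ _ h1

/-- On every chart each of the five generating invariants is itself one of the coordinates, so the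
image of the product has the full ring of invariants on its affine charts. -/
theorem adjoin_coords (p : Bool × Bool) :
    Algebra.adjoin K (Set.range (coords t p)) = ProdRing.invariants t := by
  refine le_antisymm (Algebra.adjoin_le ?_) (Algebra.adjoin_le ?_)
  · rintro _ ⟨k, rfl⟩
    exact coords_mem p k
  · obtain ⟨i, j⟩ := p
    rintro x (rfl | rfl | rfl | rfl | rfl) <;> refine Algebra.subset_adjoin ?_
    · refine ⟨3 + if j then 2 else 0, ?_⟩
      cases i <;> cases j <;> simp [coords, index₁, index₂, Curve.coords₁, Curve.coords₂]
    · refine ⟨9 + if j then 2 else 0, ?_⟩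
      cases i <;> cases j <;> simp [coords, index₁, index₂, Curve.coords₁, Curve.coords₂]
    · refine ⟨1 + if i then 6 else 0, ?_⟩
      cases i <;> cases j <;> simp [coords, index₁, index₂, Curve.coords₁, Curve.coords₂]
    · refine ⟨12 + if i then 1 else 0, ?_⟩
      cases i <;> cases j <;> simp [coords, index₁, index₂, Curve.coords₁, Curve.coords₂]
    · refine ⟨14 + if i then 1 else 0, ?_⟩
      cases i <;> cases j <;> simp [coords, index₁, index₂, Curve.coords₁, Curve.coords₂]

section Map

attribute [local instance] MvPolynomial.gradedAlgebra

variable (t) in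
theorem exists_toProj : ∃ φ : Sq t ⟶ projSpace 15 K, ∀ p, chart t p ≫ φ =
    toProj (coords t p) (unitIndex p) (isUnit_coords p) := by
  refine exists_desc _ fun p p' R _ γ γ' h₁ h₂ => ?_
  have hK : γ.comp (algebraMap K (ProdRing t)) = γ'.comp (algebraMap K (ProdRing t)) := by
    have := h₁.1
    rwa [RingHom.comp_assoc, RingHom.comp_assoc, AlgHom.comp_algebraMap] at this
  algebraize [γ.comp (algebraMap K _)]
  let α : ProdRing t →ₐ[K] R := { γ with commutes' := fun c => rfl }
  let β : ProdRing t →ₐ[K] R := { γ' with commutes' := fun c => (RingHom.congr_fun hK c).symm }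
  have e1 := specMap_toProj (coords t p) (unitIndex p) (isUnit_coords p) α
  have e2 := specMap_toProj (coords t p') (unitIndex p') (isUnit_coords p') β
  obtain ⟨u, hu, hu'⟩ := h₁.coords₁
  obtain ⟨v, hv, hv'⟩ := h₂.coords₂
  refine e1.trans (Eq.trans ?_ e2.symm)
  refine toProj_eq _ _ (u * v) (hu.mul hv) fun k => ?_
  change γ' _ = u * v * γ _
  have h3 := hu' (index₁ k)
  have h4 := hv' (index₂ k)
  simp only [RingHom.comp_apply, RingHom.coe_coe] at h3 h4
  rw [coords, coords, map_mul, map_mul, h3, h4]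
  ring

variable (t) in
/-- The morphism to projective space whose image is the quotient surface. -/
def toProj : Sq t ⟶ projSpace 15 K := (exists_toProj t).choose

theorem chart_toProj (p : Bool × Bool) : chart t p ≫ toProj t =
    SignsBielliptic.toProj (coords t p) (unitIndex p) (isUnit_coords p) :=
  (exists_toProj t).choose_spec p

theorem toProj_hom : toProj t ≫ projSpaceHom 15 K = pullback.fst _ _ ≫ Curve.hom t := by
  apply hom_ext
  intro p
  rw [← Category.assoc, chart_toProj, SignsBielliptic.toProj_hom, chart_hom]

variable (t) in
/-- The ring homomorphism describing `toProj` on a chart. -/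
def projRingHom (p : Bool × Bool) := awayHom (K := K) (coords t p) (MvPolynomial.X (unitIndex p))
  (by rw [MvPolynomial.aeval_X]; exact isUnit_coords p)

theorem toProj_isChart (p : Bool × Bool) : Chart (toProj t) (chart t p) (coordEmb K (unitIndex p))
    (Spec.map (CommRingCat.ofHom (projRingHom t p))) := by
  refine ⟨inferInstance, inferInstance, chart_toProj p, ?_⟩
  intro x hx
  obtain ⟨p', y, rfl⟩ := exists_mem_range_chart x
  have e := congrArg (fun f : Spec (.of (ProdRing t)) ⟶ projSpace 15 K => f y) (chart_toProj p')
  have h1 : SignsBielliptic.toProj (coords t p') (unitIndex p') (isUnit_coords p') y ∈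
      Set.range (coordEmb K (unitIndex p)) := e ▸ hx
  obtain ⟨h2, h3⟩ := coords_unitIndex_notMem y ((toProj_mem_range_iff _ _ _ _ _).1 h1)
  exact chart_mem_range_of _ h2 h3

theorem mem_range_projRingHom (p : Bool × Bool) (a : ProdRing t) :
    a ∈ (projRingHom t p).range ↔ a ∈ ProdRing.invariants t := by
  rw [← adjoin_coords p, ← range_awayHom _ _ (coords_unitIndex p)]
  rfl

end Map

end Sq

end Coordinates

end

/-! ### The quotient surface -/

section

section Surface

variable {K : Type} [Field K] (t : K)

instance isProper_toProj : IsProper (Sq.toProj t) := by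
  have : IsProper (Sq.toProj t ≫ projSpaceHom 15 K) := by
    rw [Sq.toProj_hom]
    infer_instance
  exact IsProper.of_comp _ (projSpaceHom 15 K)

/-- The quotient surface. -/
def Surface : Scheme.{0} := (Sq.toProj t).image

namespace Surface

/-- The quotient morphism. -/
def π : Sq t ⟶ Surface t := (Sq.toProj t).toImage

/-- The closed immersion into projective space. -/
def emb : Surface t ⟶ projSpace 15 K := (Sq.toProj t).imageι

/-- The structure morphism. -/
def hom : Surface t ⟶ Spec (.of K) := emb t ≫ projSpaceHom 15 K

theorem isProjective_hom : IsProjective (hom t) :=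
  ⟨15, emb t, inferInstanceAs (IsClosedImmersion (Sq.toProj t).imageι), rfl⟩

variable {t}

theorem π_hom : π t ≫ hom t = pullback.fst _ _ ≫ Curve.hom t := by
  rw [hom, ← Category.assoc]
  exact (congrArg (· ≫ projSpaceHom 15 K) (Scheme.Hom.toImage_imageι (Sq.toProj t))).trans
    Sq.toProj_hom

variable (t) in
-- A morphism is dominant onto its scheme-theoretic image, and this one is closed because the
-- product is proper.
theorem surjective_π : Function.Surjective (π t) := by
  have h1 : IsDominant (Sq.toProj t).toImage := inferInstance
  have h2 : UniversallyClosed (Sq.toProj t).toImage := inferInstance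
  have h3 : IsClosed (Set.range (Sq.toProj t).toImage) :=
    ((Sq.toProj t).toImage.isClosedMap).isClosed_range
  have h4 := (Sq.toProj t).toImage.denseRange
  rw [← Set.range_eq_univ]
  exact h3.closure_eq.symm.trans h4.closure_range

theorem exists_chart (p : Bool × Bool) : ∃ ι : Spec (.of (ProdRing.invariants t)) ⟶ Surface t,
    Chart (π t) (Sq.chart t p) ι (Spec.map (CommRingCat.ofHom
      ((ProdRing.invariants t).val : ProdRing.invariants t →+* ProdRing t))) := by
  obtain ⟨ι, h, -⟩ := (Sq.toProj_isChart (t := t) p).exists_image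
  have key : ∀ (B : Subring (ProdRing t)) (hB : B = (ProdRing.invariants t).toSubring)
      (ι : Spec (.of B) ⟶ (Sq.toProj t).image),
      Chart (Sq.toProj t).toImage (Sq.chart t p) ι (Spec.map (CommRingCat.ofHom B.subtype)) →
      ∃ ι : Spec (.of (ProdRing.invariants t)) ⟶ Surface t,
        Chart (π t) (Sq.chart t p) ι (Spec.map (CommRingCat.ofHom
          ((ProdRing.invariants t).val : ProdRing.invariants t →+* ProdRing t))) := by
    rintro _ rfl ι h
    exact ⟨ι, h⟩
  refine key _ (SetLike.ext fun a => ?_) ι h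
  exact Sq.mem_range_projRingHom p a

variable (t) in
/-- The affine charts of the surface. -/
def chart (p : Bool × Bool) : Spec (.of (ProdRing.invariants t)) ⟶ Surface t :=
  (exists_chart p).choose

theorem isChart (p : Bool × Bool) : Chart (π t) (Sq.chart t p) (chart t p)
    (Spec.map (CommRingCat.ofHom
      ((ProdRing.invariants t).val : ProdRing.invariants t →+* ProdRing t))) :=
  (exists_chart p).choose_spec

instance (p : Bool × Bool) : IsOpenImmersion (chart t p) := (isChart p).right

theorem exists_mem_range_chart (x : Surface t) : ∃ p, x ∈ Set.range (chart t p) := by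
  obtain ⟨y, rfl⟩ := surjective_π t x
  obtain ⟨p, z, rfl⟩ := Sq.exists_mem_range_chart y
  refine ⟨p, Spec.map (CommRingCat.ofHom
      ((ProdRing.invariants t).val : ProdRing.invariants t →+* ProdRing t)) z, ?_⟩
  exact congrArg (fun f : Spec (.of (ProdRing t)) ⟶ Surface t => f z) (isChart p).comm.symm

/-- It can be checked after the inclusion of the invariants in the ring of the product, which is
injective. -/
theorem chart_hom (p : Bool × Bool) : chart t p ≫ hom t =
    Spec.map (CommRingCat.ofHom (algebraMap K (ProdRing.invariants t))) := by
  obtain ⟨ψ, hψ⟩ := Spec.map_surjective (chart t p ≫ hom t)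
  have h1 : Spec.map (ψ ≫ CommRingCat.ofHom
      ((ProdRing.invariants t).val : ProdRing.invariants t →+* ProdRing t)) =
      Spec.map (CommRingCat.ofHom (algebraMap K (ProdRing t))) := by
    rw [Spec.map_comp, hψ, ← Category.assoc, ← (isChart p).comm, Category.assoc, π_hom,
      Sq.chart_hom]
  have h2 := Spec.map_injective h1
  rw [← hψ]
  congr 1
  refine CommRingCat.hom_ext (RingHom.ext fun c => Subtype.ext ?_)
  exact congrArg (fun f => f.hom c) h2

end Surface

end Surface

/-! ### The free action on the product -/

section Action

variable {K : Type} [Field K] (t : K)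

/-- The translation action on the first factor. -/
def Curve.translationAct : Multiplicative (ZMod 2) →* Aut (Over.mk (Curve.hom t)) :=
  involutionAct (Curve.sgn t (-1) (-1)) (Curve.sgn_hom _ _) (Curve.sgn_sgn _ _)

/-- The action on the second factor, with quotient the projective line. -/
def Curve.reflectionAct : Multiplicative (ZMod 2) →* Aut (Over.mk (Curve.hom t)) :=
  involutionAct (Curve.sgn t 1 (-1)) (Curve.sgn_hom _ _) (Curve.sgn_sgn _ _)

namespace Sq

/-- The diagonal action of `ℤ/2` on the product. -/
def act (g : Multiplicative (ZMod 2)) : Sq t ⟶ Sq t :=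
  prodEnd (Curve.translationAct t g).hom (Curve.reflectionAct t g).hom

variable {t}

theorem act_fst (g : Multiplicative (ZMod 2)) : act t g ≫ pullback.fst _ _ =
    pullback.fst _ _ ≫ (Curve.translationAct t g).hom.left := pullback.lift_fst _ _ _

theorem act_snd (g : Multiplicative (ZMod 2)) : act t g ≫ pullback.snd _ _ =
    pullback.snd _ _ ≫ (Curve.reflectionAct t g).hom.left := pullback.lift_snd _ _ _

theorem act_one : act t 1 = 𝟙 _ := by
  refine pullback.hom_ext ?_ ?_
  · rw [act_fst, Curve.translationAct, involutionAct_one]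
    exact (Category.comp_id _).trans (Category.id_comp _).symm
  · rw [act_snd, Curve.reflectionAct, involutionAct_one]
    exact (Category.comp_id _).trans (Category.id_comp _).symm

theorem chart_act (p : Bool × Bool) : chart t p ≫ act t (Multiplicative.ofAdd 1) =
    Spec.map (CommRingCat.ofHom (ProdRing.sigma t : ProdRing t →+* ProdRing t)) ≫ chart t p :=
  chart_prodEnd (involutionAct_ofAdd_one _ _ _) (involutionAct_ofAdd_one _ _ _) p

theorem act_act : act t (Multiplicative.ofAdd 1) ≫ act t (Multiplicative.ofAdd 1) = 𝟙 _ := by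
  refine pullback.hom_ext ?_ ?_
  · rw [Category.assoc, act_fst, reassoc_of% act_fst, Curve.translationAct, involutionAct_ofAdd_one,
      Curve.sgn_sgn]
    exact (Category.comp_id _).trans (Category.id_comp _).symm
  · rw [Category.assoc, act_snd, reassoc_of% act_snd, Curve.reflectionAct, involutionAct_ofAdd_one,
      Curve.sgn_sgn]
    exact (Category.comp_id _).trans (Category.id_comp _).symm

theorem act_hom : act t (Multiplicative.ofAdd 1) ≫ pullback.fst _ _ ≫ Curve.hom t =
    pullback.fst _ _ ≫ Curve.hom t := by
  rw [reassoc_of% act_fst, Curve.translationAct, involutionAct_ofAdd_one, Curve.sgn_hom]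

/-- Projected to the first factor, a fixed point would be fixed by the translation. -/
theorem comp_act_ne [CharZero K] {F : Type} [Field F] (x : Spec (.of F) ⟶ Sq t) :
    x ≫ act t (Multiplicative.ofAdd 1) ≠ x := by
  intro h
  refine Curve.comp_sgn_ne (x ≫ pullback.fst _ _) ?_
  have h1 := congrArg (· ≫ pullback.fst _ _) h
  simp only [Category.assoc] at h1
  rw [act_fst, Curve.translationAct, involutionAct_ofAdd_one] at h1
  rw [Category.assoc, h1]

theorem act_π (g : Multiplicative (ZMod 2)) : act t g ≫ Surface.π t = Surface.π t := by
  rcases multiplicative_zmod_two g with rfl | rfl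
  · rw [act_one, Category.id_comp]
  · refine hom_ext fun p => ?_
    rw [← Category.assoc, chart_act, Category.assoc, (Surface.isChart p).comm, ← Category.assoc,
      ← Spec.map_comp, ← CommRingCat.ofHom_comp]
    congr 3
    exact RingHom.ext fun x => ProdRing.sigma_of_mem x.2

variable (t) in
theorem isQuotient_π [CharZero K] : IsQuotient (act t) (Surface.π t) :=
  isQuotient_of_charts act_π (Multiplicative.ofAdd 1) Surface.isChart
    Surface.exists_mem_range_chart chart_act (fun _ => Subtype.val_injective)
    fun _ a ha => ⟨⟨a, ProdRing.mem_invariants_iff.2 ha⟩, rfl⟩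

variable (t) in
/-- The action of `ℤ/2` on the product as a scheme over the base field. -/
def actHom : Multiplicative (ZMod 2) →* Aut (Over.mk (pullback.fst (Curve.hom t) (Curve.hom t) ≫
    Curve.hom t)) :=
  involutionAct (act t (Multiplicative.ofAdd 1)) act_hom act_act

theorem actHom_eq (g : Multiplicative (ZMod 2)) : ((actHom t) g).hom.left = act t g := by
  rcases multiplicative_zmod_two g with rfl | rfl
  · rw [act_one]; exact involutionAct_one _ _ _
  · exact involutionAct_ofAdd_one _ _ _

variable (t) in
theorem isFreeAction [CharZero K] : IsFreeAction (fun g => ((actHom t) g).hom.left) := by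
  intro g hg F _ x hx
  rcases multiplicative_zmod_two g with rfl | rfl
  · exact hg rfl
  · exact comp_act_ne (t := t) x ((congrArg (x ≫ ·) (actHom_eq (Multiplicative.ofAdd 1))).symm.trans hx)

end Sq

end Action

end

/-! ### The first curve modulo translation -/

section

open scoped TensorProduct Polynomial

section QuotRing

variable {K : Type} [Field K] (t : K)

/-- The quadratic factor of the cubic polynomial `quotPoly`. -/
def quadratic : K[X] :=
  Polynomial.X ^ 2 - Polynomial.C (2 * (2 * t + 1)) * Polynomial.X + 1

/-- The cubic polynomial describing the quotient of the curve by the translation. -/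
def quotPoly : K[X] := Polynomial.X * quadratic t

theorem quadratic_monic : (quadratic t).Monic := by
  unfold quadratic; monicity!

theorem quotPoly_monic : (quotPoly t).Monic := Polynomial.monic_X.mul (quadratic_monic t)

theorem quotPoly_isCoprime [CharZero K] (h0 : t ≠ 0) (h1 : t + 1 ≠ 0) :
    IsCoprime (quotPoly t) (Polynomial.derivative (quotPoly t)) := by
  refine Polynomial.Separable.mul Polynomial.separable_X ?_ ?_
  · set e : K := (4 * (t * (t + 1)))⁻¹ with he
    have he' : e * (4 * (t * (t + 1))) = 1 :=
      inv_mul_cancel₀ (mul_ne_zero (by norm_num) (mul_ne_zero h0 h1))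
    have c4 : Polynomial.C (4 : K) = 4 := map_ofNat Polynomial.C 4
    have c2 : Polynomial.C (2 : K) = 2 := map_ofNat Polynomial.C 2
    have hE : Polynomial.C e * (4 * (Polynomial.C t * (Polynomial.C t + 1))) = 1 := by
      have h := congrArg Polynomial.C he'
      simpa only [map_mul, map_add, map_one, c4] using h
    have h2 : Polynomial.C (2⁻¹ : K) * 2 = 1 := by
      rw [← c2, ← Polynomial.C_mul, inv_mul_cancel₀ (by norm_num), Polynomial.C_1]
    have hd : Polynomial.derivative (quadratic t) =
        2 * (Polynomial.X - (2 * Polynomial.C t + 1)) := by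
      simp only [quadratic, Polynomial.derivative_add, Polynomial.derivative_sub,
        Polynomial.derivative_X_pow, Polynomial.derivative_C_mul, Polynomial.derivative_X,
        Polynomial.derivative_one]
      simp only [map_mul, map_add, map_one, map_natCast, c2]
      push_cast
      ring
    refine ⟨- Polynomial.C e, Polynomial.C e * Polynomial.C 2⁻¹ *
      (Polynomial.X - (2 * Polynomial.C t + 1)), ?_⟩
    rw [hd]
    simp only [quadratic, map_mul, map_add, map_one, c2]
    linear_combination hE + Polynomial.C e * (Polynomial.X - (2 * Polynomial.C t + 1)) ^ 2 * h2
  · refine ⟨- (Polynomial.X - Polynomial.C (2 * (2 * t + 1))), 1, ?_⟩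
    rw [quadratic]
    ring

/-- The coordinate ring of the quotient of the curve by the translation. -/
abbrev QuotRing := DoubleCover (quotPoly t)

namespace QuotRing

/-- The inclusion of the invariants. -/
def toCurveRing : QuotRing t →ₐ[K] CurveRing t :=
  DoubleCover.liftₐ (CurveRing.r t ^ 2) (CurveRing.r t * CurveRing.D t) (by
    simp only [quotPoly, quadratic, map_mul, map_add, map_sub, map_pow, map_one,
      Polynomial.aeval_X, Polynomial.aeval_C]
    rw [mul_pow, CurveRing.D_sq]
    simp only [map_mul, map_add, map_one]
    ring)

variable {t}

theorem toCurveRing_x : toCurveRing t (DoubleCover.x _) = CurveRing.r t ^ 2 :=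
  DoubleCover.liftₐ_x _ _ _

theorem toCurveRing_y : toCurveRing t (DoubleCover.y _) = CurveRing.r t * CurveRing.D t :=
  DoubleCover.liftₐ_y _ _ _

/-- The image of `p + q y` is `p(r²) + r q(r²) D`, whose two components over the polynomials in `r`
determine `p` and `q`. -/
theorem toCurveRing_injective : Function.Injective (toCurveRing t) := by
  rw [injective_iff_map_eq_zero]
  intro z hz
  have h1 : toCurveRing t z = Polynomial.aeval (CurveRing.r t) (z.re.comp (Polynomial.X ^ 2)) +
      Polynomial.aeval (CurveRing.r t) (Polynomial.X * z.im.comp (Polynomial.X ^ 2)) *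
        CurveRing.D t := by
    have h2 : ∀ f : K[X], toCurveRing t (Polynomial.aeval (DoubleCover.x (quotPoly t)) f) =
        Polynomial.aeval (CurveRing.r t) (f.comp (Polynomial.X ^ 2)) := by
      intro f
      rw [← Polynomial.aeval_algHom_apply, toCurveRing_x, Polynomial.aeval_comp, map_pow,
        Polynomial.aeval_X]
    conv_lhs => rw [DoubleCover.eq_add z]
    rw [map_add, map_mul, h2, h2, toCurveRing_y, map_mul, Polynomial.aeval_X]
    ring
  rw [h1] at hz
  obtain ⟨h3, h4⟩ := DoubleCover.ext_basis (g := quartic t) (p' := 0) (q' := 0) (hz.trans (by simp))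
  have hc : ∀ f : K[X], f.comp (Polynomial.X ^ 2) = 0 → f = 0 := by
    intro f hf
    rw [← Polynomial.expand_eq_comp_X_pow] at hf
    exact (Polynomial.expand_eq_zero two_pos).1 hf
  have h5 := hc _ h3
  have h6 := hc _ ((mul_eq_zero.1 h4).resolve_left Polynomial.X_ne_zero)
  rw [DoubleCover.eq_add z, h5, h6]
  simp

variable (t) in
/-- The inclusion into the invariants of the product. -/
def toInvariants : QuotRing t →ₐ[K] ProdRing.invariants t :=
  ((ProdRing.inl t).comp (toCurveRing t)).codRestrict _ (by
    intro z
    have hz : z ∈ Algebra.adjoin K {DoubleCover.x (quotPoly t), DoubleCover.y (quotPoly t)} := by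
      rw [DoubleCover.adjoin_eq_top]; trivial
    induction hz using Algebra.adjoin_induction with
    | mem x hx =>
      rcases hx with rfl | rfl
      · rw [AlgHom.comp_apply, toCurveRing_x, map_pow]; exact ProdRing.r₁_sq_mem
      · rw [AlgHom.comp_apply, toCurveRing_y, map_mul]; exact ProdRing.r₁_D₁_mem
    | algebraMap c => rw [AlgHom.commutes]; exact algebraMap_mem _ _
    | add x y _ _ hx hy => rw [map_add]; exact add_mem hx hy
    | mul x y _ _ hx hy => rw [map_mul]; exact mul_mem hx hy)

theorem coe_toInvariants (z : QuotRing t) :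
    (toInvariants t z : ProdRing t) = ProdRing.inl t (toCurveRing t z) := rfl

variable (t) in
theorem adjoin_invariants_eq_top : Algebra.adjoin K
    {toInvariants t (DoubleCover.x _), toInvariants t (DoubleCover.y _),
      (⟨_, ProdRing.r₂_mem⟩ : ProdRing.invariants t), ⟨_, ProdRing.r₁_D₂_mem⟩,
      ⟨_, ProdRing.D₁_D₂_mem⟩} = ⊤ := by
  refine top_unique fun x _ => ?_
  obtain ⟨x, hx⟩ := x
  induction hx using Algebra.adjoin_induction with
  | mem x hx =>
    refine Algebra.subset_adjoin ?_
    rcases hx with rfl | rfl | rfl | rfl | rfl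
    · exact Or.inl (Subtype.ext (by rw [coe_toInvariants, toCurveRing_x, map_pow]))
    · exact Or.inr (Or.inl (Subtype.ext (by rw [coe_toInvariants, toCurveRing_y, map_mul])))
    · exact Or.inr (Or.inr (Or.inl rfl))
    · exact Or.inr (Or.inr (Or.inr (Or.inl rfl)))
    · exact Or.inr (Or.inr (Or.inr (Or.inr rfl)))
  | algebraMap c => exact algebraMap_mem (Algebra.adjoin K _) c
  | add x y hx' hy' hx hy => exact add_mem (hx trivial) (hy trivial)
  | mul x y hx' hy' hx hy => exact mul_mem (hx trivial) (hy trivial)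

theorem locally_smooth [CharZero K] (h0 : t ≠ 0) (h1 : t + 1 ≠ 0) :
    RingHom.Locally (RingHom.IsStandardSmoothOfRelativeDimension 1)
      (algebraMap K (QuotRing t)) := by
  have h := DoubleCover.locally_smooth (R := K) (u := 1) (v := 1) (one_mul 1) (quotPoly_monic t)
    (quotPoly_isCoprime t h0 h1) (IsUnit.mk0 2 two_ne_zero)
  rwa [Polynomial.C_1, one_mul] at h

end QuotRing

end QuotRing

/-! ### Smoothness of the quotient surface -/

section LocalStructure

theorem mem_comap_range_of_mul_mem {B C T : Type} [CommRing B] [CommRing C] [CommRing T]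
    [Algebra B T] {f : C →+* T} {u : B} (hu : ∃ i ∈ f.range, algebraMap B T u * i = 1) {x : B}
    (hx : u * x ∈ f.range.comap (algebraMap B T)) : x ∈ f.range.comap (algebraMap B T) := by
  obtain ⟨i, hi, hui⟩ := hu
  rw [Subring.mem_comap] at hx ⊢
  have h : algebraMap B T x = i * algebraMap B T (u * x) := by
    rw [map_mul, ← mul_assoc, mul_comm i, hui, one_mul]
  rw [h]
  exact mul_mem hi hx

theorem surjective_of_comap_range {B C T : Type} [CommRing B] [CommRing C] [CommRing T]
    [Algebra B T] {f : C →+* T} {u : B} [IsLocalization.Away u T]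
    (hu : ∃ i ∈ f.range, algebraMap B T u * i = 1)
    (h : ∀ x, x ∈ f.range.comap (algebraMap B T)) : Function.Surjective f := by
  intro z
  obtain ⟨i, hi, hui⟩ := hu
  obtain ⟨n, b, hb⟩ := IsLocalization.Away.surj u z
  have h3 : z = algebraMap _ _ b * i ^ n := by
    rw [← hb, mul_assoc, ← mul_pow, hui, one_pow, mul_one]
  have : z ∈ f.range := by
    rw [h3]
    exact mul_mem (h b) (pow_mem hi n)
  exact this

open QuotRing

variable {K : Type} [Field K] {t : K} {B : Type} [CommRing B] [Algebra K B]

variable (t B) in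
/-- A ring `B` with the properties of the ring of invariants of the product, and a function `e` on
the curve, anti-invariant under translation, in a form that allows to describe the surface over the
locus where `e` is invertible. -/
structure AntiInvariant where
  /-- The inclusion of the invariants. -/
  val : B →ₐ[K] ProdRing t
  /-- The inclusion of the functions on the quotient curve. -/
  incl : QuotRing t →ₐ[K] B
  val_incl (z) : val (incl z) = ProdRing.inl t (toCurveRing t z)
  val_injective : Function.Injective val
  /-- The function `r₂`. -/
  s : B
  /-- The function `r₁ D₂`. -/
  v₁ : B
  /-- The function `D₁ D₂`. -/
  v₂ : B
  val_s : val s = ProdRing.inr t (CurveRing.r t)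
  val_v₁ : val v₁ = ProdRing.inl t (CurveRing.r t) * ProdRing.inr t (CurveRing.D t)
  val_v₂ : val v₂ = ProdRing.inl t (CurveRing.D t) * ProdRing.inr t (CurveRing.D t)
  adjoin_eq_top : Algebra.adjoin K
    {incl (DoubleCover.x _), incl (DoubleCover.y _), s, v₁, v₂} = ⊤
  /-- The anti-invariant function. -/
  e : CurveRing t
  /-- Its square. -/
  u : QuotRing t
  /-- Its product with `r`. -/
  c₁ : QuotRing t
  /-- Its product with `D`. -/
  c₂ : QuotRing t
  /-- Its product with `D₂`. -/
  w : B
  map_u : toCurveRing t u = e ^ 2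
  map_c₁ : toCurveRing t c₁ = e * CurveRing.r t
  map_c₂ : toCurveRing t c₂ = e * CurveRing.D t
  ne_zero : e ≠ 0
  val_w : val w = ProdRing.inl t e * ProdRing.inr t (CurveRing.D t)

namespace AntiInvariant

variable (a : AntiInvariant t B)

/-- The localization of the quotient curve. -/
abbrev Base := Localization.Away a.u

/-- The localization of the ring of invariants. -/
abbrev Total := Localization.Away (a.incl a.u)

/-- A double cover of the affine line over `a.Base`. -/
abbrev Cover := DoubleCover (Polynomial.C (algebraMap (QuotRing t) a.Base a.u) *
  (quartic t).map (algebraMap K a.Base))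

/-- The product `w = e D₂` of two anti-invariant functions descends to the surface. This equation
says that, where `u = e²` is invertible, the surface should be the double cover `w² = u ·
quartic(r₂)` of a line over the quotient curve, which is `Cover`. -/
theorem w_sq : a.w ^ 2 = a.incl a.u * Polynomial.aeval a.s (quartic t) := by
  refine a.val_injective ?_
  rw [map_pow, map_mul, a.val_w, a.val_incl, a.map_u, ← Polynomial.aeval_algHom_apply, a.val_s,
    mul_pow, map_pow, ProdRing.inr_D_sq]
  simp only [quartic, map_add, map_sub, map_pow, map_one, map_mul, Polynomial.aeval_X,
    Polynomial.aeval_C]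

theorem isUnit_u : IsUnit (algebraMap B a.Total (a.incl a.u)) :=
  IsLocalization.Away.algebraMap_isUnit _

/-- The localization of `incl`. -/
def baseHom : a.Base →+* a.Total :=
  IsLocalization.Away.lift a.u (g := (algebraMap B a.Total).comp (a.incl : QuotRing t →+* B))
    a.isUnit_u

theorem baseHom_algebraMap (z : QuotRing t) : a.baseHom (algebraMap _ _ z) =
    algebraMap _ _ (a.incl z) := IsLocalization.Away.lift_eq _ _ _

theorem baseHom_comp : a.baseHom.comp (algebraMap K a.Base) =
    (algebraMap B a.Total).comp (algebraMap K B) := by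
  ext c
  rw [RingHom.comp_apply, IsScalarTower.algebraMap_apply K (QuotRing t) a.Base, baseHom_algebraMap,
    AlgHom.commutes, RingHom.comp_apply]

/-- The comparison of the localized invariants with a double cover. -/
def coverHom : a.Cover →+* a.Total :=
  DoubleCover.lift a.baseHom (algebraMap _ _ a.s) (algebraMap _ _ a.w) (by
    rw [Polynomial.eval₂_mul, Polynomial.eval₂_C, baseHom_algebraMap, Polynomial.eval₂_map,
      baseHom_comp, ← map_pow, w_sq, map_mul, Polynomial.aeval_def, Polynomial.hom_eval₂])

theorem incl_mem (z : QuotRing t) : a.incl z ∈ a.coverHom.range.comap (algebraMap B a.Total) :=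
  ⟨algebraMap a.Base _ (algebraMap _ _ z), by
    rw [coverHom, DoubleCover.lift_algebraMap, baseHom_algebraMap]⟩

theorem s_mem : a.s ∈ a.coverHom.range.comap (algebraMap B a.Total) :=
  ⟨DoubleCover.x _, DoubleCover.lift_x _ _ _ _⟩

theorem w_mem : a.w ∈ a.coverHom.range.comap (algebraMap B a.Total) :=
  ⟨DoubleCover.y _, DoubleCover.lift_y _ _ _ _⟩

theorem exists_inv : ∃ i ∈ a.coverHom.range, algebraMap B a.Total (a.incl a.u) * i = 1 := by
  refine ⟨a.coverHom (algebraMap a.Base _ (IsLocalization.Away.invSelf a.u)), ⟨_, rfl⟩, ?_⟩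
  rw [coverHom, DoubleCover.lift_algebraMap, ← baseHom_algebraMap, ← map_mul,
    IsLocalization.Away.mul_invSelf, map_one]

theorem mem_of_incl_u_mul_mem (x : B)
    (hx : a.incl a.u * x ∈ a.coverHom.range.comap (algebraMap B a.Total)) :
    x ∈ a.coverHom.range.comap (algebraMap B a.Total) :=
  mem_comap_range_of_mul_mem a.exists_inv hx

/-- The remaining generators are `r₁ D₂` and `D₁ D₂`. Multiplied by `u = e²` they become `(e r₁) w`
and `(e D₁) w`, where `e r₁` and `e D₁` are functions on the quotient curve; and `u` is invertible.
-/
theorem coverHom_surjective : Function.Surjective a.coverHom := by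
  refine surjective_of_comap_range a.exists_inv fun x => ?_
  have hx : x ∈ Algebra.adjoin K
      {a.incl (DoubleCover.x _), a.incl (DoubleCover.y _), a.s, a.v₁, a.v₂} := by
    rw [a.adjoin_eq_top]; trivial
  induction hx using Algebra.adjoin_induction with
  | mem x hx =>
    rcases hx with rfl | rfl | rfl | rfl | rfl
    · exact a.incl_mem _
    · exact a.incl_mem _
    · exact a.s_mem
    · refine a.mem_of_incl_u_mul_mem _ ?_
      have h := mul_mem (a.incl_mem a.c₁) a.w_mem
      have h2 : a.incl a.c₁ * a.w = a.incl a.u * a.v₁ := by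
        refine a.val_injective ?_
        rw [map_mul, map_mul, a.val_incl, a.val_incl, a.map_u, a.map_c₁, a.val_w, a.val_v₁,
          map_mul, map_pow]
        ring
      rwa [h2] at h
    · refine a.mem_of_incl_u_mul_mem _ ?_
      have h := mul_mem (a.incl_mem a.c₂) a.w_mem
      have h2 : a.incl a.c₂ * a.w = a.incl a.u * a.v₂ := by
        refine a.val_injective ?_
        rw [map_mul, map_mul, a.val_incl, a.val_incl, a.map_u, a.map_c₂, a.val_w, a.val_v₂,
          map_mul, map_pow]
        ring
      rwa [h2] at h
  | algebraMap c => rw [← a.incl.commutes c]; exact a.incl_mem _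
  | add x y hx' hy' hx hy => exact add_mem hx hy
  | mul x y hx' hy' hx hy => exact mul_mem hx hy

/-- Compare with the double cover over the function field `F` of the first curve. There `1` and `D₂`
are independent over `F[r₂]`, the image of `w` is the nonzero `e` times `D₂`, and the localised
quotient curve embeds in `F`. -/
theorem coverHom_injective [CharZero K] (h0 : t ≠ 0) (h1 : t + 1 ≠ 0) :
    Function.Injective a.coverHom := by
  have := CurveRing.isDomain t h0 h1
  let F := FractionRing (CurveRing t)
  let E := DoubleCover ((quartic t).map (algebraMap K F))
  have hcomm : (algebraMap F E).comp (algebraMap K F) = algebraMap K E :=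
    (IsScalarTower.algebraMap_eq K F E).symm
  -- the ring of functions on the product maps to `E`
  let δ : ProdRing t →ₐ[K] E := Algebra.TensorProduct.lift
    ((IsScalarTower.toAlgHom K F E).comp (IsScalarTower.toAlgHom K (CurveRing t) F))
    (CurveRing.lift (DoubleCover.x _) (DoubleCover.y _) (by
      rw [DoubleCover.y_sq, Polynomial.aeval_map_algebraMap, CurveRing.aeval_quartic])) (fun _ _ => Commute.all _ _)
  have hδl : ∀ z : CurveRing t, δ (ProdRing.inl t z) = algebraMap F E (algebraMap _ F z) := fun z =>
    Algebra.TensorProduct.lift_tmul _ _ _ _ _ |>.trans (by rw [map_one, mul_one]; rfl)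
  have hδr : ∀ z : CurveRing t, δ (ProdRing.inr t z) = CurveRing.lift (DoubleCover.x _) (DoubleCover.y _) (by
      rw [DoubleCover.y_sq, Polynomial.aeval_map_algebraMap, CurveRing.aeval_quartic]) z := fun z =>
    Algebra.TensorProduct.lift_tmul _ _ _ _ _ |>.trans (by rw [map_one, one_mul])
  have he : algebraMap (CurveRing t) F a.e ≠ 0 :=
    (map_ne_zero_iff _ (IsFractionRing.injective (CurveRing t) F)).2 a.ne_zero
  let δB : B →+* E := (δ : ProdRing t →+* E).comp (a.val : B →+* ProdRing t)
  have hδB : ∀ z : QuotRing t, δB (a.incl z) =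
      algebraMap F E (algebraMap _ F (toCurveRing t z)) := fun z =>
    (congrArg δ (a.val_incl z)).trans (hδl _)
  let Δ : a.Total →+* E := IsLocalization.Away.lift (a.incl a.u) (g := δB) (by
    rw [hδB, a.map_u, map_pow]
    exact ((he.isUnit).pow 2).map _)
  have hΔ : ∀ z, Δ (algebraMap _ _ z) = δB z := fun z => IsLocalization.Away.lift_eq _ _ _
  have huF : algebraMap (CurveRing t) F (toCurveRing t a.u) ≠ 0 := by
    rw [a.map_u, map_pow]
    exact pow_ne_zero 2 he
  let φ : a.Base →+* F := IsLocalization.Away.lift a.u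
    (g := (algebraMap (CurveRing t) F).comp (toCurveRing t : QuotRing t →+* CurveRing t))
    huF.isUnit
  have hφ : ∀ z, φ (algebraMap _ _ z) = algebraMap _ F (toCurveRing t z) := fun z =>
    IsLocalization.Away.lift_eq _ _ _
  have hφi : Function.Injective φ := by
    rw [injective_iff_map_eq_zero]
    intro z hz
    obtain ⟨n, b, hb⟩ := IsLocalization.Away.surj a.u z
    have h2 := congrArg φ hb
    rw [map_mul, hz, zero_mul, hφ] at h2
    have h3 : b = 0 := toCurveRing_injective (IsFractionRing.injective (CurveRing t) F
      (by rw [← h2, map_zero, map_zero]))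
    rw [h3, map_zero] at hb
    exact ((IsLocalization.Away.algebraMap_isUnit a.u).pow n).mul_left_eq_zero.1 hb
  have hΔφ : Δ.comp a.baseHom = (algebraMap F E).comp φ := by
    refine IsLocalization.ringHom_ext (Submonoid.powers a.u) (RingHom.ext fun z => ?_)
    change Δ (a.baseHom (algebraMap _ _ z)) = algebraMap F E (φ (algebraMap _ _ z))
    rw [baseHom_algebraMap, hΔ, hδB, hφ]
  have hs : Δ (algebraMap _ _ a.s) = DoubleCover.x _ := by
    rw [hΔ]
    exact (congrArg δ a.val_s).trans <| (hδr _).trans (CurveRing.lift_r _ _ _)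
  have hw : Δ (algebraMap _ _ a.w) = algebraMap F E (algebraMap _ F a.e) * DoubleCover.y _ := by
    rw [hΔ]
    refine (congrArg δ a.val_w).trans ?_
    rw [map_mul, hδl, hδr, CurveRing.lift_D]
  rw [injective_iff_map_eq_zero]
  intro z hz
  have h2 := congrArg Δ hz
  have h2' : Δ (a.coverHom z) =
      Polynomial.aeval (DoubleCover.x ((quartic t).map (algebraMap K F))) (z.re.map φ) +
      Polynomial.aeval (DoubleCover.x ((quartic t).map (algebraMap K F))) (z.im.map φ) *
        (algebraMap F E (algebraMap _ F a.e) *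
          DoubleCover.y ((quartic t).map (algebraMap K F))) := by
    rw [coverHom, DoubleCover.lift_apply, map_add, map_mul, Polynomial.hom_eval₂,
      Polynomial.hom_eval₂, hΔφ, hs, hw, ← Polynomial.eval₂_map, ← Polynomial.eval₂_map,
      ← Polynomial.aeval_def, ← Polynomial.aeval_def]
  have h3 : Polynomial.aeval (DoubleCover.x ((quartic t).map (algebraMap K F))) (z.re.map φ) +
      Polynomial.aeval (DoubleCover.x ((quartic t).map (algebraMap K F)))
        (z.im.map φ * Polynomial.C (algebraMap _ F a.e)) *
          DoubleCover.y ((quartic t).map (algebraMap K F)) =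
      Polynomial.aeval (DoubleCover.x ((quartic t).map (algebraMap K F))) (0 : F[X]) +
      Polynomial.aeval (DoubleCover.x ((quartic t).map (algebraMap K F))) (0 : F[X]) *
        DoubleCover.y ((quartic t).map (algebraMap K F)) := by
    rw [map_zero, zero_mul, add_zero, map_mul, Polynomial.aeval_C, mul_assoc]
    exact h2'.symm.trans (h2.trans (map_zero Δ))
  obtain ⟨h4, h5⟩ := DoubleCover.ext_basis h3
  have h6 : z.re = 0 := Polynomial.map_injective φ hφi (by rw [h4, Polynomial.map_zero])
  have h7 : z.im = 0 := Polynomial.map_injective φ hφi (by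
    rw [Polynomial.map_zero]
    exact (mul_eq_zero.1 h5).resolve_right (Polynomial.C_ne_zero.2 he))
  exact QuadraticAlgebra.ext h6 h7

theorem specMap_ofHom_comp₄ {R₁ R₂ R₃ R₄ R₅ : Type} [CommRing R₁] [CommRing R₂] [CommRing R₃]
    [CommRing R₄] [CommRing R₅] (f₁ : R₁ →+* R₂) (f₂ : R₂ →+* R₃) (f₃ : R₃ →+* R₄)
    (f₄ : R₄ →+* R₅) : Spec.map (CommRingCat.ofHom (((f₄.comp f₃).comp f₂).comp f₁)) =
      Spec.map (CommRingCat.ofHom f₄) ≫ Spec.map (CommRingCat.ofHom f₃) ≫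
        Spec.map (CommRingCat.ofHom f₂) ≫ Spec.map (CommRingCat.ofHom f₁) := by
  simp only [← Spec.map_comp, ← CommRingCat.ofHom_comp, RingHom.comp_assoc]

theorem comp_smooth {X Y Z : Scheme.{0}} {f : X ⟶ Y} {g : Y ⟶ Z} {n m : ℕ}
    (hf : SmoothOfRelativeDimension n f) (hg : SmoothOfRelativeDimension m g) :
    SmoothOfRelativeDimension (n + m) (f ≫ g) := inferInstance

/-- A tower: a smooth double cover of relative dimension one over an open subscheme of the quotient
curve, which is itself a smooth curve. -/
theorem smooth [CharZero K] (h0 : t ≠ 0) (h1 : t + 1 ≠ 0) : SmoothOfRelativeDimension 2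
    (Spec.map (CommRingCat.ofHom ((algebraMap B a.Total).comp (algebraMap K B)))) := by
  let e : a.Cover ≃+* a.Total := RingEquiv.ofBijective a.coverHom
    ⟨a.coverHom_injective h0 h1, a.coverHom_surjective⟩
  have : IsIso (CommRingCat.ofHom a.coverHom) := e.toCommRingCatIso.isIso_hom
  have h2 : IsUnit (2 : a.Base) := by
    rw [← map_ofNat (algebraMap K a.Base)]
    exact (IsUnit.mk0 (2 : K) two_ne_zero).map _
  have hcop : IsCoprime ((quartic t).map (algebraMap K a.Base))
      (Polynomial.derivative ((quartic t).map (algebraMap K a.Base))) := by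
    rw [Polynomial.derivative_map]
    exact (quartic_isCoprime t h0 h1).map (Polynomial.mapRingHom (algebraMap K a.Base))
  have hs1 : SmoothOfRelativeDimension 1
      (Spec.map (CommRingCat.ofHom (algebraMap a.Base a.Cover))) :=
    (HasRingHomProperty.Spec_iff (P := @SmoothOfRelativeDimension 1)).2
      (DoubleCover.locally_smooth (IsLocalization.Away.mul_invSelf a.u)
        ((quartic_monic t).map _) hcop h2)
  have hs2 : SmoothOfRelativeDimension 1
      (Spec.map (CommRingCat.ofHom (algebraMap K (QuotRing t)))) :=
    (HasRingHomProperty.Spec_iff (P := @SmoothOfRelativeDimension 1)).2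
      (QuotRing.locally_smooth h0 h1)
  have ho : IsOpenImmersion (Spec.map (CommRingCat.ofHom (algebraMap (QuotRing t) a.Base))) :=
    AlgebraicGeometry.IsOpenImmersion.of_isLocalization a.u
  have heq : (algebraMap B a.Total).comp (algebraMap K B) =
      ((a.coverHom.comp (algebraMap a.Base a.Cover)).comp (algebraMap (QuotRing t) a.Base)).comp
        (algebraMap K (QuotRing t)) := by
    rw [coverHom, DoubleCover.lift_comp_algebraMap, RingHom.comp_assoc, ← baseHom_comp,
      IsScalarTower.algebraMap_eq K (QuotRing t) a.Base]
  have he : Spec.map (CommRingCat.ofHom ((algebraMap B a.Total).comp (algebraMap K B))) =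
      Spec.map (CommRingCat.ofHom a.coverHom) ≫
        Spec.map (CommRingCat.ofHom (algebraMap a.Base a.Cover)) ≫
          Spec.map (CommRingCat.ofHom (algebraMap (QuotRing t) a.Base)) ≫
            Spec.map (CommRingCat.ofHom (algebraMap K (QuotRing t))) := by
    rw [heq]
    exact specMap_ofHom_comp₄ _ _ _ _
  rw [he]
  have h3 := comp_smooth (n := 0) inferInstance hs2 (f := Spec.map (CommRingCat.ofHom (algebraMap (QuotRing t) a.Base)))
  have h4 := comp_smooth hs1 h3
  have h5 : SmoothOfRelativeDimension 0 (Spec.map (CommRingCat.ofHom a.coverHom)) := inferInstance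
  exact comp_smooth h5 h4

end AntiInvariant

theorem smooth_of_span_eq_one {u v x y : B} (h : x * u + y * v = 1) {n : ℕ}
    (hu : SmoothOfRelativeDimension n (Spec.map (CommRingCat.ofHom
      ((algebraMap B (Localization.Away u)).comp (algebraMap K B)))))
    (hv : SmoothOfRelativeDimension n (Spec.map (CommRingCat.ofHom
      ((algebraMap B (Localization.Away v)).comp (algebraMap K B))))) :
    SmoothOfRelativeDimension n (Spec.map (CommRingCat.ofHom (algebraMap K B))) := by
  let g : Bool → B := fun i => bif i then u else v
  let f : ∀ i : Bool, Spec (.of (Localization.Away (g i))) ⟶ Spec (.of B) := fun i =>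
    Spec.map (CommRingCat.ofHom (algebraMap B (Localization.Away (g i))))
  have ho : ∀ i, IsOpenImmersion (f i) := fun i =>
    AlgebraicGeometry.IsOpenImmersion.of_isLocalization (g i)
  have hcov : ∀ z : Spec (.of B), ∃ i, z ∈ Set.range (f i) := by
    intro z
    have hz : ∃ i, g i ∉ z.asIdeal := by
      by_contra! h2
      refine z.isPrime.ne_top ((Ideal.eq_top_iff_one _).2 ?_)
      rw [← h]
      exact add_mem (Ideal.mul_mem_left _ _ (h2 true)) (Ideal.mul_mem_left _ _ (h2 false))
    obtain ⟨i, hi⟩ := hz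
    exact ⟨i, (range_specMap_away (g i) z).2 hi⟩
  let 𝒰 : (Spec (.of B)).OpenCover := Scheme.Cover.mkOfCovers _ _ f hcov ho
  refine (IsZariskiLocalAtSource.iff_of_openCover (P := @SmoothOfRelativeDimension n) 𝒰).2
    fun (i : Bool) => ?_
  have key : ∀ i, SmoothOfRelativeDimension n (f i ≫
      Spec.map (CommRingCat.ofHom (algebraMap K B))) := by
    rintro (_ | _)
    · rwa [CommRingCat.ofHom_comp, Spec.map_comp] at hv
    · rwa [CommRingCat.ofHom_comp, Spec.map_comp] at hu
  exact key i

theorem map_bezout {A : Type} [CommRing A] [Algebra K A] (f : A →ₐ[K] B) {x u y v : A}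
    (h : x * u + y * v = 1) : f x * f u + f y * f v = 1 := by
  rw [← map_mul, ← map_mul, ← map_add, h, map_one]

theorem AntiInvariant.smooth_of_bezout [CharZero K] (h0 : t ≠ 0) (h1 : t + 1 ≠ 0)
    (a b : AntiInvariant t B) (hab : b.incl = a.incl) {x y : QuotRing t}
    (h : x * a.u + y * b.u = 1) :
    SmoothOfRelativeDimension 2 (Spec.map (CommRingCat.ofHom (algebraMap K B))) :=
  smooth_of_span_eq_one (u := a.incl a.u) (v := b.incl b.u)
    (by rw [hab]; exact map_bezout a.incl h) (a.smooth h0 h1) (b.smooth h0 h1)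

/-- The function `r`. -/
def antiInvariantR (t : K) : AntiInvariant t (ProdRing.invariants t) where
  val := (ProdRing.invariants t).val
  incl := toInvariants t
  val_incl _ := rfl
  val_injective := Subtype.val_injective
  s := ⟨_, ProdRing.r₂_mem⟩
  v₁ := ⟨_, ProdRing.r₁_D₂_mem⟩
  v₂ := ⟨_, ProdRing.D₁_D₂_mem⟩
  val_s := rfl
  val_v₁ := rfl
  val_v₂ := rfl
  adjoin_eq_top := adjoin_invariants_eq_top t
  e := CurveRing.r t
  u := DoubleCover.x _
  c₁ := DoubleCover.x _
  c₂ := DoubleCover.y _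
  w := ⟨_, ProdRing.r₁_D₂_mem⟩
  map_u := toCurveRing_x
  map_c₁ := by rw [toCurveRing_x, sq]
  map_c₂ := toCurveRing_y
  ne_zero h := Polynomial.X_ne_zero (R := K) (CurveRing.aeval_r_injective (t := t) (by
      rw [Polynomial.aeval_X, h, map_zero]))
  val_w := rfl

theorem toCurveRing_quadratic : toCurveRing t (Polynomial.aeval (DoubleCover.x _) (quadratic t)) =
    CurveRing.D t ^ 2 := by
  rw [← Polynomial.aeval_algHom_apply, toCurveRing_x, CurveRing.D_sq]
  simp only [quadratic, map_mul, map_add, map_sub, map_pow, map_one, Polynomial.aeval_X,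
    Polynomial.aeval_C]
  ring

/-- The function `D`. -/
def antiInvariantD (t : K) : AntiInvariant t (ProdRing.invariants t) where
  __ := antiInvariantR t
  w := ⟨_, ProdRing.D₁_D₂_mem⟩
  e := CurveRing.D t
  u := Polynomial.aeval (DoubleCover.x _) (quadratic t)
  c₁ := DoubleCover.y _
  c₂ := Polynomial.aeval (DoubleCover.x _) (quadratic t)
  map_u := toCurveRing_quadratic
  map_c₁ := by rw [toCurveRing_y, mul_comm]
  map_c₂ := by rw [toCurveRing_quadratic, sq]
  ne_zero h := by
    have h2 := DoubleCover.ext_basis (g := quartic t) (p := 0) (q := 1) (p' := 0) (q' := 0) (by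
      rw [map_one, map_zero, zero_mul, one_mul, zero_add, add_zero]; exact h)
    exact one_ne_zero h2.2
  val_w := rfl

/-- The loci where `r₁` and `D₁` are invertible cover the surface: `D₁²` is a polynomial in `r₁²`
with constant term `1`, which gives the Bézout relation. -/
theorem smooth_invariants [CharZero K] (h0 : t ≠ 0) (h1 : t + 1 ≠ 0) :
    SmoothOfRelativeDimension 2
      (Spec.map (CommRingCat.ofHom (R := K) (S := ProdRing.invariants t) (algebraMap _ _))) := by
  refine AntiInvariant.smooth_of_bezout h0 h1 (antiInvariantR t) (antiInvariantD t) rfl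
    (x := -(DoubleCover.x _ - algebraMap K _ (2 * (2 * t + 1)))) (y := 1) ?_
  change -(DoubleCover.x (quotPoly t) - algebraMap K _ (2 * (2 * t + 1))) *
    DoubleCover.x (quotPoly t) + 1 * Polynomial.aeval (DoubleCover.x (quotPoly t)) (quadratic t) = 1
  simp only [quadratic, map_mul, map_add, map_sub, map_pow, map_one, Polynomial.aeval_X,
    Polynomial.aeval_C]
  ring

theorem Surface.smooth_hom [CharZero K] (h0 : t ≠ 0) (h1 : t + 1 ≠ 0) :
    SmoothOfRelativeDimension 2 (Surface.hom t) := by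
  let 𝒰 : (Surface t).OpenCover := Scheme.Cover.mkOfCovers _ _ (Surface.chart t)
    Surface.exists_mem_range_chart inferInstance
  refine (IsZariskiLocalAtSource.iff_of_openCover (P := @SmoothOfRelativeDimension 2) 𝒰).2
    fun (p : Bool × Bool) => ?_
  have key : ∀ p, SmoothOfRelativeDimension 2 (Surface.chart t p ≫ Surface.hom t) := by
    intro p
    rw [Surface.chart_hom]
    exact smooth_invariants h0 h1
  exact key p

end LocalStructure

end

/-! ### Extension of the base field -/

section

open scoped TensorProduct Polynomial

section Generic

variable {K L : Type} [Field K] [Field L] [Algebra K L]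

/-- The comparison `L ⊗ A → B` is onto because `φ(A)` generates `B`, and injective because followed
by `g` it is `L ⊗ j`, which is injective by flatness. In this form no presentation of the ring of
invariants is needed. -/
theorem isPullback_specMap_of_adjoin {A A' B : Type} [CommRing A] [CommRing A'] [CommRing B]
    [Algebra K A] [Algebra K A'] [Algebra L B] {φ : A →+* B}
    (hφ : φ.comp (algebraMap K A) = (algebraMap L B).comp (algebraMap K L))
    (hsurj : Algebra.adjoin L (Set.range φ) = ⊤) {j : A →ₐ[K] A'} (hj : Function.Injective j)
    {g : B →+* L ⊗[K] A'} (hg : ∀ a, g (φ a) = 1 ⊗ₜ j a)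
    (hg' : ∀ l, g (algebraMap L B l) = l ⊗ₜ 1) :
    IsPullback (Spec.map (CommRingCat.ofHom φ)) (Spec.map (CommRingCat.ofHom (algebraMap L B)))
      (Spec.map (CommRingCat.ofHom (algebraMap K A)))
      (Spec.map (CommRingCat.ofHom (algebraMap K L))) := by
  let : Algebra K B := ((algebraMap L B).comp (algebraMap K L)).toAlgebra
  have : IsScalarTower K L B := .of_algebraMap_eq' rfl
  let : Algebra A B := φ.toAlgebra
  have : IsScalarTower K A B := .of_algebraMap_eq' hφ.symm
  let f : L ⊗[K] A →ₐ[L] B := Algebra.TensorProduct.lift (Algebra.ofId L B)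
    (IsScalarTower.toAlgHom K A B) fun _ _ => Commute.all _ _
  have hf : ∀ (l : L) (a : A), f (l ⊗ₜ a) = algebraMap L B l * φ a := fun l a =>
    Algebra.TensorProduct.lift_tmul _ _ _ _ _
  have hf1 : ∀ a : A, f (1 ⊗ₜ a) = φ a := fun a => by rw [hf, map_one, one_mul]
  have hfs : Function.Surjective f := by
    rw [← AlgHom.range_eq_top, ← top_le_iff, ← hsurj]
    refine Algebra.adjoin_le ?_
    rintro _ ⟨a, rfl⟩
    exact ⟨1 ⊗ₜ a, hf1 a⟩
  have hgf : ∀ z, g (f z) = LinearMap.lTensor L j.toLinearMap z := by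
    intro z
    induction z with
    | zero => simp
    | tmul l a =>
      rw [hf, map_mul, hg, hg', Algebra.TensorProduct.tmul_mul_tmul, mul_one, one_mul]
      rfl
    | add x y hx hy => rw [map_add, map_add, map_add, hx, hy]
  have hfi : Function.Injective f := by
    intro x y hxy
    refine Module.Flat.lTensor_preserves_injective_linearMap (M := L) j.toLinearMap hj ?_
    rw [← hgf, ← hgf, hxy]
  have : Algebra.IsPushout K L A B := ⟨IsBaseChange.of_equiv
    (LinearEquiv.ofBijective f.toLinearMap ⟨hfi, hfs⟩) hf1⟩
  exact (isPullback_SpecMap_of_isPushout _ _ _ _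
    (CommRingCat.isPushout_of_isPushout K L A B)).flip

theorem isPullback_specMap_subalgebra {A' B' : Type} [CommRing A'] [CommRing B'] [Algebra K A']
    [Algebra L B'] {S : Subalgebra K A'} {S' : Subalgebra L B'} {φ : S →+* S'}
    (hφ : φ.comp (algebraMap K S) = (algebraMap L S').comp (algebraMap K L))
    (hsurj : Algebra.adjoin L (Set.range φ) = ⊤) {g : B' →+* L ⊗[K] A'}
    (hg : ∀ a : S, g (φ a) = 1 ⊗ₜ (a : A')) (hg' : ∀ l, g (algebraMap L B' l) = l ⊗ₜ 1) :
    IsPullback (Spec.map (CommRingCat.ofHom φ))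
      (Spec.map (CommRingCat.ofHom (R := L) (S := S') (algebraMap _ _)))
      (Spec.map (CommRingCat.ofHom (R := K) (S := S) (algebraMap _ _)))
      (Spec.map (CommRingCat.ofHom (algebraMap K L))) :=
  isPullback_specMap_of_adjoin (A := S) (B := S') hφ hsurj (j := S.val) Subtype.val_injective
    (g := g.comp (S'.val : S' →+* B')) hg hg'

theorem exists_includeRight {A : Type} [CommRing A] [Algebra K A] : ∃ ι : A →+* L ⊗[K] A,
    (∀ a, ι a = 1 ⊗ₜ a) ∧ ∀ x, ι (algebraMap K A x) = algebraMap L _ (algebraMap K L x) :=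
  ⟨(Algebra.TensorProduct.includeRight : A →ₐ[K] L ⊗[K] A), fun _ => rfl, fun x =>
    ((Algebra.TensorProduct.includeRight : A →ₐ[K] L ⊗[K] A).commutes x).trans
      (IsScalarTower.algebraMap_apply K L (L ⊗[K] A) x)⟩

end Generic

section Rings

variable {K L : Type} [Field K] [Field L] [Algebra K L] {t : K} {t' : L}

theorem CurveRing.exists_ringHom {R : Type} [CommRing R] (c : K →+* R) (a b : R)
    (h : b ^ 2 = a ^ 4 - c (2 * (2 * t + 1)) * a ^ 2 + 1) : ∃ φ : CurveRing t →+* R,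
      φ.comp (algebraMap K _) = c ∧ φ (CurveRing.r t) = a ∧ φ (CurveRing.D t) = b := by
  algebraize [c]
  exact ⟨CurveRing.lift (R := R) (t := t) a b h,
    AlgHom.comp_algebraMap (CurveRing.lift (R := R) (t := t) a b h), CurveRing.lift_r a b h,
    CurveRing.lift_D a b h⟩

theorem ProdRing.exists_ringHom {R : Type} [CommRing R] (f g : CurveRing t →+* R)
    (h : f.comp (algebraMap K _) = g.comp (algebraMap K _)) : ∃ φ : ProdRing t →+* R,
      φ.comp (ProdRing.inl t : CurveRing t →+* ProdRing t) = f ∧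
      φ.comp (ProdRing.inr t : CurveRing t →+* ProdRing t) = g := by
  algebraize [f.comp (algebraMap K _)]
  let f' : CurveRing t →ₐ[K] R := { f with commutes' := fun c => rfl }
  let g' : CurveRing t →ₐ[K] R := { g with commutes' := fun c => (RingHom.congr_fun h c).symm }
  have hc : ∀ x y, Commute (f' x) (g' y) := fun _ _ => Commute.all _ _
  let φ : ProdRing t →ₐ[K] R := Algebra.TensorProduct.lift f' g' hc
  refine ⟨φ, RingHom.ext fun x => ?_, RingHom.ext fun x => ?_⟩
  · refine (Algebra.TensorProduct.lift_tmul f' g' hc x 1).trans ?_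
    rw [map_one, mul_one]
    rfl
  · refine (Algebra.TensorProduct.lift_tmul f' g' hc 1 x).trans ?_
    rw [map_one, one_mul]
    rfl

variable (ht : t' = algebraMap K L t)
include ht

theorem CurveRing.exists_baseChange : ∃ φ : CurveRing t →+* CurveRing t',
    φ.comp (algebraMap K _) = (algebraMap L _).comp (algebraMap K L) ∧
      φ (CurveRing.r t) = CurveRing.r t' ∧ φ (CurveRing.D t) = CurveRing.D t' :=
  CurveRing.exists_ringHom _ _ _ (by
    rw [CurveRing.D_sq, ht]
    simp only [RingHom.comp_apply, map_mul, map_add, map_one, map_ofNat])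

/-- The base change homomorphism of the coordinate ring of the curve. -/
def CurveRing.baseChange : CurveRing t →+* CurveRing t' := (CurveRing.exists_baseChange ht).choose

theorem CurveRing.baseChange_comp : (CurveRing.baseChange ht).comp (algebraMap K _) =
    (algebraMap L _).comp (algebraMap K L) := (CurveRing.exists_baseChange ht).choose_spec.1

theorem CurveRing.baseChange_r : CurveRing.baseChange ht (CurveRing.r t) = CurveRing.r t' :=
  (CurveRing.exists_baseChange ht).choose_spec.2.1

theorem CurveRing.baseChange_D : CurveRing.baseChange ht (CurveRing.D t) = CurveRing.D t' :=
  (CurveRing.exists_baseChange ht).choose_spec.2.2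

theorem CurveRing.baseChange_sgnHom (ε δ : ℤˣ) (z : CurveRing t) :
    CurveRing.baseChange ht (sgnHom t ε δ z) = sgnHom t' ε δ (CurveRing.baseChange ht z) := by
  have h : (CurveRing.baseChange ht).comp (sgnHom t ε δ : CurveRing t →+* CurveRing t) =
      (sgnHom t' ε δ : CurveRing t' →+* CurveRing t').comp (CurveRing.baseChange ht) := by
    refine ringHom_ext ?_ ?_ ?_
    · rw [RingHom.comp_assoc, AlgHom.comp_algebraMap, baseChange_comp, RingHom.comp_assoc,
        baseChange_comp, ← RingHom.comp_assoc, AlgHom.comp_algebraMap]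
    · simp only [RingHom.comp_apply, RingHom.coe_coe, sgnHom_r, baseChange_r, map_mul, map_intCast]
    · simp only [RingHom.comp_apply, RingHom.coe_coe, sgnHom_D, baseChange_D, map_mul, map_intCast]
  exact RingHom.congr_fun h z

theorem ProdRing.exists_baseChange : ∃ φ : ProdRing t →+* ProdRing t',
    φ.comp (ProdRing.inl t : CurveRing t →+* ProdRing t) =
      (ProdRing.inl t' : CurveRing t' →+* ProdRing t').comp (CurveRing.baseChange ht) ∧
    φ.comp (ProdRing.inr t : CurveRing t →+* ProdRing t) =
      (ProdRing.inr t' : CurveRing t' →+* ProdRing t').comp (CurveRing.baseChange ht) :=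
  ProdRing.exists_ringHom _ _ (by
    rw [RingHom.comp_assoc, RingHom.comp_assoc, CurveRing.baseChange_comp, ← RingHom.comp_assoc,
      ← RingHom.comp_assoc, AlgHom.comp_algebraMap, AlgHom.comp_algebraMap])

/-- The base change homomorphism of the coordinate ring of the product. -/
def ProdRing.baseChange : ProdRing t →+* ProdRing t' := (ProdRing.exists_baseChange ht).choose

theorem ProdRing.baseChange_comp_inl :
    (ProdRing.baseChange ht).comp (ProdRing.inl t : CurveRing t →+* ProdRing t) =
      (ProdRing.inl t' : CurveRing t' →+* ProdRing t').comp (CurveRing.baseChange ht) :=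
  (ProdRing.exists_baseChange ht).choose_spec.1

theorem ProdRing.baseChange_comp_inr :
    (ProdRing.baseChange ht).comp (ProdRing.inr t : CurveRing t →+* ProdRing t) =
      (ProdRing.inr t' : CurveRing t' →+* ProdRing t').comp (CurveRing.baseChange ht) :=
  (ProdRing.exists_baseChange ht).choose_spec.2

theorem ProdRing.baseChange_inl (z : CurveRing t) : ProdRing.baseChange ht (ProdRing.inl t z) =
    ProdRing.inl t' (CurveRing.baseChange ht z) :=
  RingHom.congr_fun (ProdRing.baseChange_comp_inl ht) z

theorem ProdRing.baseChange_inr (z : CurveRing t) : ProdRing.baseChange ht (ProdRing.inr t z) =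
    ProdRing.inr t' (CurveRing.baseChange ht z) :=
  RingHom.congr_fun (ProdRing.baseChange_comp_inr ht) z

theorem ProdRing.baseChange_comp : (ProdRing.baseChange ht).comp (algebraMap K _) =
    (algebraMap L _).comp (algebraMap K L) := by
  rw [← AlgHom.comp_algebraMap (ProdRing.inl t), ← AlgHom.comp_algebraMap (ProdRing.inl t'),
    ← RingHom.comp_assoc, ProdRing.baseChange_comp_inl, RingHom.comp_assoc, RingHom.comp_assoc,
    CurveRing.baseChange_comp]

theorem ProdRing.sigma_comp_baseChange :
    (ProdRing.baseChange ht).comp (sigma t : ProdRing t →+* ProdRing t) =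
      (sigma t' : ProdRing t' →+* ProdRing t').comp (ProdRing.baseChange ht) := by
  refine ProdRing.ringHom_ext (RingHom.ext fun z => ?_) (RingHom.ext fun z => ?_)
  · change baseChange ht (sigma t (inl t z)) = sigma t' (baseChange ht (inl t z))
    rw [sigma_inl, baseChange_inl, baseChange_inl, sigma_inl, CurveRing.baseChange_sgnHom]
  · change baseChange ht (sigma t (inr t z)) = sigma t' (baseChange ht (inr t z))
    rw [sigma_inr, baseChange_inr, baseChange_inr, sigma_inr, CurveRing.baseChange_sgnHom]

/-- The generators of the ring of invariants. -/
theorem ProdRing.baseChange_generators :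
    ProdRing.baseChange ht (inl t (CurveRing.r t) ^ 2) = inl t' (CurveRing.r t') ^ 2 ∧
    ProdRing.baseChange ht (inl t (CurveRing.r t) * inl t (CurveRing.D t)) =
      inl t' (CurveRing.r t') * inl t' (CurveRing.D t') ∧
    ProdRing.baseChange ht (inr t (CurveRing.r t)) = inr t' (CurveRing.r t') ∧
    ProdRing.baseChange ht (inl t (CurveRing.r t) * inr t (CurveRing.D t)) =
      inl t' (CurveRing.r t') * inr t' (CurveRing.D t') ∧
    ProdRing.baseChange ht (inl t (CurveRing.D t) * inr t (CurveRing.D t)) =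
      inl t' (CurveRing.D t') * inr t' (CurveRing.D t') := by
  simp only [map_mul, map_pow, baseChange_inl, baseChange_inr, CurveRing.baseChange_r,
    CurveRing.baseChange_D, and_self]

theorem ProdRing.baseChange_mem {z : ProdRing t} (hz : z ∈ invariants t) :
    ProdRing.baseChange ht z ∈ invariants t' := by
  obtain ⟨h1, h2, h3, h4, h5⟩ := baseChange_generators ht
  induction hz using Algebra.adjoin_induction with
  | mem x hx =>
    rcases hx with rfl | rfl | rfl | rfl | rfl
    · rw [h1]; exact r₁_sq_mem
    · rw [h2]; exact r₁_D₁_mem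
    · rw [h3]; exact r₂_mem
    · rw [h4]; exact r₁_D₂_mem
    · rw [h5]; exact D₁_D₂_mem
  | algebraMap c =>
    rw [show baseChange ht (algebraMap K _ c) = algebraMap L _ (algebraMap K L c) from
      RingHom.congr_fun (baseChange_comp ht) c]
    exact algebraMap_mem _ _
  | add x y _ _ hx hy => rw [map_add]; exact add_mem hx hy
  | mul x y _ _ hx hy => rw [map_mul]; exact mul_mem hx hy

/-- The base change homomorphism of the ring of invariants. -/
def ProdRing.baseChangeInvariants : invariants t →+* invariants t' :=
  ((ProdRing.baseChange ht).comp ((invariants t).val : invariants t →+* ProdRing t)).codRestrict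
    (invariants t') fun z => baseChange_mem ht z.2

theorem ProdRing.adjoin_range_baseChangeInvariants :
    Algebra.adjoin L (Set.range (baseChangeInvariants ht)) = ⊤ := by
  obtain ⟨h1, h2, h3, h4, h5⟩ := baseChange_generators ht
  refine top_unique fun x _ => ?_
  obtain ⟨x, hx⟩ := x
  induction hx using Algebra.adjoin_induction with
  | mem x hx =>
    refine Algebra.subset_adjoin ?_
    rcases hx with rfl | rfl | rfl | rfl | rfl
    · exact ⟨⟨_, r₁_sq_mem⟩, Subtype.ext h1⟩
    · exact ⟨⟨_, r₁_D₁_mem⟩, Subtype.ext h2⟩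
    · exact ⟨⟨_, r₂_mem⟩, Subtype.ext h3⟩
    · exact ⟨⟨_, r₁_D₂_mem⟩, Subtype.ext h4⟩
    · exact ⟨⟨_, D₁_D₂_mem⟩, Subtype.ext h5⟩
  | algebraMap c => exact algebraMap_mem (Algebra.adjoin L _) c
  | add x y hx' hy' hx hy => exact add_mem (hx trivial) (hy trivial)
  | mul x y hx' hy' hx hy => exact mul_mem (hx trivial) (hy trivial)

/-- Over `L` the product ring is determined by the same equations, with `t'` the image of `t`, so a
homomorphism out of the ring over `K` extends. -/
theorem ProdRing.exists_lift {T : Type} [CommRing T] [Algebra L T] (ι : ProdRing t →+* T)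
    (hιc : ∀ x, ι (algebraMap K _ x) = algebraMap L T (algebraMap K L x)) :
    ∃ g : ProdRing t' →+* T, (∀ a, g (ProdRing.baseChange ht a) = ι a) ∧
      ∀ l, g (algebraMap L _ l) = algebraMap L T l := by
  have key : ∀ j : CurveRing t →ₐ[K] ProdRing t, ι (j (CurveRing.D t)) ^ 2 =
      ι (j (CurveRing.r t)) ^ 4 - algebraMap L T (2 * (2 * t' + 1)) *
        ι (j (CurveRing.r t)) ^ 2 + 1 := by
    intro j
    have h := congrArg (fun z => ι (j z)) (CurveRing.D_sq (t := t))
    have h2 : ι (j (algebraMap K _ (2 * (2 * t + 1)))) = algebraMap L T (2 * (2 * t' + 1)) := by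
      rw [j.commutes, hιc, ht]
      simp only [map_mul, map_add, map_one, map_ofNat]
    rw [map_pow, map_pow] at h
    rw [h, map_add, map_sub, map_mul, map_add, map_sub, map_mul, h2]
    simp only [map_pow, map_one]
  let gl : CurveRing t' →ₐ[L] T := CurveRing.lift _ _ (key (inl t))
  let gr : CurveRing t' →ₐ[L] T := CurveRing.lift _ _ (key (inr t))
  have hcomm : ∀ x y, Commute (gl x) (gr y) := fun _ _ => Commute.all _ _
  let g : ProdRing t' →ₐ[L] T := Algebra.TensorProduct.lift gl gr hcomm
  have hl : ∀ z, g (inl t' z) = gl z := fun z =>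
    (Algebra.TensorProduct.lift_tmul gl gr hcomm z 1).trans (by rw [map_one, mul_one])
  have hr : ∀ z, g (inr t' z) = gr z := fun z =>
    (Algebra.TensorProduct.lift_tmul gl gr hcomm 1 z).trans (by rw [map_one, one_mul])
  have hc : ∀ l, g (algebraMap L _ l) = algebraMap L T l := fun l => g.commutes l
  refine ⟨g, fun a => ?_, hc⟩
  have h : (g : ProdRing t' →+* T).comp (ProdRing.baseChange ht) =
      ι := by
    refine ProdRing.ringHom_ext (CurveRing.ringHom_ext (RingHom.ext fun c => ?_) ?_ ?_)
      (CurveRing.ringHom_ext (RingHom.ext fun c => ?_) ?_ ?_)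
    · change g (baseChange ht (inl t (algebraMap K _ c))) = ι (inl t (algebraMap K _ c))
      rw [AlgHom.commutes, hιc, ← hc]
      exact congrArg g (RingHom.congr_fun (baseChange_comp ht) c)
    · change g (baseChange ht (inl t _)) = ι (inl t _)
      rw [baseChange_inl, CurveRing.baseChange_r, hl]
      exact CurveRing.lift_r _ _ (key (inl t))
    · change g (baseChange ht (inl t _)) = ι (inl t _)
      rw [baseChange_inl, CurveRing.baseChange_D, hl]
      exact CurveRing.lift_D _ _ (key (inl t))
    · change g (baseChange ht (inr t (algebraMap K _ c))) = ι (inr t (algebraMap K _ c))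
      rw [AlgHom.commutes, hιc, ← hc]
      exact congrArg g (RingHom.congr_fun (baseChange_comp ht) c)
    · change g (baseChange ht (inr t _)) = ι (inr t _)
      rw [baseChange_inr, CurveRing.baseChange_r, hr]
      exact CurveRing.lift_r _ _ (key (inr t))
    · change g (baseChange ht (inr t _)) = ι (inr t _)
      rw [baseChange_inr, CurveRing.baseChange_D, hr]
      exact CurveRing.lift_D _ _ (key (inr t))
  exact RingHom.congr_fun h a

theorem ProdRing.exists_tensor : ∃ g : ProdRing t' →+* L ⊗[K] ProdRing t,
    (∀ a, g (ProdRing.baseChange ht a) = 1 ⊗ₜ a) ∧ ∀ l, g (algebraMap L _ l) = l ⊗ₜ 1 := by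
  obtain ⟨ι, h1, h2⟩ := exists_includeRight (L := L) (A := ProdRing t) (K := K)
  obtain ⟨g, hg, hg'⟩ := ProdRing.exists_lift ht ι h2
  exact ⟨g, fun a => (hg a).trans (h1 a), hg'⟩

end Rings

section Schemes

variable {K L : Type} [Field K] [Field L] [Algebra K L] {t : K} {t' : L}
  (ht : t' = algebraMap K L t)
include ht

theorem isPullback_invariants :
    IsPullback (Spec.map (CommRingCat.ofHom (ProdRing.baseChangeInvariants ht)))
      (Spec.map (CommRingCat.ofHom (R := L) (S := ProdRing.invariants t') (algebraMap _ _)))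
      (Spec.map (CommRingCat.ofHom (R := K) (S := ProdRing.invariants t) (algebraMap _ _)))
      (Spec.map (CommRingCat.ofHom (algebraMap K L))) := by
  obtain ⟨g, hg, hg'⟩ := ProdRing.exists_tensor ht
  exact isPullback_specMap_subalgebra
    (RingHom.ext fun c => Subtype.ext (RingHom.congr_fun (ProdRing.baseChange_comp ht) c))
    (ProdRing.adjoin_range_baseChangeInvariants ht) (fun a => hg _) hg'

theorem Curve.exists_baseChange : ∃ k : Curve t' ⟶ Curve t, ∀ i, Curve.chart t' i ≫ k =
    Spec.map (CommRingCat.ofHom (CurveRing.baseChange ht)) ≫ Curve.chart t i := by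
  refine Curve.exists_desc _ fun i j R _ α β h => ?_
  rw [← Category.assoc, ← Category.assoc, ← Spec.map_comp, ← Spec.map_comp,
    ← CommRingCat.ofHom_comp, ← CommRingCat.ofHom_comp, Curve.specMap_chart_eq_iff]
  refine ⟨?_, ?_⟩
  · rw [RingHom.comp_assoc, RingHom.comp_assoc, CurveRing.baseChange_comp, ← RingHom.comp_assoc,
      ← RingHom.comp_assoc, h.1]
  · simp only [RingHom.comp_apply, CurveRing.baseChange_r, CurveRing.baseChange_D]
    exact h.2

/-- The base change morphism of the curve. -/
def Curve.baseChange : Curve t' ⟶ Curve t := (Curve.exists_baseChange ht).choose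

theorem Curve.chart_baseChange (i : Bool) : Curve.chart t' i ≫ Curve.baseChange ht =
    Spec.map (CommRingCat.ofHom (CurveRing.baseChange ht)) ≫ Curve.chart t i :=
  (Curve.exists_baseChange ht).choose_spec i

theorem Curve.baseChange_hom : Curve.baseChange ht ≫ Curve.hom t =
    Curve.hom t' ≫ Spec.map (CommRingCat.ofHom (algebraMap K L)) := by
  refine Curve.hom_ext _ fun i => ?_
  rw [reassoc_of% Curve.chart_baseChange, Curve.chart_hom, ← Category.assoc, Curve.chart_hom,
    ← Spec.map_comp, ← Spec.map_comp, ← CommRingCat.ofHom_comp, ← CommRingCat.ofHom_comp,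
    CurveRing.baseChange_comp]

theorem Curve.mem_range_chart_of_baseChange {i : Bool} (x : Curve t')
    (hx : Curve.baseChange ht x ∈ Set.range (Curve.chart t i)) :
    x ∈ Set.range (Curve.chart t' i) := by
  obtain ⟨j, z, rfl⟩ := Curve.exists_mem_range_chart t' x
  refine Curve.chart_mem_range z (or_iff_not_imp_left.2 fun hij => ?_)
  have h1 : Curve.baseChange ht (Curve.chart t' j z) =
      Curve.chart t j (Spec.map (CommRingCat.ofHom (CurveRing.baseChange ht)) z) :=
    congrArg (fun f : Spec (.of (CurveRing t')) ⟶ Curve t => f z) (Curve.chart_baseChange ht j)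
  rw [h1] at hx
  have h2 := Curve.notMem_of_chart_mem_range hij _ hx
  intro h3
  refine h2 ?_
  change CurveRing.baseChange ht (CurveRing.r t) ∈ z.asIdeal
  rw [CurveRing.baseChange_r]
  exact h3

namespace Sq

/-- The base change morphism of the product. -/
def baseChange : Sq t' ⟶ Sq t :=
  pullback.map _ _ _ _ (Curve.baseChange ht) (Curve.baseChange ht)
    (Spec.map (CommRingCat.ofHom (algebraMap K L))) (Curve.baseChange_hom ht).symm
    (Curve.baseChange_hom ht).symm

theorem baseChange_fst : baseChange ht ≫ pullback.fst _ _ = pullback.fst _ _ ≫ Curve.baseChange ht :=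
  pullback.lift_fst _ _ _

theorem baseChange_snd : baseChange ht ≫ pullback.snd _ _ = pullback.snd _ _ ≫ Curve.baseChange ht :=
  pullback.lift_snd _ _ _

theorem chart_baseChange (p : Bool × Bool) : chart t' p ≫ baseChange ht =
    Spec.map (CommRingCat.ofHom (ProdRing.baseChange ht)) ≫ chart t p := by
  refine pullback.hom_ext ?_ ?_
  · rw [Category.assoc, Category.assoc, baseChange_fst, chart_fst, reassoc_of% chart_fst,
      Curve.chart_baseChange, ← Category.assoc, ← Category.assoc, ← Spec.map_comp, ← Spec.map_comp,
      ← CommRingCat.ofHom_comp, ← CommRingCat.ofHom_comp, ProdRing.baseChange_comp_inl]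
  · rw [Category.assoc, Category.assoc, baseChange_snd, chart_snd, reassoc_of% chart_snd,
      Curve.chart_baseChange, ← Category.assoc, ← Category.assoc, ← Spec.map_comp, ← Spec.map_comp,
      ← CommRingCat.ofHom_comp, ← CommRingCat.ofHom_comp, ProdRing.baseChange_comp_inr]

theorem mem_range_chart_of_baseChange {p : Bool × Bool} (x : Sq t')
    (hx : baseChange ht x ∈ Set.range (chart t p)) : x ∈ Set.range (chart t' p) := by
  rw [mem_range_chart_iff] at hx ⊢
  have h1 : pullback.fst (Curve.hom t) (Curve.hom t) (baseChange ht x) =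
      Curve.baseChange ht (pullback.fst (Curve.hom t') (Curve.hom t') x) :=
    congrArg (fun f : Sq t' ⟶ Curve t => f x) (baseChange_fst ht)
  have h2 : pullback.snd (Curve.hom t) (Curve.hom t) (baseChange ht x) =
      Curve.baseChange ht (pullback.snd (Curve.hom t') (Curve.hom t') x) :=
    congrArg (fun f : Sq t' ⟶ Curve t => f x) (baseChange_snd ht)
  rw [h1, h2] at hx
  exact ⟨Curve.mem_range_chart_of_baseChange ht _ hx.1,
    Curve.mem_range_chart_of_baseChange ht _ hx.2⟩

theorem baseChange_act (g : Multiplicative (ZMod 2)) :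
    act t' g ≫ baseChange ht = baseChange ht ≫ act t g := by
  rcases multiplicative_zmod_two g with rfl | rfl
  · rw [act_one, act_one, Category.id_comp, Category.comp_id]
  · refine hom_ext fun p => ?_
    rw [← Category.assoc, chart_act, Category.assoc, chart_baseChange, reassoc_of% chart_baseChange,
      chart_act, ← Category.assoc, ← Category.assoc, ← Spec.map_comp, ← Spec.map_comp,
      ← CommRingCat.ofHom_comp, ← CommRingCat.ofHom_comp]
    exact congrArg (fun f => Spec.map (CommRingCat.ofHom f) ≫ chart t p)
      (ProdRing.sigma_comp_baseChange ht).symm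

end Sq

namespace Surface

/-- The base change of the surface. -/
abbrev Extension (L : Type) [Field L] [Algebra K L] (t : K) : Scheme.{0} :=
  pullback (hom t) (Spec.map (CommRingCat.ofHom (algebraMap K L)))

/-- The quotient map to the base change of the surface. -/
def πExtension : Sq t' ⟶ Extension L t :=
  pullback.lift (Sq.baseChange ht ≫ π t) (pullback.fst _ _ ≫ Curve.hom t') (by
    rw [Category.assoc, π_hom, reassoc_of% Sq.baseChange_fst, Curve.baseChange_hom, Category.assoc])

theorem πExtension_fst : πExtension ht ≫ pullback.fst _ _ = Sq.baseChange ht ≫ π t :=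
  pullback.lift_fst _ _ _

theorem πExtension_snd : πExtension ht ≫ pullback.snd _ _ = pullback.fst _ _ ≫ Curve.hom t' :=
  pullback.lift_snd _ _ _

/-- The charts of the base change of the surface. -/
def chartExtension (p : Bool × Bool) : Spec (.of (ProdRing.invariants t')) ⟶ Extension L t :=
  pullback.lift (Spec.map (CommRingCat.ofHom (ProdRing.baseChangeInvariants ht)) ≫ chart t p)
    (Spec.map (CommRingCat.ofHom (R := L) (S := ProdRing.invariants t') (algebraMap _ _))) (by
      rw [Category.assoc, chart_hom]
      exact (isPullback_invariants ht).w)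

theorem chartExtension_fst (p : Bool × Bool) : chartExtension ht p ≫ pullback.fst _ _ =
    Spec.map (CommRingCat.ofHom (ProdRing.baseChangeInvariants ht)) ≫ chart t p :=
  pullback.lift_fst _ _ _

theorem chartExtension_snd (p : Bool × Bool) : chartExtension ht p ≫ pullback.snd _ _ =
    Spec.map (CommRingCat.ofHom (R := L) (S := ProdRing.invariants t') (algebraMap _ _)) :=
  pullback.lift_snd _ _ _

/-- Pasting of fibre products: the base change of the surface restricts over each chart to the base
change of the ring of invariants. -/
theorem isChart_fst (p : Bool × Bool) : Chart
    (pullback.fst (hom t) (Spec.map (CommRingCat.ofHom (algebraMap K L)))) (chartExtension ht p)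
    (chart t p) (Spec.map (CommRingCat.ofHom (ProdRing.baseChangeInvariants ht))) := by
  have h : IsPullback (Spec.map (CommRingCat.ofHom (ProdRing.baseChangeInvariants ht)))
      (chartExtension ht p) (chart t p)
      (pullback.fst (hom t) (Spec.map (CommRingCat.ofHom (algebraMap K L)))) := by
    refine IsPullback.of_bot (v₂₁ := pullback.snd _ _) (v₂₂ := hom t)
      (h₃₁ := Spec.map (CommRingCat.ofHom (algebraMap K L))) ?_ (chartExtension_fst ht p).symm
      (IsPullback.of_hasPullback _ _)
    rw [chartExtension_snd, chart_hom]
    exact isPullback_invariants ht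
  exact .of_isPullback h

theorem isChart_extension (p : Bool × Bool) : Chart (πExtension ht) (Sq.chart t' p)
    (chartExtension ht p) (Spec.map (CommRingCat.ofHom
      ((ProdRing.invariants t').val : ProdRing.invariants t' →+* ProdRing t'))) where
  left := inferInstance
  right := (isChart_fst ht p).left
  comm := by
    refine pullback.hom_ext ?_ ?_
    · rw [Category.assoc, Category.assoc, πExtension_fst, chartExtension_fst,
        reassoc_of% Sq.chart_baseChange, (isChart p).comm, ← Category.assoc, ← Category.assoc,
        ← Spec.map_comp, ← Spec.map_comp]
      rfl
    · rw [Category.assoc, Category.assoc, πExtension_snd, chartExtension_snd, Sq.chart_hom,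
        ← Spec.map_comp]
      rfl
  range_le x hx := by
    obtain ⟨z, hz⟩ := hx
    refine Sq.mem_range_chart_of_baseChange ht x ((isChart p).range_le _ ?_)
    have h1 : π t (Sq.baseChange ht x) = pullback.fst (hom t) _ (πExtension ht x) :=
      congrArg (fun f : Sq t' ⟶ Surface t => f x) (πExtension_fst ht).symm
    rw [h1, ← hz]
    exact ⟨_, (congrArg (fun f : Spec (.of (ProdRing.invariants t')) ⟶ Surface t => f z)
      (chartExtension_fst ht p)).symm⟩

theorem exists_mem_range_chartExtension (y : Extension L t) :
    ∃ p, y ∈ Set.range (chartExtension ht p) := by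
  obtain ⟨p, hp⟩ := exists_mem_range_chart (pullback.fst (hom t) _ y)
  exact ⟨p, (isChart_fst ht p).range_le _ hp⟩

theorem act_πExtension (g : Multiplicative (ZMod 2)) :
    Sq.act t' g ≫ πExtension ht = πExtension ht := by
  refine pullback.hom_ext ?_ ?_
  · rw [Category.assoc, πExtension_fst, ← Category.assoc, Sq.baseChange_act, Category.assoc,
      Sq.act_π]
  · rw [Category.assoc, πExtension_snd]
    rcases multiplicative_zmod_two g with rfl | rfl
    · rw [Sq.act_one, Category.id_comp]
    · rw [Sq.act_hom]

theorem isQuotient_πExtension [CharZero L] : IsQuotient (Sq.act t') (πExtension ht) :=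
  isQuotient_of_charts (act_πExtension ht) (Multiplicative.ofAdd 1) (isChart_extension ht)
    (exists_mem_range_chartExtension ht) Sq.chart_act (fun _ => Subtype.val_injective)
    fun _ a ha => ⟨⟨a, ProdRing.mem_invariants_iff.2 ha⟩, rfl⟩

omit ht in
-- Curve, product, action and quotient were built over an arbitrary base field, so the base change
-- of the surface is compared with the same construction for the image `t'` of `t` in `L`. Both
-- elliptic curves are `legendre t'`; the first factor carries the translation and the second the
-- reflection.
theorem isBiellipticQuotient [CharZero L] [IsAlgClosed L] (h0 : t ≠ 0) (h1 : t + 1 ≠ 0) :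
    IsBiellipticQuotient (pullback.snd (hom t) (Spec.map (CommRingCat.ofHom (algebraMap K L)))) := by
  obtain ⟨t', ht⟩ : ∃ t' : L, t' = algebraMap K L t := ⟨_, rfl⟩
  have h0' : t' ≠ 0 := by
    rw [ht]
    exact (map_ne_zero_iff _ (algebraMap K L).injective).2 h0
  have h1' : t' + 1 ≠ 0 := by
    rw [ht, ← map_one (algebraMap K L), ← map_add]
    exact (map_ne_zero_iff _ (algebraMap K L).injective).2 h1
  refine ⟨legendre t', legendre t', Curve t', Curve t', Curve.hom t', legendre.embedding t' h0' h1',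
    Curve.hom t', legendre.embedding t' h0' h1', Multiplicative (ZMod 2), inferInstance,
    inferInstance, Curve.translationAct t', Curve.reflectionAct t', legendre.isEllipticCurve,
    legendre.isEllipticCurve, involutionAct_injective _ _ Curve.sgn_ne_id, ?_,
    ⟨Curve.proj t', Curve.proj_hom, Curve.isQuotient_proj t'⟩, πExtension ht, πExtension_snd ht,
    isQuotient_πExtension ht⟩
  intro g
  rcases multiplicative_zmod_two g with rfl | rfl
  · rw [Curve.translationAct, involutionAct_one]
    exact legendre.isTranslation_id
  · rw [Curve.translationAct, involutionAct_ofAdd_one]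
    exact legendre.isTranslation_sgn

end Surface

end Schemes

end

/-! ### Semi-algebraic subsets of an interval -/

section

open scoped Polynomial Topology

section Tame

variable {K : Type} [Field K] [LinearOrder K] [IsStrictOrderedRing K]

/-- A subset of an interval whose boundary is contained in the zero set of a polynomial. -/
def TameOn (I T : Set K) : Prop :=
  ∃ N : K[X], N ≠ 0 ∧ ∀ α ∈ I, ∀ β ∈ I, α ≤ β → (∀ c ∈ Set.Icc α β, N.eval c ≠ 0) →
    (α ∈ T ↔ β ∈ T)

variable {I T T' : Set K}

omit [IsStrictOrderedRing K] in
theorem TameOn.compl (h : TameOn I T) : TameOn I Tᶜ := by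
  obtain ⟨N, hN, h⟩ := h
  exact ⟨N, hN, fun α hα β hβ hαβ hc => not_congr (h α hα β hβ hαβ hc)⟩

theorem TameOn.inter (h : TameOn I T) (h' : TameOn I T') : TameOn I (T ∩ T') := by
  obtain ⟨N, hN, h⟩ := h
  obtain ⟨N', hN', h'⟩ := h'
  refine ⟨N * N', mul_ne_zero hN hN', fun α hα β hβ hαβ hc => and_congr ?_ ?_⟩
  · exact h α hα β hβ hαβ fun c hcI h0 => hc c hcI (by rw [Polynomial.eval_mul, h0, zero_mul])
  · exact h' α hα β hβ hαβ fun c hcI h0 => hc c hcI (by rw [Polynomial.eval_mul, h0, mul_zero])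

/-- A tame subset of an interval that is locally constant is constant. -/
theorem TameOn.iff_of_locally (h : TameOn I T) (hI : I.OrdConnected)
    (hloc : ∀ c ∈ I, ∃ δ > 0, ∀ r ∈ I, |r - c| < δ → (r ∈ T ↔ c ∈ T)) {α β : K} (hα : α ∈ I)
    (hβ : β ∈ I) : α ∈ T ↔ β ∈ T := by
  obtain ⟨N, hN, h⟩ := h
  -- Induction on the number of roots of `N` between the end points. At a root `c`, local constancy
  -- joins `c` to nearby points on either side, and the two remaining intervals contain fewer roots.
  have key : ∀ n : ℕ, ∀ α ∈ I, ∀ β ∈ I, α ≤ β →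
      (N.roots.toFinset.filter fun c => c ∈ Set.Icc α β).card ≤ n → (α ∈ T ↔ β ∈ T) := by
    intro n
    induction n with
    | zero =>
      intro α hα β hβ hαβ hn
      refine h α hα β hβ hαβ fun c hc h0 => ?_
      have h1 : c ∈ N.roots.toFinset.filter fun c => c ∈ Set.Icc α β :=
        Finset.mem_filter.2 ⟨Multiset.mem_toFinset.2 ((Polynomial.mem_roots hN).2 h0), hc⟩
      rw [Finset.card_eq_zero.1 (Nat.le_zero.1 hn)] at h1
      exact absurd h1 (Finset.notMem_empty c)
    | succ n ih =>
      intro α hα β hβ hαβ hn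
      by_cases hex : ∃ c ∈ Set.Icc α β, N.eval c = 0
      swap
      · push Not at hex
        exact h α hα β hβ hαβ hex
      obtain ⟨c, hc, hc0⟩ := hex
      have hcI : c ∈ I := hI.out hα hβ hc
      have hcr : c ∈ N.roots.toFinset.filter fun c => c ∈ Set.Icc α β :=
        Finset.mem_filter.2 ⟨Multiset.mem_toFinset.2 ((Polynomial.mem_roots hN).2 hc0), hc⟩
      have hcard : ∀ α' β', α ≤ α' → β' ≤ β → c ∉ Set.Icc α' β' →
          (N.roots.toFinset.filter fun c => c ∈ Set.Icc α' β').card ≤ n := by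
        intro α' β' h1 h2 h3
        refine Nat.lt_succ_iff.1 (lt_of_lt_of_le (Finset.card_lt_card ?_) hn)
        refine (Finset.ssubset_iff_of_subset fun x hx => ?_).2 ⟨c, hcr, fun hx => ?_⟩
        · rw [Finset.mem_filter] at hx ⊢
          exact ⟨hx.1, h1.trans hx.2.1, hx.2.2.trans h2⟩
        · exact h3 (Finset.mem_filter.1 hx).2
      obtain ⟨δ, hδ, hloc⟩ := hloc c hcI
      have h1 : α ∈ T ↔ c ∈ T := by
        rcases hc.1.eq_or_lt with rfl | hlt
        · rfl
        have hm : max α (c - δ / 2) < c := max_lt hlt (by linarith)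
        have hmI : max α (c - δ / 2) ∈ I := hI.out hα hcI ⟨le_max_left _ _, hm.le⟩
        rw [ih α hα _ hmI (le_max_left _ _) (hcard _ _ le_rfl (hm.le.trans hc.2)
          fun h => absurd h.2 (not_le.2 hm))]
        refine hloc _ hmI ?_
        rw [abs_sub_lt_iff]
        constructor <;> linarith [le_max_right α (c - δ / 2)]
      have h2 : β ∈ T ↔ c ∈ T := by
        rcases hc.2.eq_or_lt with rfl | hlt
        · rfl
        have hm : c < min β (c + δ / 2) := lt_min hlt (by linarith)
        have hmI : min β (c + δ / 2) ∈ I := hI.out hcI hβ ⟨hm.le, min_le_left _ _⟩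
        rw [← ih _ hmI β hβ (min_le_left _ _) (hcard _ _ (hc.1.trans hm.le) le_rfl
          fun h => absurd h.1 (not_le.2 hm))]
        refine hloc _ hmI ?_
        rw [abs_sub_lt_iff]
        constructor <;> linarith [min_le_right β (c + δ / 2)]
      rw [h1, h2]
  rcases le_total α β with hαβ | hαβ
  · exact key _ α hα β hβ hαβ le_rfl
  · exact (key _ β hβ α hα hαβ le_rfl).symm

theorem HasIVP.pos_iff {P : Puiseux[X]} (h : HasIVP P) {α β : Puiseux} (hαβ : α ≤ β)
    (h0 : ∀ c ∈ Set.Icc α β, P.eval c ≠ 0) : 0 < P.eval α ↔ 0 < P.eval β := by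
  by_contra hne
  have hα := h0 α ⟨le_rfl, hαβ⟩
  have hβ := h0 β ⟨hαβ, le_rfl⟩
  have hneg : P.eval α * P.eval β < 0 := by
    rcases lt_or_gt_of_ne hα with h1 | h1 <;> rcases lt_or_gt_of_ne hβ with h2 | h2
    · exact absurd (iff_of_false h1.not_gt h2.not_gt) hne
    · exact mul_neg_of_neg_of_pos h1 h2
    · exact mul_neg_of_pos_of_neg h1 h2
    · exact absurd (iff_of_true h1 h2) hne
  obtain ⟨c, hc, hc0⟩ := h α β hαβ hneg
  exact h0 c hc hc0

theorem pos_add_iff_of_sq_lt {p y : K} (h : y ^ 2 < p ^ 2) : 0 < p + y ↔ 0 < p := by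
  have h2 := abs_lt.1 (sq_lt_sq.1 h)
  constructor
  · intro h3
    by_contra h4
    rw [abs_of_nonpos (not_lt.1 h4)] at h2
    linarith [h2.2]
  · intro h3
    rw [abs_of_pos h3] at h2
    linarith [h2.1]

/-- Between zeros of the norm `P² - Q² q` its sign is constant. Where it is positive, `P` is larger
than `Q w` in absolute value and decides the sign; where it is negative, `Q w` does. The deciding
polynomial, `P` or `Q`, does not vanish on the interval, so its sign is constant by the intermediate
value theorem. -/
theorem tameOn_pos {q : Puiseux[X]}
    (hq : ∀ P Q : Puiseux[X], P ^ 2 - Q ^ 2 * q = 0 → P = 0 ∧ Q = 0) {I : Set Puiseux}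
    (hI : I.OrdConnected) {w : Puiseux → Puiseux} (hw : ∀ r ∈ I, 0 ≤ w r)
    (hwq : ∀ r ∈ I, w r ^ 2 = q.eval r) (P Q : Puiseux[X]) :
    TameOn I {r | 0 < P.eval r + Q.eval r * w r} := by
  by_cases hN : P ^ 2 - Q ^ 2 * q = 0
  · obtain ⟨rfl, rfl⟩ := hq P Q hN
    exact ⟨1, one_ne_zero, fun α _ β _ _ _ => by simp⟩
  refine ⟨_, hN, fun α hα β hβ hαβ hc => ?_⟩
  have hN0 := (puiseux_ivt _).pos_iff hαβ hc
  have hNe : ∀ r ∈ I, (P ^ 2 - Q ^ 2 * q).eval r = P.eval r ^ 2 - (Q.eval r * w r) ^ 2 := by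
    intro r hr
    rw [Polynomial.eval_sub, Polynomial.eval_mul, Polynomial.eval_pow, Polynomial.eval_pow, mul_pow,
      hwq r hr]
  by_cases hα0 : 0 < (P ^ 2 - Q ^ 2 * q).eval α
  · have hpos : ∀ c ∈ Set.Icc α β, (Q.eval c * w c) ^ 2 < P.eval c ^ 2 := by
      intro c hc'
      have h1 : 0 < (P ^ 2 - Q ^ 2 * q).eval c :=
        ((puiseux_ivt _).pos_iff hc'.1 fun d hd => hc d ⟨hd.1, hd.2.trans hc'.2⟩).1 hα0
      rw [hNe c (hI.out hα hβ hc')] at h1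
      linarith
    have hP : 0 < P.eval α ↔ 0 < P.eval β := (puiseux_ivt _).pos_iff hαβ fun c hc' h0 => by
      have := hpos c hc'
      rw [h0] at this
      nlinarith [sq_nonneg (Q.eval c * w c)]
    change 0 < P.eval α + Q.eval α * w α ↔ 0 < P.eval β + Q.eval β * w β
    rw [pos_add_iff_of_sq_lt (hpos α ⟨le_rfl, hαβ⟩), pos_add_iff_of_sq_lt (hpos β ⟨hαβ, le_rfl⟩),
      hP]
  · have hneg : ∀ c ∈ Set.Icc α β, P.eval c ^ 2 < (Q.eval c * w c) ^ 2 := by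
      intro c hc'
      have h1 : ¬ 0 < (P ^ 2 - Q ^ 2 * q).eval c := fun h => hα0
        (((puiseux_ivt _).pos_iff hc'.1 fun d hd => hc d ⟨hd.1, hd.2.trans hc'.2⟩).2 h)
      have h2 := lt_of_le_of_ne (not_lt.1 h1) (hc c hc')
      rw [hNe c (hI.out hα hβ hc')] at h2
      linarith
    have hw0 : ∀ c ∈ Set.Icc α β, 0 < w c := by
      intro c hc'
      refine lt_of_le_of_ne (hw c (hI.out hα hβ hc')) fun h => ?_
      have := hneg c hc'
      rw [← h] at this
      nlinarith [sq_nonneg (P.eval c)]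
    have hQ : 0 < Q.eval α ↔ 0 < Q.eval β := (puiseux_ivt _).pos_iff hαβ fun c hc' h0 => by
      have := hneg c hc'
      rw [h0] at this
      nlinarith [sq_nonneg (P.eval c)]
    change 0 < P.eval α + Q.eval α * w α ↔ 0 < P.eval β + Q.eval β * w β
    rw [add_comm, pos_add_iff_of_sq_lt (hneg α ⟨le_rfl, hαβ⟩), add_comm,
      pos_add_iff_of_sq_lt (hneg β ⟨hαβ, le_rfl⟩), mul_pos_iff_of_pos_right (hw0 α ⟨le_rfl, hαβ⟩),
      mul_pos_iff_of_pos_right (hw0 β ⟨hαβ, le_rfl⟩), hQ]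

theorem locally_pos {w : K → K} (hw : ∀ c ∈ I, ∀ ε > 0, ∃ δ > 0, ∀ r ∈ I, |r - c| < δ →
      |w r - w c| < ε) (P Q : K[X]) {c : K} (hc : c ∈ I) (h : 0 < P.eval c + Q.eval c * w c) :
    ∃ δ > 0, ∀ r ∈ I, |r - c| < δ → 0 < P.eval r + Q.eval r * w r := by
  let _ : TopologicalSpace K := Preorder.topology K
  have : OrderTopology K := ⟨rfl⟩
  have hw' : ContinuousWithinAt w I c := by
    refine LinearOrderedAddCommGroup.tendsto_nhds.2 fun ε hε => ?_
    obtain ⟨δ, hδ, h⟩ := hw c hc ε hε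
    rw [eventually_nhdsWithin_iff]
    filter_upwards [eventually_abs_sub_lt c hδ] with r hr hrI using h r hrI hr
  have hcont : ContinuousWithinAt (fun r => P.eval r + Q.eval r * w r) I c :=
    P.continuous.continuousWithinAt.add (Q.continuous.continuousWithinAt.mul hw')
  have hev := hcont.eventually (lt_mem_nhds h)
  rw [eventually_nhdsWithin_iff, (nhds_basis_abs_sub_lt c).eventually_iff] at hev
  obtain ⟨δ, hδ, h⟩ := hev
  exact ⟨δ, hδ, fun r hrI hr => h hr hrI⟩

end Tame

section PointTopology

variable {K : Type} [Field K] [LinearOrder K] {R R' : Type} [CommRing R] [Algebra K R]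
  [CommRing R'] [Algebra K R']

/-- The euclidean topology on the rational points of an affine scheme. -/
@[reducible] def pointTopology (K R : Type) [Field K] [LinearOrder K] [CommRing R] [Algebra K R] :
    TopologicalSpace (R →ₐ[K] K) :=
  TopologicalSpace.generateFrom {S | ∃ z : R, S = {φ | 0 < φ z}}

/-- The semi-algebraic sets of rational points of an affine scheme. -/
inductive IsTame : Set (R →ₐ[K] K) → Prop
  | pos (z : R) : IsTame {φ | 0 < φ z}
  | compl (S : Set (R →ₐ[K] K)) : IsTame S → IsTame Sᶜ
  | inter (S T : Set (R →ₐ[K] K)) : IsTame S → IsTame T → IsTame (S ∩ T)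

end PointTopology

/-! ### Connectedness of the ovals of the curve -/

section Arcs

theorem exists_sqrt_function : ∃ s : Puiseux → Puiseux, (∀ x, 0 ≤ s x) ∧ ∀ x, 0 ≤ x → s x ^ 2 = x := by
  have h : ∀ x : Puiseux, ∃ y, 0 ≤ y ∧ (0 ≤ x → y ^ 2 = x) := by
    intro x
    by_cases hx : 0 ≤ x
    · obtain ⟨y, hy, h⟩ := puiseux_exists_sqrt hx
      exact ⟨y, hy, fun _ => h⟩
    · exact ⟨0, le_rfl, fun h => absurd h hx⟩
  choose s h1 h2 using h
  exact ⟨s, h1, h2⟩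

local notation "𝕥" => puiseuxT

theorem eval_quartic {K : Type} [Field K] (t r : K) :
    (quartic t).eval r = r ^ 4 - 2 * (2 * t + 1) * r ^ 2 + 1 := by
  simp [quartic]

/-- The end point of the oval. -/
theorem exists_oval : ∃ ρ : Puiseux, 0 < ρ ∧ (quartic 𝕥).eval ρ = 0 ∧
    (∀ r ∈ Set.Icc (-ρ) ρ, 0 ≤ (quartic 𝕥).eval r) ∧
    ∀ r, r ^ 2 < 1 → 0 ≤ (quartic 𝕥).eval r → r ∈ Set.Icc (-ρ) ρ := by
  have ht := puiseuxT_pos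
  obtain ⟨b, hb, hb2⟩ := puiseux_exists_sqrt (x := 𝕥 * (𝕥 + 1)) (by positivity)
  have htb : 𝕥 < b := by
    refine lt_of_pow_lt_pow_left₀ 2 hb ?_
    rw [hb2]; nlinarith
  -- The quartic is quadratic in `r²`. `X₀` is the smaller root of this quadratic polynomial; the
  -- product of the roots is `1`, so `0 < X₀ < 1`, and the oval ends at `± √X₀`.
  set X₀ := 2 * 𝕥 + 1 - 2 * b with hX₀
  have hX : X₀ * (2 * 𝕥 + 1 + 2 * b) = 1 := by
    rw [hX₀]; linear_combination (-4) * hb2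
  have hX₁ : 1 < 2 * 𝕥 + 1 + 2 * b := by linarith
  have hX₀0 : 0 < X₀ := by
    by_contra h
    nlinarith
  obtain ⟨ρ, hρ, hρ2⟩ := puiseux_exists_sqrt hX₀0.le
  have hρ0 : 0 < ρ := lt_of_le_of_ne hρ fun h => by rw [← h] at hρ2; simp at hρ2; linarith
  have hfac : ∀ r, (quartic 𝕥).eval r = (X₀ - r ^ 2) * (2 * 𝕥 + 1 + 2 * b - r ^ 2) := by
    intro r
    rw [eval_quartic]
    linear_combination (-1) * hX - r ^ 2 * hX₀ 
  have hlt : X₀ < 1 := by rw [hX₀]; linarith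
  refine ⟨ρ, hρ0, ?_, fun r hr => ?_, fun r hr h => ?_⟩
  · rw [hfac, hρ2, sub_self, zero_mul]
  · have : r ^ 2 ≤ ρ ^ 2 := sq_le_sq' hr.1 hr.2
    rw [hρ2] at this
    rw [hfac]
    exact mul_nonneg (by linarith) (by linarith)
  · rw [hfac] at h
    have h1 : r ^ 2 ≤ ρ ^ 2 := by
      rw [hρ2]
      by_contra hcon
      push Not at hcon
      nlinarith
    exact abs_le.1 (abs_le_of_sq_le_sq h1 hρ)

theorem abs_sub_lt_of_sq {x y ε : Puiseux} (hx : 0 ≤ x) (hy : 0 ≤ y) (hε : 0 < ε)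
    (h : |x ^ 2 - y ^ 2| < ε ^ 2) : |x - y| < ε := by
  have h1 : |x - y| ^ 2 ≤ |x ^ 2 - y ^ 2| := by
    rw [show x ^ 2 - y ^ 2 = (x - y) * (x + y) by ring, abs_mul, sq]
    refine mul_le_mul_of_nonneg_left ?_ (abs_nonneg _)
    rw [abs_of_nonneg (add_nonneg hx hy)]
    exact abs_sub_le_iff.2 ⟨by linarith, by linarith⟩
  exact lt_of_pow_lt_pow_left₀ 2 hε.le (h1.trans_lt h)

/-- The left-hand side is the product of the conjugates `P + Q D` and `P - Q D` in the coordinate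
ring of the curve, which is a domain. -/
theorem quartic_not_square {P Q : Puiseux[X]} (h : P ^ 2 - Q ^ 2 * quartic 𝕥 = 0) :
    P = 0 ∧ Q = 0 := by
  have := CurveRing.isDomain 𝕥 puiseuxT_pos.ne' (by linarith [puiseuxT_pos] : 0 < 𝕥 + 1).ne'
  have hx := DoubleCover.y_sq (g := quartic 𝕥)
  have h1 : (Polynomial.aeval (DoubleCover.x (quartic 𝕥)) P +
      Polynomial.aeval (DoubleCover.x (quartic 𝕥)) Q * DoubleCover.y (quartic 𝕥)) *
      (Polynomial.aeval (DoubleCover.x (quartic 𝕥)) P +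
        Polynomial.aeval (DoubleCover.x (quartic 𝕥)) (-Q) * DoubleCover.y (quartic 𝕥)) = 0 := by
    have h2 := congrArg (Polynomial.aeval (DoubleCover.x (quartic 𝕥))) h
    rw [map_sub, map_mul, map_pow, map_pow, map_zero] at h2
    rw [map_neg]
    linear_combination h2 - (Polynomial.aeval (DoubleCover.x (quartic 𝕥)) Q) ^ 2 * hx
  have h0 : (0 : DoubleCover (quartic 𝕥)) = Polynomial.aeval (DoubleCover.x (quartic 𝕥)) (0 : Puiseux[X]) +
      Polynomial.aeval (DoubleCover.x (quartic 𝕥)) (0 : Puiseux[X]) * DoubleCover.y (quartic 𝕥) := by simp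
  rcases (mul_eq_zero (M₀ := CurveRing 𝕥)).1 h1 with h3 | h3
  · exact DoubleCover.ext_basis (h3.trans h0)
  · have h4 := DoubleCover.ext_basis (h3.trans h0)
    exact ⟨h4.1, neg_eq_zero.1 h4.2⟩

/-- Clopen semi-algebraic subsets of the curve do not separate points of the oval. -/
theorem IsTame.iff_of_oval {S : Set (CurveRing 𝕥 →ₐ[Puiseux] Puiseux)} (hS : IsTame S)
    (ho : IsOpen[pointTopology Puiseux (CurveRing 𝕥)] S)
    (ho' : IsOpen[pointTopology Puiseux (CurveRing 𝕥)] Sᶜ)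
    {φ ψ : CurveRing 𝕥 →ₐ[Puiseux] Puiseux} (hφ : φ (CurveRing.r 𝕥) ^ 2 < 1)
    (hψ : ψ (CurveRing.r 𝕥) ^ 2 < 1) : φ ∈ S ↔ ψ ∈ S := by
  obtain ⟨ρ, hρ0, hρ, hpos, hoval⟩ := exists_oval
  obtain ⟨s, hs0, hs⟩ := exists_sqrt_function
  let I := Set.Icc (-ρ) ρ
  have hI : I.OrdConnected := Set.ordConnected_Icc
  let w : Puiseux → Puiseux := fun r => s ((quartic 𝕥).eval r)
  have hw0 : ∀ r ∈ I, 0 ≤ w r := fun r _ => hs0 _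
  have hw : ∀ r ∈ I, w r ^ 2 = (quartic 𝕥).eval r := fun r hr => hs _ (hpos r hr)
  have hwc : ∀ c ∈ I, ∀ ε > 0, ∃ δ > 0, ∀ r ∈ I, |r - c| < δ → |w r - w c| < ε := by
    intro c hc ε hε
    obtain ⟨δ₁, hδ₁, h₁⟩ := locally_pos (I := I) (w := fun _ => 0) (fun _ _ ε hε => ⟨1, one_pos, fun _ _ _ => by simpa using hε⟩)
      (Polynomial.C (ε ^ 2 + (quartic 𝕥).eval c) - quartic 𝕥) 0 hc (by simpa using pow_pos hε 2)
    obtain ⟨δ₂, hδ₂, h₂⟩ := locally_pos (I := I) (w := fun _ => 0) (fun _ _ ε hε => ⟨1, one_pos, fun _ _ _ => by simpa using hε⟩)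
      (Polynomial.C (ε ^ 2 - (quartic 𝕥).eval c) + quartic 𝕥) 0 hc (by simpa using pow_pos hε 2)
    refine ⟨min δ₁ δ₂, lt_min hδ₁ hδ₂, fun r hr hrc => ?_⟩
    refine abs_sub_lt_of_sq (hw0 r hr) (hw0 c hc) hε ?_
    rw [hw r hr, hw c hc, abs_sub_lt_iff]
    have h3 := h₁ r hr (hrc.trans_le (min_le_left _ _))
    have h4 := h₂ r hr (hrc.trans_le (min_le_right _ _))
    simp only [Polynomial.eval_sub, Polynomial.eval_add, Polynomial.eval_C, mul_zero, add_zero] at h3 h4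
    constructor <;> linarith
  -- membership in terms of the arcs
  have hval : ∀ (χ : CurveRing 𝕥 →ₐ[Puiseux] Puiseux) (z : CurveRing 𝕥),
      χ z = z.re.eval (χ (CurveRing.r 𝕥)) + z.im.eval (χ (CurveRing.r 𝕥)) * χ (CurveRing.D 𝕥) := by
    intro χ z
    conv_lhs => rw [DoubleCover.eq_add z]
    rw [map_add, map_mul, ← Polynomial.aeval_algHom_apply, ← Polynomial.aeval_algHom_apply,
      Polynomial.coe_aeval_eq_eval]
    rfl
  -- The oval consists of the two arcs `D = ± w(r)` over the interval `I`. On each of them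
  -- membership in `S` becomes a tame and locally constant subset of `I`.
  have key : ∀ ε : Puiseux, ε ^ 2 = 1 → ∀ χ χ' : CurveRing 𝕥 →ₐ[Puiseux] Puiseux,
      χ (CurveRing.r 𝕥) ∈ I → χ (CurveRing.D 𝕥) = ε * w (χ (CurveRing.r 𝕥)) →
      χ' (CurveRing.r 𝕥) ∈ I → χ' (CurveRing.D 𝕥) = ε * w (χ' (CurveRing.r 𝕥)) →
      (χ ∈ S ↔ χ' ∈ S) := by
    intro ε hε
    have hex : ∀ r ∈ I, ∃ χ : CurveRing 𝕥 →ₐ[Puiseux] Puiseux, χ (CurveRing.r 𝕥) = r ∧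
        χ (CurveRing.D 𝕥) = ε * w r := by
      intro r hr
      have h : (ε * w r) ^ 2 = r ^ 4 - algebraMap Puiseux Puiseux (2 * (2 * 𝕥 + 1)) * r ^ 2 + 1 := by
        rw [mul_pow, hε, one_mul, hw r hr, eval_quartic]
        rfl
      exact ⟨CurveRing.lift _ _ h, CurveRing.lift_r _ _ h, CurveRing.lift_D _ _ h⟩
    let Arc (S : Set (CurveRing 𝕥 →ₐ[Puiseux] Puiseux)) : Set Puiseux :=
      {r | ∃ χ ∈ S, χ (CurveRing.r 𝕥) = r ∧ χ (CurveRing.D 𝕥) = ε * w r}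
    have hArc : ∀ S, ∀ χ : CurveRing 𝕥 →ₐ[Puiseux] Puiseux,
        χ (CurveRing.D 𝕥) = ε * w (χ (CurveRing.r 𝕥)) → (χ (CurveRing.r 𝕥) ∈ Arc S ↔ χ ∈ S) := by
      intro S χ hχ
      refine ⟨fun ⟨χ', h1, h2, h3⟩ => ?_, fun h => ⟨χ, h, rfl, hχ⟩⟩
      rwa [← CurveRing.algHom_ext h2 (h3.trans hχ.symm)]
    have hArcc : ∀ S, ∀ r ∈ I, r ∈ Arc Sᶜ ↔ r ∉ Arc S := by
      intro S r hr
      obtain ⟨χ, rfl, hχ⟩ := hex r hr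
      rw [hArc _ _ hχ, hArc _ _ hχ]
      rfl
    have hArcpos : ∀ z : CurveRing 𝕥, ∀ r ∈ I, r ∈ Arc {χ | 0 < χ z} ↔
        0 < z.re.eval r + (z.im * Polynomial.C ε).eval r * w r := by
      intro z r hr
      obtain ⟨χ, rfl, hχ⟩ := hex r hr
      rw [hArc _ _ hχ, Set.mem_ofPred_eq, hval, hχ, Polynomial.eval_mul, Polynomial.eval_C, mul_assoc]
    have congr_tame : ∀ T T' : Set Puiseux, (∀ r ∈ I, r ∈ T ↔ r ∈ T') → TameOn I T → TameOn I T' := by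
      rintro T T' h ⟨N, hN, h2⟩
      exact ⟨N, hN, fun α hα β hβ hαβ hc => by rw [← h α hα, ← h β hβ]; exact h2 α hα β hβ hαβ hc⟩
    have htame : TameOn I (Arc S) := by
      clear ho ho'
      induction hS with
      | pos z =>
        exact congr_tame {r | 0 < z.re.eval r + (z.im * Polynomial.C ε).eval r * w r} _
          (fun r hr => (hArcpos z r hr).symm)
          (tameOn_pos (fun _ _ => quartic_not_square) hI hw0 hw _ _)
      | compl S _ ih => exact congr_tame _ _ (fun r hr => (hArcc S r hr).symm) ih.compl
      | inter S S' _ _ ih ih' =>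
        refine congr_tame _ _ (fun r hr => ?_) (ih.inter ih')
        obtain ⟨χ, rfl, hχ⟩ := hex r hr
        rw [Set.mem_inter_iff, hArc _ _ hχ, hArc _ _ hχ, hArc _ _ hχ]
        rfl
    have hopen : ∀ S, IsOpen[pointTopology Puiseux (CurveRing 𝕥)] S → ∀ c ∈ I, c ∈ Arc S →
        ∃ δ > 0, ∀ r ∈ I, |r - c| < δ → r ∈ Arc S := by
      intro S hS
      induction hS with
      | basic S hS =>
        obtain ⟨z, rfl⟩ := hS
        intro c hc hcS
        obtain ⟨δ, hδ, h⟩ := locally_pos hwc _ _ hc ((hArcpos z c hc).1 hcS)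
        exact ⟨δ, hδ, fun r hr hrc => (hArcpos z r hr).2 (h r hr hrc)⟩
      | univ =>
        intro c _ _
        refine ⟨1, one_pos, fun r hr _ => ?_⟩
        obtain ⟨χ, h1, h2⟩ := hex r hr
        exact ⟨χ, trivial, h1, h2⟩
      | inter S S' _ _ ih ih' =>
        rintro c hc ⟨χ, hχ, h1, h2⟩
        obtain ⟨δ, hδ, h⟩ := ih c hc ⟨χ, hχ.1, h1, h2⟩
        obtain ⟨δ', hδ', h'⟩ := ih' c hc ⟨χ, hχ.2, h1, h2⟩
        refine ⟨min δ δ', lt_min hδ hδ', fun r hr hrc => ?_⟩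
        have h3 := h r hr (hrc.trans_le (min_le_left _ _))
        have h4 := h' r hr (hrc.trans_le (min_le_right _ _))
        obtain ⟨χ', rfl, hχ'⟩ := hex r hr
        rw [hArc _ _ hχ'] at h3 h4 ⊢
        exact ⟨h3, h4⟩
      | sUnion 𝒮 _ ih =>
        rintro c hc ⟨χ, ⟨S, hS, hχ⟩, h1, h2⟩
        obtain ⟨δ, hδ, h⟩ := ih S hS c hc ⟨χ, hχ, h1, h2⟩
        refine ⟨δ, hδ, fun r hr hrc => ?_⟩
        obtain ⟨χ', h3, h4⟩ := h r hr hrc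
        exact ⟨χ', ⟨S, hS, h3⟩, h4⟩
    have hloc : ∀ c ∈ I, ∃ δ > 0, ∀ r ∈ I, |r - c| < δ → (r ∈ Arc S ↔ c ∈ Arc S) := by
      intro c hc
      by_cases hcS : c ∈ Arc S
      · obtain ⟨δ, hδ, h⟩ := hopen S ho c hc hcS
        exact ⟨δ, hδ, fun r hr hrc => iff_of_true (h r hr hrc) hcS⟩
      · obtain ⟨δ, hδ, h⟩ := hopen Sᶜ ho' c hc ((hArcc S c hc).2 hcS)
        exact ⟨δ, hδ, fun r hr hrc => iff_of_false ((hArcc S r hr).1 (h r hr hrc)) hcS⟩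
    intro χ χ' h1 h2 h3 h4
    rw [← hArc S χ h2, ← hArc S χ' h4]
    exact htame.iff_of_locally hI hloc h1 h3
  -- The two arcs meet at the end point `r = ρ`, `D = 0`, to which every point of the oval is
  -- compared.
  have hρI : ρ ∈ I := ⟨by linarith, le_rfl⟩
  have hwρ : w ρ = 0 := by
    have h := hw ρ hρI
    rw [hρ] at h
    exact pow_eq_zero_iff two_ne_zero |>.1 h
  have h : (0 : Puiseux) ^ 2 = ρ ^ 4 - algebraMap Puiseux Puiseux (2 * (2 * 𝕥 + 1)) * ρ ^ 2 + 1 := by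
    rw [zero_pow two_ne_zero, ← hρ, eval_quartic]
    rfl
  let χ₀ : CurveRing 𝕥 →ₐ[Puiseux] Puiseux := CurveRing.lift _ _ h
  have hχ₀ : χ₀ (CurveRing.r 𝕥) = ρ := CurveRing.lift_r _ _ h
  have hχ₀' : χ₀ (CurveRing.D 𝕥) = 0 := CurveRing.lift_D _ _ h
  have hfin : ∀ χ : CurveRing 𝕥 →ₐ[Puiseux] Puiseux, χ (CurveRing.r 𝕥) ^ 2 < 1 →
      (χ ∈ S ↔ χ₀ ∈ S) := by
    intro χ hχ
    have hD : χ (CurveRing.D 𝕥) ^ 2 = (quartic 𝕥).eval (χ (CurveRing.r 𝕥)) := by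
      have h := congrArg χ (CurveRing.D_sq (t := 𝕥))
      rw [map_pow, map_add, map_sub, map_mul, map_pow, map_pow, map_one, AlgHom.commutes] at h
      rw [h, eval_quartic]
      rfl
    have hI' := hoval _ hχ (by rw [← hD]; positivity)
    rw [← hw _ hI', sq_eq_sq_iff_eq_or_eq_neg] at hD
    rcases hD with hD | hD
    · exact key 1 (one_pow 2) χ χ₀ hI' (by rw [hD, one_mul]) (by rw [hχ₀]; exact hρI)
        (by rw [hχ₀, hχ₀', hwρ, mul_zero])
    · exact key (-1) (by norm_num) χ χ₀ hI' (by rw [hD, neg_one_mul]) (by rw [hχ₀]; exact hρI)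
        (by rw [hχ₀, hχ₀', hwρ, mul_zero])
  rw [hfin φ hφ, hfin ψ hψ]

end Arcs

end

/-! ### Evaluation of regular functions at rational points -/

section

open scoped Topology

section Evaluation

variable {K : Type} [Field K] {X : Scheme.{0}} {f : X ⟶ Spec (.of K)}

theorem eval_specMap {A : Type} [CommRing A] (c : Spec (.of A) ⟶ X) (φ : A →+* K) (p : RatPoint f)
    (hp : p.1 = Spec.map (CommRingCat.ofHom φ) ≫ c) (U : X.Opens) (hc : ⊤ ≤ c ⁻¹ᵁ U)
    (h : ⊤ ≤ p.1 ⁻¹ᵁ U) (s : Γ(X, U)) :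
    p.eval U h s = φ ((Scheme.ΓSpecIso (.of A)).hom.hom ((c.appLE U ⊤ hc).hom s)) := by
  obtain ⟨p, hpf⟩ := p
  subst hp
  have h1 : ((Spec.map (CommRingCat.ofHom φ) ≫ c).appLE U ⊤ h).hom s =
      (Spec.map (CommRingCat.ofHom φ)).appTop.hom ((c.appLE U ⊤ hc).hom s) := by
    exact (appLE_appLE_apply (Spec.map (CommRingCat.ofHom φ)) c U ⊤ ⊤ hc le_top s).symm.trans
      (appTop_apply _ le_top _).symm
  have h2 := Scheme.ΓSpecIso_naturality (CommRingCat.ofHom φ)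
  exact (congrArg (Scheme.ΓSpecIso (.of K)).hom.hom h1).trans
    (congrArg (fun g => g.hom ((c.appLE U ⊤ hc).hom s)) h2)

variable {R : Type} [CommRing R] [Algebra K R] {c : Spec (.of R) ⟶ X}
  {m : (R →ₐ[K] K) → RatPoint f}

/-- A section is locally a fraction. -/
theorem exists_fraction (hm : ∀ φ, (m φ).1 = Spec.map (CommRingCat.ofHom (φ : R →+* K)) ≫ c)
    (U : X.Opens) (s : Γ(X, U)) {x : PrimeSpectrum R} (hx : c x ∈ U) :
    ∃ (h G : R) (n : ℕ), h ∉ x.asIdeal ∧ (∀ y : PrimeSpectrum R, h ∉ y.asIdeal → c y ∈ U) ∧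
      ∀ φ : R →ₐ[K] K, φ h ≠ 0 → ∃ hU : ⊤ ≤ (m φ).1 ⁻¹ᵁ U,
        (m φ).eval U hU s * φ h ^ n = φ G := by
  obtain ⟨_, ⟨h, rfl⟩, hxh, hhU⟩ :=
    (PrimeSpectrum.isTopologicalBasis_basic_opens (R := R)).exists_subset_of_mem_open
      (u := {y | c y ∈ U}) hx (c ⁻¹ᵁ U).isOpen
  let j : Spec (.of (Localization.Away h)) ⟶ Spec (.of R) :=
    Spec.map (CommRingCat.ofHom (algebraMap R (Localization.Away h)))
  have hc : ⊤ ≤ (j ≫ c) ⁻¹ᵁ U := by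
    intro y _
    exact hhU ((range_specMap_away h (j y)).1 ⟨y, rfl⟩)
  obtain ⟨n, G, hG⟩ := IsLocalization.Away.surj h ((Scheme.ΓSpecIso (.of (Localization.Away h))).hom.hom
    (((j ≫ c).appLE U ⊤ hc).hom s))
  refine ⟨h, G, n, hxh, fun y hy => hhU hy, fun φ hφ => ?_⟩
  let φ' : Localization.Away h →+* K := IsLocalization.Away.lift h (g := (φ : R →+* K)) hφ.isUnit
  have hφ' : φ'.comp (algebraMap R _) = (φ : R →+* K) := IsLocalization.Away.lift_comp _ _
  have hp : (m φ).1 = Spec.map (CommRingCat.ofHom φ') ≫ j ≫ c := by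
    rw [hm, ← Category.assoc, ← Spec.map_comp, ← CommRingCat.ofHom_comp, hφ']
  have hU : ⊤ ≤ (m φ).1 ⁻¹ᵁ U := by
    rw [hp]
    intro y _
    exact hc (Set.mem_univ (Spec.map (CommRingCat.ofHom φ') y))
  refine ⟨hU, ?_⟩
  have hev : ∀ z : R, φ z = φ' (algebraMap R _ z) := fun z => (RingHom.congr_fun hφ' z).symm
  rw [eval_specMap (j ≫ c) φ' (m φ) hp U hc hU, hev, hev, ← map_pow, ← map_mul, hG]

variable [LinearOrder K] [IsStrictOrderedRing K]

theorem mem_posLocus_of_fraction {U : X.Opens} {s : Γ(X, U)} {p : RatPoint f}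
    {hU : ⊤ ≤ p.1 ⁻¹ᵁ U} {h G : K} {n : ℕ} (hh : h ≠ 0) (he : p.eval U hU s * h ^ n = G) :
    p ∈ posLocus f U s ↔ 0 < G * h ^ n := by
  have h1 : G * h ^ n = p.eval U hU s * (h ^ n) ^ 2 := by rw [← he]; ring
  have h2 : 0 < (h ^ n) ^ 2 := by positivity
  rw [h1, mul_pos_iff_of_pos_right h2]
  exact ⟨fun ⟨_, h⟩ => h, fun h => ⟨hU, h⟩⟩

/-- The point of the spectrum under a rational point. -/
def pointOf (φ : R →ₐ[K] K) : PrimeSpectrum R := PrimeSpectrum.comap (φ : R →+* K) ⊥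

omit [LinearOrder K] [IsStrictOrderedRing K] in
theorem notMem_pointOf {φ : R →ₐ[K] K} {h : R} : h ∉ (pointOf φ).asIdeal ↔ φ h ≠ 0 :=
  not_congr (Ideal.mem_bot (R := K) (x := φ h))

omit [LinearOrder K] [IsStrictOrderedRing K] in
theorem map_pointOf_mem (hm : ∀ φ, (m φ).1 = Spec.map (CommRingCat.ofHom (φ : R →+* K)) ≫ c)
    {U : X.Opens} {φ : R →ₐ[K] K} (h : ⊤ ≤ (m φ).1 ⁻¹ᵁ U) : c (pointOf φ) ∈ U := by
  rw [hm] at h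
  exact h (Set.mem_univ (⊥ : PrimeSpectrum K))

/-- Near a point the section is a fraction `G / hⁿ`, whose sign is that of `G hⁿ`; the condition `h
≠ 0` is the positivity of `h²`. -/
theorem isOpen_preimage_posLocus
    (hm : ∀ φ, (m φ).1 = Spec.map (CommRingCat.ofHom (φ : R →+* K)) ≫ c)
    (U : X.Opens) (s : Γ(X, U)) : IsOpen[pointTopology K R] (m ⁻¹' posLocus f U s) := by
  let _ := pointTopology K R
  refine isOpen_iff_forall_mem_open.2 fun φ hφ => ?_
  obtain ⟨hU, -⟩ := id hφ
  obtain ⟨h, G, n, hh, -, hG⟩ := exists_fraction hm U s (map_pointOf_mem hm hU)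
  have hmem : ∀ φ : R →ₐ[K] K, φ h ≠ 0 → (m φ ∈ posLocus f U s ↔ 0 < φ (G * h ^ n)) := by
    intro φ hφ
    obtain ⟨hU, he⟩ := hG φ hφ
    rw [mem_posLocus_of_fraction hφ he, map_mul, map_pow]
  have hsq : ∀ φ : R →ₐ[K] K, 0 < φ (h ^ 2) ↔ φ h ≠ 0 := fun φ => by
    rw [map_pow, sq_pos_iff]
  refine ⟨{φ | 0 < φ (h ^ 2)} ∩ {φ | 0 < φ (G * h ^ n)}, ?_, ?_, ?_⟩
  · rintro ψ ⟨h1, h2⟩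
    exact (hmem ψ ((hsq ψ).1 h1)).2 h2
  · have hz : ∀ z : R, IsOpen {φ : R →ₐ[K] K | 0 < φ z} := fun z =>
      TopologicalSpace.isOpen_generateFrom_of_mem ⟨z, rfl⟩
    exact (hz _).inter (hz _)
  · have h1 := notMem_pointOf.1 hh
    exact ⟨(hsq φ).2 h1, (hmem φ h1).1 hφ⟩

theorem continuous_point (hm : ∀ φ, (m φ).1 = Spec.map (CommRingCat.ofHom (φ : R →+* K)) ≫ c) :
    Continuous[pointTopology K R, _] m := by
  let _ := pointTopology K R
  refine continuous_generateFrom_iff.2 ?_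
  rintro _ ⟨U, -, s, rfl⟩
  exact isOpen_preimage_posLocus hm U s

omit [IsStrictOrderedRing K] in
theorem IsTame.union {S T : Set (R →ₐ[K] K)} (hS : IsTame S) (hT : IsTame T) : IsTame (S ∪ T) := by
  rw [← compl_compl (S ∪ T), Set.compl_union]
  exact (hS.compl.inter _ _ hT.compl).compl

omit [IsStrictOrderedRing K] in
theorem IsTame.empty : IsTame (∅ : Set (R →ₐ[K] K)) := by
  convert IsTame.pos (K := K) (0 : R)
  simp

omit [IsStrictOrderedRing K] in
theorem IsTame.biUnion {ι : Type} (F : Finset ι) {S : ι → Set (R →ₐ[K] K)} (h : ∀ i, IsTame (S i))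
    (h0 : IsTame (∅ : Set (R →ₐ[K] K))) : IsTame (⋃ i ∈ F, S i) := by
  classical
  induction F using Finset.induction_on with
  | empty => simpa using h0
  | insert i F _ ih =>
    rw [Finset.set_biUnion_insert]
    exact (h i).union ih

/-- The same local fractions as for openness; noetherianity makes finitely many of them enough. -/
theorem isTame_preimage_posLocus [IsNoetherianRing R]
    (hm : ∀ φ, (m φ).1 = Spec.map (CommRingCat.ofHom (φ : R →+* K)) ≫ c)
    (U : X.Opens) (s : Γ(X, U)) : IsTame (m ⁻¹' posLocus f U s) := by
  choose h G n hh hU hG using fun x : {x : PrimeSpectrum R // c x ∈ U} =>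
    exists_fraction hm U s x.2
  have hcomp : IsCompact {x : PrimeSpectrum R | c x ∈ U} :=
    TopologicalSpace.NoetherianSpace.isCompact _
  obtain ⟨F, hF⟩ := hcomp.elim_finite_subcover
    (fun x => (PrimeSpectrum.basicOpen (h x) : Set (PrimeSpectrum R)))
    (fun x => (PrimeSpectrum.basicOpen (h x)).isOpen)
    fun x hx => Set.mem_iUnion.2 ⟨⟨x, hx⟩, hh ⟨x, hx⟩⟩
  have hmem : ∀ x, ∀ φ : R →ₐ[K] K, φ (h x) ≠ 0 →
      (m φ ∈ posLocus f U s ↔ 0 < φ (G x * h x ^ n x)) := by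
    intro x φ hφ
    obtain ⟨hU, he⟩ := hG x φ hφ
    rw [mem_posLocus_of_fraction hφ he, map_mul, map_pow]
  have hsq : ∀ x, ∀ φ : R →ₐ[K] K, 0 < φ (h x ^ 2) ↔ φ (h x) ≠ 0 := fun x φ => by
    rw [map_pow, sq_pos_iff]
  have heq : m ⁻¹' posLocus f U s =
      ⋃ x ∈ F, ({φ | 0 < φ (h x ^ 2)} ∩ {φ | 0 < φ (G x * h x ^ n x)}) := by
    ext φ
    simp only [Set.mem_iUnion, exists_prop]
    constructor
    · intro hφ
      obtain ⟨hU, -⟩ := id hφ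
      obtain ⟨x, hxF, hx⟩ := Set.mem_iUnion₂.1 (hF (map_pointOf_mem hm hU))
      have h1 : φ (h x) ≠ 0 := notMem_pointOf.1 hx
      exact ⟨x, hxF, (hsq x φ).2 h1, (hmem x φ h1).1 hφ⟩
    · rintro ⟨x, -, h1, h2⟩
      exact (hmem x φ ((hsq x φ).1 h1)).2 h2
  rw [heq]
  exact IsTame.biUnion F (fun x => (IsTame.pos _).inter _ _ (IsTame.pos _)) IsTame.empty

theorem IsSemialgebraic.isTame_preimage [IsNoetherianRing R]
    (hm : ∀ φ, (m φ).1 = Spec.map (CommRingCat.ofHom (φ : R →+* K)) ≫ c)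
    {A : Set (RatPoint f)} (hA : IsSemialgebraic f A) : IsTame (m ⁻¹' A) := by
  induction hA with
  | pos U _ s => exact isTame_preimage_posLocus hm U s
  | compl A _ ih => exact ih.compl
  | inter A B _ _ ihA ihB => exact ihA.inter _ _ ihB

end Evaluation

section Charts

variable {K : Type} [Field K] {X : Scheme.{0}} {f : X ⟶ Spec (.of K)} [LinearOrder K]
  [IsStrictOrderedRing K] {A : Type} [CommRing A]

omit [IsStrictOrderedRing K] in
/-- A function on an affine open chart defines a locus of positivity. -/
theorem exists_posLocus (c : Spec (.of A) ⟶ X) [IsOpenImmersion c] (a : A) :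
    ∃ (U : X.Opens) (_ : IsAffineOpen U) (s : Γ(X, U)), ∀ p : RatPoint f, p ∈ posLocus f U s ↔
      ∃ φ : A →+* K, p.1 = Spec.map (CommRingCat.ofHom φ) ≫ c ∧ 0 < φ a := by
  obtain ⟨s, hs⟩ := (bijective_appLE_opensRange c).2 ((Scheme.ΓSpecIso (.of A)).inv.hom a)
  have hev : ∀ (p : RatPoint f) (h) (φ : A →+* K), p.1 = Spec.map (CommRingCat.ofHom φ) ≫ c →
      p.eval c.opensRange h s = φ a := by
    intro p h φ hφ
    rw [eval_specMap c φ p hφ _ (top_le_preimage_opensRange c) h s]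
    refine congrArg φ ((congrArg (Scheme.ΓSpecIso (.of A)).hom.hom hs).trans ?_)
    exact congrArg (fun g => g.hom a) (Scheme.ΓSpecIso (.of A)).inv_hom_id
  refine ⟨c.opensRange, isAffineOpen_opensRange c, s, fun p => ⟨fun ⟨h, hp⟩ => ?_, ?_⟩⟩
  · have hr : Set.range p.1 ⊆ Set.range c := by
      rintro _ ⟨y, rfl⟩
      exact h (Set.mem_univ y)
    obtain ⟨φ, hφ⟩ := Spec.map_surjective (IsOpenImmersion.lift c p.1 hr)
    have hφ' : p.1 = Spec.map (CommRingCat.ofHom φ.hom) ≫ c := by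
      rw [CommRingCat.ofHom_hom, hφ, IsOpenImmersion.lift_fac]
    exact ⟨φ.hom, hφ', by rwa [← hev p h φ.hom hφ']⟩
  · rintro ⟨φ, hφ, hpos⟩
    have h : ⊤ ≤ p.1 ⁻¹ᵁ c.opensRange := by
      rw [hφ]
      intro y _
      exact ⟨_, rfl⟩
    exact ⟨h, by rwa [hev p h φ hφ]⟩

end Charts

end

/-! ### Rational points of the product and of the surface -/

section

open scoped Topology TensorProduct

section Points

variable {K : Type} [Field K] {t : K}

instance CurveRing.isNoetherianRing : IsNoetherianRing (CurveRing t) := by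
  have : Algebra.FiniteType K (CurveRing t) :=
    ⟨⟨(Set.toFinite {CurveRing.r t, CurveRing.D t}).toFinset, by
      rw [Set.Finite.coe_toFinset]
      exact CurveRing.adjoin_eq_top t⟩⟩
  exact Algebra.FiniteType.isNoetherianRing K _

theorem CurveRing.exists_point {x y : K} (h : y ^ 2 = (quartic t).eval x) :
    ∃ φ : CurveRing t →ₐ[K] K, φ (CurveRing.r t) = x ∧ φ (CurveRing.D t) = y := by
  have h : y ^ 2 = x ^ 4 - algebraMap K K (2 * (2 * t + 1)) * x ^ 2 + 1 := by
    rw [h, eval_quartic]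
    rfl
  exact ⟨CurveRing.lift _ _ h, CurveRing.lift_r _ _ h, CurveRing.lift_D _ _ h⟩

theorem CurveRing.point_D_sq (φ : CurveRing t →ₐ[K] K) :
    φ (CurveRing.D t) ^ 2 = (quartic t).eval (φ (CurveRing.r t)) := by
  have h := congrArg φ (CurveRing.D_sq (t := t))
  rw [map_pow, map_add, map_sub, map_mul, map_pow, map_pow, map_one, AlgHom.commutes] at h
  rw [h, eval_quartic]
  rfl

namespace ProdRing

/-- The homomorphism defined by a pair of homomorphisms. -/
def pair {R : Type} [CommRing R] [Algebra K R] (φ ψ : CurveRing t →ₐ[K] R) : ProdRing t →ₐ[K] R :=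
  Algebra.TensorProduct.lift φ ψ fun _ _ => Commute.all _ _

theorem pair_inl {R : Type} [CommRing R] [Algebra K R] (φ ψ : CurveRing t →ₐ[K] R)
    (z : CurveRing t) : pair φ ψ (inl t z) = φ z := by
  refine (Algebra.TensorProduct.lift_tmul φ ψ (fun _ _ => Commute.all _ _) z 1).trans ?_
  rw [map_one, mul_one]

theorem pair_inr {R : Type} [CommRing R] [Algebra K R] (φ ψ : CurveRing t →ₐ[K] R)
    (z : CurveRing t) : pair φ ψ (inr t z) = ψ z := by
  refine (Algebra.TensorProduct.lift_tmul φ ψ (fun _ _ => Commute.all _ _) 1 z).trans ?_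
  rw [map_one, one_mul]

theorem pair_comp {R : Type} [CommRing R] [Algebra K R] (χ : ProdRing t →ₐ[K] R) :
    pair (χ.comp (inl t)) (χ.comp (inr t)) = χ :=
  algHom_ext (AlgHom.ext fun z => pair_inl _ _ z) (AlgHom.ext fun z => pair_inr _ _ z)

end ProdRing

namespace Surface

/-- The rational point of the surface with given coordinates on a chart of the product. -/
def point (p : Bool × Bool) (χ : ProdRing t →ₐ[K] K) : RatPoint (hom t) :=
  ⟨Spec.map (CommRingCat.ofHom (χ : ProdRing t →+* K)) ≫ Sq.chart t p ≫ π t, by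
    rw [Category.assoc, Category.assoc, π_hom, Sq.chart_hom, ← Spec.map_comp,
      ← CommRingCat.ofHom_comp, AlgHom.comp_algebraMap]
    exact Spec.map_id _⟩

/-- The restriction of a homomorphism to the invariants. -/
def restrict (χ : ProdRing t →ₐ[K] K) : ProdRing.invariants t →+* K :=
  (χ : ProdRing t →+* K).comp ((ProdRing.invariants t).val : ProdRing.invariants t →+* ProdRing t)

theorem restrict_apply (χ : ProdRing t →ₐ[K] K) (z : ProdRing.invariants t) :
    restrict χ z = χ z := rfl

theorem point_eq (p : Bool × Bool) (χ : ProdRing t →ₐ[K] K) :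
    (point p χ).1 = Spec.map (CommRingCat.ofHom (restrict χ)) ≫ chart t p := by
  refine (congrArg (Spec.map (CommRingCat.ofHom (χ : ProdRing t →+* K)) ≫ ·)
    (isChart p).comm).trans ?_
  rw [← Category.assoc, ← Spec.map_comp]
  rfl

theorem algebraMap_of_chart {p : Bool × Bool} {q : RatPoint (hom t)}
    {φ : ProdRing.invariants t →+* K}
    (hq : q.1 = Spec.map (CommRingCat.ofHom φ) ≫ chart t p) (x : K) :
    φ (algebraMap K (ProdRing.invariants t) x) = x := by
  have h := q.2
  rw [hq, Category.assoc, chart_hom, ← Spec.map_comp] at h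
  have h2 := Spec.map_injective (h.trans (Spec.map_id _).symm)
  exact congrArg (fun f => f.hom x) h2

theorem point_eq_of_glued {p p' : Bool × Bool} {χ χ' : ProdRing t →ₐ[K] K}
    (h1 : Curve.Glued p.1 p'.1 ((χ.comp (ProdRing.inl t) : CurveRing t →ₐ[K] K) : CurveRing t →+* K)
      ((χ'.comp (ProdRing.inl t) : CurveRing t →ₐ[K] K) : CurveRing t →+* K))
    (h2 : Curve.Glued p.2 p'.2 ((χ.comp (ProdRing.inr t) : CurveRing t →ₐ[K] K) : CurveRing t →+* K)
      ((χ'.comp (ProdRing.inr t) : CurveRing t →ₐ[K] K) : CurveRing t →+* K)) :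
    point p χ = point p' χ' := by
  refine Subtype.ext ?_
  have h := (Sq.specMap_chart_eq_iff (γ := (χ : ProdRing t →+* K))
    (γ' := (χ' : ProdRing t →+* K))).2 ⟨h1, h2⟩
  exact (Category.assoc _ _ _).symm.trans ((congrArg (· ≫ π t) h).trans (Category.assoc _ _ _))

/-- Different charts at a rational point. -/
theorem exists_glued_of_chart {p p' : Bool × Bool} {χ : ProdRing t →ₐ[K] K}
    {φ : ProdRing.invariants t →+* K}
    (h : (point p χ).1 = Spec.map (CommRingCat.ofHom φ) ≫ chart t p') :
    ∃ γ : ProdRing t →+* K, (∀ z : ProdRing.invariants t, φ z = γ z) ∧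
      Spec.map (CommRingCat.ofHom (χ : ProdRing t →+* K)) ≫ Sq.chart t p =
        Spec.map (CommRingCat.ofHom γ) ≫ Sq.chart t p' := by
  have hr : Set.range (Spec.map (CommRingCat.ofHom (χ : ProdRing t →+* K)) ≫ Sq.chart t p) ⊆
      Set.range (Sq.chart t p') := by
    rintro _ ⟨y, rfl⟩
    refine (isChart p').range_le _ ?_
    refine ⟨Spec.map (CommRingCat.ofHom φ) y, ?_⟩
    exact (congrArg (fun f : Spec (.of K) ⟶ Surface t => f y) h).symm
  obtain ⟨γ', hγ⟩ := Spec.map_surjective (IsOpenImmersion.lift (Sq.chart t p') _ hr)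
  obtain ⟨γ, rfl⟩ : ∃ γ : ProdRing t →+* K, CommRingCat.ofHom γ = γ' := ⟨γ'.hom, rfl⟩
  have hγ' : Spec.map (CommRingCat.ofHom (χ : ProdRing t →+* K)) ≫ Sq.chart t p =
      Spec.map (CommRingCat.ofHom γ) ≫ Sq.chart t p' := by
    rw [hγ, IsOpenImmersion.lift_fac]
  refine ⟨γ, ?_, hγ'⟩
  have h2 : Spec.map (CommRingCat.ofHom φ) = Spec.map (CommRingCat.ofHom (RingHom.comp (α := ProdRing.invariants t) γ
      ((ProdRing.invariants t).val : ProdRing.invariants t →+* ProdRing t))) := by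
    rw [← cancel_mono (chart t p'), ← h, CommRingCat.ofHom_comp, Spec.map_comp, Category.assoc,
      ← (isChart p').comm, ← Category.assoc, ← hγ', Category.assoc]
    rfl
  have h3 := Spec.map_injective h2
  exact fun z => congrArg (fun f => f.hom z) h3

end Surface

theorem algHom_eq_of_adjoin {A : Type} [CommRing A] [Algebra K A] {s : Set A}
    (φ : Algebra.adjoin K s →+* K) (hφ : ∀ x, φ (algebraMap K (Algebra.adjoin K s) x) = x)
    (χ : A →ₐ[K] K) (h : ∀ a, ∀ ha : a ∈ s, χ a = φ ⟨a, Algebra.subset_adjoin ha⟩)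
    (z : Algebra.adjoin K s) : χ z = φ z := by
  obtain ⟨z, hz⟩ := z
  change χ z = φ ⟨z, hz⟩
  induction hz using Algebra.adjoin_induction with
  | mem z hz => exact h z hz
  | algebraMap c => exact (χ.commutes c).trans (hφ c).symm
  | add x y hx' hy' hx hy => rw [map_add, hx, hy, ← map_add]; rfl
  | mul x y hx' hy' hx hy => rw [map_mul, hx, hy, ← map_mul]; rfl

end Points

/-! ### Lifting rational points of the surface to the product -/

section RealPoints

local notation "𝕥" => puiseuxT

/-- The letters stand for the invariants `X = r₁²`, `M = D₁²`, `e = r₁ D₁`, `s = r₂`, `w₁ = r₁ D₂`,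
`w₂ = D₁ D₂`. If `X < 0`, then `M > 0` since `t > 0`, so `e² = X M < 0`, which is absurd. If `X >
0`, choose `x = √X` and divide by it; if `X = 0`, then `M = 1` and `x = 0`, `y = 1`, `d = w₂` will
do. -/
theorem exists_square_roots {X M e s w₁ w₂ : Puiseux}
    (e1 : M = X ^ 2 - 2 * (2 * 𝕥 + 1) * X + 1) (e2 : e ^ 2 = X * M) (e3 : e * w₁ = X * w₂)
    (e4 : w₁ ^ 2 = X * (s ^ 4 - 2 * (2 * 𝕥 + 1) * s ^ 2 + 1))
    (e5 : w₂ ^ 2 = M * (s ^ 4 - 2 * (2 * 𝕥 + 1) * s ^ 2 + 1)) :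
    ∃ x y d : Puiseux, y ^ 2 = (quartic 𝕥).eval x ∧
      d ^ 2 = (quartic 𝕥).eval s ∧ x ^ 2 = X ∧ x * y = e ∧ x * d = w₁ ∧ y * d = w₂ := by
  have ht := puiseuxT_pos
  have hX0 : 0 ≤ X := by
    by_contra hneg
    push Not at hneg
    have : 0 < M := by rw [e1]; nlinarith
    nlinarith [sq_nonneg e]
  simp only [eval_quartic]
  rcases hX0.eq_or_lt with h0 | hpos
  · rw [← h0] at e1 e2 e4
    have hM1 : M = 1 := by rw [e1]; ring
    have he0 : e = 0 := by
      rw [zero_mul] at e2; exact pow_eq_zero_iff two_ne_zero |>.1 e2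
    have hw0 : w₁ = 0 := by
      rw [zero_mul] at e4; exact pow_eq_zero_iff two_ne_zero |>.1 e4
    refine ⟨0, 1, w₂, by ring, by rw [e5, hM1, one_mul], by rw [← h0]; ring, by rw [he0]; ring,
      by rw [hw0]; ring, by ring⟩
  · obtain ⟨x, hx, hxX⟩ := puiseux_exists_sqrt hpos.le
    have hx0 : x ≠ 0 := by
      rintro rfl
      rw [zero_pow two_ne_zero] at hxX
      exact hpos.ne hxX
    refine ⟨x, e / x, w₁ / x, ?_, ?_, hxX, mul_div_cancel₀ _ hx0, mul_div_cancel₀ _ hx0, ?_⟩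
    · rw [div_pow, e2, hxX, mul_div_cancel_left₀ _ hpos.ne', e1, ← hxX]; ring
    · rw [div_pow, e4, hxX, mul_div_cancel_left₀ _ hpos.ne']
    · rw [div_mul_div_comm, e3, ← sq, hxX, mul_div_cancel_left₀ _ hpos.ne']

theorem exists_square_roots_of_hom {B : Type} [CommRing B] (φ : B →+* Puiseux)
    {X M e s w₁ w₂ c : B} (hc : φ c = 2 * (2 * 𝕥 + 1)) (e1 : M = X ^ 2 - c * X + 1)
    (e2 : e ^ 2 = X * M) (e3 : e * w₁ = X * w₂) (e4 : w₁ ^ 2 = X * (s ^ 4 - c * s ^ 2 + 1))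
    (e5 : w₂ ^ 2 = M * (s ^ 4 - c * s ^ 2 + 1)) :
    ∃ x y d : Puiseux, y ^ 2 = (quartic 𝕥).eval x ∧ d ^ 2 = (quartic 𝕥).eval (φ s) ∧
      x ^ 2 = φ X ∧ x * y = φ e ∧ x * d = φ w₁ ∧ y * d = φ w₂ := by
  refine exists_square_roots (M := φ M) ?_ ?_ ?_ ?_ ?_ <;> try rw [← hc]
  · rw [e1]; simp only [map_add, map_sub, map_mul, map_pow, map_one]
  · rw [← map_pow, e2, map_mul]
  · rw [← map_mul, e3, map_mul]
  · rw [← map_pow, e4]; simp only [map_add, map_sub, map_mul, map_pow, map_one]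
  · rw [← map_pow φ w₂, e5]; simp only [map_add, map_sub, map_mul, map_pow, map_one]

open ProdRing in
/-- Real points of the quotient lift. -/
theorem ProdRing.exists_lift_real (φ : invariants 𝕥 →+* Puiseux)
    (hφ : ∀ x, φ (algebraMap Puiseux (invariants 𝕥) x) = x) :
    ∃ χ : ProdRing 𝕥 →ₐ[Puiseux] Puiseux, ∀ z : invariants 𝕥, χ z = φ z := by
  have e1 : inl 𝕥 (CurveRing.D 𝕥) ^ 2 = (inl 𝕥 (CurveRing.r 𝕥) ^ 2) ^ 2 -
      algebraMap Puiseux _ (2 * (2 * 𝕥 + 1)) * (inl 𝕥 (CurveRing.r 𝕥) ^ 2) + 1 := by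
    rw [inl_D_sq]; ring
  have e3 : inl 𝕥 (CurveRing.r 𝕥) * inl 𝕥 (CurveRing.D 𝕥) *
      (inl 𝕥 (CurveRing.r 𝕥) * inr 𝕥 (CurveRing.D 𝕥)) = inl 𝕥 (CurveRing.r 𝕥) ^ 2 *
      (inl 𝕥 (CurveRing.D 𝕥) * inr 𝕥 (CurveRing.D 𝕥)) := by ring
  have e4 : ∀ z : ProdRing 𝕥, (z * inr 𝕥 (CurveRing.D 𝕥)) ^ 2 = z ^ 2 *
      (inr 𝕥 (CurveRing.r 𝕥) ^ 4 - algebraMap Puiseux _ (2 * (2 * 𝕥 + 1)) *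
        inr 𝕥 (CurveRing.r 𝕥) ^ 2 + 1) := fun z => by rw [← inr_D_sq, mul_pow]
  obtain ⟨x, y, d, g1, g2, g3, g4, g5, g6⟩ := exists_square_roots_of_hom (B := invariants 𝕥) φ
    (X := ⟨_, r₁_sq_mem⟩) (M := ⟨_, D₁_sq_mem⟩) (e := ⟨_, r₁_D₁_mem⟩) (s := ⟨_, r₂_mem⟩)
    (w₁ := ⟨_, r₁_D₂_mem⟩) (w₂ := ⟨_, D₁_D₂_mem⟩)
    (hφ (2 * (2 * 𝕥 + 1))) (Subtype.ext e1) (Subtype.ext (mul_pow _ _ 2)) (Subtype.ext e3)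
    (Subtype.ext (e4 _)) (Subtype.ext (e4 _))
  obtain ⟨α, hα, hα'⟩ := CurveRing.exists_point g1
  obtain ⟨β, hβ, hβ'⟩ := CurveRing.exists_point g2
  refine ⟨pair α β, algHom_eq_of_adjoin φ hφ (pair α β) ?_⟩
  rintro a (rfl | rfl | rfl | rfl | rfl)
  · rw [map_pow, pair_inl, hα]; exact g3
  · rw [map_mul, pair_inl, pair_inl, hα, hα']; exact g4
  · rw [pair_inr]; exact hβ
  · rw [map_mul, pair_inl, pair_inr, hα, hβ']; exact g5
  · rw [map_mul, pair_inl, pair_inr, hα', hβ']; exact g6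

namespace Surface

theorem exists_point_of_chart {p : Bool × Bool} {q : RatPoint (hom 𝕥)}
    {φ : ProdRing.invariants 𝕥 →+* Puiseux}
    (hq : q.1 = Spec.map (CommRingCat.ofHom φ) ≫ chart 𝕥 p) :
    ∃ χ, q = point p χ ∧ ∀ z : ProdRing.invariants 𝕥, χ z = φ z := by
  obtain ⟨χ, hχ⟩ := ProdRing.exists_lift_real φ (algebraMap_of_chart hq)
  refine ⟨χ, Subtype.ext ?_, hχ⟩
  rw [hq, point_eq]
  congr 3
  exact RingHom.ext fun z => (hχ z).symm

theorem exists_point (q : RatPoint (hom 𝕥)) : ∃ p χ, q = point p χ := by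
  obtain ⟨p, hp⟩ := exists_mem_range_chart (q.1 (⊥ : PrimeSpectrum Puiseux))
  have hr : Set.range q.1 ⊆ Set.range (chart 𝕥 p) := by
    rintro _ ⟨y, rfl⟩
    have : y = (⊥ : PrimeSpectrum Puiseux) := Subsingleton.elim (α := PrimeSpectrum Puiseux) _ _
    rw [this]
    exact hp
  obtain ⟨φ, hφ⟩ := Spec.map_surjective (IsOpenImmersion.lift (chart 𝕥 p) q.1 hr)
  have hφ' : q.1 = Spec.map (CommRingCat.ofHom φ.hom) ≫ chart 𝕥 p := by
    rw [CommRingCat.ofHom_hom, hφ, IsOpenImmersion.lift_fac]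
  obtain ⟨χ, hχ, -⟩ := exists_point_of_chart hφ'
  exact ⟨p, χ, hχ⟩

end Surface

end RealPoints

end

/-! ### The connected components of the set of rational points -/

section

open scoped Topology TensorProduct

local notation "𝕥" => puiseuxT

/-- At `r² = 1` the quartic takes the value `-4t`, which is not a square. -/
theorem CurveRing.point_r_sq_ne_one (φ : CurveRing 𝕥 →ₐ[Puiseux] Puiseux) :
    φ (CurveRing.r 𝕥) ^ 2 ≠ 1 := by
  intro h
  have h1 := CurveRing.point_D_sq φ
  rw [eval_quartic, show φ (CurveRing.r 𝕥) ^ 4 = (φ (CurveRing.r 𝕥) ^ 2) ^ 2 by ring, h] at h1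
  nlinarith [sq_nonneg (φ (CurveRing.D 𝕥)), puiseuxT_pos]

/-- The coordinate change `r ↦ 1 / r` brings the oval `r² > 1` to the oval `r² < 1` of the other
chart, so each oval is `r² < 1` in one of the charts. -/
theorem Curve.exists_glued (φ : CurveRing 𝕥 →ₐ[Puiseux] Puiseux) (i : Bool) :
    ∃ (j : Bool) (ψ : CurveRing 𝕥 →ₐ[Puiseux] Puiseux),
      Curve.Glued i j (φ : CurveRing 𝕥 →+* Puiseux) (ψ : CurveRing 𝕥 →+* Puiseux) ∧
        ψ (CurveRing.r 𝕥) ^ 2 < 1 := by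
  rcases lt_or_gt_of_ne (CurveRing.point_r_sq_ne_one φ) with h | h
  · exact ⟨i, φ, ⟨rfl, by rw [if_pos rfl]; exact ⟨rfl, rfl⟩⟩, h⟩
  · have hx : φ (CurveRing.r 𝕥) ≠ 0 := fun h0 => by
      rw [h0, zero_pow two_ne_zero] at h
      exact absurd h (not_lt.2 zero_le_one)
    obtain ⟨ψ, h1, h2⟩ := CurveRing.exists_point (t := 𝕥) (x := (φ (CurveRing.r 𝕥))⁻¹)
      (y := φ (CurveRing.D 𝕥) * (φ (CurveRing.r 𝕥))⁻¹ ^ 2) (by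
        rw [mul_pow, CurveRing.point_D_sq, eval_quartic, eval_quartic]
        field_simp
        ring)
    refine ⟨!i, ψ, ⟨?_, ?_⟩, ?_⟩
    · rw [AlgHom.comp_algebraMap, AlgHom.comp_algebraMap]
    · rw [if_neg (by cases i <;> decide)]
      change φ (CurveRing.r 𝕥) * ψ (CurveRing.r 𝕥) = 1 ∧
        ψ (CurveRing.D 𝕥) = φ (CurveRing.D 𝕥) * ψ (CurveRing.r 𝕥) ^ 2
      rw [h1, h2]
      exact ⟨mul_inv_cancel₀ hx, rfl⟩
    · rw [h1, inv_pow]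
      exact inv_lt_one_of_one_lt₀ h

namespace ProdRing

variable {K : Type} [Field K] {t : K} (φ ψ : CurveRing t →ₐ[K] K)

/-- Exhibits the points with a fixed second coordinate as a copy of the curve inside the product, so
that results on the curve apply to such slices. -/
theorem pair_eq_comp_left : pair φ ψ =
    φ.comp (pair (AlgHom.id K (CurveRing t)) ((Algebra.ofId K (CurveRing t)).comp ψ)) := by
  refine algHom_ext (AlgHom.ext fun z => (pair_inl _ _ z).trans ?_)
    (AlgHom.ext fun z => (pair_inr _ _ z).trans ?_)
  · exact (congrArg φ (pair_inl (AlgHom.id K (CurveRing t)) ((Algebra.ofId K (CurveRing t)).comp ψ) z)).symm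
  · exact ((congrArg φ (pair_inr _ _ z)).trans (φ.commutes (ψ z))).symm

theorem pair_eq_comp_right : pair φ ψ =
    ψ.comp (pair ((Algebra.ofId K (CurveRing t)).comp φ) (AlgHom.id K (CurveRing t))) := by
  refine algHom_ext (AlgHom.ext fun z => (pair_inl _ _ z).trans ?_)
    (AlgHom.ext fun z => (pair_inr _ _ z).trans ?_)
  · exact ((congrArg ψ (pair_inl _ _ z)).trans (ψ.commutes (φ z))).symm
  · exact (congrArg ψ (pair_inr ((Algebra.ofId K (CurveRing t)).comp φ) (AlgHom.id K (CurveRing t)) z)).symm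

end ProdRing

namespace Surface

/-- The connected components of the set of rational points. -/
def oval (p : Bool × Bool) : Set (RatPoint (hom 𝕥)) :=
  {q | ∃ χ : ProdRing 𝕥 →ₐ[Puiseux] Puiseux, q = point p χ ∧
    χ (ProdRing.inl 𝕥 (CurveRing.r 𝕥)) ^ 2 < 1 ∧ χ (ProdRing.inr 𝕥 (CurveRing.r 𝕥)) ^ 2 < 1}

theorem exists_mem_oval (q : RatPoint (hom 𝕥)) : ∃ p, q ∈ oval p := by
  obtain ⟨p, χ, rfl⟩ := exists_point q
  obtain ⟨i, φ, h1, h2⟩ := Curve.exists_glued (χ.comp (ProdRing.inl 𝕥)) p.1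
  obtain ⟨j, ψ, h3, h4⟩ := Curve.exists_glued (χ.comp (ProdRing.inr 𝕥)) p.2
  refine ⟨(i, j), ProdRing.pair φ ψ, point_eq_of_glued ?_ ?_, ?_, ?_⟩
  · rwa [show (ProdRing.pair φ ψ).comp (ProdRing.inl 𝕥) = φ from
      AlgHom.ext fun z => ProdRing.pair_inl _ _ z]
  · rwa [show (ProdRing.pair φ ψ).comp (ProdRing.inr 𝕥) = ψ from
      AlgHom.ext fun z => ProdRing.pair_inr _ _ z]
  · rwa [ProdRing.pair_inl]
  · rwa [ProdRing.pair_inr]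

theorem eq_of_glued_of_lt {i j : Bool} {α β : CurveRing 𝕥 →+* Puiseux}
    (h : Curve.Glued i j α β) (h1 : α (CurveRing.r 𝕥) ^ 2 < 1) (h2 : β (CurveRing.r 𝕥) ^ 2 < 1) :
    i = j := by
  by_contra hij
  have h3 := h.2
  rw [if_neg hij] at h3
  have h4 : α (CurveRing.r 𝕥) ^ 2 * β (CurveRing.r 𝕥) ^ 2 = 1 := by
    rw [← mul_pow, h3.1, one_pow]
  nlinarith [sq_nonneg (α (CurveRing.r 𝕥)), sq_nonneg (β (CurveRing.r 𝕥))]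

theorem exists_glued_of_mem_oval {p p' : Bool × Bool} {χ : ProdRing 𝕥 →ₐ[Puiseux] Puiseux}
    (h : point p χ ∈ oval p') : ∃ γ : ProdRing 𝕥 →+* Puiseux,
      Spec.map (CommRingCat.ofHom (χ : ProdRing 𝕥 →+* Puiseux)) ≫ Sq.chart 𝕥 p =
        Spec.map (CommRingCat.ofHom γ) ≫ Sq.chart 𝕥 p' ∧
      γ (ProdRing.inl 𝕥 (CurveRing.r 𝕥)) ^ 2 < 1 ∧ γ (ProdRing.inr 𝕥 (CurveRing.r 𝕥)) ^ 2 < 1 := by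
  obtain ⟨χ', he, h3, h4⟩ := h
  obtain ⟨γ, hγ, hg⟩ := exists_glued_of_chart (p := p) (χ := χ) (φ := restrict χ') (p' := p')
    ((congrArg Subtype.val he).trans (point_eq p' χ'))
  refine ⟨γ, hg, ?_, ?_⟩
  · have := hγ ⟨_, ProdRing.r₁_sq_mem⟩
    rw [← map_pow, ← this, restrict_apply, map_pow]
    exact h3
  · have := hγ ⟨_, ProdRing.r₂_mem⟩
    rw [← this]
    exact h4

theorem eq_of_mem_oval {p p' : Bool × Bool} {q : RatPoint (hom 𝕥)} (h : q ∈ oval p)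
    (h' : q ∈ oval p') : p = p' := by
  obtain ⟨χ, rfl, h1, h2⟩ := h
  obtain ⟨γ, hg, h5, h6⟩ := exists_glued_of_mem_oval h'
  obtain ⟨g1, g2⟩ := Sq.specMap_chart_eq_iff.1 hg
  exact Prod.ext (eq_of_glued_of_lt g1 h1 h5) (eq_of_glued_of_lt g2 h2 h6)

theorem point_mem_oval_iff {p : Bool × Bool} {χ : ProdRing 𝕥 →ₐ[Puiseux] Puiseux} :
    point p χ ∈ oval p ↔ χ (ProdRing.inl 𝕥 (CurveRing.r 𝕥)) ^ 2 < 1 ∧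
      χ (ProdRing.inr 𝕥 (CurveRing.r 𝕥)) ^ 2 < 1 := by
  refine ⟨fun h => ?_, fun h => ⟨χ, rfl, h⟩⟩
  obtain ⟨γ, hg, h5, h6⟩ := exists_glued_of_mem_oval h
  obtain ⟨g1, g2⟩ := Sq.specMap_chart_eq_iff.1 hg
  have g1 := g1.2
  have g2 := g2.2
  rw [if_pos rfl] at g1 g2
  have e1 : χ (ProdRing.inl 𝕥 (CurveRing.r 𝕥)) = γ (ProdRing.inl 𝕥 (CurveRing.r 𝕥)) := g1.1
  have e2 : χ (ProdRing.inr 𝕥 (CurveRing.r 𝕥)) = γ (ProdRing.inr 𝕥 (CurveRing.r 𝕥)) := g2.1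
  rw [e1, e2]
  exact ⟨h5, h6⟩

/-- The functions `1 - r₁²` and `1 - r₂²` are invariant, hence live on a chart of the surface;
conversely, rational points of the chart where both are positive lift to the product. -/
theorem exists_oval_eq (p : Bool × Bool) : ∃ (U V : (Surface 𝕥).Opens) (_ : IsAffineOpen U)
    (_ : IsAffineOpen V) (s : Γ(Surface 𝕥, U)) (s' : Γ(Surface 𝕥, V)),
    oval p = posLocus (hom 𝕥) U s ∩ posLocus (hom 𝕥) V s' := by
  obtain ⟨U, hU, s, hs⟩ := exists_posLocus (f := hom 𝕥) (A := ProdRing.invariants 𝕥) (chart 𝕥 p)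
    ⟨1 - ProdRing.inl 𝕥 (CurveRing.r 𝕥) ^ 2, sub_mem (one_mem _) ProdRing.r₁_sq_mem⟩
  obtain ⟨V, hV, s', hs'⟩ := exists_posLocus (f := hom 𝕥) (A := ProdRing.invariants 𝕥) (chart 𝕥 p)
    ⟨1 - ProdRing.inr 𝕥 (CurveRing.r 𝕥) ^ 2,
      sub_mem (one_mem _) (pow_mem ProdRing.r₂_mem 2)⟩
  have h1 : ∀ χ : ProdRing 𝕥 →ₐ[Puiseux] Puiseux, ∀ z, 0 < χ (1 - z ^ 2) ↔ χ z ^ 2 < 1 := by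
    intro χ z
    rw [map_sub, map_one, map_pow, sub_pos]
  refine ⟨U, V, hU, hV, s, s', Set.ext fun q => ⟨?_, ?_⟩⟩
  · rintro ⟨χ, rfl, h2, h3⟩
    exact ⟨(hs _).2 ⟨restrict χ, point_eq p χ, (h1 χ _).2 h2⟩,
      (hs' _).2 ⟨restrict χ, point_eq p χ, (h1 χ _).2 h3⟩⟩
  · rintro ⟨h2, h3⟩
    obtain ⟨φ, hφ, h4⟩ := (hs q).1 h2
    obtain ⟨φ', hφ', h5⟩ := (hs' q).1 h3
    obtain rfl : φ = φ' := by
      have h6 := (cancel_mono (chart 𝕥 p)).1 (hφ.symm.trans hφ')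
      exact congrArg (fun f => f.hom) (Spec.map_injective h6)
    obtain ⟨χ, hq, hχ⟩ := exists_point_of_chart hφ
    rw [← hχ] at h4 h5
    exact ⟨χ, hq, (h1 χ _).1 h4, (h1 χ _).1 h5⟩

theorem isOpen_oval (p : Bool × Bool) : IsOpen (oval p) := by
  obtain ⟨U, V, hU, hV, s, s', h⟩ := exists_oval_eq p
  rw [h]
  have hopen : ∀ (U : (Surface 𝕥).Opens) (_ : IsAffineOpen U) (s : Γ(Surface 𝕥, U)),
      IsOpen (posLocus (hom 𝕥) U s) := fun U hU s =>
    TopologicalSpace.isOpen_generateFrom_of_mem ⟨U, hU, s, rfl⟩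
  exact (hopen U hU s).inter (hopen V hV s')

theorem isSemialgebraic_oval (p : Bool × Bool) : IsSemialgebraic (hom 𝕥) (oval p) := by
  obtain ⟨U, V, hU, hV, s, s', h⟩ := exists_oval_eq p
  rw [h]
  exact (IsSemialgebraic.pos U hU s).inter _ _ (.pos V hV s')

theorem isClopen_oval (p : Bool × Bool) : IsClopen (oval p) := by
  refine ⟨⟨?_⟩, isOpen_oval p⟩
  have h : (oval p)ᶜ = ⋃ p' ∈ {p' | p' ≠ p}, oval p' := by
    ext q
    simp only [Set.mem_iUnion, exists_prop]
    refine ⟨fun h => ?_, ?_⟩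
    · obtain ⟨p', hp'⟩ := exists_mem_oval q
      exact ⟨p', fun h2 => h (h2 ▸ hp'), hp'⟩
    · rintro ⟨p', hne, hp'⟩ h2
      exact hne (eq_of_mem_oval hp' h2)
  rw [h]
  exact isOpen_biUnion fun p' _ => isOpen_oval p'

/-- Pull `A` back along the copy of the curve parametrised by `θ`: the preimage is tame and clopen,
so it does not separate points of the oval. -/
theorem mem_iff_of_arc {A : Set (RatPoint (hom 𝕥))} (hA : IsSemialgebraic (hom 𝕥) A)
    (ho : IsOpen A) (ho' : IsOpen Aᶜ) (p : Bool × Bool)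
    (θ : ProdRing 𝕥 →ₐ[Puiseux] CurveRing 𝕥) {φ ψ : CurveRing 𝕥 →ₐ[Puiseux] Puiseux}
    (hφ : φ (CurveRing.r 𝕥) ^ 2 < 1) (hψ : ψ (CurveRing.r 𝕥) ^ 2 < 1) :
    point p (φ.comp θ) ∈ A ↔ point p (ψ.comp θ) ∈ A := by
  let m : (CurveRing 𝕥 →ₐ[Puiseux] Puiseux) → RatPoint (hom 𝕥) := fun φ => point p (φ.comp θ)
  let c : Spec (.of (CurveRing 𝕥)) ⟶ Surface 𝕥 :=
    Spec.map (CommRingCat.ofHom (θ : ProdRing 𝕥 →+* CurveRing 𝕥)) ≫ Sq.chart 𝕥 p ≫ π 𝕥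
  have hm : ∀ φ, (m φ).1 =
      Spec.map (CommRingCat.ofHom (φ : CurveRing 𝕥 →+* Puiseux)) ≫ c := by
    intro φ
    refine Eq.trans ?_ (Category.assoc _ _ _)
    rw [← Spec.map_comp]
    rfl
  let _ := pointTopology Puiseux (CurveRing 𝕥)
  have hc : Continuous m := continuous_point hm
  exact (hA.isTame_preimage hm).iff_of_oval (ho.preimage hc) (ho'.preimage hc) hφ hψ

theorem mem_iff_pair_left {A : Set (RatPoint (hom 𝕥))} (hA : IsSemialgebraic (hom 𝕥) A)
    (ho : IsOpen A) (ho' : IsOpen Aᶜ) (p : Bool × Bool) (ψ : CurveRing 𝕥 →ₐ[Puiseux] Puiseux)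
    {φ φ' : CurveRing 𝕥 →ₐ[Puiseux] Puiseux} (hφ : φ (CurveRing.r 𝕥) ^ 2 < 1)
    (hφ' : φ' (CurveRing.r 𝕥) ^ 2 < 1) :
    point p (ProdRing.pair φ ψ) ∈ A ↔ point p (ProdRing.pair φ' ψ) ∈ A := by
  rw [ProdRing.pair_eq_comp_left φ ψ, ProdRing.pair_eq_comp_left φ' ψ]
  exact mem_iff_of_arc hA ho ho' p _ hφ hφ'

theorem mem_iff_pair_right {A : Set (RatPoint (hom 𝕥))} (hA : IsSemialgebraic (hom 𝕥) A)
    (ho : IsOpen A) (ho' : IsOpen Aᶜ) (p : Bool × Bool) (φ : CurveRing 𝕥 →ₐ[Puiseux] Puiseux)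
    {ψ ψ' : CurveRing 𝕥 →ₐ[Puiseux] Puiseux} (hψ : ψ (CurveRing.r 𝕥) ^ 2 < 1)
    (hψ' : ψ' (CurveRing.r 𝕥) ^ 2 < 1) :
    point p (ProdRing.pair φ ψ) ∈ A ↔ point p (ProdRing.pair φ ψ') ∈ A := by
  rw [ProdRing.pair_eq_comp_right φ ψ, ProdRing.pair_eq_comp_right φ ψ']
  exact mem_iff_of_arc hA ho ho' p _ hψ hψ'

/-- Any two points of a product of ovals are joined by changing first one coordinate and then the
other, each time inside a slice isomorphic to the curve. -/
theorem isSemialgConnected_oval (p : Bool × Bool) : IsSemialgConnected (hom 𝕥) (oval p) := by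
  rintro A B hA - hAB hdis ⟨F, hF, hAF⟩ ⟨F', hF', hBF'⟩
  have hAc : IsClosed A := hAF ▸ (isClopen_oval p).1.inter hF
  have hBc : IsClosed B := hBF' ▸ (isClopen_oval p).1.inter hF'
  have hAo : IsOpen A := by
    have h : A = oval p ∩ Bᶜ := by
      rw [← hAB, Set.union_inter_distrib_right, Set.inter_compl_self, Set.union_empty]
      exact (Set.inter_eq_left.2 (Set.disjoint_left.1 hdis)).symm
    rw [h]
    exact (isOpen_oval p).inter hBc.isOpen_compl
  have key : ∀ χ χ' : ProdRing 𝕥 →ₐ[Puiseux] Puiseux,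
      χ (ProdRing.inl 𝕥 (CurveRing.r 𝕥)) ^ 2 < 1 → χ (ProdRing.inr 𝕥 (CurveRing.r 𝕥)) ^ 2 < 1 →
      χ' (ProdRing.inl 𝕥 (CurveRing.r 𝕥)) ^ 2 < 1 → χ' (ProdRing.inr 𝕥 (CurveRing.r 𝕥)) ^ 2 < 1 →
      (point p χ ∈ A ↔ point p χ' ∈ A) := by
    intro χ χ' h1 h2 h3 h4
    have e := (mem_iff_pair_left hA hAo hAc.isOpen_compl p (χ.comp (ProdRing.inr 𝕥))
      (φ := χ.comp (ProdRing.inl 𝕥)) (φ' := χ'.comp (ProdRing.inl 𝕥)) h1 h3).trans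
      (mem_iff_pair_right hA hAo hAc.isOpen_compl p (χ'.comp (ProdRing.inl 𝕥))
        (ψ := χ.comp (ProdRing.inr 𝕥)) (ψ' := χ'.comp (ProdRing.inr 𝕥)) h2 h4)
    rwa [ProdRing.pair_comp, ProdRing.pair_comp] at e
  rcases A.eq_empty_or_nonempty with h | ⟨q, hq⟩
  · exact Or.inl h
  · right
    rw [Set.eq_empty_iff_forall_notMem]
    intro q' hq'
    obtain ⟨χ, rfl, h1, h2⟩ : q ∈ oval p := hAB ▸ Or.inl hq
    obtain ⟨χ', rfl, h3, h4⟩ : q' ∈ oval p := hAB ▸ Or.inr hq'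
    exact Set.disjoint_left.1 hdis ((key χ χ' h1 h2 h3 h4).1 hq) hq'

theorem isSemialgComponent_oval {p : Bool × Bool} (h : (oval p).Nonempty) :
    IsSemialgComponent (hom 𝕥) (oval p) :=
  ⟨h, isSemialgebraic_oval p, isClopen_oval p, isSemialgConnected_oval p⟩

end Surface

end

/-! ### Generic points near the node and the failure of the signs property -/

section

open scoped Topology TensorProduct

section GenericPoints

open Filter

local notation "𝕥" => puiseuxT

/-- With `s = ± t^β` the equation asks for `x² = s + (2t+1) + t(t+1)/s`. The condition `0 < β < 1`
is what makes both `s` and `t/s` infinitesimal, so the right-hand side is infinitely close to `1`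
and has a nonnegative square root. -/
theorem exists_root_of_monomial (u : ℤˣ) (β : Set.Ioo (0 : ℚ) 1) : ∃ x : Puiseux,
    0 < pval (x - 1) ∧ sgn u * tpow β * x ^ 2 =
      (sgn u * tpow β) ^ 2 + (2 * 𝕥 + 1) * (sgn u * tpow β) + 𝕥 * (𝕥 + 1) := by
  set s := sgn u * tpow β with hs
  have hsv : pval s = (β : ℚ) := by rw [hs, pval_sgn_mul, pval_tpow]
  have hs0 : s ≠ 0 := mul_ne_zero (sgn_ne_zero u) (tpow_pos _).ne'
  have h1v : pval (1 : Puiseux) = 0 := AddValuation.map_one _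
  have h01 : (0 : WithTop ℚ) < (1 : ℚ) := WithTop.coe_lt_coe.2 one_pos
  have hβ0 : 0 < pval s := hsv ▸ WithTop.coe_lt_coe.2 β.2.1
  have ht : 0 < pval 𝕥 := pval_puiseuxT ▸ h01
  have hts : 0 < pval (𝕥 / s) := by
    by_contra hcon
    have h : pval 𝕥 = pval (𝕥 / s) + pval s := by
      rw [← AddValuation.map_mul, div_mul_cancel₀ _ hs0]
    have h2 : pval 𝕥 ≤ pval s := by
      rw [h]
      exact (add_le_add_left (not_lt.1 hcon) (pval s)).trans (zero_add _).le
    rw [hsv, pval_puiseuxT] at h2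
    exact absurd (WithTop.coe_le_coe.1 h2) (not_le.2 β.2.2)
  have hmul : ∀ {x y : Puiseux}, 0 < pval x → 0 ≤ pval y → 0 < pval (x * y) := fun hx hy => by
    rw [AddValuation.map_mul]
    exact add_pos_of_pos_of_nonneg hx hy
  set X := s + (2 * 𝕥 + 1) + 𝕥 / s * (𝕥 + 1) with hX
  have hX1 : 0 < pval (X - 1) := by
    rw [show X - 1 = s + 𝕥 * 2 + 𝕥 / s * (𝕥 + 1) by rw [hX]; ring]
    refine AddValuation.map_lt_add _ (AddValuation.map_lt_add _ hβ0 (hmul ht pval_two.ge))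
      (hmul hts ?_)
    exact AddValuation.map_le_add _ ht.le h1v.ge
  have hX0 : 0 < X := pos_of_pval_sub_lt (y := 1) (by rw [h1v]; exact hX1) one_pos
  obtain ⟨x, hx, hxX⟩ := puiseux_exists_sqrt hX0.le
  refine ⟨x, ?_, ?_⟩
  -- The valuation of `x² - 1` is the sum of those of `x - 1` and `x + 1`, so one of them is
  -- positive; if it is that of `x + 1`, then `x` is infinitely close to `-1`, contrary to `x ≥ 0`.
  · by_contra hcon
    have h2 : 0 < pval (x + 1) := by
      have h3 : pval (X - 1) = pval (x - 1) + pval (x + 1) := by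
        rw [← AddValuation.map_mul, ← hxX]
        congr 1
        ring
      by_contra hcon'
      rw [h3] at hX1
      exact absurd hX1 (not_lt.2 (add_nonpos (not_lt.1 hcon) (not_lt.1 hcon')))
    have h4 : -1 > x := by
      have := neg_of_pval_sub_lt (x := -x - 2) (y := -1) (by
        rw [AddValuation.map_neg, h1v, show -x - 2 - -1 = -(x + 1) by ring, AddValuation.map_neg]
        exact h2) (by linarith)
      exact absurd (neg_of_pval_sub_lt (x := x) (y := -1) (by
        rw [AddValuation.map_neg, h1v, sub_neg_eq_add]; exact h2) (by linarith)) (not_lt.2 hx)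
    linarith
  · rw [hxX, hX]
    field_simp

namespace CurveRing

variable {K : Type} [Field K] (t : K)

/-- The function `(r² - (2 t + 1) + D) / 2`, a unit. -/
def s : CurveRing t := algebraMap K _ 2⁻¹ * (r t ^ 2 - algebraMap K _ (2 * t + 1) + D t)

section

variable [CharZero K]

theorem algebraMap_half : algebraMap K (CurveRing t) 2⁻¹ * 2 = 1 := by
  rw [← map_ofNat (algebraMap K (CurveRing t)) 2, ← map_mul, inv_mul_cancel₀ two_ne_zero, map_one]

omit [CharZero K] in
theorem D_sq' : D t ^ 2 = r t ^ 4 - 2 * algebraMap K _ (2 * t + 1) * r t ^ 2 + 1 := by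
  rw [D_sq, map_mul, map_ofNat]

omit [CharZero K] in
theorem algebraMap_sq_sub_one : algebraMap K (CurveRing t) (2 * t + 1) ^ 2 - 1 =
    4 * algebraMap K _ (t * (t + 1)) := by
  simp only [map_add, map_mul, map_ofNat, map_one]
  ring

theorem s_mul_r_sq : s t * r t ^ 2 =
    s t ^ 2 + algebraMap K _ (2 * t + 1) * s t + algebraMap K _ (t * (t + 1)) := by
  have h1 := algebraMap_half t
  have h2 := D_sq' t
  have h3 := algebraMap_sq_sub_one t
  rw [s]
  generalize algebraMap K (CurveRing t) 2⁻¹ = h at *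
  generalize algebraMap K (CurveRing t) (2 * t + 1) = a at *
  generalize algebraMap K (CurveRing t) (t * (t + 1)) = b at *
  generalize r t = r at *
  generalize D t = D at *
  have h4 : h ^ 2 * 4 = 1 := by linear_combination (h * 2 + 1) * h1
  linear_combination (-h * (r ^ 2 - a + D) * (r ^ 2 - a)) * h1 - h ^ 2 * h2 + h ^ 2 * h3 + b * h4

theorem s_mul_D : s t * D t = s t ^ 2 - algebraMap K _ (t * (t + 1)) := by
  have h1 := algebraMap_half t
  have h2 := D_sq' t
  have h3 := algebraMap_sq_sub_one t
  rw [s]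
  generalize algebraMap K (CurveRing t) 2⁻¹ = h at *
  generalize algebraMap K (CurveRing t) (2 * t + 1) = a at *
  generalize algebraMap K (CurveRing t) (t * (t + 1)) = b at *
  generalize r t = r at *
  generalize D t = D at *
  have h4 : h ^ 2 * 4 = 1 := by linear_combination (h * 2 + 1) * h1
  linear_combination (-h * (r ^ 2 - a + D) * D) * h1 + h ^ 2 * h2 - h ^ 2 * h3 - b * h4

theorem isUnit_s (h0 : t ≠ 0) (h1 : t + 1 ≠ 0) : IsUnit (s t) := by
  refine isUnit_of_dvd_unit (y := algebraMap K _ (t * (t + 1))) ⟨s t - D t, ?_⟩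
    ((IsUnit.mk0 _ (mul_ne_zero h0 h1)).map _)
  linear_combination s_mul_D t

end

/-- The right-hand side is positive, so `s` has the sign of `r² - 1`: the sign of `s` tells the two
ovals apart. -/
theorem point_s_mul (φ : CurveRing 𝕥 →ₐ[Puiseux] Puiseux) :
    φ (s 𝕥) * (φ (r 𝕥) ^ 2 - 1) = (φ (s 𝕥) + 𝕥) ^ 2 + 𝕥 := by
  have h := congrArg φ (s_mul_r_sq 𝕥)
  rw [map_add, map_add, map_mul, map_mul, map_pow, map_pow, AlgHom.commutes, AlgHom.commutes] at h
  change _ = _ + (2 * 𝕥 + 1) * _ + 𝕥 * (𝕥 + 1) at h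
  linear_combination h

theorem exists_monomial_point (u : ℤˣ) (β : Set.Ioo (0 : ℚ) 1) :
    ∃ φ : CurveRing 𝕥 →ₐ[Puiseux] Puiseux, 0 < pval (φ (r 𝕥) - 1) ∧
      φ (s 𝕥) = sgn u * tpow β := by
  obtain ⟨x, hx, h⟩ := exists_root_of_monomial u β
  have hs0 : sgn u * tpow β ≠ 0 := mul_ne_zero (sgn_ne_zero u) (tpow_pos _).ne'
  generalize sgn u * tpow β = σ at *
  obtain ⟨φ, h1, h2⟩ := exists_point (t := 𝕥) (x := x) (y := 2 * σ - (x ^ 2 - (2 * 𝕥 + 1))) (by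
    rw [eval_quartic]
    linear_combination -4 * h)
  refine ⟨φ, h1 ▸ hx, ?_⟩
  rw [s, map_mul, map_add, map_sub, map_pow, AlgHom.commutes, AlgHom.commutes, h1, h2]
  change 2⁻¹ * (x ^ 2 - (2 * 𝕥 + 1) + (2 * σ - (x ^ 2 - (2 * 𝕥 + 1)))) = σ
  ring

/-- A real point at which the unit `s` is a given signed monomial. -/
def monomialPoint (u : ℤˣ) (β : Set.Ioo (0 : ℚ) 1) : CurveRing 𝕥 →ₐ[Puiseux] Puiseux :=
  (exists_monomial_point u β).choose

theorem pval_monomialPoint_r (u : ℤˣ) (β : Set.Ioo (0 : ℚ) 1) :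
    0 < pval (monomialPoint u β (r 𝕥) - 1) := (exists_monomial_point u β).choose_spec.1

theorem monomialPoint_s (u : ℤˣ) (β : Set.Ioo (0 : ℚ) 1) :
    monomialPoint u β (s 𝕥) = sgn u * tpow β := (exists_monomial_point u β).choose_spec.2

theorem monomialPoint_r_sq_lt_one_iff (u : ℤˣ) (β : Set.Ioo (0 : ℚ) 1) :
    monomialPoint u β (r 𝕥) ^ 2 < 1 ↔ u = -1 := by
  have h := point_s_mul (monomialPoint u β)
  rw [monomialPoint_s] at h
  have h1 := tpow_pos β
  have h2 := puiseuxT_pos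
  rcases Int.units_eq_one_or u with rfl | rfl
  · have e : sgn 1 = 1 := by simp [sgn]
    rw [e, one_mul] at h
    refine iff_of_false (fun h3 => ?_) (by decide)
    nlinarith [sq_nonneg (tpow β + 𝕥)]
  · have e : sgn (-1) = -1 := by simp [sgn]
    rw [e] at h
    refine iff_of_true ?_ rfl
    by_contra h3
    nlinarith [sq_nonneg (-1 * tpow β + 𝕥)]

/-- First application of `GenericMono.curve`: the coefficients are the constants and the parameter
is the exponent `β`. -/
theorem genericMono {Λ : Type*} [CommGroup Λ] (e : Λ →* ℤˣ) :
    GenericMono ((pure () : Filter Unit).curry cofinite)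
      (fun p y => (monomialPoint (e y) p.2 : CurveRing 𝕥 →+* Puiseux)) :=
  GenericMono.curve genericMono_id e (r := r 𝕥) (D := D 𝕥) (s := s 𝕥) (a := 2 * 𝕥 + 1)
    (b := 𝕥 * (𝕥 + 1)) (adjoin_eq_top 𝕥)
    (isUnit_s 𝕥 puiseuxT_pos.ne' (by have := puiseuxT_pos; positivity)) (s_mul_r_sq 𝕥) (s_mul_D 𝕥)
    (fun p β y x => (monomialPoint (e y) β).commutes x)
    (fun p y => pval_monomialPoint_r _ _) (fun p y => monomialPoint_s _ _)

end CurveRing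

namespace ProdRing

theorem adjoin_inr {K : Type} [Field K] {t : K} [Algebra (CurveRing t) (ProdRing t)]
    (halg : ∀ z, algebraMap (CurveRing t) (ProdRing t) z = inl t z) :
    Algebra.adjoin (CurveRing t) {inr t (CurveRing.r t), inr t (CurveRing.D t)} = ⊤ := by
  rw [eq_top_iff]
  intro z _
  have hz : z ∈ Algebra.adjoin K {inl t (CurveRing.r t), inl t (CurveRing.D t),
      inr t (CurveRing.r t), inr t (CurveRing.D t)} := by rw [adjoin_eq_top]; trivial
  have hinl : ∀ a, inl t a ∈ Algebra.adjoin (CurveRing t)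
      {inr t (CurveRing.r t), inr t (CurveRing.D t)} := fun a => halg a ▸ algebraMap_mem _ a
  induction hz using Algebra.adjoin_induction with
  | mem x hx =>
    rcases hx with rfl | rfl | rfl | rfl
    · exact hinl _
    · exact hinl _
    · exact Algebra.subset_adjoin (by simp)
    · exact Algebra.subset_adjoin (by simp)
  | algebraMap c => exact (inl t).commutes c ▸ hinl (algebraMap K _ c)
  | add x y _ _ hx hy => exact add_mem (hx trivial) (hy trivial)
  | mul x y _ _ hx hy => exact mul_mem (hx trivial) (hy trivial)

/-- The pairs of monomial points. -/
def monomialPoint (β₁ β₂ : Set.Ioo (0 : ℚ) 1) (y : ℤˣ × ℤˣ) : ProdRing 𝕥 →ₐ[Puiseux] Puiseux :=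
  pair (CurveRing.monomialPoint y.1 β₁) (CurveRing.monomialPoint y.2 β₂)

theorem map_relations {A B : Type} [CommRing A] [CommRing B] (f : A →+* B) {s r D a b : A}
    (h1 : s * r ^ 2 = s ^ 2 + a * s + b) (h2 : s * D = s ^ 2 - b) :
    f s * f r ^ 2 = f s ^ 2 + f a * f s + f b ∧ f s * f D = f s ^ 2 - f b := by
  constructor
  · rw [← map_pow, ← map_mul, h1, map_add, map_add, map_mul, map_pow]
  · rw [← map_mul, h2, map_sub, map_pow]

/-- Second application of `GenericMono.curve`: the product is a curve over the coordinate ring of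
the first factor, whose elements are already generically monomial-like. The second exponent is
chosen after the first, avoiding finitely many values depending on it. -/
theorem genericMono : GenericMono (((pure () : Filter Unit).curry cofinite).curry cofinite)
    (fun p y => (monomialPoint p.1.2 p.2 y : ProdRing 𝕥 →+* Puiseux)) := by
  have h1 : 𝕥 + 1 ≠ 0 := by have := puiseuxT_pos; positivity
  have : IsDomain (CurveRing 𝕥) := CurveRing.isDomain 𝕥 puiseuxT_pos.ne' h1
  let _ : Algebra (CurveRing 𝕥) (ProdRing 𝕥) :=
    ((inl 𝕥 : CurveRing 𝕥 →+* ProdRing 𝕥)).toAlgebra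
  have hrel := map_relations (inr 𝕥 : CurveRing 𝕥 →+* ProdRing 𝕥) (CurveRing.s_mul_r_sq 𝕥)
    (CurveRing.s_mul_D 𝕥)
  have hc : ∀ x : Puiseux, inr 𝕥 (algebraMap Puiseux (CurveRing 𝕥) x) =
      algebraMap (CurveRing 𝕥) (ProdRing 𝕥) (algebraMap Puiseux (CurveRing 𝕥) x) := fun x =>
    ((inr 𝕥).commutes x).trans ((inl 𝕥).commutes x).symm
  refine GenericMono.curve (CurveRing.genericMono (MonoidHom.fst ℤˣ ℤˣ)) (MonoidHom.snd ℤˣ ℤˣ)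
    (r := inr 𝕥 (CurveRing.r 𝕥)) (D := inr 𝕥 (CurveRing.D 𝕥)) (s := inr 𝕥 (CurveRing.s 𝕥))
    (a := algebraMap Puiseux _ (2 * 𝕥 + 1)) (b := algebraMap Puiseux _ (𝕥 * (𝕥 + 1)))
    (adjoin_inr fun _ => rfl) ((CurveRing.isUnit_s 𝕥 puiseuxT_pos.ne' h1).map (inr 𝕥)) ?_ ?_
    (fun p β y x => pair_inl _ _ x) (fun p y => ?_) (fun p y => ?_)
  · rw [← hc, ← hc]
    exact hrel.1
  · rw [← hc]
    exact hrel.2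
  · have := CurveRing.pval_monomialPoint_r y.2 p.2
    rwa [← pair_inr (CurveRing.monomialPoint y.1 p.1.2)] at this
  · exact (pair_inr _ _ _).trans (CurveRing.monomialPoint_s _ _)

theorem exists_isMonomialLike {x y : ProdRing 𝕥} (hx : x ≠ 0) (hy : y ≠ 0) :
    ∃ β₁ β₂, IsMonomialLike (fun u => monomialPoint β₁ β₂ u x) ∧
      IsMonomialLike (fun u => monomialPoint β₁ β₂ u y) := by
  have h := (genericMono x hx).and (genericMono y hy)
  rw [eventually_curry_iff, eventually_curry_iff, eventually_pure] at h
  have : Infinite (Set.Ioo (0 : ℚ) 1) := Set.Ioo.infinite one_pos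
  obtain ⟨β₁, h1⟩ := h.exists
  obtain ⟨β₂, h2⟩ := h1.exists
  exact ⟨β₁, β₂, h2⟩

end ProdRing

namespace Surface

theorem mem_oval_monomialPoint_iff (β₁ β₂ : Set.Ioo (0 : ℚ) 1) (y : ℤˣ × ℤˣ) :
    point (false, false) (ProdRing.monomialPoint β₁ β₂ y) ∈ oval (false, false) ↔
      y = (-1, -1) := by
  rw [point_mem_oval_iff, ProdRing.monomialPoint, ProdRing.pair_inl, ProdRing.pair_inr,
    CurveRing.monomialPoint_r_sq_lt_one_iff, CurveRing.monomialPoint_r_sq_lt_one_iff, Prod.ext_iff]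

/-- Take for the union of components the single oval `(false, false)`. At generic monomial points on
the chart `(false, false)` the function would be positive for the pair of signs `(-1, -1)` and
negative for the three others, contrary to `IsMonomialLike.four_signs`. -/
theorem not_signsProperty : ¬ SignsProperty (hom 𝕥) := by
  intro hS
  let β₀ : Set.Ioo (0 : ℚ) 1 := ⟨1 / 2, by norm_num⟩
  let q := ProdRing.monomialPoint β₀ β₀ (-1, -1)
  have hcomp : IsSemialgComponent (hom 𝕥) (oval (false, false)) :=
    isSemialgComponent_oval ⟨_, (mem_oval_monomialPoint_iff β₀ β₀ (-1, -1)).2 rfl⟩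
  obtain ⟨U, -, hU, g, hpos, hneg⟩ := hS {oval (false, false)} fun C hC => by
    rw [Set.mem_singleton_iff.1 hC]; exact hcomp
  rw [Set.sUnion_singleton] at hpos hneg
  have hne : ∀ p : RatPoint (hom 𝕥), p.eval U (hU p) g ≠ 0 := fun p => by
    by_cases hp : p ∈ oval (false, false)
    · exact (hpos p hp).ne'
    · exact (hneg p hp).ne
  have hm : ∀ χ : ProdRing 𝕥 →ₐ[Puiseux] Puiseux, (point (false, false) χ).1 =
      Spec.map (CommRingCat.ofHom (χ : ProdRing 𝕥 →+* Puiseux)) ≫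
        Sq.chart 𝕥 (false, false) ≫ π 𝕥 := fun χ => rfl
  -- The function `g` is written as a fraction `G / hⁿ` near one auxiliary rational point `q`; its
  -- only role is to show that `h` and `G` are nonzero. The exponents are chosen generically for
  -- both afterwards.
  obtain ⟨h, G, n, hh, -, hG⟩ := exists_fraction hm U g (map_pointOf_mem hm (hU (point _ q)))
  have hG' : ∀ χ : ProdRing 𝕥 →ₐ[Puiseux] Puiseux, χ h ≠ 0 →
      (point (false, false) χ).eval U (hU _) g * χ h ^ n = χ G := fun χ hχ => (hG χ hχ).2
  have hq : q h ≠ 0 := notMem_pointOf.1 hh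
  have hqG : q G ≠ 0 := by
    rw [← hG' q hq]
    exact mul_ne_zero (hne _) (pow_ne_zero _ hq)
  obtain ⟨β₁, β₂, h1, h2⟩ := ProdRing.exists_isMonomialLike (x := h) (y := G)
    (fun h0 => hq (by rw [h0, map_zero])) (fun h0 => hqG (by rw [h0, map_zero]))
  let f : ℤˣ × ℤˣ → Puiseux := fun y =>
    (point (false, false) (ProdRing.monomialPoint β₁ β₂ y)).eval U (hU _) g
  have hf : IsMonomialLike f := by
    refine IsMonomialLike.of_mul ?_ (h1.pow n)
    convert h2 using 2 with y
    exact hG' _ (h1.ne_zero y)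
  have hf' : ∀ y, y ≠ (-1, -1) → f y < 0 := fun y hy =>
    hneg _ fun hy' => hy ((mem_oval_monomialPoint_iff β₁ β₂ y).1 hy')
  -- The four elements of `{±1}²` have product `1`, whereas the values there have signs `-`, `-`,
  -- `-`, `+`.
  have h3 := hf.four_signs (x := (1, 1)) (y := (1, -1)) (z := (-1, 1)) (w := (-1, -1)) (by decide)
  exact absurd h3 (mul_neg_of_pos_of_neg
    (mul_pos_of_neg_of_neg (hf' _ (by decide)) (hf' _ (by decide)))
    (mul_neg_of_neg_of_pos (hf' _ (by decide))
      (hpos _ ((mem_oval_monomialPoint_iff β₁ β₂ _).2 rfl)))).not_gt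

end Surface

end GenericPoints

end

end SignsBielliptic

end

/-! ### The proposition -/

theorem proposition9p18 :
    ∃ (S : Scheme.{0}) (s : S ⟶ Spec (.of Puiseux)),
      IsBielliptic s ∧
      (∃ (E : Scheme.{0}) (e : E ⟶ Spec (.of Puiseux))
        (j : Spec (.of curveW.toAffine.CoordinateRing) ⟶ E)
        (ρ : Multiplicative (ZMod 2) →* Aut (Over.mk (pullback.fst e e ≫ e)))
        (π : pullback e e ⟶ S),
        IsEllipticCurve curveW e j ∧
        π ≫ s = pullback.fst e e ≫ e ∧
        IsFreeAction (fun g => (ρ g).hom.left) ∧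
        IsQuotient (fun g => (ρ g).hom.left) π) ∧
      ¬ SignsProperty s := by
  have h0 : puiseuxT ≠ 0 := puiseuxT_pos.ne'
  have h1 : puiseuxT + 1 ≠ 0 := by have := puiseuxT_pos; positivity
  have hq : (fun g => ((Sq.actHom puiseuxT) g).hom.left) = Sq.act puiseuxT :=
    funext fun g => Sq.actHom_eq g
  exact ⟨Surface puiseuxT, Surface.hom puiseuxT,
    ⟨Surface.smooth_hom h0 h1, Surface.isProjective_hom _, Surface.isBiellipticQuotient h0 h1⟩,
    -- `curveW` agrees by definition with `legendre puiseuxT`, so the general results on `legendre`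
    -- apply to it.
    ⟨Curve puiseuxT, Curve.hom puiseuxT, legendre.embedding puiseuxT h0 h1, Sq.actHom puiseuxT,
      Surface.π puiseuxT, legendre.isEllipticCurve, Surface.π_hom,
      Sq.isFreeAction puiseuxT, hq ▸ Sq.isQuotient_π puiseuxT⟩,
    Surface.not_signsProperty⟩
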